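/- Conventions. Let $\mathbb M=\mathbb R^4$ with $\eta=\mathrm{diag}(1,-1,-1,-1)$, $(xy)=\eta_{\mu\nu}x^\mu y^\nu$, $x^2=(xx)$, $x_\mu=\eta_{\mu\nu}x^\nu$, and let $H=\{e\in\mathbb M: e^2<0\}$. For a distribution $u$ on an open set $X\subset\mathbb M$ and a test function $\phi\in C_c^\infty(X)$ put $\widehat{\phi u}(k)=u(\phi\, e^{i(k\,\cdot)})$. The wavefront set $\mathrm{WF}(u)$ is the set of $(x;p)\in X\times(\mathbb M\setminus 0)$ such that for no $\phi\in C_c^\infty(X)$ with $\phi(x)\neq 0$ is $\widehat{\phi u}$ rapidly decaying in an open conic neighbourhood of $p$. The Hörmander product $uv$ exists on $X$ if $(x;p)\in \mathrm{WF}(u)$ implies $(x;-p)\notin\mathrm{WF}(v)$; it is the distribution $w$ on $X$ such that every point of $X$ has a neighbourhood $U$ with $w(\phi\psi)=(2\pi)^{-4}\int d^4k\,\widehat{\phi u}(k)\,\widehat{\psi v}(-k)$, absolutely convergent, for all test functions $\phi,\psi$ supported in $U$. The massless Feynman propagator is $D=[x^2-i0]^{-1}=\lim_{\varepsilon\downarrow0}(x^2-i\varepsilon)^{-1}\in\mathcal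 S'(\mathbb M)$. A propagator of point-localized fields of mass $m\ge0$ is a tempered distribution of the form $$\int\frac{d^4p}{(2\pi)^4}\,e^{-i(px)}\Big(\frac{P(p)}{p^2-m^2+i0}+Q(p)\Big)$$ with complex polynomials $P,Q$ (the term $Q$ gives a linear combination of derivatives of $\delta$). For $p,e,e'\in\mathbb M$ let $$E_{\mu\kappa}(p,e,e')=\eta_{\mu\kappa}-\frac{e_\kappa p_\mu}{(pe)-i0}-\frac{e'_\mu p_\kappa}{(pe')+i0}+\frac{(ee')\,p_\mu p_\kappa}{[(pe)-i0][(pe')+i0]}.$$ For a spin/helicity $s\in\mathbb N_0$, coefficients $\beta_n\in\mathbb C$ and four-vectors $f,f'\in\mathbb M$ let $$M(p,e,e')=(-1)^s\sum_{2n\le s}\beta_n\,(E_{ff})^n(E_{f'f'})^n(E_{ff'})^{s-2n},$$ $$E_{ff}=f^\mu E_{\mu\kappa}(p,e,-e)f^\kappa,\quad E_{f'f'}=f'^\mu E_{\mu\kappa}(p,-e',e')f'^\kappa,\quad E_{ff'}=f^\mu E_{\mu\kappa}(p,e,e')f'^\kappa,$$ so that every $(pe)$ carries the shift $-i0$ and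 every $(pe')$ the shift $+i0$. (For suitable $\beta_n$, depending on $s$, this is the kernel of the propagator of the string-localized potentials of spin/helicity $s$.) For $c\in\mathcal D(H)$ the smeared massless string-localized kinematic propagator is $$T_c(x)=\int\frac{d^4p}{(2\pi)^4}\,e^{-i(px)}\int d^4e\int d^4e'\,c(e)\,c(e')\,\frac{M(p,e,e')}{p^2+i0},$$ where the boundary values $(pe)-i0$, $(pe')+i0$, $p^2+i0$ are the joint limit of $(pe)-ia$, $(pe')+ib$, $p^2+i\varepsilon$ as $a,b,\varepsilon\downarrow0$ independently, taken after pairing with a Schwartz function. Theorem. (i) $D$ is a well-defined tempered distribution with $$\mathrm{WF}(D)=\{(x;\lambda x): x^2=0,\ x\ne0,\ \lambda>0\}\cup\{(0;p):p\ne0\}.$$ For all $s\in\mathbb N_0$, all $\beta_n\in\mathbb C$, all $f,f'\in\mathbb M$ and all $c\in\mathcal D(H)$, the limit defining $T_c$ exists as a tempered distribution on $\mathbb M$, and $\mathrm{WF}(T_c)\subseteq\mathrm{WF}(D)$. (ii) The limits $\varepsilon\downarrow 0$ defining the propagators of point-localized fields exist as tempered distributions. Any finite nonempty list of distributions, each of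 which is either a smeared massless string-localized kinematic propagator (with its own $s,\beta,f,f',c$) or a propagator of point-localized fields (with its own $m\ge0$, $P$, $Q$), has, after restriction to $\mathbb M\setminus0$, a well-defined product: the iterated Hörmander product $u_1(u_2(\cdots u_n))$ exists, and it is unique. -/

import Mathlib

open MeasureTheory Filter Set TopologicalSpace
open scoped Topology ContDiff Distributions SchwartzMap

noncomputable section

/-! ### Minkowski space -/

/-- Minkowski space `ℝ⁴`; the Euclidean structure only provides topology and Lebesgue measure. -/
abbrev Mink := EuclideanSpace ℝ (Fin 4)

/-- The diagonal entries of the mostly negative metric `η = diag(1, -1, -1, -1)`. -/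
def etaDiag : Fin 4 → ℝ := ![1, -1, -1, -1]

/-- The metric tensor `η_{μν}`. -/
def eta (μ ν : Fin 4) : ℝ := if μ = ν then etaDiag μ else 0

/-- The Minkowski product `(xy) = η_{μν} x^μ y^ν`. -/
def mdot (x y : Mink) : ℝ := ∑ μ, etaDiag μ * x μ * y μ

/-- The covariant components `x_μ = η_{μν} x^ν`. -/
def lower (x : Mink) (μ : Fin 4) : ℝ := etaDiag μ * x μ

theorem contDiff_mdot (k : Mink) : ContDiff ℝ ∞ (fun x : Mink => mdot k x) := by
  unfold mdot
  fun_prop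

theorem continuous_mdot_self : Continuous (fun x : Mink => mdot x x) := by
  unfold mdot
  fun_prop

/-- The open set `H` of spacelike vectors. -/
def spacelike : Opens Mink :=
  ⟨{e | mdot e e < 0}, isOpen_lt continuous_mdot_self continuous_const⟩

/-- Minkowski space without the origin. -/
def punctured : Opens Mink := ⟨{0}ᶜ, isOpen_compl_singleton⟩

/-! ### Distributions on open subsets -/

/-- Complex distributions on `Ω`: continuous `ℂ`-linear forms on the LF-space of complex valued
test functions. -/
abbrev Distr (Ω : Opens Mink) := 𝓓(Ω, ℂ) →L[ℂ] ℂ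

/-- The product `φ g` of a test function with a smooth function. -/
def testMul {Ω : Opens Mink} (φ : 𝓓(Ω, ℂ)) (g : Mink → ℂ) (hg : ContDiff ℝ ∞ g) : 𝓓(Ω, ℂ) where
  toFun := fun x => φ x * g x
  contDiff' := φ.contDiff.mul hg
  hasCompactSupport' := φ.hasCompactSupport.mul_right
  tsupport_subset' := (tsupport_mul_subset_left (f := fun x => φ x) (g := g)).trans
    φ.tsupport_subset

/-- The inclusion of test functions into Schwartz functions. -/
def testToSchwartz {Ω : Opens Mink} (φ : 𝓓(Ω, ℂ)) : 𝓢(Mink, ℂ) :=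
  φ.hasCompactSupport.toSchwartzMap φ.contDiff

theorem testToSchwartz_apply {Ω : Opens Mink} (φ : 𝓓(Ω, ℂ)) (x : Mink) :
    testToSchwartz φ x = φ x := rfl

theorem continuous_testToSchwartz_ofSupportedIn {Ω : Opens Mink} (K : Compacts Mink)
    (hK : (K : Set Mink) ⊆ Ω) :
    Continuous ((testToSchwartz : 𝓓(Ω, ℂ) → 𝓢(Mink, ℂ)) ∘ TestFunction.ofSupportedIn hK) := by
  let L : 𝓓^{⊤}_{K}(Mink, ℂ) →ₗ[ℝ] 𝓢(Mink, ℂ) :=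
    { toFun := fun f => testToSchwartz (TestFunction.ofSupportedIn hK f)
      map_add' := fun _ _ => rfl
      map_smul' := fun _ _ => rfl }
  change Continuous L
  refine WithSeminorms.continuous_of_isBounded
    (ContDiffMapSupportedIn.withSeminorms ℝ Mink ℂ ⊤ K) (schwartz_withSeminorms ℝ Mink ℂ) L ?_
  rintro ⟨k, n⟩
  obtain ⟨R, hR⟩ := K.isCompact.isBounded.exists_norm_le
  have hM : 0 ≤ (max R 0) ^ k := pow_nonneg (le_max_right _ _) _
  refine ⟨{n}, ⟨(max R 0) ^ k, hM⟩, fun f => ?_⟩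
  rw [Finset.sup_singleton]
  change SchwartzMap.seminorm ℝ k n (L f) ≤
    (max R 0) ^ k * ContDiffMapSupportedIn.seminorm ℝ Mink ℂ ⊤ K n f
  refine SchwartzMap.seminorm_le_bound ℝ k n (L f) (mul_nonneg hM (apply_nonneg _ _)) fun x => ?_
  change ‖x‖ ^ k * ‖iteratedFDeriv ℝ n (f : Mink → ℂ) x‖ ≤ _
  by_cases hx : x ∈ K
  · exact mul_le_mul (pow_le_pow_left₀ (norm_nonneg _) ((hR x hx).trans (le_max_left _ _)) _)
      (ContDiffMapSupportedIn.norm_iteratedFDeriv_apply_le_seminorm_top ℝ) (norm_nonneg _) hM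
  · have h0 : iteratedFDeriv ℝ n (f : Mink → ℂ) x = 0 := f.iteratedFDeriv_zero_on_compl hx
    rw [h0, norm_zero, mul_zero]
    exact mul_nonneg hM (apply_nonneg _ _)

/-- The continuous inclusion `𝓓(Ω) → 𝓢(ℝ⁴)`. -/
def testToSchwartzCLM (Ω : Opens Mink) : 𝓓(Ω, ℂ) →L[ℂ] 𝓢(Mink, ℂ) :=
  TestFunction.mkCLM ℂ testToSchwartz (fun _ _ => rfl) (fun _ _ => rfl)
    continuous_testToSchwartz_ofSupportedIn

/-- The restriction of a tempered distribution to the open set `Ω`. -/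
def restrictTo (Ω : Opens Mink) (T : 𝓢'(Mink, ℂ)) : Distr Ω where
  toFun φ := T (testToSchwartzCLM Ω φ)
  map_add' φ ψ := by simp
  map_smul' a φ := by simp
  cont := (map_continuous T).comp (testToSchwartzCLM Ω).continuous

/-! ### Wavefront sets and Hörmander products -/

/-- The plane wave `x ↦ e^{i(kx)}`, with the Minkowski product in the exponent. -/
def planeWave (k x : Mink) : ℂ := Complex.exp (Complex.I * (mdot k x : ℂ))

theorem contDiff_planeWave (k : Mink) : ContDiff ℝ ∞ (planeWave k) := by
  unfold planeWave
  exact (contDiff_const.mul (Complex.ofRealCLM.contDiff.comp (contDiff_mdot k))).cexp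

/-- The Fourier transform `k ↦ ∫ d⁴x e^{i(kx)} φ(x) u(x)` of the compactly supported distribution
`φ u`. -/
def localFourier {Ω : Opens Mink} (u : Distr Ω) (φ : 𝓓(Ω, ℂ)) (k : Mink) : ℂ :=
  u (testMul φ (planeWave k) (contDiff_planeWave k))

/-- `F` decays rapidly in an open conic neighbourhood of the direction `p`. -/
def RapidlyDecayingNear (F : Mink → ℂ) (p : Mink) : Prop :=
  ∃ V : Set Mink, IsOpen V ∧ p ∈ V ∧ (∀ k ∈ V, ∀ t : ℝ, 0 < t → t • k ∈ V) ∧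
    ∀ N : ℕ, ∃ C : ℝ, ∀ k ∈ V, (1 + ‖k‖) ^ N * ‖F k‖ ≤ C

/-- The frequency set of `u` over `x`: the intersection, over all test functions `φ` with
`φ x ≠ 0`, of the sets of nonzero `p` having no conic neighbourhood of rapid decay of the Fourier
transform of `φ u`. -/
def frequencySet {Ω : Opens Mink} (u : Distr Ω) (x : Mink) : Set Mink :=
  {p | p ≠ 0 ∧ ∀ φ : 𝓓(Ω, ℂ), φ x ≠ 0 → ¬ RapidlyDecayingNear (localFourier u φ) p}

/-- The wavefront set of `u`, a subset of `Ω × (ℝ⁴ ∖ 0)`. -/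
def waveFrontSet {Ω : Opens Mink} (u : Distr Ω) : Set (Mink × Mink) :=
  {z | z.1 ∈ Ω ∧ z.2 ∈ frequencySet u z.1}

/-- Hörmander's criterion: `(x; p) ∈ WF u` implies `(x; -p) ∉ WF v`. -/
def HormanderCriterion {Ω : Opens Mink} (u v : Distr Ω) : Prop :=
  ∀ x p : Mink, (x, p) ∈ waveFrontSet u → (x, -p) ∉ waveFrontSet v

/-- `w` is the Hörmander product `u v` on `Ω`: Hörmander's criterion holds and near every point `w`
is given by the absolutely convergent convolution of the Fourier transforms of localizations,
`w(φψ) = (2π)⁻⁴ ∫ d⁴k (φu)^(k) (ψv)^(-k)`. -/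
def IsHormanderProduct {Ω : Opens Mink} (u v w : Distr Ω) : Prop :=
  HormanderCriterion u v ∧
  ∀ x ∈ Ω, ∃ U : Set Mink, IsOpen U ∧ x ∈ U ∧
    ∀ φ ψ : 𝓓(Ω, ℂ), tsupport φ ⊆ U → tsupport ψ ⊆ U →
      Integrable (fun k => localFourier u φ k * localFourier v ψ (-k)) ∧
      w (testMul φ ψ ψ.contDiff) =
        ((2 * Real.pi : ℝ) : ℂ)⁻¹ ^ 4 * ∫ k, localFourier u φ k * localFourier v ψ (-k)

/-- `w` is the iterated Hörmander product `u₁ (u₂ (⋯ uₙ))` of a nonempty list. -/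
inductive IsHormanderProductList {Ω : Opens Mink} : List (Distr Ω) → Distr Ω → Prop
  | single (u : Distr Ω) : IsHormanderProductList [u] u
  | cons (u : Distr Ω) (us : List (Distr Ω)) (v w : Distr Ω)
      (hv : IsHormanderProductList us v) (hw : IsHormanderProduct u v w) :
      IsHormanderProductList (u :: us) w

/-! ### Propagators -/

/-- The massless Feynman propagator `D = [x² - i0]⁻¹`. -/
def IsMasslessFeynman (D : 𝓢'(Mink, ℂ)) : Prop :=
  ∀ φ : 𝓢(Mink, ℂ), Tendsto
    (fun ε : ℝ => ∫ x, φ x / ((mdot x x : ℂ) - Complex.I * (ε : ℂ))) (𝓝[>] 0) (𝓝 (D φ))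

/-- `∫ d⁴p/(2π)⁴ K(p) ∫ d⁴x e^{-i(px)} φ(x)`: the pairing with `φ` of the configuration space
distribution `∫ d⁴p/(2π)⁴ e^{-i(px)} K(p)`. -/
def momentumPairing (K : Mink → ℂ) (φ : 𝓢(Mink, ℂ)) : ℂ :=
  ((2 * Real.pi : ℝ) : ℂ)⁻¹ ^ 4 * ∫ p, K p * ∫ x, planeWave (-p) x * φ x

/-- `T = ∫ d⁴p/(2π)⁴ e^{-i(px)} (P(p) / (p² - m² + i0) + Q(p))` with polynomials `P`, `Q` in `p`:
the propagator of two point-localized fields of mass `m`, i.e. the kinematic propagator with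
kernel `P` up to a linear combination of derivatives of the Dirac delta. -/
def IsPointPropagator (m : ℝ) (P Q : MvPolynomial (Fin 4) ℂ) (T : 𝓢'(Mink, ℂ)) : Prop :=
  ∀ φ : 𝓢(Mink, ℂ), Tendsto
    (fun ε : ℝ => momentumPairing
      (fun p => MvPolynomial.eval (fun μ => (p μ : ℂ)) P /
          ((mdot p p : ℂ) - (m : ℂ) ^ 2 + Complex.I * (ε : ℂ))
        + MvPolynomial.eval (fun μ => (p μ : ℂ)) Q) φ)
    (𝓝[>] 0) (𝓝 (T φ))

/-- The tensor `E_{μκ}(p, e, e')` with `(pe) - i0`, `(pe') + i0` replaced by `(pe) - ia`,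
`(pe') + ib`. -/
def tensorE (a b : ℝ) (p e e' : Mink) (μ κ : Fin 4) : ℂ :=
  (eta μ κ : ℂ)
    - (lower e κ * lower p μ : ℂ) / ((mdot p e : ℂ) - Complex.I * (a : ℂ))
    - (lower e' μ * lower p κ : ℂ) / ((mdot p e' : ℂ) + Complex.I * (b : ℂ))
    + (mdot e e' * lower p μ * lower p κ : ℂ) /
      (((mdot p e : ℂ) - Complex.I * (a : ℂ)) * ((mdot p e' : ℂ) + Complex.I * (b : ℂ)))

/-- The contraction `f^μ E_{μκ}(p, e, e') g^κ`. -/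
def contractE (f g : Mink) (a b : ℝ) (p e e' : Mink) : ℂ :=
  ∑ μ, ∑ κ, (f μ : ℂ) * tensorE a b p e e' μ κ * (g κ : ℂ)

/-- The kernel `(-1)^s ∑_{2n ≤ s} β_n (E_ff)^n (E_f'f')^n (E_ff')^(s-2n)`, where
`E_ff = f E(p, e, -e) f`, `E_f'f' = f' E(p, -e', e') f'`, `E_ff' = f E(p, e, e') f'`. Every `(pe)`
carries the shift `-ia` and every `(pe')` the shift `+ib`. -/
def stringKernel (s : ℕ) (β : ℕ → ℂ) (f f' : Mink) (a b : ℝ) (p e e' : Mink) : ℂ :=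
  (-1) ^ s * ∑ n ∈ Finset.range (s / 2 + 1),
    β n * contractE f f a a p e (-e) ^ n * contractE f' f' b b p (-e') e' ^ n
      * contractE f f' a b p e e' ^ (s - 2 * n)

/-- `T(x) = ∫ d⁴p/(2π)⁴ e^{-i(px)} ∫ d⁴e ∫ d⁴e' c(e) c(e') M(p, e, e') / (p² + i0)`: the massless
kinematic propagator of the string-localized potentials with polarizations `f`, `f'`, smeared in
both string variables with `c`. The three boundary values `(pe) - i0`, `(pe') + i0` and `p² + i0`
are taken with independent regulators `a, b, ε ↓ 0`. -/
def IsSmearedStringPropagator (s : ℕ) (β : ℕ → ℂ) (f f' : Mink) (c : 𝓓(spacelike, ℂ))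
    (T : 𝓢'(Mink, ℂ)) : Prop :=
  ∀ φ : 𝓢(Mink, ℂ), Tendsto
    (fun r : ℝ × ℝ × ℝ => momentumPairing
      (fun p => (∫ e, ∫ e', c e * c e' * stringKernel s β f f' r.1 r.2.1 p e e') /
        ((mdot p p : ℂ) + Complex.I * (r.2.2 : ℂ))) φ)
    (𝓝[>] 0 ×ˢ 𝓝[>] 0 ×ˢ 𝓝[>] 0) (𝓝 (T φ))

end

/-!
Every propagator in the theorem has the form `∫ d⁴p/(2π)⁴ e^{-i(px)} K(p) / (p² - μ + i0)`, and
the proof rests on two properties of such integrals, for kernels `K` that need not be smooth at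
`p = 0`.

*Boundary values.* The Schwinger representation writes `1 / (p² - μ + i0)` as an integral over
`t > 0` of `e^{it(p² - μ)}`. Let `J` be the reflection of the spatial coordinates. Along the flow
`exp (s J)`, the function `p²` has derivative `2 ‖p‖²`, so that two integrations by parts along
this flow bound `∫ e^{itp²} g(p) d⁴p` by a multiple of `min(1, |t|^{-3/2})` (`norm_oscInt_le`). Only
derivatives of `g` along the flow enter, and the flow commutes with dilations; hence functions `g`
that are homogeneous of degree zero times a Schwartz function are admissible. Since the bound is
integrable in `t`, all limits exist by dominated convergence (`tendsto_propFunctional`), also when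
the numerators depend on further regulators.

*Microlocal regularity.* Let `K` be homogeneous and smooth away from the origin, and let `φ` be
supported near `x ≠ 0`. The Fourier transform of `φ T` at a large momentum `k` in the direction of
`p` receives a contribution from momenta near `k`, with phase `t q² - (q x)` after rescaling, and a
rapidly decreasing contribution from all others. The phase is stationary only if `x` is a positive
multiple of the momentum, at `t > 0`, and the stationary points with `p² ≠ 0` disappear on changing
the sign of `i0`, which is immaterial off the mass shell. This leaves `x² = 0`, `p = λ x`, `λ > 0`
(`HomogeneousKernel.microlocallyRegular`), and bounds the wavefront set from above
(`MicrolocallyRegular.waveFrontSet_subset`).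

*String-localized propagators.* The string kernel depends on `p` only through the ratios
`(fp)/((pe) - ia)` and `(f'p)/((pe') + ib)`, and it is a sum of products of a function of `e` and
a function of `e'`. Writing a power of the first ratio as a Laplace integral turns the smearing in
`e` into a Fourier transform, and the smeared factor becomes a radial integral
`∫₀^∞ e^{-aτ} H(τp) dτ/τ` of a Schwartz function `H` with `H(0) = 0`. It is flow bounded
uniformly in `a`, and at `a = 0` homogeneous of degree zero and smooth away from the origin
(`exists_stringFactor_limit`, `exists_isSmearedStringPropagator`). For point-localized fields the
kernel is a polynomial, a sum of homogeneous kernels.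

*The wavefront set of `D`.* The Fresnel integral identifies `D` with the propagator with constant
kernel `-4π²i`. Over the origin the localized Fourier transform decays only like `|p|⁻²` in
directions with `p² ≠ 0`, so all directions are singular (`mem_frequencySet_zero`). If `D` were
microlocally regular at `(x, λ x)` with `x` lightlike, it would be a bounded function near `x`,
whereas `D = 1/x²` off the light cone (`smul_mem_frequencySet_feynmanPropagator`).

*Products.* Away from the origin, each of the distributions has near every point a spectral density
that decays rapidly outside arbitrarily narrow cones around one direction, which depends only on
the point if the point is lightlike (`ConeDirected`). Two vectors of such a cone cannot cancel.
Hence Hörmander's criterion holds, the convolution of two densities converges and has the same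
property, and the local products obtained in this way glue to a distribution by a partition of
unity. The class of such distributions is closed under products, and induction over the list gives
the iterated product (`existsUnique_hormanderProductList`).
-/

noncomputable section

/-! ### Minkowski geometry -/

/-- The reflection `(x⁰, x⃗) ↦ (x⁰, -x⃗)`, which turns the Euclidean product into the Minkowski
product. -/
def minkReflect : Mink ≃ₗᵢ[ℝ] Mink :=
  LinearIsometryEquiv.piLpCongrRight 2 fun i : Fin 4 =>
    if i = 0 then LinearIsometryEquiv.refl ℝ ℝ else LinearIsometryEquiv.neg ℝ

theorem minkReflect_apply (x : Mink) (μ : Fin 4) : minkReflect x μ = etaDiag μ * x μ := by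
  fin_cases μ <;> simp [minkReflect, etaDiag]

theorem etaDiag_mul_self (μ : Fin 4) : etaDiag μ * etaDiag μ = 1 := by
  fin_cases μ <;> simp [etaDiag]

theorem minkReflect_minkReflect (x : Mink) : minkReflect (minkReflect x) = x := by
  ext μ
  rw [minkReflect_apply, minkReflect_apply, ← mul_assoc, etaDiag_mul_self, one_mul]

theorem mdot_eq_inner (x y : Mink) : mdot x y = inner ℝ (minkReflect x) y := by
  simp only [mdot, PiLp.inner_apply, minkReflect_apply]
  refine Finset.sum_congr rfl fun μ _ => ?_
  simp; ring

theorem mdot_comm (x y : Mink) : mdot x y = mdot y x := by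
  simp only [mdot]
  exact Finset.sum_congr rfl fun μ _ => by ring

theorem mdot_add_left (x y z : Mink) : mdot (x + y) z = mdot x z + mdot y z := by
  simp only [mdot_eq_inner, map_add, inner_add_left]

theorem mdot_add_right (x y z : Mink) : mdot x (y + z) = mdot x y + mdot x z := by
  simp only [mdot_eq_inner, inner_add_right]

theorem mdot_sub_left (x y z : Mink) : mdot (x - y) z = mdot x z - mdot y z := by
  simp only [mdot_eq_inner, map_sub, inner_sub_left]

theorem mdot_smul_left (a : ℝ) (x y : Mink) : mdot (a • x) y = a * mdot x y := by
  simp only [mdot_eq_inner, map_smul, real_inner_smul_left]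

theorem mdot_smul_right (a : ℝ) (x y : Mink) : mdot x (a • y) = a * mdot x y := by
  simp only [mdot_eq_inner, real_inner_smul_right]

theorem mdot_neg_left (x y : Mink) : mdot (-x) y = -mdot x y := by
  simp only [mdot_eq_inner, map_neg, inner_neg_left]

theorem mdot_neg_right (x y : Mink) : mdot x (-y) = -mdot x y := by
  simp only [mdot_eq_inner, inner_neg_right]

theorem mdot_minkReflect_left (x y : Mink) : mdot (minkReflect x) y = inner ℝ x y := by
  rw [mdot_eq_inner, minkReflect_minkReflect]

theorem mdot_minkReflect_self (x : Mink) : mdot (minkReflect x) x = ‖x‖ ^ 2 := by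
  rw [mdot_minkReflect_left, real_inner_self_eq_norm_sq]

theorem abs_mdot_le (x y : Mink) : |mdot x y| ≤ ‖x‖ * ‖y‖ := by
  rw [mdot_eq_inner]
  exact (abs_real_inner_le_norm _ _).trans_eq (by rw [minkReflect.norm_map])

theorem Continuous.mdot {X : Type*} [TopologicalSpace X] {f g : X → Mink} (hf : Continuous f)
    (hg : Continuous g) : Continuous fun x => mdot (f x) (g x) := by
  simp only [mdot_eq_inner]
  exact (minkReflect.continuous.comp hf).inner hg

theorem hasFDerivAt_mdot_left (v p : Mink) :
    HasFDerivAt (fun q => mdot q v) (innerSL ℝ (minkReflect v)) p := by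
  have h : (fun q => mdot q v) = innerSL ℝ (minkReflect v) := by
    ext q
    rw [mdot_comm, mdot_eq_inner]
    rfl
  rw [h]
  exact ContinuousLinearMap.hasFDerivAt _

/-! ### Plane waves and the Minkowski Fourier transform -/

theorem norm_planeWave (k x : Mink) : ‖planeWave k x‖ = 1 := by
  rw [planeWave, mul_comm, Complex.norm_exp_ofReal_mul_I]

theorem planeWave_add_left (k l x : Mink) :
    planeWave (k + l) x = planeWave k x * planeWave l x := by
  simp only [planeWave, mdot_add_left, ← Complex.exp_add]
  push_cast
  ring_nf

theorem planeWave_comm (k x : Mink) : planeWave k x = planeWave x k := by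
  rw [planeWave, planeWave, mdot_comm]

theorem planeWave_zero (x : Mink) : planeWave 0 x = 1 := by
  simp [planeWave, mdot]

theorem Continuous.planeWave {X : Type*} [TopologicalSpace X] {f g : X → Mink}
    (hf : Continuous f) (hg : Continuous g) : Continuous fun x => planeWave (f x) (g x) := by
  unfold _root_.planeWave
  exact Complex.continuous_exp.comp
    (continuous_const.mul (Complex.continuous_ofReal.comp (hf.mdot hg)))

/-- The Fourier transform `p ↦ ∫ d⁴x e^{-i(px)} f(x)`. -/
def minkFourier (f : Mink → ℂ) (p : Mink) : ℂ := ∫ x, planeWave (-p) x * f x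

/-- The linear change of variables relating the Minkowski Fourier transform to the Euclidean one
with kernel `e^{-2πi⟨x, w⟩}`. -/
def fourierScaling : Mink ≃L[ℝ] Mink :=
  minkReflect.toContinuousLinearEquiv.trans
    (ContinuousLinearEquiv.smulLeft (Units.mk0 (2 * Real.pi)⁻¹ (by positivity)))

theorem fourierScaling_apply (p : Mink) :
    fourierScaling p = (2 * Real.pi)⁻¹ • minkReflect p := rfl

/-- The Minkowski Fourier transform of Schwartz functions. -/
def minkFourierCLM : 𝓢(Mink, ℂ) →L[ℂ] 𝓢(Mink, ℂ) :=
  (SchwartzMap.compCLMOfContinuousLinearEquiv ℂ fourierScaling).comp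
    (SchwartzMap.fourierTransformCLM ℂ)

theorem minkFourier_eq_fourier (f : Mink → ℂ) (p : Mink) :
    minkFourier f p = FourierTransform.fourier f (fourierScaling p) := by
  rw [Real.fourier_eq', minkFourier]
  refine integral_congr_ae (Eventually.of_forall fun x => ?_)
  simp only [smul_eq_mul, fourierScaling_apply, real_inner_smul_right, planeWave]
  congr 2
  rw [real_inner_comm, ← mdot_eq_inner, mdot_neg_left]
  have : (Real.pi : ℂ) ≠ 0 := by exact_mod_cast Real.pi_ne_zero
  push_cast
  field_simp

theorem minkFourierCLM_apply (f : 𝓢(Mink, ℂ)) (p : Mink) :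
    minkFourierCLM f p = minkFourier f p := by
  rw [minkFourier_eq_fourier]
  rfl

theorem coe_minkFourierCLM (f : 𝓢(Mink, ℂ)) : ⇑(minkFourierCLM f) = minkFourier f :=
  funext (minkFourierCLM_apply f)

theorem integral_comp_fourierScaling (h : Mink → ℂ) :
    ∫ p, h (fourierScaling p) = ((2 * Real.pi : ℝ) : ℂ) ^ 4 * ∫ p, h p := by
  simp only [fourierScaling_apply]
  have h1 : ∫ p, h ((2 * Real.pi)⁻¹ • minkReflect p) = ∫ p, h ((2 * Real.pi)⁻¹ • p) :=
    minkReflect.measurePreserving.integral_comp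
      minkReflect.toHomeomorph.measurableEmbedding (fun q => h ((2 * Real.pi)⁻¹ • q))
  rw [h1, Measure.integral_comp_smul]
  have : (0 : ℝ) < (2 * Real.pi) ^ 4 := by positivity
  simp only [finrank_euclideanSpace, Fintype.card_fin, inv_pow, inv_inv, abs_of_pos this]
  rw [Complex.real_smul]
  push_cast
  rfl

/-- Fourier inversion. -/
theorem integral_minkFourier_mul_planeWave (f : 𝓢(Mink, ℂ)) (x : Mink) :
    ((2 * Real.pi : ℝ) : ℂ)⁻¹ ^ 4 * ∫ p, minkFourier f p * planeWave p x = f x := by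
  have h0 : ((2 * Real.pi : ℝ) : ℂ) ≠ 0 := by exact_mod_cast (by positivity : 2 * Real.pi ≠ 0)
  have h1 : ∀ p, minkFourier f p * planeWave p x =
      (fun w => Complex.exp (↑(2 * Real.pi * inner ℝ w x) * Complex.I) •
        FourierTransform.fourier (f : Mink → ℂ) w) (fourierScaling p) := by
    intro p
    rw [minkFourier_eq_fourier]
    simp only [smul_eq_mul, fourierScaling_apply, real_inner_smul_left, planeWave]
    rw [mul_comm, ← mdot_eq_inner]
    congr 2
    have : (Real.pi : ℂ) ≠ 0 := by exact_mod_cast Real.pi_ne_zero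
    push_cast
    field_simp
  rw [integral_congr_ae (Eventually.of_forall h1), integral_comp_fourierScaling
    (fun w => Complex.exp (↑(2 * Real.pi * inner ℝ w x) * Complex.I) •
        FourierTransform.fourier (f : Mink → ℂ) w), ← mul_assoc, inv_pow,
      inv_mul_cancel₀ (pow_ne_zero _ h0),
    one_mul, ← Real.fourierInv_eq']
  have := DFunLike.congr_fun
    (FourierTransform.fourierInv_fourier_eq (F := 𝓢(Mink, ℂ)) f) x
  simp only [SchwartzMap.fourierInv_coe, SchwartzMap.fourier_coe] at this
  exact this

theorem minkFourier_mul_planeWave (f : Mink → ℂ) (k p : Mink) :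
    minkFourier (fun x => f x * planeWave k x) p = minkFourier f (p - k) := by
  unfold minkFourier
  refine integral_congr_ae (Eventually.of_forall fun x => ?_)
  simp only
  rw [show -(p - k) = -p + k by abel, planeWave_add_left]
  ring

/-- The Fourier transform of a product is a convolution. -/
theorem minkFourier_mul (f g : 𝓢(Mink, ℂ)) (p : Mink) :
    minkFourier (fun x => f x * g x) p =
      ((2 * Real.pi : ℝ) : ℂ)⁻¹ ^ 4 * ∫ k, minkFourier g k * minkFourier f (p - k) := by
  have hint : Integrable (Function.uncurry fun (x k : Mink) =>
      planeWave (-p) x * f x * (minkFourier g k * planeWave k x)) (volume.prod volume) := by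
    have h := (f.integrable (μ := volume)).mul_prod ((minkFourierCLM g).integrable (μ := volume))
    rw [coe_minkFourierCLM] at h
    have hc : Continuous fun z : Mink × Mink => planeWave (-p + z.2) z.1 :=
      (continuous_const.add continuous_snd).planeWave continuous_fst
    refine (h.bdd_mul (c := 1) hc.aestronglyMeasurable
      (Eventually.of_forall fun z => (norm_planeWave _ _).le)).congr
      (Eventually.of_forall fun z => ?_)
    simp only [Function.uncurry, planeWave_add_left]
    ring
  calc minkFourier (fun x => f x * g x) p
      = ∫ x, ((2 * Real.pi : ℝ) : ℂ)⁻¹ ^ 4 *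
          ∫ k, planeWave (-p) x * f x * (minkFourier g k * planeWave k x) := by
        refine integral_congr_ae (Eventually.of_forall fun x => ?_)
        simp only
        rw [integral_const_mul, ← integral_minkFourier_mul_planeWave g x]
        ring
    _ = ((2 * Real.pi : ℝ) : ℂ)⁻¹ ^ 4 *
          ∫ k, ∫ x, planeWave (-p) x * f x * (minkFourier g k * planeWave k x) := by
        rw [integral_const_mul, integral_integral_swap hint]
    _ = _ := by
        congr 1
        refine integral_congr_ae (Eventually.of_forall fun k => ?_)
        simp only
        rw [minkFourier.eq_1 f, ← integral_const_mul]
        refine integral_congr_ae (Eventually.of_forall fun x => ?_)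
        simp only
        rw [show -(p - k) = -p + k by abel, planeWave_add_left]
        ring

/-! ### Polynomial weights -/

theorem integrable_inv_one_add_norm_pow :
    Integrable fun x : Mink => ((1 + ‖x‖) ^ 6)⁻¹ := by
  have h := integrable_one_add_norm (E := Mink) (μ := volume) (r := 6)
    (by simp [finrank_euclideanSpace]; norm_num)
  refine h.congr (Eventually.of_forall fun x => ?_)
  simp only
  rw [Real.rpow_neg (by positivity)]
  norm_cast

theorem one_add_norm_add_le (x y : Mink) : 1 + ‖x + y‖ ≤ (1 + ‖x‖) * (1 + ‖y‖) := by
  nlinarith [norm_add_le x y, mul_nonneg (norm_nonneg x) (norm_nonneg y)]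

theorem SchwartzMap.exists_decay {F : Type*} [NormedAddCommGroup F] [NormedSpace ℝ F]
    (f : 𝓢(Mink, F)) (N : ℕ) :
    ∃ C : ℝ, 0 ≤ C ∧ ∀ x, ‖f x‖ ≤ C * ((1 + ‖x‖) ^ N)⁻¹ := by
  refine ⟨2 ^ N * (Finset.Iic (N, 0)).sup (fun m => SchwartzMap.seminorm ℝ m.1 m.2) f,
    by positivity, fun x => ?_⟩
  have h := SchwartzMap.one_add_le_sup_seminorm_apply (𝕜 := ℝ) (m := (N, 0)) (k := N) (n := 0)
    le_rfl le_rfl f x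
  rw [norm_iteratedFDeriv_zero] at h
  rw [← div_eq_mul_inv, le_div_iff₀ (by positivity), mul_comm]
  exact h

/-! ### The hyperbolic flow and decay of oscillatory integrals -/

/-- The flow `exp (s J)` of the linear vector field `p ↦ J p`, where `J = minkReflect`. Along it
`p²` has derivative `2 ‖p‖²`, so it is transversal to the light cone away from the origin. -/
def hypFlow (s : ℝ) (p : Mink) : Mink := Real.cosh s • p + Real.sinh s • minkReflect p

theorem hypFlow_zero (p : Mink) : hypFlow 0 p = p := by simp [hypFlow]

theorem hypFlow_hypFlow (s t : ℝ) (p : Mink) : hypFlow s (hypFlow t p) = hypFlow (s + t) p := by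
  simp only [hypFlow, map_add, map_smul, minkReflect_minkReflect, Real.cosh_add, Real.sinh_add]
  module

theorem hypFlow_smul (s τ : ℝ) (p : Mink) : hypFlow s (τ • p) = τ • hypFlow s p := by
  simp only [hypFlow, map_smul]
  module

theorem hasDerivAt_hypFlow (p : Mink) :
    HasDerivAt (fun s => hypFlow s p) (minkReflect p) 0 := by
  have h := ((Real.hasDerivAt_cosh 0).smul_const p).add
    ((Real.hasDerivAt_sinh 0).smul_const (minkReflect p))
  exact h.congr_deriv (by simp)

theorem continuous_hypFlow_right (s : ℝ) : Continuous (hypFlow s) := by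
  unfold hypFlow
  have := minkReflect.continuous
  fun_prop

theorem minkReflect_hypFlow (s : ℝ) (p : Mink) :
    minkReflect (hypFlow s p) = hypFlow s (minkReflect p) := by
  simp only [hypFlow, map_add, map_smul]

theorem norm_hypFlow_le {s : ℝ} (hs : |s| ≤ 1) (p : Mink) : ‖hypFlow s p‖ ≤ 3 * ‖p‖ := by
  have h1 : Real.cosh s + |Real.sinh s| ≤ 3 := by
    rw [Real.abs_sinh, ← Real.cosh_abs, Real.cosh_add_sinh]
    have := Real.exp_one_lt_d9
    linarith [Real.exp_le_exp.2 hs]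
  calc ‖hypFlow s p‖ ≤ ‖Real.cosh s • p‖ + ‖Real.sinh s • minkReflect p‖ := norm_add_le _ _
    _ = (Real.cosh s + |Real.sinh s|) * ‖p‖ := by
        rw [norm_smul, norm_smul, minkReflect.norm_map, Real.norm_eq_abs, Real.norm_eq_abs,
          abs_of_pos (Real.cosh_pos s), add_mul]
    _ ≤ _ := by gcongr

theorem norm_le_hypFlow {s : ℝ} (hs : |s| ≤ 1) (p : Mink) : ‖p‖ ≤ 3 * ‖hypFlow s p‖ := by
  have h := norm_hypFlow_le (s := -s) (by rwa [abs_neg]) (hypFlow s p)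
  rwa [hypFlow_hypFlow, neg_add_cancel, hypFlow_zero] at h

/-- The flow as a linear map. -/
def hypFlowLin (s : ℝ) : Mink →ₗ[ℝ] Mink :=
  Real.cosh s • LinearMap.id + Real.sinh s • minkReflect.toLinearEquiv.toLinearMap

theorem det_hypFlowLin (s : ℝ) : LinearMap.det (hypFlowLin s) = Real.exp (-2 * s) := by
  let b := (EuclideanSpace.basisFun (Fin 4) ℝ).toBasis
  have h : LinearMap.toMatrix b b (hypFlowLin s) =
      Matrix.diagonal fun μ => Real.cosh s + Real.sinh s * etaDiag μ := by
    ext μ ν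
    rw [LinearMap.toMatrix_apply, Matrix.diagonal_apply]
    have hJ : minkReflect (EuclideanSpace.single ν (1 : ℝ)) μ
        = etaDiag μ * EuclideanSpace.single ν (1 : ℝ) μ := minkReflect_apply _ _
    by_cases hμν : μ = ν
    · subst hμν
      simp [b, hypFlowLin, hJ]
    · simp [b, hypFlowLin, hJ, hμν]
  rw [← LinearMap.det_toMatrix b, h, Matrix.det_diagonal, Fin.prod_univ_four]
  have h1 : Real.exp s = Real.cosh s + Real.sinh s := (Real.cosh_add_sinh s).symm
  have h2 : Real.exp (-s) = Real.cosh s - Real.sinh s := (Real.cosh_sub_sinh s).symm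
  rw [show -2 * s = s + (-s + (-s + -s)) by ring, Real.exp_add, Real.exp_add, Real.exp_add]
  simp only [h1, h2, etaDiag, Matrix.cons_val]
  ring

/-- The flow as a homeomorphism. -/
def hypFlowHomeo (s : ℝ) : Mink ≃ₜ Mink where
  toFun := hypFlow s
  invFun := hypFlow (-s)
  left_inv := fun p => by rw [hypFlow_hypFlow, neg_add_cancel, hypFlow_zero]
  right_inv := fun p => by rw [hypFlow_hypFlow, add_neg_cancel, hypFlow_zero]
  continuous_toFun := continuous_hypFlow_right s
  continuous_invFun := continuous_hypFlow_right (-s)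

theorem map_hypFlow_volume (s : ℝ) :
    Measure.map (hypFlow s) volume =
      ENNReal.ofReal (Real.exp (2 * s)) • (volume : Measure Mink) := by
  have hdet : LinearMap.det (hypFlowLin s) ≠ 0 := by
    rw [det_hypFlowLin]; positivity
  have hmap := Measure.map_linearMap_addHaar_eq_smul_addHaar (volume : Measure Mink) hdet
  have h : |(Real.exp (-2 * s))⁻¹| = Real.exp (2 * s) := by
    rw [abs_of_pos (by positivity), ← Real.exp_neg]
    congr 1
    ring
  rw [det_hypFlowLin, h] at hmap
  exact hmap

theorem integral_comp_hypFlow (s : ℝ) (h : Mink → ℂ) :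
    ∫ p, h (hypFlow s p) = (Real.exp (2 * s) : ℂ) * ∫ p, h p := by
  have h1 := (hypFlowHomeo s).measurableEmbedding.integral_map (μ := volume) h
  have h2 : Measure.map (hypFlowHomeo s) volume = _ := map_hypFlow_volume s
  rw [h2, integral_smul_measure, ENNReal.toReal_ofReal (by positivity), Complex.real_smul] at h1
  exact h1.symm

/-- `g'` is the derivative of `g` along the hyperbolic flow. -/
def HasFlowDeriv (g g' : Mink → ℂ) : Prop :=
  ∀ p, HasDerivAt (fun s => g (hypFlow s p)) (g' p) 0

theorem HasFlowDeriv.hasDerivAt {g g' : Mink → ℂ} (h : HasFlowDeriv g g') (p : Mink) (s : ℝ) :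
    HasDerivAt (fun s => g (hypFlow s p)) (g' (hypFlow s p)) s := by
  have h1 := h (hypFlow s p)
  rw [← sub_self s] at h1
  have h2 := h1.comp_sub_const s s
  simpa only [hypFlow_hypFlow, sub_add_cancel] using h2

theorem HasFlowDeriv.add {f f' g g' : Mink → ℂ} (hf : HasFlowDeriv f f') (hg : HasFlowDeriv g g') :
    HasFlowDeriv (fun p => f p + g p) (fun p => f' p + g' p) :=
  fun p => (hf p).add (hg p)

theorem HasFlowDeriv.sub {f f' g g' : Mink → ℂ} (hf : HasFlowDeriv f f') (hg : HasFlowDeriv g g') :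
    HasFlowDeriv (fun p => f p - g p) (fun p => f' p - g' p) :=
  fun p => (hf p).sub (hg p)

theorem HasFlowDeriv.const_mul {f f' : Mink → ℂ} (hf : HasFlowDeriv f f') (c : ℂ) :
    HasFlowDeriv (fun p => c * f p) (fun p => c * f' p) :=
  fun p => (hf p).const_mul c

theorem HasFlowDeriv.const (c : ℂ) : HasFlowDeriv (fun _ => c) (fun _ => 0) :=
  fun _ => hasDerivAt_const _ _

theorem HasFlowDeriv.mul {f f' g g' : Mink → ℂ} (hf : HasFlowDeriv f f') (hg : HasFlowDeriv g g') :
    HasFlowDeriv (fun p => f p * g p) (fun p => f' p * g p + f p * g' p) := fun p => by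
  have h := (hf p).mul (hg p)
  simp only [hypFlow_zero] at h
  exact h

theorem HasFlowDeriv.cexp {f f' : Mink → ℂ} (hf : HasFlowDeriv f f') :
    HasFlowDeriv (fun p => Complex.exp (f p)) (fun p => Complex.exp (f p) * f' p) := fun p => by
  have h := (hf p).cexp
  simpa only [hypFlow_zero] using h

theorem HasFlowDeriv.inv {f f' : Mink → ℂ} (hf : HasFlowDeriv f f') (h0 : ∀ p, f p ≠ 0) :
    HasFlowDeriv (fun p => (f p)⁻¹) (fun p => -f' p / f p ^ 2) := fun p => by
  have h := (hf p).inv (by rw [hypFlow_zero]; exact h0 p)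
  simp only [hypFlow_zero] at h
  exact h

theorem hasFlowDeriv_mdot_self :
    HasFlowDeriv (fun p => (mdot p p : ℂ)) (fun p => 2 * (‖p‖ : ℂ) ^ 2) := fun p => by
  have h1 := hasDerivAt_hypFlow p
  have h2 : HasDerivAt (fun s => minkReflect (hypFlow s p)) (minkReflect (minkReflect p)) 0 := by
    simp only [minkReflect_hypFlow]
    exact hasDerivAt_hypFlow _
  have h3 := (h2.inner ℝ h1).ofReal_comp
  rw [hypFlow_zero, minkReflect_minkReflect, real_inner_self_eq_norm_sq,
    real_inner_self_eq_norm_sq, minkReflect.norm_map] at h3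
  simp only [mdot_eq_inner]
  convert h3 using 1
  push_cast
  ring

theorem hasFlowDeriv_norm_sq :
    HasFlowDeriv (fun p => (‖p‖ : ℂ) ^ 2) (fun p => 2 * (mdot p p : ℂ)) := fun p => by
  have h1 := hasDerivAt_hypFlow p
  have h3 := (h1.inner ℝ h1).ofReal_comp
  simp only [real_inner_self_eq_norm_sq, Complex.ofReal_pow, hypFlow_zero] at h3
  convert h3 using 1
  rw [real_inner_comm, ← mdot_eq_inner]
  push_cast
  ring

/-- The infinitesimal form of `integral_comp_hypFlow`: a function and its flow derivative have
proportional integrals. -/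
theorem integral_flowDeriv {h h' : Mink → ℂ} (hm : Measurable h) (hm' : Measurable h')
    (hd : HasFlowDeriv h h') {A : ℝ} (hb : ∀ p, ‖h p‖ ≤ A * ((1 + ‖p‖) ^ 6)⁻¹)
    (hb' : ∀ p, ‖h' p‖ ≤ A * ((1 + ‖p‖) ^ 6)⁻¹) :
    ∫ p, h' p = 2 * ∫ p, h p := by
  have hA : 0 ≤ A := by
    have := (norm_nonneg _).trans (hb 0)
    simpa using this
  have hflow : ∀ s : ℝ, Measurable (hypFlow s) := fun s =>
    (continuous_hypFlow_right s).measurable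
  -- differentiate `∫ h (hypFlow s p) = e^{2s} ∫ h` at `s = 0` under the integral sign
  have key := hasDerivAt_integral_of_dominated_loc_of_deriv_le (μ := (volume : Measure Mink))
    (F := fun s p => h (hypFlow s p)) (F' := fun s p => h' (hypFlow s p)) (x₀ := (0 : ℝ))
    (s := Metric.ball 0 1) (bound := fun p => A * 3 ^ 6 * ((1 + ‖p‖) ^ 6)⁻¹)
    (Metric.ball_mem_nhds 0 one_pos)
    (Eventually.of_forall fun s => (hm.comp (hflow s)).aestronglyMeasurable)
    (by
      simp only [hypFlow_zero]
      exact (integrable_inv_one_add_norm_pow.const_mul A).mono' hm.aestronglyMeasurable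
        (Eventually.of_forall hb))
    (hm'.comp (hflow 0)).aestronglyMeasurable
    (Eventually.of_forall fun p s hs => by
      have hs' : |s| ≤ 1 := by
        rw [Metric.mem_ball, dist_zero_right, Real.norm_eq_abs] at hs; exact hs.le
      refine (hb' _).trans ?_
      rw [mul_assoc]
      refine mul_le_mul_of_nonneg_left ?_ hA
      rw [← div_eq_mul_inv, inv_eq_one_div, div_le_div_iff₀ (by positivity) (by positivity),
        ← mul_pow, one_mul]
      refine pow_le_pow_left₀ (by positivity) ?_ 6
      linarith [norm_le_hypFlow hs' p])
    (integrable_inv_one_add_norm_pow.const_mul _)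
    (Eventually.of_forall fun p s _ => hd.hasDerivAt p s)
  have h1 := key.2
  simp only [integral_comp_hypFlow, hypFlow_zero] at h1
  have h2 : HasDerivAt (fun s : ℝ => (Real.exp (2 * s) : ℂ) * ∫ p, h p)
      (((2 : ℝ) : ℂ) * ∫ p, h p) 0 := by
    have : HasDerivAt (fun s : ℝ => Real.exp (2 * s)) 2 0 := by
      simpa using ((hasDerivAt_id (0 : ℝ)).const_mul 2).exp
    exact this.ofReal_comp.mul_const _
  rw [h1.unique h2]
  norm_num

/-- The oscillatory integral `∫ d⁴p e^{it p²} g(p)`. -/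
def oscInt (t : ℝ) (g : Mink → ℂ) : ℂ := ∫ p, Complex.exp (Complex.I * t * (mdot p p : ℂ)) * g p

theorem norm_cexp_I_mul_mul (t a : ℝ) : ‖Complex.exp (Complex.I * t * (a : ℂ))‖ = 1 := by
  rw [show Complex.I * t * (a : ℂ) = ((t * a : ℝ) : ℂ) * Complex.I by push_cast; ring,
    Complex.norm_exp_ofReal_mul_I]

theorem continuous_oscPhase :
    Continuous fun z : ℝ × Mink => Complex.exp (Complex.I * z.1 * (mdot z.2 z.2 : ℂ)) := by
  have h : Continuous fun z : ℝ × Mink => mdot z.2 z.2 := continuous_snd.mdot continuous_snd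
  fun_prop

theorem measurable_oscPhase (t : ℝ) :
    Measurable fun p : Mink => Complex.exp (Complex.I * t * (mdot p p : ℂ)) :=
  (continuous_oscPhase.comp (by fun_prop : Continuous fun p : Mink => (t, p))).measurable

/-- The damping factor `(1 + 2it‖p‖²)⁻¹` produced by one integration by parts along the flow. -/
def oscWeight (t : ℝ) (p : Mink) : ℂ := (1 + 2 * Complex.I * t * (‖p‖ : ℂ) ^ 2)⁻¹

/-- Minus the logarithmic flow derivative of `oscWeight`. Its own flow derivative is again a
bounded expression in `oscWeight` and `oscTheta`, so that integration by parts can be iterated. -/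
def oscTheta (t : ℝ) (p : Mink) : ℂ := 4 * Complex.I * t * (mdot p p : ℂ) * oscWeight t p

theorem normSq_oscWeight_denom (t : ℝ) (p : Mink) :
    ‖1 + 2 * Complex.I * t * (‖p‖ : ℂ) ^ 2‖ ^ 2 = 1 + (2 * t * ‖p‖ ^ 2) ^ 2 := by
  rw [← Complex.normSq_eq_norm_sq, show (1 + 2 * Complex.I * t * (‖p‖ : ℂ) ^ 2 : ℂ) =
    ((1 : ℝ) : ℂ) + ((2 * t * ‖p‖ ^ 2 : ℝ) : ℂ) * Complex.I by push_cast; ring,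
    Complex.normSq_add_mul_I]
  ring

theorem oscWeight_denom_ne_zero (t : ℝ) (p : Mink) :
    1 + 2 * Complex.I * t * (‖p‖ : ℂ) ^ 2 ≠ 0 := fun h => by
  have := normSq_oscWeight_denom t p
  rw [h, norm_zero] at this
  nlinarith [sq_nonneg (2 * t * ‖p‖ ^ 2)]

theorem norm_sq_oscWeight (t : ℝ) (p : Mink) :
    ‖oscWeight t p‖ ^ 2 = (1 + (2 * t * ‖p‖ ^ 2) ^ 2)⁻¹ := by
  rw [oscWeight, norm_inv, inv_pow, normSq_oscWeight_denom]

theorem norm_oscWeight_le_one (t : ℝ) (p : Mink) : ‖oscWeight t p‖ ≤ 1 := by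
  have h := norm_sq_oscWeight t p
  have h2 : (1 + (2 * t * ‖p‖ ^ 2) ^ 2)⁻¹ ≤ 1 :=
    inv_le_one_of_one_le₀ (by nlinarith [sq_nonneg (2 * t * ‖p‖ ^ 2)])
  rw [← h] at h2
  exact (sq_le_one_iff₀ (norm_nonneg _)).1 h2

theorem norm_oscTheta_le (t : ℝ) (p : Mink) : ‖oscTheta t p‖ ≤ 2 := by
  have h := norm_sq_oscWeight t p
  have h2 : ‖oscTheta t p‖ ^ 2 ≤ 2 ^ 2 := by
    rw [oscTheta, norm_mul, mul_pow, h]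
    have h3 : ‖4 * Complex.I * t * (mdot p p : ℂ)‖ = 4 * |t| * |mdot p p| := by simp
    rw [h3, ← div_eq_mul_inv, div_le_iff₀ (by positivity)]
    have h4 : |mdot p p| ≤ ‖p‖ ^ 2 := (abs_mdot_le p p).trans_eq (by ring)
    have h5 : (4 * |t| * |mdot p p|) ^ 2 ≤ (4 * |t| * ‖p‖ ^ 2) ^ 2 := by gcongr
    have h6 : (4 * |t| * ‖p‖ ^ 2) ^ 2 = 16 * t ^ 2 * (‖p‖ ^ 2) ^ 2 := by
      rw [mul_pow, mul_pow, sq_abs]; norm_num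
    nlinarith [sq_nonneg (2 * t * ‖p‖ ^ 2)]
  exact (pow_le_pow_iff_left₀ (norm_nonneg _) (by norm_num) two_ne_zero).1 h2

theorem measurable_oscWeight (t : ℝ) : Measurable (oscWeight t) := by
  unfold oscWeight; fun_prop

theorem measurable_mdot_self : Measurable fun p : Mink => mdot p p :=
  continuous_mdot_self.measurable

theorem measurable_oscTheta (t : ℝ) : Measurable (oscTheta t) := by
  unfold oscTheta
  have := measurable_mdot_self
  have := measurable_oscWeight t
  fun_prop

theorem hasFlowDeriv_oscWeight (t : ℝ) :
    HasFlowDeriv (oscWeight t) (fun p => -oscTheta t p * oscWeight t p) := by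
  have h := (((HasFlowDeriv.const 1).add (hasFlowDeriv_norm_sq.const_mul (2 * Complex.I * t)))).inv
    (oscWeight_denom_ne_zero t)
  intro p
  refine (h p).congr_deriv ?_
  simp only
  rw [oscTheta, oscWeight]
  have := oscWeight_denom_ne_zero t p
  field_simp
  ring

theorem two_I_mul_oscWeight (t : ℝ) (p : Mink) :
    2 * Complex.I * t * (‖p‖ : ℂ) ^ 2 * oscWeight t p = 1 - oscWeight t p := by
  have := oscWeight_denom_ne_zero t p
  rw [oscWeight]
  field_simp
  ring

theorem hasFlowDeriv_oscTheta (t : ℝ) :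
    HasFlowDeriv (oscTheta t) (fun p => 4 * (1 - oscWeight t p) - oscTheta t p ^ 2) := by
  have h := (hasFlowDeriv_mdot_self.const_mul (4 * Complex.I * t)).mul (hasFlowDeriv_oscWeight t)
  intro p
  refine (h p).congr_deriv ?_
  simp only
  rw [← two_I_mul_oscWeight, oscTheta]
  ring

/-- One integration by parts along the flow: the integral of the flow derivative of `e^{itp²} w
g`, with `w = oscWeight t`, is twice the integral of that function. -/
theorem oscInt_eq_oscInt_weight (t : ℝ) {g g' : Mink → ℂ} (hm : Measurable g)
    (hm' : Measurable g') (hd : HasFlowDeriv g g') {A : ℝ}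
    (hb : ∀ p, ‖g p‖ ≤ A * ((1 + ‖p‖) ^ 6)⁻¹) (hb' : ∀ p, ‖g' p‖ ≤ A * ((1 + ‖p‖) ^ 6)⁻¹) :
    oscInt t g = oscInt t fun p => oscWeight t p * (3 * g p + oscTheta t p * g p - g' p) := by
  have hA : 0 ≤ A := by
    have := (norm_nonneg _).trans (hb 0)
    simpa using this
  set e : Mink → ℂ := fun p => Complex.exp (Complex.I * t * (mdot p p : ℂ)) with he
  have hme : Measurable e := measurable_oscPhase t
  have hmw := measurable_oscWeight t
  have hmθ := measurable_oscTheta t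
  have hne : ∀ p, ‖e p‖ = 1 := fun p => norm_cexp_I_mul_mul t _
  have hde : HasFlowDeriv e (fun p => e p * (2 * Complex.I * t * (‖p‖ : ℂ) ^ 2)) := fun p => by
    have h := (hasFlowDeriv_mdot_self.const_mul (Complex.I * t)).cexp p
    convert h using 1
    simp only [he]
    ring
  -- the derivative of the phase is `2it‖p‖²`, and `2it‖p‖² w = 1 - w`
  have hd1 : HasFlowDeriv (fun p => e p * (oscWeight t p * g p))
      (fun p => e p * (-oscTheta t p * (oscWeight t p * g p) + oscWeight t p * g' p
        + (1 - oscWeight t p) * g p)) := fun p => by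
    have h := (hde.mul ((hasFlowDeriv_oscWeight t).mul hd)) p
    convert h using 1
    simp only
    rw [← two_I_mul_oscWeight]
    ring
  have hω : ∀ p : Mink, 0 ≤ A * ((1 + ‖p‖) ^ 6)⁻¹ := fun p => by positivity
  have hB1 : ∀ p, ‖e p * (oscWeight t p * g p)‖ ≤ 5 * A * ((1 + ‖p‖) ^ 6)⁻¹ := fun p => by
    rw [norm_mul, norm_mul, hne, one_mul]
    have := mul_le_mul (norm_oscWeight_le_one t p) (hb p) (norm_nonneg _) zero_le_one
    linarith [hω p]
  have hB2 : ∀ p, ‖e p * (-oscTheta t p * (oscWeight t p * g p) + oscWeight t p * g' p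
        + (1 - oscWeight t p) * g p)‖ ≤ 5 * A * ((1 + ‖p‖) ^ 6)⁻¹ := fun p => by
    rw [norm_mul, hne, one_mul]
    have h1 := norm_oscWeight_le_one t p
    have h2 := norm_oscTheta_le t p
    have h3 : ‖1 - oscWeight t p‖ ≤ 2 := by
      refine (norm_sub_le _ _).trans ?_
      rw [norm_one]; linarith
    calc _ ≤ ‖-oscTheta t p * (oscWeight t p * g p)‖ + ‖oscWeight t p * g' p‖
          + ‖(1 - oscWeight t p) * g p‖ := norm_add₃_le
      _ = ‖oscTheta t p‖ * (‖oscWeight t p‖ * ‖g p‖) + ‖oscWeight t p‖ * ‖g' p‖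
          + ‖1 - oscWeight t p‖ * ‖g p‖ := by simp only [norm_mul, norm_neg]
      _ ≤ 2 * (1 * (A * ((1 + ‖p‖) ^ 6)⁻¹)) + 1 * (A * ((1 + ‖p‖) ^ 6)⁻¹)
          + 2 * (A * ((1 + ‖p‖) ^ 6)⁻¹) := by
            have := hb p; have := hb' p
            gcongr
      _ = _ := by ring
  have hm1 : Measurable fun p => e p * (oscWeight t p * g p) := by fun_prop
  have hm2 : Measurable fun p => e p * (-oscTheta t p * (oscWeight t p * g p) + oscWeight t p * g' p
        + (1 - oscWeight t p) * g p) := by fun_prop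
  have hI := integral_flowDeriv hm1 hm2 hd1 hB1 hB2
  have hint1 : Integrable fun p => e p * (oscWeight t p * g p) :=
    (integrable_inv_one_add_norm_pow.const_mul (5 * A)).mono' hm1.aestronglyMeasurable
      (Eventually.of_forall hB1)
  have hint2 : Integrable fun p => e p * (-oscTheta t p * (oscWeight t p * g p)
      + oscWeight t p * g' p + (1 - oscWeight t p) * g p) :=
    (integrable_inv_one_add_norm_pow.const_mul (5 * A)).mono' hm2.aestronglyMeasurable
      (Eventually.of_forall hB2)
  -- the difference of the two amplitudes is `h' - 2h` for the function `h = e^{itp²} w g`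
  have hdecomp : ∀ p, e p * g p = e p * (oscWeight t p * (3 * g p + oscTheta t p * g p - g' p))
      + (e p * (-oscTheta t p * (oscWeight t p * g p)
      + oscWeight t p * g' p + (1 - oscWeight t p) * g p) - 2 * (e p * (oscWeight t p * g p))) := by
    intro p; ring
  have hint3 : Integrable fun p =>
      e p * (oscWeight t p * (3 * g p + oscTheta t p * g p - g' p)) := by
    have hg : Integrable fun p => e p * g p :=
      (integrable_inv_one_add_norm_pow.const_mul A).mono'
        (by fun_prop : Measurable fun p => e p * g p).aestronglyMeasurable
        (Eventually.of_forall fun p => by rw [norm_mul, hne, one_mul]; exact hb p)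
    refine (hg.sub (hint2.sub (hint1.const_mul 2))).congr (Eventually.of_forall fun p => ?_)
    simp only [Pi.sub_apply]
    rw [hdecomp p]
    ring
  change ∫ p, e p * g p = ∫ p, e p * _
  have h1 := integral_sub hint2 (hint1.const_mul 2)
  rw [hI, integral_const_mul, sub_self] at h1
  have h2 := integral_add hint3 (hint2.sub (hint1.const_mul 2))
  simp only [Pi.sub_apply] at h2
  rw [integral_congr_ae (Eventually.of_forall hdecomp), h2, h1, add_zero]

/-- `g` and its first two flow derivatives are measurable and dominated by `b`. -/
def FlowBounded (g : Mink → ℂ) (b : Mink → ℝ) : Prop :=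
  ∃ g' g'' : Mink → ℂ, Measurable g ∧ Measurable g' ∧ Measurable g'' ∧ HasFlowDeriv g g' ∧
    HasFlowDeriv g' g'' ∧ ∀ p, ‖g p‖ ≤ b p ∧ ‖g' p‖ ≤ b p ∧ ‖g'' p‖ ≤ b p

/-- The integrable majorant `min(1, |t|^{-3/2})` for oscillatory integrals. -/
def oscDecay (t : ℝ) : ℝ := min 1 (|t| ^ (-(3 / 2) : ℝ))

/-- The square of the damping factor decays like the integrable power `|t|^{-3/2}`, at the expense
of a singularity `‖p‖⁻³` that is integrable in four dimensions. -/
theorem norm_sq_oscWeight_le {t : ℝ} (ht : t ≠ 0) {p : Mink} (hp : p ≠ 0) :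
    ‖oscWeight t p‖ ^ 2 ≤ oscDecay t * (1 + (‖p‖ ^ 3)⁻¹) := by
  have h1 : ‖oscWeight t p‖ ^ 2 ≤ 1 := pow_le_one₀ (norm_nonneg _) (norm_oscWeight_le_one t p)
  have h2 : 0 < |t| := abs_pos.2 ht
  have h3 : 0 < ‖p‖ := norm_pos_iff.2 hp
  have h4 : 0 ≤ (‖p‖ ^ 3)⁻¹ := by positivity
  rw [oscDecay]
  rcases min_cases 1 (|t| ^ (-(3 / 2) : ℝ)) with ⟨h, -⟩ | ⟨h, -⟩
  · rw [h]
    linarith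
  · rw [h]
    have h5 : ‖oscWeight t p‖ ^ 2 ≤ |t| ^ (-(3 / 2) : ℝ) * (‖p‖ ^ 3)⁻¹ := by
      -- the elementary inequality `y ^ (3/2) ≤ 1 + y ^ 2` for `y = |t| ‖p‖²`
      have h6 : |t| ^ (-(3 / 2) : ℝ) * (‖p‖ ^ 3)⁻¹ = ((|t| * ‖p‖ ^ 2) ^ (3 / 2 : ℝ))⁻¹ := by
        rw [Real.mul_rpow h2.le (by positivity), mul_inv, ← Real.rpow_neg h2.le,
          ← Real.rpow_natCast ‖p‖ 2, ← Real.rpow_mul h3.le]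
        norm_num
      rw [norm_sq_oscWeight, h6]
      refine inv_anti₀ (by positivity) ?_
      set y := |t| * ‖p‖ ^ 2 with hy
      have hy0 : 0 < y := by positivity
      have h7 : (2 * t * ‖p‖ ^ 2) ^ 2 = 4 * y ^ 2 := by
        rw [hy, mul_pow, mul_pow, mul_pow, sq_abs]; ring
      rw [h7]
      rcases le_total y 1 with h8 | h8
      · have := Real.rpow_le_one hy0.le h8 (by norm_num : (0 : ℝ) ≤ 3 / 2)
        nlinarith [sq_nonneg y]
      · have h9 := Real.rpow_le_rpow_of_exponent_le h8 (by norm_num : (3 / 2 : ℝ) ≤ (2 : ℕ))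
        rw [Real.rpow_natCast] at h9
        nlinarith [sq_nonneg y]
    have h6 : 0 ≤ |t| ^ (-(3 / 2) : ℝ) := by positivity
    linarith

theorem oscDecay_nonneg (t : ℝ) : 0 ≤ oscDecay t := by
  unfold oscDecay; positivity

theorem measurable_oscDecay : Measurable oscDecay := by
  unfold oscDecay
  fun_prop

theorem integrableOn_oscDecay : IntegrableOn oscDecay (Ioi 0) := by
  rw [← Ioc_union_Ioi_eq_Ioi zero_le_one]
  refine IntegrableOn.union ?_ ?_
  · refine Integrable.mono' (g := fun _ => 1) (by simp) measurable_oscDecay.aestronglyMeasurable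
      (Eventually.of_forall fun t => ?_)
    rw [Real.norm_eq_abs, abs_of_nonneg (oscDecay_nonneg t)]
    exact min_le_left _ _
  · refine Integrable.mono' (integrableOn_Ioi_rpow_of_lt (by norm_num : (-(3 / 2) : ℝ) < -1)
      one_pos) measurable_oscDecay.aestronglyMeasurable ?_
    refine (ae_restrict_iff' measurableSet_Ioi).2 (Eventually.of_forall fun t ht => ?_)
    rw [Real.norm_eq_abs, abs_of_nonneg (oscDecay_nonneg t)]
    rw [mem_Ioi] at ht
    refine (min_le_right _ _).trans_eq ?_
    rw [abs_of_pos (by linarith)]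

theorem integrable_singular_weight :
    Integrable fun p : Mink => (1 + (‖p‖ ^ 3)⁻¹) * ((1 + ‖p‖) ^ 6)⁻¹ := by
  have h : Integrable fun p : Mink => (‖p‖ ^ 3)⁻¹ * ((1 + ‖p‖) ^ 6)⁻¹ := by
    rw [integrable_fun_norm_addHaar (volume : Measure Mink)
      (f := fun r : ℝ => (r ^ 3)⁻¹ * ((1 + r) ^ 6)⁻¹)]
    have h1 : Integrable fun r : ℝ => (1 + ‖r‖) ^ (-6 : ℝ) := integrable_one_add_norm (by simp)
    refine (h1.integrableOn (s := Ioi 0)).congr_fun (fun r hr => ?_) measurableSet_Ioi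
    have hr' : (0 : ℝ) < r := hr
    simp only [finrank_euclideanSpace, Fintype.card_fin, smul_eq_mul]
    rw [Real.rpow_neg (by positivity), Real.norm_eq_abs, abs_of_pos hr']
    norm_cast
    field_simp
  refine (integrable_inv_one_add_norm_pow.add h).congr (Eventually.of_forall fun p => ?_)
  simp only [Pi.add_apply]
  ring

/-- The constant of the decay estimate `norm_oscInt_le`. -/
def oscConst : ℝ := 60 * ∫ p : Mink, (1 + (‖p‖ ^ 3)⁻¹) * ((1 + ‖p‖) ^ 6)⁻¹

theorem oscConst_nonneg : 0 ≤ oscConst :=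
  mul_nonneg (by norm_num) (integral_nonneg fun p => by positivity)

/-- Two integrations by parts along the flow. The flow preserves functions that are homogeneous of
degree zero, so that no smoothness of `g` at the origin is needed. -/
theorem norm_oscInt_le {t : ℝ} (ht : t ≠ 0) {g : Mink → ℂ} {A : ℝ}
    (hg : FlowBounded g fun p => A * ((1 + ‖p‖) ^ 6)⁻¹) :
    ‖oscInt t g‖ ≤ A * (oscConst * oscDecay t) := by
  obtain ⟨g', g'', hm, hm', hm'', hd, hd', hb⟩ := hg
  have hA : 0 ≤ A := by
    have := (norm_nonneg _).trans (hb 0).1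
    simpa using this
  have hmw := measurable_oscWeight t
  have hmθ := measurable_oscTheta t
  have hω : ∀ p : Mink, 0 ≤ A * ((1 + ‖p‖) ^ 6)⁻¹ := fun p => by positivity
  -- `h` is the amplitude after the first integration by parts and `h'` its flow derivative
  set h : Mink → ℂ := fun p => oscWeight t p * (3 * g p + oscTheta t p * g p - g' p) with hh
  set θ' : Mink → ℂ := fun p => 4 * (1 - oscWeight t p) - oscTheta t p ^ 2 with hθ'
  set k : Mink → ℂ := fun p => 3 * g' p + (θ' p * g p + oscTheta t p * g' p) - g'' p with hk
  set h' : Mink → ℂ := fun p => -oscTheta t p * h p + oscWeight t p * k p with hh'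
  have hdh : HasFlowDeriv h h' := fun p => by
    have e := ((hasFlowDeriv_oscWeight t).mul (((hd.const_mul 3).add
      ((hasFlowDeriv_oscTheta t).mul hd)).sub hd')) p
    convert e using 1
    simp only [hh', hh, hk, hθ']
    ring
  have hw := norm_oscWeight_le_one t
  have hθ := norm_oscTheta_le t
  have hbh : ∀ p, ‖h p‖ ≤ ‖oscWeight t p‖ * (6 * (A * ((1 + ‖p‖) ^ 6)⁻¹)) := fun p => by
    rw [hh]
    simp only
    rw [norm_mul]
    refine mul_le_mul_of_nonneg_left ?_ (norm_nonneg _)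
    obtain ⟨h1, h2, -⟩ := hb p
    calc _ ≤ ‖3 * g p‖ + ‖oscTheta t p * g p‖ + ‖g' p‖ :=
          (norm_sub_le _ _).trans (by gcongr; exact norm_add_le _ _)
      _ = 3 * ‖g p‖ + ‖oscTheta t p‖ * ‖g p‖ + ‖g' p‖ := by simp
      _ ≤ 3 * (A * ((1 + ‖p‖) ^ 6)⁻¹) + 2 * (A * ((1 + ‖p‖) ^ 6)⁻¹)
          + A * ((1 + ‖p‖) ^ 6)⁻¹ := by
          have := hθ p
          gcongr
      _ = _ := by ring
  have hbθ' : ∀ p, ‖θ' p‖ ≤ 12 := fun p => by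
    calc ‖θ' p‖ ≤ ‖4 * (1 - oscWeight t p)‖ + ‖oscTheta t p ^ 2‖ := norm_sub_le _ _
      _ = 4 * ‖1 - oscWeight t p‖ + ‖oscTheta t p‖ ^ 2 := by simp
      _ ≤ 4 * (1 + 1) + 2 ^ 2 := by
        have h1 := hθ p
        have h2 : ‖1 - oscWeight t p‖ ≤ 1 + 1 :=
          (norm_sub_le _ _).trans (by rw [norm_one]; linarith [hw p])
        gcongr
      _ = 12 := by norm_num
  have hbk : ∀ p, ‖k p‖ ≤ 18 * (A * ((1 + ‖p‖) ^ 6)⁻¹) := fun p => by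
    obtain ⟨h1, h2, h3⟩ := hb p
    calc ‖k p‖ ≤ ‖3 * g' p‖ + (‖θ' p * g p‖ + ‖oscTheta t p * g' p‖) + ‖g'' p‖ := by
          refine (norm_sub_le _ _).trans ?_
          gcongr
          refine (norm_add_le _ _).trans ?_
          gcongr
          exact norm_add_le _ _
      _ = 3 * ‖g' p‖ + (‖θ' p‖ * ‖g p‖ + ‖oscTheta t p‖ * ‖g' p‖) + ‖g'' p‖ := by simp
      _ ≤ 3 * (A * ((1 + ‖p‖) ^ 6)⁻¹) + (12 * (A * ((1 + ‖p‖) ^ 6)⁻¹)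
          + 2 * (A * ((1 + ‖p‖) ^ 6)⁻¹)) + A * ((1 + ‖p‖) ^ 6)⁻¹ := by
          have := hθ p
          have := hbθ' p
          gcongr
      _ = _ := by ring
  have hbh' : ∀ p, ‖h' p‖ ≤ ‖oscWeight t p‖ * (30 * (A * ((1 + ‖p‖) ^ 6)⁻¹)) := fun p => by
    calc ‖h' p‖ ≤ ‖-oscTheta t p * h p‖ + ‖oscWeight t p * k p‖ := norm_add_le _ _
      _ = ‖oscTheta t p‖ * ‖h p‖ + ‖oscWeight t p‖ * ‖k p‖ := by simp
      _ ≤ 2 * (‖oscWeight t p‖ * (6 * (A * ((1 + ‖p‖) ^ 6)⁻¹)))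
          + ‖oscWeight t p‖ * (18 * (A * ((1 + ‖p‖) ^ 6)⁻¹)) := by
          have := hθ p
          have := hbh p
          have := hbk p
          gcongr
      _ = _ := by ring
  have hle : ∀ p (c : ℝ), 0 ≤ c → c ≤ 30 → ‖oscWeight t p‖ * (c * (A * ((1 + ‖p‖) ^ 6)⁻¹)) ≤
      30 * A * ((1 + ‖p‖) ^ 6)⁻¹ := fun p c hc hc' => by
    calc _ ≤ 1 * (30 * (A * ((1 + ‖p‖) ^ 6)⁻¹)) := by
          have := hw p
          have := hω p
          gcongr
      _ = _ := by ring
  have hmh : Measurable h := by fun_prop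
  have hmh' : Measurable h' := by fun_prop
  rw [oscInt_eq_oscInt_weight t hm hm' hd (fun p => (hb p).1) (fun p => (hb p).2.1),
    oscInt_eq_oscInt_weight t hmh hmh' hdh (A := 30 * A)
      (fun p => (hbh p).trans (hle p 6 (by norm_num) (by norm_num)))
      (fun p => (hbh' p).trans (hle p 30 (by norm_num) le_rfl)), oscInt]
  -- after the second integration by parts the amplitude has the factor `oscWeight ^ 2`
  have hfin : ∀ᵐ p : Mink, ‖Complex.exp (Complex.I * t * (mdot p p : ℂ)) *
      (oscWeight t p * (3 * h p + oscTheta t p * h p - h' p))‖ ≤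
      60 * A * oscDecay t * ((1 + (‖p‖ ^ 3)⁻¹) * ((1 + ‖p‖) ^ 6)⁻¹) := by
    -- the majorant takes the junk value `0⁻¹` at the origin, a null set
    filter_upwards [compl_mem_ae_iff.2 (measure_singleton (0 : Mink))] with p hp
    have hp0 : p ≠ 0 := hp
    rw [norm_mul, norm_cexp_I_mul_mul, one_mul, norm_mul]
    have h1 : ‖3 * h p + oscTheta t p * h p - h' p‖ ≤
        ‖oscWeight t p‖ * (60 * (A * ((1 + ‖p‖) ^ 6)⁻¹)) := by
      calc _ ≤ ‖3 * h p‖ + ‖oscTheta t p * h p‖ + ‖h' p‖ :=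
            (norm_sub_le _ _).trans (by gcongr; exact norm_add_le _ _)
        _ = 3 * ‖h p‖ + ‖oscTheta t p‖ * ‖h p‖ + ‖h' p‖ := by simp
        _ ≤ 3 * (‖oscWeight t p‖ * (6 * (A * ((1 + ‖p‖) ^ 6)⁻¹)))
            + 2 * (‖oscWeight t p‖ * (6 * (A * ((1 + ‖p‖) ^ 6)⁻¹)))
            + ‖oscWeight t p‖ * (30 * (A * ((1 + ‖p‖) ^ 6)⁻¹)) := by
            have := hθ p
            have := hbh p
            have := hbh' p
            gcongr
        _ = _ := by ring
    calc _ ≤ ‖oscWeight t p‖ * (‖oscWeight t p‖ * (60 * (A * ((1 + ‖p‖) ^ 6)⁻¹))) := by gcongr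
      _ = ‖oscWeight t p‖ ^ 2 * (60 * (A * ((1 + ‖p‖) ^ 6)⁻¹)) := by ring
      _ ≤ (oscDecay t * (1 + (‖p‖ ^ 3)⁻¹)) * (60 * (A * ((1 + ‖p‖) ^ 6)⁻¹)) := by
          have := norm_sq_oscWeight_le ht hp0
          have := hω p
          gcongr
      _ = _ := by ring
  refine (norm_integral_le_of_norm_le (integrable_singular_weight.const_mul _) hfin).trans_eq ?_
  rw [integral_const_mul, oscConst]
  ring

theorem FlowBounded.measurable {g : Mink → ℂ} {b : Mink → ℝ} (h : FlowBounded g b) :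
    Measurable g := h.choose_spec.choose_spec.1

theorem FlowBounded.norm_le {g : Mink → ℂ} {b : Mink → ℝ} (h : FlowBounded g b) (p : Mink) :
    ‖g p‖ ≤ b p := by
  obtain ⟨_, _, _, _, _, _, _, hb⟩ := h
  exact (hb p).1

theorem FlowBounded.mono {g : Mink → ℂ} {b b' : Mink → ℝ} (h : FlowBounded g b)
    (hb : ∀ p, b p ≤ b' p) : FlowBounded g b' := by
  obtain ⟨g', g'', h1, h2, h3, h4, h5, h6⟩ := h
  exact ⟨g', g'', h1, h2, h3, h4, h5, fun p => ⟨(h6 p).1.trans (hb p), (h6 p).2.1.trans (hb p),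
    (h6 p).2.2.trans (hb p)⟩⟩

theorem FlowBounded.add {f g : Mink → ℂ} {a b : Mink → ℝ} (hf : FlowBounded f a)
    (hg : FlowBounded g b) : FlowBounded (fun p => f p + g p) fun p => a p + b p := by
  obtain ⟨f', f'', h1, h2, h3, h4, h5, h6⟩ := hf
  obtain ⟨g', g'', k1, k2, k3, k4, k5, k6⟩ := hg
  exact ⟨_, _, h1.add k1, h2.add k2, h3.add k3, h4.add k4, h5.add k5, fun p =>
    ⟨norm_add_le_of_le (h6 p).1 (k6 p).1, norm_add_le_of_le (h6 p).2.1 (k6 p).2.1,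
      norm_add_le_of_le (h6 p).2.2 (k6 p).2.2⟩⟩

theorem FlowBounded.const (c : ℂ) : FlowBounded (fun _ => c) fun _ => ‖c‖ :=
  ⟨_, _, measurable_const, measurable_const, measurable_const, HasFlowDeriv.const c,
    HasFlowDeriv.const 0, fun _ => ⟨le_rfl, by simp, by simp⟩⟩

theorem FlowBounded.mul {f g : Mink → ℂ} {a b : Mink → ℝ} (hf : FlowBounded f a)
    (hg : FlowBounded g b) : FlowBounded (fun p => f p * g p) fun p => 4 * (a p * b p) := by
  obtain ⟨f', f'', h1, h2, h3, h4, h5, h6⟩ := hf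
  obtain ⟨g', g'', k1, k2, k3, k4, k5, k6⟩ := hg
  refine ⟨_, _, h1.mul k1, (h2.mul k1).add (h1.mul k2),
    ((h3.mul k1).add (h2.mul k2)).add ((h2.mul k2).add (h1.mul k3)), h4.mul k4,
    (h5.mul k4).add (h4.mul k5), fun p => ?_⟩
  obtain ⟨a1, a2, a3⟩ := h6 p
  obtain ⟨b1, b2, b3⟩ := k6 p
  have key : ∀ x y : ℂ, ‖x‖ ≤ a p → ‖y‖ ≤ b p → ‖x * y‖ ≤ a p * b p := fun x y hx hy => by
    rw [norm_mul]
    exact mul_le_mul hx hy (norm_nonneg _) ((norm_nonneg _).trans hx)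
  have h0 : 0 ≤ a p * b p := mul_nonneg ((norm_nonneg _).trans a1) ((norm_nonneg _).trans b1)
  refine ⟨(key _ _ a1 b1).trans (by linarith), ?_, ?_⟩
  · refine (norm_add_le_of_le (key _ _ a2 b1) (key _ _ a1 b2)).trans (by linarith)
  · refine (norm_add_le_of_le (norm_add_le_of_le (key _ _ a3 b1) (key _ _ a2 b2))
      (norm_add_le_of_le (key _ _ a2 b2) (key _ _ a1 b3))).trans (by linarith)

/-- The flow commutes with dilations. -/
theorem FlowBounded.comp_smul {f : Mink → ℂ} {a : Mink → ℝ} (hf : FlowBounded f a) (r : ℝ) :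
    FlowBounded (fun p => f (r • p)) fun p => a (r • p) := by
  obtain ⟨f', f'', h1, h2, h3, h4, h5, h6⟩ := hf
  refine ⟨fun p => f' (r • p), fun p => f'' (r • p), by fun_prop, by fun_prop, by fun_prop,
    fun p => ?_, fun p => ?_, fun p => h6 _⟩
  · simpa only [hypFlow_smul] using h4 (r • p)
  · simpa only [hypFlow_smul] using h5 (r • p)

/-- The flow derivative of a smooth function is its derivative in direction `J p`, which costs one
power of `‖p‖`. -/
theorem flowBounded_of_contDiff {f : Mink → ℂ} (hf : ContDiff ℝ ∞ f) {D : Mink → ℝ}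
    (hD : ∀ p, ∀ j ≤ 2, ‖iteratedFDeriv ℝ j f p‖ ≤ D p) :
    FlowBounded f fun p => 2 * ((1 + ‖p‖) ^ 2 * D p) := by
  have hf1 : ContDiff ℝ ∞ (fderiv ℝ f) := hf.fderiv_right (by simp)
  have hf2 : ContDiff ℝ ∞ (fderiv ℝ (fderiv ℝ f)) := hf1.fderiv_right (by simp)
  have hJ := minkReflect.continuous
  have hc1 := hf1.continuous
  have hc2 := hf2.continuous
  refine ⟨fun p => fderiv ℝ f p (minkReflect p),
    fun p => fderiv ℝ (fderiv ℝ f) p (minkReflect p) (minkReflect p) + fderiv ℝ f p p,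
    hf.continuous.measurable, (hc1.clm_apply hJ).measurable,
    (((hc2.clm_apply hJ).clm_apply hJ).add (hc1.clm_apply continuous_id)).measurable,
    fun p => ?_, fun p => ?_, fun p => ?_⟩
  · have h := ((hf.differentiable (by simp)).differentiableAt (x := hypFlow 0 p)).hasFDerivAt
    have h2 := h.comp_hasDerivAt (0 : ℝ) (hasDerivAt_hypFlow p)
    rw [hypFlow_zero] at h2
    exact h2
  · have h := ((hf1.differentiable (by simp)).differentiableAt (x := hypFlow 0 p)).hasFDerivAt
    have h2 := h.comp_hasDerivAt (0 : ℝ) (hasDerivAt_hypFlow p)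
    have h3 := h2.clm_apply (hasDerivAt_hypFlow (minkReflect p))
    simp only [Function.comp_apply, hypFlow_zero, minkReflect_minkReflect] at h3
    simp only [minkReflect_hypFlow]
    exact h3
  · have d0 : ‖f p‖ ≤ D p := by simpa using hD p 0 (by norm_num)
    have d1 : ‖fderiv ℝ f p‖ ≤ D p := by simpa using hD p 1 (by norm_num)
    have d2 : ‖fderiv ℝ (fderiv ℝ f) p‖ ≤ D p := by
      have := hD p 2 le_rfl
      rw [← norm_iteratedFDeriv_fderiv, ← norm_iteratedFDeriv_fderiv, norm_iteratedFDeriv_zero]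
        at this
      exact this
    have hp := norm_nonneg p
    have hD0 : 0 ≤ D p := (norm_nonneg _).trans d0
    have hJp : ‖minkReflect p‖ = ‖p‖ := minkReflect.norm_map p
    have e1 : ‖p‖ ≤ (1 + ‖p‖) ^ 2 := by nlinarith
    have e2 : ‖p‖ * ‖p‖ ≤ (1 + ‖p‖) ^ 2 := by nlinarith
    have e3 : 1 ≤ (1 + ‖p‖) ^ 2 := by nlinarith
    have c1 : ‖fderiv ℝ f p p‖ ≤ (1 + ‖p‖) ^ 2 * D p := by
      refine (ContinuousLinearMap.le_opNorm _ _).trans ?_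
      rw [mul_comm]
      gcongr
    have c2 : ‖fderiv ℝ f p (minkReflect p)‖ ≤ (1 + ‖p‖) ^ 2 * D p := by
      refine (ContinuousLinearMap.le_opNorm _ _).trans ?_
      rw [mul_comm, hJp]
      gcongr
    have c3 : ‖fderiv ℝ (fderiv ℝ f) p (minkReflect p) (minkReflect p)‖ ≤ (1 + ‖p‖) ^ 2 * D p := by
      refine (ContinuousLinearMap.le_opNorm₂ _ _ _).trans ?_
      rw [hJp, mul_assoc, mul_comm]
      gcongr
    have c0 : 0 ≤ (1 + ‖p‖) ^ 2 * D p := by positivity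
    have c4 : D p ≤ (1 + ‖p‖) ^ 2 * D p := le_mul_of_one_le_left hD0 e3
    exact ⟨by linarith, by linarith, (norm_add_le_of_le c3 c1).trans (by linarith)⟩

/-- A continuous seminorm on Schwartz space. -/
def schwartzSup (m : ℕ × ℕ) (f : 𝓢(Mink, ℂ)) : ℝ :=
  (Finset.Iic m).sup (schwartzSeminormFamily ℂ Mink ℂ) f

theorem schwartzSup_nonneg (m : ℕ × ℕ) (f : 𝓢(Mink, ℂ)) : 0 ≤ schwartzSup m f :=
  apply_nonneg _ _

theorem SchwartzMap.iteratedFDeriv_le (f : 𝓢(Mink, ℂ)) (N : ℕ) (p : Mink) (j : ℕ) (hj : j ≤ 2) :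
    ‖iteratedFDeriv ℝ j f p‖ ≤ 2 ^ N * schwartzSup (N, 2) f * ((1 + ‖p‖) ^ N)⁻¹ := by
  have h := SchwartzMap.one_add_le_sup_seminorm_apply (𝕜 := ℂ) (m := (N, 2)) (k := N) (n := j)
    le_rfl hj f p
  rw [← div_eq_mul_inv, le_div_iff₀ (by positivity), mul_comm]
  exact h

theorem SchwartzMap.flowBounded (f : 𝓢(Mink, ℂ)) (N : ℕ) :
    FlowBounded f fun p => 2 * (2 ^ (N + 2) * schwartzSup (N + 2, 2) f) * ((1 + ‖p‖) ^ N)⁻¹ := by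
  refine (flowBounded_of_contDiff (f.smooth ⊤) (f.iteratedFDeriv_le (N + 2))).mono fun p => ?_
  have : (1 + ‖p‖) ^ 2 ≠ 0 := by positivity
  rw [pow_add (1 + ‖p‖) N 2]
  refine le_of_eq ?_
  field_simp

theorem SchwartzMap.flowBounded_translate (f : 𝓢(Mink, ℂ)) (N : ℕ) (k : Mink) :
    FlowBounded (fun p => f (p - k)) fun p =>
      2 * ((1 + ‖p‖) ^ 2 * (2 ^ N * schwartzSup (N, 2) f * ((1 + ‖p - k‖) ^ N)⁻¹)) := by
  refine flowBounded_of_contDiff ((f.smooth ⊤).comp (contDiff_id.sub contDiff_const))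
    fun p j hj => ?_
  have h := iteratedFDeriv_comp_sub (𝕜 := ℝ) (f := (f : Mink → ℂ)) j k p
  exact (congrArg norm h).le.trans (f.iteratedFDeriv_le N (p - k) j hj)

theorem FlowBounded.integrable {g : Mink → ℂ} {A : ℝ}
    (hg : FlowBounded g fun p => A * ((1 + ‖p‖) ^ 6)⁻¹) : Integrable g :=
  (integrable_inv_one_add_norm_pow.const_mul A).mono' hg.measurable.aestronglyMeasurable
    (Eventually.of_forall hg.norm_le)

/-! ### Boundary values of `(p² - μ)⁻¹` -/

theorem integrable_oscPhase_mul {g : Mink → ℂ} (hg : Integrable g) (t : ℝ) :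
    Integrable fun p => Complex.exp (Complex.I * t * (mdot p p : ℂ)) * g p :=
  hg.bdd_mul (c := 1) (measurable_oscPhase t).aestronglyMeasurable
    (Eventually.of_forall fun _ => (norm_cexp_I_mul_mul t _).le)

theorem continuous_oscInt {g : Mink → ℂ} (hg : Integrable g) : Continuous fun t => oscInt t g := by
  refine continuous_of_dominated (bound := fun p => ‖g p‖)
    (fun t => (integrable_oscPhase_mul hg t).aestronglyMeasurable)
    (fun t => Eventually.of_forall fun p => by rw [norm_mul, norm_cexp_I_mul_mul, one_mul]) hg.norm
    (Eventually.of_forall fun p => by fun_prop)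

theorem oscInt_add {f g : Mink → ℂ} (hf : Integrable f) (hg : Integrable g) (t : ℝ) :
    oscInt t (fun p => f p + g p) = oscInt t f + oscInt t g := by
  rw [oscInt, oscInt, oscInt, ← integral_add (integrable_oscPhase_mul hf t)
    (integrable_oscPhase_mul hg t)]
  simp only [mul_add]

theorem oscInt_const_mul (c : ℂ) (g : Mink → ℂ) (t : ℝ) :
    oscInt t (fun p => c * g p) = c * oscInt t g := by
  rw [oscInt, oscInt, ← integral_const_mul]
  exact integral_congr_ae (Eventually.of_forall fun p => by simp only; ring)

/-- The boundary value `∫ d⁴p g(p) / (p² - μ + σi0)`, `σ = ±1`, as a convergent integral over the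
Schwinger parameter `t`. -/
def propFunctional (σ μ : ℝ) (g : Mink → ℂ) : ℂ :=
  -(Complex.I * σ) *
    ∫ t in Ioi (0 : ℝ), Complex.exp (Complex.I * ((-(σ * μ) : ℝ) : ℂ) * (t : ℂ)) * oscInt (σ * t) g

/-- The Schwinger representation of `(z + σiε)⁻¹` as a Laplace integral. -/
theorem inv_eq_schwinger {σ : ℝ} (hσ : σ ^ 2 = 1) {ε : ℝ} (hε : 0 < ε) (z : ℝ) :
    ((z : ℂ) + σ * Complex.I * ε)⁻¹ = -(Complex.I * σ) *
      ∫ t in Ioi (0 : ℝ), Complex.exp ((-ε + Complex.I * σ * z) * (t : ℂ)) := by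
  have h0 : (z : ℂ) + σ * Complex.I * ε ≠ 0 := fun h => by
    have him := congrArg Complex.im h
    simp at him
    rcases him with h1 | h1
    · rw [h1] at hσ; norm_num at hσ
    · exact hε.ne' h1
  have hσ' : (σ : ℂ) ^ 2 = 1 := by exact_mod_cast hσ
  have hfac : (-ε + Complex.I * σ * z : ℂ) = Complex.I * σ * (z + σ * Complex.I * ε) := by
    linear_combination -(ε : ℂ) * (1 : ℂ) * (σ : ℂ) ^ 2 * Complex.I_sq + (ε : ℂ) * hσ'
  have h1 : (-ε + Complex.I * σ * z : ℂ) ≠ 0 := by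
    rw [hfac]
    refine mul_ne_zero (mul_ne_zero Complex.I_ne_zero ?_) h0
    intro h
    rw [h] at hσ'
    norm_num at hσ'
  rw [integral_exp_mul_complex_Ioi (by simp [hε])]
  simp only [Complex.ofReal_zero, mul_zero, Complex.exp_zero]
  rw [hfac] at h1 ⊢
  have h2 : (Complex.I * σ : ℂ) ≠ 0 := left_ne_zero_of_mul h1
  have h3 : (σ : ℂ) ≠ 0 := right_ne_zero_of_mul h2
  field_simp

/-- Integrated over momenta, the Schwinger representation becomes an integral of oscillatory
integrals. -/
theorem integral_div_eq_schwinger {σ : ℝ} (hσ : σ ^ 2 = 1) (μ : ℝ) {ε : ℝ} (hε : 0 < ε)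
    {g : Mink → ℂ} (hg : Integrable g) :
    ∫ p, g p / ((mdot p p : ℂ) - μ + σ * Complex.I * ε) = -(Complex.I * σ) *
      ∫ t in Ioi (0 : ℝ), Complex.exp (-(ε : ℂ) * t) *
        (Complex.exp (Complex.I * ((-(σ * μ) : ℝ) : ℂ) * (t : ℂ)) * oscInt (σ * t) g) := by
  have hint : Integrable (Function.uncurry fun (p : Mink) (t : ℝ) =>
      g p * Complex.exp ((-ε + Complex.I * σ * ((mdot p p - μ : ℝ) : ℂ)) * (t : ℂ)))
      (volume.prod (volume.restrict (Ioi (0 : ℝ)))) := by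
    have h1 : Integrable (fun t : ℝ => Complex.exp (-(ε : ℂ) * t))
        (volume.restrict (Ioi (0 : ℝ))) :=
      integrableOn_exp_mul_complex_Ioi (by simp [hε]) 0
    have h2 := hg.mul_prod h1
    have hc : Continuous fun z : Mink × ℝ =>
        Complex.exp (Complex.I * ((σ * (mdot z.1 z.1 - μ) : ℝ) : ℂ) * (z.2 : ℂ)) := by
      have h : Continuous fun z : Mink × ℝ => mdot z.1 z.1 := continuous_fst.mdot continuous_fst
      fun_prop
    refine (h2.bdd_mul (c := 1) hc.aestronglyMeasurable (Eventually.of_forall fun z => ?_)).congr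
      (Eventually.of_forall fun z => ?_)
    · have := norm_cexp_I_mul_mul (σ * (mdot z.1 z.1 - μ)) z.2
      exact this.le
    · simp only [Function.uncurry]
      rw [mul_left_comm, ← Complex.exp_add]
      push_cast
      ring_nf
  calc ∫ p, g p / ((mdot p p : ℂ) - μ + σ * Complex.I * ε)
      = ∫ p, -(Complex.I * σ) * ∫ t in Ioi (0 : ℝ),
          g p * Complex.exp ((-ε + Complex.I * σ * ((mdot p p - μ : ℝ) : ℂ)) * (t : ℂ)) := by
        refine integral_congr_ae (Eventually.of_forall fun p => ?_)
        simp only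
        rw [integral_const_mul, mul_left_comm, ← inv_eq_schwinger hσ hε, div_eq_mul_inv]
        push_cast
        rfl
    _ = _ := by
        rw [integral_const_mul, integral_integral_swap hint]
        congr 1
        refine integral_congr_ae (Eventually.of_forall fun t => ?_)
        simp only
        rw [oscInt, ← integral_const_mul, ← integral_const_mul]
        refine integral_congr_ae (Eventually.of_forall fun p => ?_)
        simp only
        rw [mul_comm (g p), ← mul_assoc, ← mul_assoc, ← Complex.exp_add, ← Complex.exp_add]
        push_cast
        ring_nf

/-- The boundary value is the limit of the regularized integrals. -/
theorem tendsto_propFunctional {ι : Type*} {l : Filter ι} [l.IsCountablyGenerated] {σ : ℝ}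
    (hσ : σ ^ 2 = 1) (μ : ℝ) {g : ι → Mink → ℂ} {g₀ : Mink → ℂ} {ε : ι → ℝ} {B : ℝ → ℝ}
    (hε : ∀ᶠ i in l, 0 < ε i) (hε0 : Tendsto ε l (𝓝 0)) (hg : ∀ᶠ i in l, Integrable (g i))
    (hB : IntegrableOn B (Ioi 0)) (hgB : ∀ᶠ i in l, ∀ t > 0, ‖oscInt (σ * t) (g i)‖ ≤ B t)
    (hlim : ∀ t > 0, Tendsto (fun i => oscInt (σ * t) (g i)) l (𝓝 (oscInt (σ * t) g₀))) :
    Tendsto (fun i => ∫ p, g i p / ((mdot p p : ℂ) - μ + σ * Complex.I * ε i)) l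
      (𝓝 (propFunctional σ μ g₀)) := by
  have h1 : Tendsto (fun i => -(Complex.I * σ) *
      ∫ t in Ioi (0 : ℝ), Complex.exp (-(ε i : ℂ) * t) *
        (Complex.exp (Complex.I * ((-(σ * μ) : ℝ) : ℂ) * (t : ℂ)) * oscInt (σ * t) (g i))) l
      (𝓝 (propFunctional σ μ g₀)) := by
    refine Tendsto.const_mul _ ?_
    refine tendsto_integral_filter_of_dominated_convergence B ?_ ?_ hB ?_
    · filter_upwards [hg] with i hi
      have h : Continuous fun t : ℝ => oscInt (σ * t) (g i) :=
        (continuous_oscInt hi).comp (by fun_prop)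
      have h2 : Continuous fun t : ℝ => Complex.exp (-(ε i : ℂ) * t) *
        (Complex.exp (Complex.I * ((-(σ * μ) : ℝ) : ℂ) * (t : ℂ)) * oscInt (σ * t) (g i)) := by
        fun_prop
      exact h2.aestronglyMeasurable
    · filter_upwards [hε, hgB] with i hi hi'
      refine (ae_restrict_iff' measurableSet_Ioi).2 (Eventually.of_forall fun t ht => ?_)
      rw [norm_mul, norm_mul, norm_cexp_I_mul_mul, one_mul, Complex.norm_exp]
      have : Real.exp (-(ε i : ℂ) * t).re ≤ 1 := by
        rw [Real.exp_le_one_iff]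
        have := mul_pos hi (mem_Ioi.1 ht)
        simp
        linarith
      calc _ ≤ 1 * B t := mul_le_mul this (hi' t ht) (norm_nonneg _) zero_le_one
        _ = B t := one_mul _
    · refine (ae_restrict_iff' measurableSet_Ioi).2 (Eventually.of_forall fun t ht => ?_)
      have h2 : Tendsto (fun i => Complex.exp (-(ε i : ℂ) * t)) l (𝓝 1) := by
        have h3 : Continuous fun e : ℝ => Complex.exp (-(e : ℂ) * t) := by fun_prop
        have h4 := (h3.tendsto 0).comp hε0
        simp only [Complex.ofReal_zero, neg_zero, zero_mul, Complex.exp_zero] at h4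
        exact h4
      simpa using h2.mul ((hlim t ht).const_mul
        (Complex.exp (Complex.I * ((-(σ * μ) : ℝ) : ℂ) * (t : ℂ))))
  refine h1.congr' ?_
  filter_upwards [hε, hg] with i hi hi'
  rw [integral_div_eq_schwinger hσ μ hi hi']

theorem FlowBounded.norm_oscInt_le {σ : ℝ} (hσ : σ ^ 2 = 1) {g : Mink → ℂ} {A : ℝ}
    (hg : FlowBounded g fun p => A * ((1 + ‖p‖) ^ 6)⁻¹) {t : ℝ} (ht : 0 < t) :
    ‖oscInt (σ * t) g‖ ≤ A * (oscConst * oscDecay t) := by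
  have hσ0 : σ ≠ 0 := fun h => by rw [h] at hσ; norm_num at hσ
  refine (_root_.norm_oscInt_le (mul_ne_zero hσ0 ht.ne') hg).trans_eq ?_
  have : |σ| = 1 := by rw [← sq_eq_sq₀ (abs_nonneg _) zero_le_one, sq_abs, hσ, one_pow]
  rw [oscDecay, abs_mul, this, one_mul, oscDecay]

theorem integrableOn_oscBound (A : ℝ) :
    IntegrableOn (fun t => A * (oscConst * oscDecay t)) (Ioi 0) :=
  (integrableOn_oscDecay.const_mul oscConst).const_mul A

/-- The constant of the continuity estimate `FlowBounded.norm_propFunctional_le`. -/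
def propConst : ℝ := ∫ t in Ioi (0 : ℝ), oscConst * oscDecay t

theorem propConst_nonneg : 0 ≤ propConst :=
  integral_nonneg fun t => mul_nonneg oscConst_nonneg (oscDecay_nonneg t)

theorem norm_sign_eq_one {σ : ℝ} (hσ : σ ^ 2 = 1) : ‖-(Complex.I * σ)‖ = 1 := by
  have : |σ| = 1 := by rw [← sq_eq_sq₀ (abs_nonneg _) zero_le_one, sq_abs, hσ, one_pow]
  simp [this]

theorem FlowBounded.norm_propFunctional_le {σ : ℝ} (hσ : σ ^ 2 = 1) (μ : ℝ) {g : Mink → ℂ} {A : ℝ}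
    (hg : FlowBounded g fun p => A * ((1 + ‖p‖) ^ 6)⁻¹) :
    ‖propFunctional σ μ g‖ ≤ A * propConst := by
  rw [propFunctional, norm_mul, norm_sign_eq_one hσ, one_mul, propConst, ← integral_const_mul]
  refine norm_integral_le_of_norm_le (integrableOn_oscBound A) ?_
  refine (ae_restrict_iff' measurableSet_Ioi).2 (Eventually.of_forall fun t ht => ?_)
  rw [norm_mul, norm_cexp_I_mul_mul, one_mul]
  exact hg.norm_oscInt_le hσ ht

theorem FlowBounded.integrable_schwinger {σ : ℝ} (hσ : σ ^ 2 = 1) (μ : ℝ) {g : Mink → ℂ} {A : ℝ}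
    (hg : FlowBounded g fun p => A * ((1 + ‖p‖) ^ 6)⁻¹) :
    IntegrableOn (fun t : ℝ => Complex.exp (Complex.I * ((-(σ * μ) : ℝ) : ℂ) * (t : ℂ)) *
      oscInt (σ * t) g) (Ioi 0) := by
  have h : Continuous fun t : ℝ => oscInt (σ * t) g :=
    (continuous_oscInt hg.integrable).comp (by fun_prop)
  have h2 : Continuous fun t : ℝ => Complex.exp (Complex.I * ((-(σ * μ) : ℝ) : ℂ) * (t : ℂ)) *
      oscInt (σ * t) g := by fun_prop
  refine (integrableOn_oscBound A).mono' h2.aestronglyMeasurable ?_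
  refine (ae_restrict_iff' measurableSet_Ioi).2 (Eventually.of_forall fun t ht => ?_)
  rw [norm_mul, norm_cexp_I_mul_mul, one_mul]
  exact hg.norm_oscInt_le hσ ht

theorem propFunctional_add {σ : ℝ} (hσ : σ ^ 2 = 1) (μ : ℝ) {f g : Mink → ℂ} {A B : ℝ}
    (hf : FlowBounded f fun p => A * ((1 + ‖p‖) ^ 6)⁻¹)
    (hg : FlowBounded g fun p => B * ((1 + ‖p‖) ^ 6)⁻¹) :
    propFunctional σ μ (fun p => f p + g p) = propFunctional σ μ f + propFunctional σ μ g := by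
  simp only [propFunctional, oscInt_add hf.integrable hg.integrable, mul_add]
  rw [integral_add (hf.integrable_schwinger hσ μ) (hg.integrable_schwinger hσ μ), mul_add]

theorem propFunctional_const_mul (σ μ : ℝ) (c : ℂ) (g : Mink → ℂ) :
    propFunctional σ μ (fun p => c * g p) = c * propFunctional σ μ g := by
  simp only [propFunctional, oscInt_const_mul]
  rw [mul_left_comm c, ← integral_const_mul c]
  congr 1
  exact integral_congr_ae (Eventually.of_forall fun t => by simp only; ring)

/-- Away from the mass shell the two boundary values agree. -/
theorem propFunctional_eq_integral {σ : ℝ} (hσ : σ ^ 2 = 1) (μ : ℝ) {g : Mink → ℂ} {A : ℝ}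
    (hg : FlowBounded g fun p => A * ((1 + ‖p‖) ^ 6)⁻¹) {c : ℝ} (hc : 0 < c)
    (hgc : ∀ p, g p ≠ 0 → c ≤ |mdot p p - μ|) :
    propFunctional σ μ g = ∫ p, g p / ((mdot p p : ℂ) - μ) := by
  have h1 : Tendsto (fun ε : ℝ => ∫ p, g p / ((mdot p p : ℂ) - μ + σ * Complex.I * ε)) (𝓝[>] 0)
      (𝓝 (propFunctional σ μ g)) :=
    tendsto_propFunctional hσ μ (g := fun _ => g) (ε := fun ε => ε) self_mem_nhdsWithin
      nhdsWithin_le_nhds (Eventually.of_forall fun _ => hg.integrable) (integrableOn_oscBound A)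
      (Eventually.of_forall fun _ t ht => hg.norm_oscInt_le hσ ht) fun t _ => tendsto_const_nhds
  -- off the mass shell the regularized integrals also converge by domination
  refine tendsto_nhds_unique h1 ?_
  have hmeas : ∀ ε : ℝ, Measurable fun p => g p / ((mdot p p : ℂ) - μ + σ * Complex.I * ε) :=
    fun ε => by
      have := hg.measurable
      have := measurable_mdot_self
      fun_prop
  refine tendsto_integral_filter_of_dominated_convergence (fun p => ‖g p‖ * c⁻¹)
    (Eventually.of_forall fun ε => (hmeas ε).aestronglyMeasurable)
    (Eventually.of_forall fun ε => Eventually.of_forall fun p => ?_)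
    (hg.integrable.norm.mul_const _) (Eventually.of_forall fun p => ?_)
  · by_cases hp : g p = 0
    · simp [hp]
    · rw [norm_div, div_eq_mul_inv]
      refine mul_le_mul_of_nonneg_left (inv_anti₀ hc ((hgc p hp).trans ?_)) (norm_nonneg _)
      refine le_trans (le_of_eq ?_) (Complex.abs_re_le_norm _)
      simp
  · by_cases hp : g p = 0
    · simp [hp]
    · have h0 : (mdot p p : ℂ) - μ ≠ 0 := fun h => by
        have h2 : mdot p p - μ = 0 := by exact_mod_cast h
        have := hgc p hp
        rw [h2, abs_zero] at this
        linarith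
      have hcont :
          ContinuousAt (fun ε : ℝ => g p / ((mdot p p : ℂ) - μ + σ * Complex.I * ε)) 0 := by
        refine ContinuousAt.div continuousAt_const (by fun_prop) (by simpa using h0)
      have h2 := hcont.tendsto.mono_left (nhdsWithin_le_nhds (s := Ioi 0))
      simpa using h2

/-! ### Propagators as tempered distributions -/

/-- A momentum space kernel of polynomial growth, together with its first two derivatives along
the hyperbolic flow. -/
def GrowthKernel (K : Mink → ℂ) : Prop :=
  ∃ (A : ℝ) (d : ℕ), FlowBounded K fun p => A * (1 + ‖p‖) ^ d

theorem FlowBounded.nonneg {K : Mink → ℂ} {A : ℝ} {d : ℕ}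
    (h : FlowBounded K fun p => A * (1 + ‖p‖) ^ d) : 0 ≤ A := by
  have := (norm_nonneg _).trans (h.norm_le 0)
  simpa using this

theorem FlowBounded.mul_schwartz {K : Mink → ℂ} {A : ℝ} {d : ℕ}
    (h : FlowBounded K fun p => A * (1 + ‖p‖) ^ d) (f : 𝓢(Mink, ℂ)) :
    FlowBounded (fun p => K p * f p)
      fun p => 8 * A * 2 ^ (d + 8) * schwartzSup (d + 8, 2) f * ((1 + ‖p‖) ^ 6)⁻¹ := by
  refine (h.mul (f.flowBounded (d + 6))).mono fun p => le_of_eq ?_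
  have : (1 + ‖p‖) ^ d ≠ 0 := by positivity
  have : (1 + ‖p‖) ^ 6 ≠ 0 := by positivity
  rw [pow_add (1 + ‖p‖) d 6]
  field_simp
  ring

theorem FlowBounded.mul_translate {K : Mink → ℂ} {A : ℝ} {d : ℕ}
    (h : FlowBounded K fun p => A * (1 + ‖p‖) ^ d) (f : 𝓢(Mink, ℂ)) (k : Mink) :
    FlowBounded (fun p => K p * f (p - k)) fun p =>
      8 * A * 2 ^ (d + 8) * schwartzSup (d + 8, 2) f * (1 + ‖k‖) ^ (d + 8)
        * ((1 + ‖p‖) ^ 6)⁻¹ := by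
  have hA := h.nonneg
  have hS := schwartzSup_nonneg (d + 8, 2) f
  refine (h.mul (f.flowBounded_translate (d + 8) k)).mono fun p => ?_
  have h1 : ((1 + ‖p - k‖) ^ (d + 8))⁻¹ ≤ (1 + ‖k‖) ^ (d + 8) * ((1 + ‖p‖) ^ (d + 8))⁻¹ := by
    rw [← div_eq_mul_inv, inv_eq_one_div, div_le_div_iff₀ (by positivity) (by positivity), one_mul,
      ← mul_pow]
    refine pow_le_pow_left₀ (by positivity) ?_ _
    have := one_add_norm_add_le k (p - k)
    rwa [add_sub_cancel] at this
  calc 4 * (A * (1 + ‖p‖) ^ d * (2 * ((1 + ‖p‖) ^ 2 *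
        (2 ^ (d + 8) * schwartzSup (d + 8, 2) f * ((1 + ‖p - k‖) ^ (d + 8))⁻¹))))
      ≤ 4 * (A * (1 + ‖p‖) ^ d * (2 * ((1 + ‖p‖) ^ 2 *
        (2 ^ (d + 8) * schwartzSup (d + 8, 2) f *
          ((1 + ‖k‖) ^ (d + 8) * ((1 + ‖p‖) ^ (d + 8))⁻¹))))) := by gcongr
    _ = _ := by
      have : (1 + ‖p‖) ^ d ≠ 0 := by positivity
      have : (1 + ‖p‖) ≠ 0 := by positivity
      rw [pow_add (1 + ‖p‖) d 8]
      field_simp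
      ring

/-- The functional `f ↦ ∫ d⁴p K(p) f(p) / (p² - μ + i0)`. -/
def kernelCLM (μ : ℝ) (K : Mink → ℂ) (hK : GrowthKernel K) : 𝓢(Mink, ℂ) →L[ℂ] ℂ :=
  SchwartzMap.mkCLMtoNormedSpace (σ := RingHom.id ℂ)
    (fun f => propFunctional 1 μ fun p => K p * f p)
    (fun f g => by
      obtain ⟨A, d, h⟩ := hK
      simp only [_root_.add_apply, mul_add]
      exact propFunctional_add (one_pow 2) μ (h.mul_schwartz f) (h.mul_schwartz g))
    (fun a f => by
      simp only [_root_.smul_apply, smul_eq_mul, RingHom.id_apply]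
      rw [← propFunctional_const_mul]
      congr 1
      ext p
      ring)
    (by
      obtain ⟨A, d, h⟩ := hK
      have hA := h.nonneg
      refine ⟨Finset.Iic (d + 8, 2), 8 * A * 2 ^ (d + 8) * propConst,
        mul_nonneg (by positivity) propConst_nonneg, fun f => ?_⟩
      refine ((h.mul_schwartz f).norm_propFunctional_le (one_pow 2) μ).trans_eq ?_
      rw [schwartzSup]
      ring)

/-- The configuration space distribution `∫ d⁴p/(2π)⁴ e^{-i(px)} K(p) / (p² - μ + i0)`. -/
def propagator (μ : ℝ) (K : Mink → ℂ) (hK : GrowthKernel K) : 𝓢'(Mink, ℂ) :=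
  ContinuousLinearMap.toPointwiseConvergenceCLM _ _ _ _
    ((((2 * Real.pi : ℝ) : ℂ)⁻¹ ^ 4) • (kernelCLM μ K hK).comp minkFourierCLM)

theorem propagator_apply (μ : ℝ) (K : Mink → ℂ) (hK : GrowthKernel K) (φ : 𝓢(Mink, ℂ)) :
    propagator μ K hK φ = ((2 * Real.pi : ℝ) : ℂ)⁻¹ ^ 4 *
      propFunctional 1 μ fun p => K p * minkFourier φ p := by
  rw [← coe_minkFourierCLM]
  rfl

/-- The value of the propagator with kernel `K` on `φ e^{i(k·)}`, with `f` the Fourier transform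
of `φ` and up to the normalization `(2π)⁻⁴`. -/
def shiftedProp (σ μ : ℝ) (K f : Mink → ℂ) (k : Mink) : ℂ :=
  propFunctional σ μ fun p => K p * f (p - k)

theorem FlowBounded.norm_shiftedProp_le {σ : ℝ} (hσ : σ ^ 2 = 1) (μ : ℝ) {K : Mink → ℂ} {A : ℝ}
    {d : ℕ} (h : FlowBounded K fun p => A * (1 + ‖p‖) ^ d) (f : 𝓢(Mink, ℂ)) (k : Mink) :
    ‖shiftedProp σ μ K f k‖ ≤
      8 * A * 2 ^ (d + 8) * schwartzSup (d + 8, 2) f * propConst * (1 + ‖k‖) ^ (d + 8) :=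
  ((h.mul_translate f k).norm_propFunctional_le hσ μ).trans_eq (by ring)

theorem Measurable.oscPhase {X : Type*} [MeasurableSpace X] {a : X → ℝ} {q : X → Mink}
    (ha : Measurable a) (hq : Measurable q) :
    Measurable fun x => Complex.exp (Complex.I * (a x : ℂ) * (mdot (q x) (q x) : ℂ)) :=
  continuous_oscPhase.measurable.comp (ha.prodMk hq)

theorem stronglyMeasurable_oscInt_translate (σ : ℝ) {K : Mink → ℂ} (hK : Measurable K)
    (f : 𝓢(Mink, ℂ)) :
    StronglyMeasurable fun z : ℝ × Mink => oscInt (σ * z.1) fun p => K p * f (p - z.2) := by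
  have hf : Measurable (f : Mink → ℂ) := f.continuous.measurable
  have h1 : Measurable fun w : (ℝ × Mink) × Mink =>
      Complex.exp (Complex.I * ((σ * w.1.1 : ℝ) : ℂ) * (mdot w.2 w.2 : ℂ)) :=
    Measurable.oscPhase (by fun_prop) measurable_snd
  have h2 : Measurable fun w : (ℝ × Mink) × Mink => K w.2 * f (w.2 - w.1.2) := by fun_prop
  exact (h1.mul h2).stronglyMeasurable.integral_prod_right'

theorem stronglyMeasurable_shiftedProp (σ μ : ℝ) {K : Mink → ℂ} (hK : Measurable K)
    (f : 𝓢(Mink, ℂ)) : StronglyMeasurable (shiftedProp σ μ K f) := by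
  have key : ∀ (c : ℝ) (G : ℝ × Mink → ℂ), Measurable G → StronglyMeasurable fun k =>
      ∫ t in Ioi (0 : ℝ), Complex.exp (Complex.I * (c : ℂ) * (t : ℂ)) * G (t, k) := by
    intro c G hG
    have h2 : Measurable fun w : Mink × ℝ =>
        Complex.exp (Complex.I * (c : ℂ) * (w.2 : ℂ)) * G (w.2, w.1) := by fun_prop
    exact h2.stronglyMeasurable.integral_prod_right'
  exact (key (-(σ * μ)) _ (stronglyMeasurable_oscInt_translate σ hK f).measurable).const_mul _

/-- The functional `propFunctional` commutes with superpositions of translates. -/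
theorem propFunctional_convolution {σ : ℝ} (hσ : σ ^ 2 = 1) (μ : ℝ) {K : Mink → ℂ}
    (hK : GrowthKernel K) (f h : 𝓢(Mink, ℂ)) :
    propFunctional σ μ (fun p => K p * ∫ k, h k * f (p - k)) =
      ∫ k, h k * shiftedProp σ μ K f k := by
  obtain ⟨A, d, hKb⟩ := hK
  have hA := hKb.nonneg
  have hKm := hKb.measurable
  have hfm : Measurable (f : Mink → ℂ) := f.continuous.measurable
  have hhm : Measurable (h : Mink → ℂ) := h.continuous.measurable
  set C : ℝ := 8 * A * 2 ^ (d + 8) * schwartzSup (d + 8, 2) f with hC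
  have hC0 : 0 ≤ C := mul_nonneg (by positivity) (schwartzSup_nonneg _ _)
  obtain ⟨C', hC', hh⟩ := h.exists_decay (d + 8 + 6)
  have hh' : ∀ k, ‖h k‖ * (1 + ‖k‖) ^ (d + 8) ≤ C' * ((1 + ‖k‖) ^ 6)⁻¹ := fun k => by
    calc _ ≤ C' * ((1 + ‖k‖) ^ (d + 8 + 6))⁻¹ * (1 + ‖k‖) ^ (d + 8) := by
          gcongr; exact hh k
      _ = _ := by
          have : (1 + ‖k‖) ^ (d + 8) ≠ 0 := by positivity
          rw [pow_add (1 + ‖k‖) (d + 8) 6]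
          field_simp
  -- exchange of the integrals over `p` and `k`
  have hosc : ∀ τ : ℝ, oscInt τ (fun p => K p * ∫ k, h k * f (p - k)) =
      ∫ k, h k * oscInt τ fun p => K p * f (p - k) := fun τ => by
    have hm := measurable_oscPhase τ
    have hint : Integrable (Function.uncurry fun (p k : Mink) =>
        Complex.exp (Complex.I * τ * (mdot p p : ℂ)) * (K p * (h k * f (p - k))))
        (volume.prod volume) := by
      refine ((integrable_inv_one_add_norm_pow.const_mul C).mul_prod
        (integrable_inv_one_add_norm_pow.const_mul C')).mono' ?_ (Eventually.of_forall fun z => ?_)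
      · have h1 : Measurable fun w : Mink × Mink =>
            Complex.exp (Complex.I * (τ : ℂ) * (mdot w.1 w.1 : ℂ)) :=
          Measurable.oscPhase measurable_const measurable_fst
        have h2 : Measurable fun w : Mink × Mink => K w.1 * (h w.2 * f (w.1 - w.2)) := by fun_prop
        exact (h1.mul h2).aestronglyMeasurable
      · obtain ⟨p, k⟩ := z
        simp only [Function.uncurry]
        rw [norm_mul, norm_cexp_I_mul_mul, one_mul, mul_left_comm, norm_mul]
        have h1 : ‖K p * f (p - k)‖ ≤ C * (1 + ‖k‖) ^ (d + 8) * ((1 + ‖p‖) ^ 6)⁻¹ :=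
          (hKb.mul_translate f k).norm_le p
        calc _ ≤ ‖h k‖ * (C * (1 + ‖k‖) ^ (d + 8) * ((1 + ‖p‖) ^ 6)⁻¹) := by gcongr
          _ = (C * ((1 + ‖p‖) ^ 6)⁻¹) * (‖h k‖ * (1 + ‖k‖) ^ (d + 8)) := by ring
          _ ≤ _ := mul_le_mul_of_nonneg_left (hh' k) (by positivity)
    calc oscInt τ (fun p => K p * ∫ k, h k * f (p - k))
        = ∫ p, ∫ k, Complex.exp (Complex.I * τ * (mdot p p : ℂ)) * (K p * (h k * f (p - k))) := by
          refine integral_congr_ae (Eventually.of_forall fun p => ?_)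
          simp only
          rw [integral_const_mul, integral_const_mul]
      _ = _ := by
          rw [integral_integral_swap hint]
          refine integral_congr_ae (Eventually.of_forall fun k => ?_)
          simp only
          rw [oscInt, ← integral_const_mul]
          refine integral_congr_ae (Eventually.of_forall fun p => ?_)
          simp only
          ring
  -- exchange of the integrals over the Schwinger parameter and `k`
  have hint : Integrable (Function.uncurry fun (t : ℝ) (k : Mink) =>
      Complex.exp (Complex.I * ((-(σ * μ) : ℝ) : ℂ) * (t : ℂ)) *
        (h k * oscInt (σ * t) fun p => K p * f (p - k)))
      ((volume.restrict (Ioi (0 : ℝ))).prod volume) := by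
    have hdec : IntegrableOn (fun t => C * (oscConst * oscDecay t)) (Ioi 0) :=
      integrableOn_oscBound C
    refine (hdec.integrable.mul_prod
      (integrable_inv_one_add_norm_pow.const_mul C')).mono' ?_ ?_
    · have h1 := (stronglyMeasurable_oscInt_translate σ hKm f).measurable
      refine Measurable.aestronglyMeasurable ?_
      unfold Function.uncurry
      fun_prop
    · have hset : ∀ᵐ z : ℝ × Mink ∂((volume.restrict (Ioi (0 : ℝ))).prod volume), z.1 ∈ Ioi 0 :=
        Measure.quasiMeasurePreserving_fst.ae (ae_restrict_mem measurableSet_Ioi)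
      filter_upwards [hset] with z hz
      obtain ⟨t, k⟩ := z
      simp only [Function.uncurry]
      rw [norm_mul, norm_cexp_I_mul_mul, one_mul, norm_mul]
      have h1 : ‖oscInt (σ * t) fun p => K p * f (p - k)‖ ≤
          C * (1 + ‖k‖) ^ (d + 8) * (oscConst * oscDecay t) :=
        (hKb.mul_translate f k).norm_oscInt_le hσ hz
      have h2 := mul_nonneg oscConst_nonneg (oscDecay_nonneg t)
      calc _ ≤ ‖h k‖ * (C * (1 + ‖k‖) ^ (d + 8) * (oscConst * oscDecay t)) := by gcongr
        _ = C * (oscConst * oscDecay t) * (‖h k‖ * (1 + ‖k‖) ^ (d + 8)) := by ring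
        _ ≤ _ := mul_le_mul_of_nonneg_left (hh' k) (by positivity)
  rw [propFunctional]
  calc _ = -(Complex.I * σ) * ∫ t in Ioi (0 : ℝ), ∫ k,
        Complex.exp (Complex.I * ((-(σ * μ) : ℝ) : ℂ) * (t : ℂ)) *
        (h k * oscInt (σ * t) fun p => K p * f (p - k)) := by
        congr 1
        refine integral_congr_ae (Eventually.of_forall fun t => ?_)
        simp only
        rw [hosc, integral_const_mul]
    _ = _ := by
        rw [integral_integral_swap hint, ← integral_const_mul]
        refine integral_congr_ae (Eventually.of_forall fun k => ?_)
        simp only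
        rw [shiftedProp, propFunctional, mul_left_comm (h k), ← integral_const_mul (h k)]
        congr 1
        refine integral_congr_ae (Eventually.of_forall fun t => ?_)
        simp only
        ring

/-! ### Non-stationary phase -/

/-- The reciprocal `(1 + T) / (2 σ T (q v) - (x v))` of the normalized derivative of the phase in
direction `v`. -/
def nsRecip (σ T : ℝ) (v x q : Mink) : ℝ := (1 + T) / (2 * σ * T * mdot q v - mdot x v)

theorem hasFDerivAt_nsDenom (σ T : ℝ) (v x q : Mink) :
    HasFDerivAt (fun q => 2 * σ * T * mdot q v - mdot x v)
      ((2 * σ * T) • innerSL ℝ (minkReflect v)) q :=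
  ((hasFDerivAt_mdot_left v q).const_mul _).sub_const _

theorem contDiff_mdot_self : ContDiff ℝ ∞ fun q : Mink => mdot q q := by
  unfold mdot
  fun_prop

theorem hasFDerivAt_mdot_self (q : Mink) :
    HasFDerivAt (fun q => mdot q q) ((2 : ℝ) • innerSL ℝ (minkReflect q)) q := by
  have h := ((minkReflect.toContinuousLinearEquiv : Mink →L[ℝ] Mink).hasFDerivAt (x := q)).inner ℝ
    (hasFDerivAt_id q)
  have h2 : HasFDerivAt (fun q => mdot q q) _ q :=
    h.congr_of_eventuallyEq (Eventually.of_forall fun q => mdot_eq_inner q q)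
  refine h2.congr_fderiv (ContinuousLinearMap.ext fun w => ?_)
  simp only [_root_.smul_apply, innerSL_apply_apply, smul_eq_mul,
    ContinuousLinearMap.comp_apply, ContinuousLinearMap.prod_apply, fderivInnerCLM_apply,
    ContinuousLinearMap.id_apply, id]
  have e1 : inner ℝ (minkReflect w) q = inner ℝ (minkReflect q) w := by
    rw [← mdot_eq_inner, ← mdot_eq_inner, mdot_comm]
  have e2 : inner ℝ (((minkReflect.toContinuousLinearEquiv : Mink →L[ℝ] Mink)) w) q
      = inner ℝ (minkReflect w) q := rfl
  have e3 : inner ℝ (((minkReflect.toContinuousLinearEquiv : Mink →L[ℝ] Mink)) q) w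
      = inner ℝ (minkReflect q) w := rfl
  rw [e2, e3, e1]
  ring

theorem contDiff_nsPhase (r σ T : ℝ) (x : Mink) :
    ContDiff ℝ ∞ fun q => Complex.exp (Complex.I * (r * (σ * T * mdot q q - mdot q x) : ℝ)) := by
  have h1 := contDiff_mdot_self
  have h2 : ContDiff ℝ ∞ fun q : Mink => mdot q x := by
    simp only [mdot_comm _ x]; exact contDiff_mdot x
  have h3 : ContDiff ℝ ∞ fun q : Mink => r * (σ * T * mdot q q - mdot q x) := by fun_prop
  exact (contDiff_const.mul (Complex.ofRealCLM.contDiff.comp h3)).cexp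

theorem fderiv_nsPhase (r σ T : ℝ) (v x q : Mink) :
    fderiv ℝ (fun q => Complex.exp (Complex.I * (r * (σ * T * mdot q q - mdot q x) : ℝ))) q v =
      Complex.I * (r * (2 * σ * T * mdot q v - mdot x v) : ℝ) *
        Complex.exp (Complex.I * (r * (σ * T * mdot q q - mdot q x) : ℝ)) := by
  have h1 : HasFDerivAt (fun q => r * (σ * T * mdot q q - mdot q x)) _ q :=
    (((hasFDerivAt_mdot_self q).const_mul (σ * T)).sub (hasFDerivAt_mdot_left x q)).const_mul r
  have h2 := ((Complex.ofRealCLM.hasFDerivAt.comp q h1).const_mul Complex.I).cexp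
  have h4 : fderiv ℝ (fun q => Complex.exp
      (Complex.I * (r * (σ * T * mdot q q - mdot q x) : ℝ))) q = _ := h2.fderiv
  rw [h4]
  have e1 : inner ℝ (minkReflect q) v = mdot q v := (mdot_eq_inner _ _).symm
  have e2 : inner ℝ (minkReflect x) v = mdot x v := (mdot_eq_inner _ _).symm
  simp [e1, e2]
  ring

/-- Non-stationary phase with an explicit large parameter: if `σ (q v)` and `-(x v)` are bounded
below, then the phase `σ T q² - (q x)` has derivative at least `c (1 + T)` in direction `v`, and
each integration by parts gains a factor `(r (1 + T))⁻¹`. -/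
theorem exists_nonstationary_bound {σ : ℝ} (hσ : σ ^ 2 = 1) {v : Mink} {c : ℝ} (hc : 0 < c)
    {W S : Set Mink} (hW : ∀ q ∈ W, c ≤ σ * mdot q v) (hS : ∀ x ∈ S, c ≤ -mdot x v) (N : ℕ) :
    ∀ (n : ℕ) (b : Mink → ℂ), ContDiff ℝ ∞ b → HasCompactSupport b → tsupport b ⊆ W →
    ∃ C : ℝ, ∀ r > 0, ∀ T ≥ 0, ∀ x ∈ S,
      ‖∫ q, b q * (nsRecip σ T v x q : ℂ) ^ n *
        Complex.exp (Complex.I * (r * (σ * T * mdot q q - mdot q x) : ℝ))‖ ≤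
      C * ((r * (1 + T)) ^ N)⁻¹ := by
  have hden : ∀ q ∈ W, ∀ T ≥ (0 : ℝ), ∀ x ∈ S,
      c * (1 + T) ≤ 2 * σ * T * mdot q v - mdot x v := fun q hq T hT x hx => by
    have := hW q hq
    have := hS x hx
    nlinarith
  have hrec : ∀ q ∈ W, ∀ T ≥ (0 : ℝ), ∀ x ∈ S, |nsRecip σ T v x q| ≤ c⁻¹ :=
      fun q hq T hT x hx => by
    have h1 := hden q hq T hT x hx
    have h2 : 0 < c * (1 + T) := by positivity
    rw [nsRecip, abs_div, abs_of_pos (by linarith : 0 < 1 + T), abs_of_pos (by linarith),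
      div_le_iff₀ (by linarith)]
    calc 1 + T = c⁻¹ * (c * (1 + T)) := by field_simp
      _ ≤ _ := by gcongr
  have hE : ∀ (r σ T : ℝ) (x q : Mink),
      ‖Complex.exp (Complex.I * (r * (σ * T * mdot q q - mdot q x) : ℝ))‖ = 1 := fun r σ T x q => by
    rw [mul_comm, Complex.norm_exp_ofReal_mul_I]
  induction N with
  | zero =>
    intro n b hb hbc hbW
    refine ⟨∫ q, ‖b q‖ * c⁻¹ ^ n, fun r _ T hT x hx => ?_⟩
    rw [pow_zero, inv_one, mul_one]
    refine norm_integral_le_of_norm_le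
      ((hb.continuous.integrable_of_hasCompactSupport hbc).norm.mul_const _)
      (Eventually.of_forall fun q => ?_)
    rw [norm_mul, hE, mul_one, norm_mul, norm_pow, Complex.norm_real, Real.norm_eq_abs]
    by_cases hq : q ∈ tsupport b
    · have := hrec q (hbW hq) T hT x hx
      gcongr
    · rw [image_eq_zero_of_notMem_tsupport hq]
      simp
  | succ N ih =>
    intro n b hb hbc hbW
    set b' : Mink → ℂ := fun q => fderiv ℝ b q v with hb'
    have hb's : ContDiff ℝ ∞ b' := (hb.fderiv_right (by simp)).clm_apply contDiff_const
    have hb'c : HasCompactSupport b' := hbc.fderiv_apply ℝ v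
    have hb'W : tsupport b' ⊆ W := (tsupport_fderiv_apply_subset ℝ v).trans hbW
    obtain ⟨C1, hC1⟩ := ih (n + 1) b' hb's hb'c hb'W
    obtain ⟨C2, hC2⟩ := ih (n + 2) b hb hbc hbW
    refine ⟨C1 + (n + 1) * (2 * |mdot v v|) * C2, fun r hr T hT x hx => ?_⟩
    set E : Mink → ℂ := fun q => Complex.exp (Complex.I * (r * (σ * T * mdot q q - mdot q x) : ℝ))
      with hEdef
    set u : Mink → ℂ := fun q => (nsRecip σ T v x q : ℂ) with hu
    have hT1 : 0 < 1 + T := by linarith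
    have hdne : ∀ q ∈ tsupport b, 2 * σ * T * mdot q v - mdot x v ≠ 0 := fun q hq => by
      have := hden q (hbW hq) T hT x hx
      have : 0 < c * (1 + T) := by positivity
      linarith
    -- the derivative of `u` in direction `v` is `κ u²`
    set κ : ℝ := -(2 * σ * T * mdot v v) / (1 + T) with hκ
    have hu' : ∀ q ∈ tsupport b, HasFDerivAt u (Complex.ofRealCLM.comp
        ((-(1 + T) / (2 * σ * T * mdot q v - mdot x v) ^ 2) •
          ((2 * σ * T) • innerSL ℝ (minkReflect v)))) q := fun q hq => by
      have h1 : HasFDerivAt (nsRecip σ T v x)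
          ((-(1 + T) / (2 * σ * T * mdot q v - mdot x v) ^ 2) •
          ((2 * σ * T) • innerSL ℝ (minkReflect v))) q := by
        have h2 : HasDerivAt (fun y : ℝ => (1 + T) / y)
            (-(1 + T) / (2 * σ * T * mdot q v - mdot x v) ^ 2)
            (2 * σ * T * mdot q v - mdot x v) := by
          have h3 := ((hasDerivAt_inv (hdne q hq)).const_mul (1 + T))
          refine (h3.congr_deriv ?_)
          field_simp
        exact h2.comp_hasFDerivAt q (hasFDerivAt_nsDenom σ T v x q)
      exact Complex.ofRealCLM.hasFDerivAt.comp q h1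
    have hus : ∀ q ∈ tsupport b, ContDiffAt ℝ ∞ u q := fun q hq => by
      have h1 : ContDiff ℝ ∞ fun q : Mink => 2 * σ * T * mdot q v - mdot x v := by
        have h2 : ContDiff ℝ ∞ fun q : Mink => mdot q v := by
          simp only [mdot_comm _ v]; exact contDiff_mdot v
        fun_prop
      exact Complex.ofRealCLM.contDiff.contDiffAt.comp q
        (contDiffAt_const.div h1.contDiffAt (hdne q hq))
    -- `u` is smooth only near the support of `b`, which suffices for the products
    have hF : ∀ (a : Mink → ℂ) (m : ℕ), ContDiff ℝ ∞ a → tsupport a ⊆ tsupport b →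
        ContDiff ℝ ∞ fun q => a q * u q ^ m := fun a m ha has => by
      refine contDiff_iff_contDiffAt.2 fun q => ?_
      by_cases hq : q ∈ tsupport a
      · exact ha.contDiffAt.mul ((hus q (has hq)).pow m)
      · refine (contDiffAt_const (c := (0 : ℂ))).congr_of_eventuallyEq ?_
        filter_upwards [notMem_tsupport_iff_eventuallyEq.1 hq] with y hy
        rw [hy]; simp
    have hbb' : tsupport b' ⊆ tsupport b := tsupport_fderiv_apply_subset ℝ v
    have hF1 := hF b (n + 1) hb Subset.rfl
    have hF1c : HasCompactSupport fun q => b q * u q ^ (n + 1) := hbc.mul_right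
    have hEs : ContDiff ℝ ∞ E := contDiff_nsPhase r σ T x
    -- since `∂ᵥ E = i r (1 + T) u⁻¹ E`, one integration by parts trades a factor `r (1 + T)` for
    -- the amplitudes `∂ᵥ b u^(n+1)` and `(n+1) κ b u^(n+2)`
    have hibp := integral_mul_fderiv_eq_neg_fderiv_mul_of_integrable (μ := (volume : Measure Mink))
      (f := fun q => b q * u q ^ (n + 1)) (g := E) (v := v)
      ((((hF1.fderiv_right (m := ∞) (by simp)).clm_apply contDiff_const).continuous.mul
        hEs.continuous).integrable_of_hasCompactSupport
        ((hF1c.fderiv_apply ℝ v).mul_right))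
      ((hF1.continuous.mul ((hEs.fderiv_right (m := ∞) (by simp)).clm_apply
        contDiff_const).continuous).integrable_of_hasCompactSupport hF1c.mul_right)
      ((hF1.continuous.mul hEs.continuous).integrable_of_hasCompactSupport hF1c.mul_right)
      (fun q _ => (hF1.differentiable (by simp)).differentiableAt)
      (fun q _ => (hEs.differentiable (by simp)).differentiableAt)
    have hleft : ∀ q, b q * u q ^ (n + 1) * fderiv ℝ E q v =
        Complex.I * r * (1 + T) * (b q * u q ^ n * E q) := fun q => by
      by_cases hq : q ∈ tsupport b
      · have h1 := fderiv_nsPhase r σ T v x q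
        have h2 : u q * ((2 * σ * T * mdot q v - mdot x v : ℝ) : ℂ) = 1 + T := by
          have h3 : nsRecip σ T v x q * (2 * σ * T * mdot q v - mdot x v) = 1 + T := by
            rw [nsRecip, div_mul_cancel₀ _ (hdne q hq)]
          have h4 := congrArg (fun y : ℝ => (y : ℂ)) h3
          push_cast at h4
          simp only [hu]
          push_cast
          exact h4
        rw [h1, pow_succ, ← h2]
        simp only [hEdef]
        push_cast
        ring
      · rw [image_eq_zero_of_notMem_tsupport hq]
        ring
    have hright : ∀ q, fderiv ℝ (fun q => b q * u q ^ (n + 1)) q v =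
        b' q * u q ^ (n + 1) + (n + 1) * κ * (b q * u q ^ (n + 2)) := fun q => by
      by_cases hq : q ∈ tsupport b
      · have h1 := (hb.differentiable (by simp)).differentiableAt (x := q) |>.hasFDerivAt
        have h2 := h1.mul ((hu' q hq).pow (n + 1))
        have h3 : fderiv ℝ (fun q => b q * u q ^ (n + 1)) q = _ := h2.fderiv
        rw [h3]
        have e1 : inner ℝ (minkReflect v) v = mdot v v := (mdot_eq_inner _ _).symm
        have hne := hdne q hq
        have hT1' : (1 + T : ℂ) ≠ 0 := by exact_mod_cast hT1.ne'
        simp only [hb', hκ, hu, nsRecip, _root_.add_apply,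
          _root_.smul_apply, ContinuousLinearMap.comp_apply, Complex.ofRealCLM_apply,
          innerSL_apply_apply, smul_eq_mul, e1, nsmul_eq_mul, Nat.add_sub_cancel]
        generalize 2 * σ * T * mdot q v - mdot x v = d at hne ⊢
        have hne' : (d : ℂ) ≠ 0 := by exact_mod_cast hne
        push_cast
        rw [pow_succ _ n, pow_add _ n 2]
        generalize ((1 + T) / d : ℂ) ^ n = Z
        field_simp
        ring
      · have h1 : (fun q => b q * u q ^ (n + 1)) =ᶠ[𝓝 q] fun _ => 0 := by
          filter_upwards [(notMem_tsupport_iff_eventuallyEq.1 hq)] with y hy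
          rw [hy]; simp
        rw [h1.fderiv_eq, image_eq_zero_of_notMem_tsupport hq,
          image_eq_zero_of_notMem_tsupport (fun h => hq (hbb' h))]
        simp
    rw [integral_congr_ae (Eventually.of_forall hleft), integral_const_mul] at hibp
    have hI1 : Integrable fun q => b' q * u q ^ (n + 1) * E q :=
      ((hF b' (n + 1) hb's hbb').continuous.mul hEs.continuous).integrable_of_hasCompactSupport
        (hb'c.mul_right.mul_right)
    have hI2 : Integrable fun q => b q * u q ^ (n + 2) * E q :=
      ((hF b (n + 2) hb Subset.rfl).continuous.mul hEs.continuous).integrable_of_hasCompactSupport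
        (hbc.mul_right.mul_right)
    have hR : ∫ q, fderiv ℝ (fun q => b q * u q ^ (n + 1)) q v * E q =
        (∫ q, b' q * u q ^ (n + 1) * E q) + (n + 1) * κ * ∫ q, b q * u q ^ (n + 2) * E q := by
      rw [← integral_const_mul, ← integral_add hI1 (hI2.const_mul _)]
      refine integral_congr_ae (Eventually.of_forall fun q => ?_)
      simp only [hright]
      ring
    rw [hR] at hibp
    have hnorm := congrArg norm hibp
    rw [norm_neg, norm_mul, norm_mul, norm_mul, Complex.norm_I, one_mul, Complex.norm_real,
      Real.norm_eq_abs, abs_of_pos hr, show (1 + T : ℂ) = ((1 + T : ℝ) : ℂ) by push_cast; rfl,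
      Complex.norm_real, Real.norm_eq_abs, abs_of_pos hT1] at hnorm
    have hκle : |κ| ≤ 2 * |mdot v v| := by
      have hσ1 : |σ| = 1 := by rw [← sq_eq_sq₀ (abs_nonneg _) zero_le_one, sq_abs, hσ, one_pow]
      rw [hκ, abs_div, abs_neg, abs_mul, abs_mul, abs_mul, hσ1, abs_of_pos hT1, abs_of_nonneg hT,
        div_le_iff₀ hT1, abs_two]
      nlinarith [abs_nonneg (mdot v v)]
    have h1 := hC1 r hr T hT x hx
    have h2 := hC2 r hr T hT x hx
    have hfin : r * (1 + T) * ‖∫ q, b q * u q ^ n * E q‖ ≤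
        (C1 + (n + 1) * (2 * |mdot v v|) * C2) * ((r * (1 + T)) ^ N)⁻¹ := by
      rw [hnorm]
      refine (norm_add_le _ _).trans ?_
      rw [norm_mul, norm_mul, Complex.norm_real, Real.norm_eq_abs]
      have h3 : ‖((n : ℂ) + 1)‖ = n + 1 := by
        have := Complex.norm_natCast (n + 1); push_cast at this; exact this
      rw [h3, add_mul _ _ ((r * (1 + T)) ^ N)⁻¹]
      refine add_le_add h1 ?_
      rw [mul_assoc _ C2]
      refine mul_le_mul ?_ h2 (norm_nonneg _) (by positivity)
      gcongr
    have hpos : 0 < r * (1 + T) := by positivity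
    rw [pow_succ, mul_inv, ← mul_assoc, ← div_eq_mul_inv, le_div_iff₀ hpos, mul_comm]
    exact hfin

/-! ### Microlocal regularity of homogeneous kernels -/

theorem integrable_inv_one_add_sq_Ioi : IntegrableOn (fun t : ℝ => (1 + t ^ 2)⁻¹) (Ioi 0) :=
  integrable_inv_one_add_sq.integrableOn

/-- After rescaling `p = r q`, the Schwinger integrand of a compactly supported amplitude at scale
`r` is a superposition, over the support of `φ`, of non-stationary oscillatory integrals. -/
theorem oscInt_scaled_mul_minkFourier (σ t : ℝ) {r : ℝ} (hr : 0 < r) {b : Mink → ℂ}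
    (hb : Continuous b) (hbc : HasCompactSupport b) (φ : 𝓢(Mink, ℂ)) (k : Mink) :
    oscInt (σ * t) (fun p => b (r⁻¹ • p) * minkFourier φ (p - k)) =
      r ^ 4 * ∫ x, planeWave k x * φ x * ∫ q, b q *
        Complex.exp (Complex.I * (r * (σ * (t * r) * mdot q q - mdot q x) : ℝ)) := by
  have h1 : oscInt (σ * t) (fun p => b (r⁻¹ • p) * minkFourier φ (p - k)) =
      r ^ 4 * ∫ q, Complex.exp (Complex.I * (σ * t : ℝ) * (mdot (r • q) (r • q) : ℂ)) *
        (b q * minkFourier φ (r • q - k)) := by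
    have := MeasureTheory.Measure.integral_comp_smul (volume : Measure Mink)
      (fun p => Complex.exp (Complex.I * (σ * t : ℝ) * (mdot p p : ℂ)) *
        (b (r⁻¹ • p) * minkFourier φ (p - k))) r
    simp only [smul_smul, inv_mul_cancel₀ hr.ne', one_smul, finrank_euclideanSpace,
      Fintype.card_fin] at this
    rw [this, abs_of_pos (by positivity), Complex.real_smul, ← mul_assoc]
    have h0 : (r : ℂ) ≠ 0 := by exact_mod_cast hr.ne'
    push_cast
    rw [mul_inv_cancel₀ (pow_ne_zero _ h0), one_mul, oscInt]
    push_cast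
    rfl
  rw [h1]
  congr 1
  have hpt : ∀ q x : Mink, Complex.exp (Complex.I * (σ * t : ℝ) * (mdot (r • q) (r • q) : ℂ)) *
      (b q * (planeWave (-(r • q - k)) x * φ x)) = planeWave k x * φ x * (b q *
        Complex.exp (Complex.I * (r * (σ * (t * r) * mdot q q - mdot q x) : ℝ))) := fun q x => by
    have h2 : planeWave (-(r • q - k)) x = planeWave k x *
        Complex.exp (Complex.I * ((-(r * mdot q x) : ℝ) : ℂ)) := by
      rw [planeWave, planeWave, ← Complex.exp_add, ← mul_add]
      congr 2
      rw [mdot_neg_left, mdot_sub_left, mdot_smul_left]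
      push_cast
      ring
    have h3 : Complex.exp (Complex.I * (r * (σ * (t * r) * mdot q q - mdot q x) : ℝ)) =
        Complex.exp (Complex.I * (σ * t : ℝ) * (mdot (r • q) (r • q) : ℂ)) *
        Complex.exp (Complex.I * ((-(r * mdot q x) : ℝ) : ℂ)) := by
      rw [← Complex.exp_add]
      congr 1
      rw [mdot_smul_left, mdot_smul_right]
      push_cast
      ring
    rw [h2, h3]
    ring
  have hL : ∀ q, Complex.exp (Complex.I * (σ * t : ℝ) * (mdot (r • q) (r • q) : ℂ)) *
      (b q * minkFourier φ (r • q - k)) = ∫ x, planeWave k x * φ x * (b q *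
        Complex.exp (Complex.I * (r * (σ * (t * r) * mdot q q - mdot q x) : ℝ))) := fun q => by
    rw [minkFourier, ← integral_const_mul, ← integral_const_mul]
    exact integral_congr_ae (Eventually.of_forall fun x => hpt q x)
  simp only [hL, ← integral_const_mul]
  refine integral_integral_swap ?_
  have hbi := hb.integrable_of_hasCompactSupport (μ := (volume : Measure Mink)) hbc
  refine ((hbi.norm).mul_prod (φ.integrable (μ := volume)).norm).mono' ?_
    (Eventually.of_forall fun z => ?_)
  · have hc1 : Continuous fun z : Mink × Mink => planeWave k z.2 :=
      continuous_const.planeWave continuous_snd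
    have hc2 : Continuous fun z : Mink × Mink => r * (σ * (t * r) * mdot z.1 z.1 - mdot z.1 z.2) :=
      continuous_const.mul ((continuous_const.mul (continuous_fst.mdot continuous_fst)).sub
        (continuous_fst.mdot continuous_snd))
    exact ((hc1.mul (φ.continuous.comp continuous_snd)).mul ((hb.comp continuous_fst).mul
      (Complex.continuous_exp.comp (continuous_const.mul
        (Complex.continuous_ofReal.comp hc2))))).aestronglyMeasurable
  · simp only [Function.uncurry]
    rw [norm_mul, norm_mul, norm_mul, norm_planeWave, one_mul, mul_comm Complex.I,
      Complex.norm_exp_ofReal_mul_I, mul_one, mul_comm]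

/-- If the phase has no critical point on the relevant supports, the contribution of momenta of
size `r` to the propagator is rapidly decreasing in `r`. -/
theorem exists_norm_propFunctional_scaled_le {σ : ℝ} (hσ : σ ^ 2 = 1) (μ : ℝ) {v : Mink} {c : ℝ}
    (hc : 0 < c) {W S : Set Mink} (hW : ∀ q ∈ W, c ≤ σ * mdot q v) (hS : ∀ x ∈ S, c ≤ -mdot x v)
    {b : Mink → ℂ} (hb : ContDiff ℝ ∞ b) (hbc : HasCompactSupport b) (hbW : tsupport b ⊆ W)
    (φ : 𝓢(Mink, ℂ)) (hφ : ∀ x, φ x ≠ 0 → x ∈ S) (N : ℕ) :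
    ∃ C : ℝ, 0 ≤ C ∧ ∀ r ≥ 1, ∀ k,
      ‖propFunctional σ μ fun p => b (r⁻¹ • p) * minkFourier φ (p - k)‖ ≤ C * (r ^ N)⁻¹ := by
  -- four more powers pay for the Jacobian `r⁴` of the rescaling
  obtain ⟨C, hC⟩ := exists_nonstationary_bound hσ hc hW hS (N + 4) 0 b hb hbc hbW
  set I : ℝ := ∫ x, ‖φ x‖ with hI
  have hI0 : 0 ≤ I := integral_nonneg fun _ => norm_nonneg _
  refine ⟨(I * |C|) * ∫ t in Ioi (0 : ℝ), (1 + t ^ 2)⁻¹,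
    mul_nonneg (by positivity) (setIntegral_nonneg measurableSet_Ioi fun t _ => by positivity),
    fun r hr k => ?_⟩
  have hr0 : 0 < r := by linarith
  have key : ∀ t > 0, ‖oscInt (σ * t) fun p => b (r⁻¹ • p) * minkFourier φ (p - k)‖ ≤
      (I * |C|) * (r ^ N)⁻¹ * (1 + t ^ 2)⁻¹ := fun t ht => by
    rw [oscInt_scaled_mul_minkFourier σ t hr0 hb.continuous hbc, norm_mul, norm_pow,
      Complex.norm_real, Real.norm_eq_abs, abs_of_pos hr0]
    -- the rescaled Schwinger parameter is `T = t r ≥ t`, so the bound is integrable over `t`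
    have hB : ((r * (1 + t * r)) ^ (N + 4))⁻¹ ≤ (r ^ (N + 4))⁻¹ * (1 + t ^ 2)⁻¹ := by
      rw [← mul_inv, mul_pow]
      have h1 : 1 + t ^ 2 ≤ (1 + t * r) ^ (N + 4) := by
        have h2 : 1 + t ≤ 1 + t * r := by nlinarith
        have h3 : (1 + t) ^ 2 ≤ (1 + t * r) ^ (N + 4) :=
          (pow_le_pow_left₀ (by linarith) h2 2).trans
            (pow_le_pow_right₀ (by nlinarith) (by omega))
        nlinarith
      gcongr
    have h1 : ‖∫ x, planeWave k x * φ x * ∫ q, b q *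
        Complex.exp (Complex.I * (r * (σ * (t * r) * mdot q q - mdot q x) : ℝ))‖ ≤
        I * (|C| * ((r ^ (N + 4))⁻¹ * (1 + t ^ 2)⁻¹)) := by
      rw [hI, ← integral_mul_const]
      refine norm_integral_le_of_norm_le ((φ.integrable (μ := volume)).norm.mul_const _)
        (Eventually.of_forall fun x => ?_)
      rw [norm_mul, norm_mul, norm_planeWave, one_mul]
      by_cases hx : φ x = 0
      · rw [hx]; simp
      have h2 := hC r hr0 (t * r) (by positivity) x (hφ x hx)
      simp only [pow_zero, mul_one] at h2
      have h3 : C * ((r * (1 + t * r)) ^ (N + 4))⁻¹ ≤ |C| * ((r ^ (N + 4))⁻¹ * (1 + t ^ 2)⁻¹) :=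
        mul_le_mul (le_abs_self C) hB (by positivity) (abs_nonneg C)
      exact mul_le_mul_of_nonneg_left (h2.trans h3) (norm_nonneg _)
    refine (mul_le_mul_of_nonneg_left h1 (by positivity)).trans_eq ?_
    rw [pow_add]
    field_simp
  rw [propFunctional, norm_mul, norm_sign_eq_one hσ, one_mul]
  calc _ ≤ ∫ t in Ioi (0 : ℝ), (I * |C|) * (r ^ N)⁻¹ * (1 + t ^ 2)⁻¹ := by
        refine norm_integral_le_of_norm_le (integrable_inv_one_add_sq_Ioi.const_mul _)
          ((ae_restrict_iff' measurableSet_Ioi).2 (Eventually.of_forall fun t ht => ?_))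
        rw [norm_mul]
        refine (le_of_eq ?_).trans (key t ht)
        rw [norm_cexp_I_mul_mul, one_mul]
    _ = _ := by rw [integral_const_mul]; ring

theorem contDiffBump_ofReal {p : Mink} (χ : ContDiffBump p) :
    ContDiff ℝ ∞ fun q => (χ q : ℂ) :=
  Complex.ofRealCLM.contDiff.comp χ.contDiff

/-- The complement of a rescaled bump function is flow bounded uniformly in the scale, and it
vanishes on the rescaled inner ball. -/
theorem exists_flowBounded_one_sub_bump {p : Mink} (χ : ContDiffBump p) :
    ∃ B : ℝ, 0 ≤ B ∧ ∀ r ≥ 1, FlowBounded (fun q => 1 - (χ ((r : ℝ)⁻¹ • q) : ℂ)) fun q =>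
      if ‖r⁻¹ • q - p‖ < χ.rIn then 0 else B * (1 + ‖q‖) ^ 2 := by
  set g : Mink → ℂ := fun q => (χ q : ℂ) with hg
  have hgs : ContDiff ℝ ∞ g := contDiffBump_ofReal χ
  have hgc : HasCompactSupport g := χ.hasCompactSupport.comp_left (g := fun x : ℝ => (x : ℂ)) rfl
  have hbd : ∀ j : ℕ, ∃ C, ∀ q, ‖iteratedFDeriv ℝ j g q‖ ≤ C := fun j =>
    (hgs.continuous_iteratedFDeriv (m := j)
      (by exact_mod_cast le_top)).bounded_above_of_compact_support
      (hgc.iteratedFDeriv j)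
  choose C hC using hbd
  -- on the inner ball `1 - χ` vanishes together with its derivatives
  set D : Mink → ℝ := fun q => if ‖q - p‖ < χ.rIn then 0 else 1 + |C 0| + |C 1| + |C 2|
    with hD
  have h1 : FlowBounded (fun q => 1 - g q) fun q => 2 * ((1 + ‖q‖) ^ 2 * D q) := by
    refine flowBounded_of_contDiff (contDiff_const.sub hgs) fun q j hj => ?_
    by_cases hq : ‖q - p‖ < χ.rIn
    · have h0 : (fun q => 1 - g q) =ᶠ[𝓝 q] fun _ => 0 := by
        filter_upwards [Metric.isOpen_ball.mem_nhds (mem_ball_iff_norm.2 hq)] with y hy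
        simp [hg, χ.one_of_mem_closedBall (Metric.ball_subset_closedBall hy)]
      rw [(h0.iteratedFDeriv ℝ j).eq_of_nhds]
      simp [hD, hq]
    · simp only [hD, hq, if_false]
      have e : iteratedFDeriv ℝ j (fun q => 1 - g q) q =
          iteratedFDeriv ℝ j (fun _ : Mink => (1 : ℂ)) q - iteratedFDeriv ℝ j g q :=
        iteratedFDeriv_sub_apply (f := fun _ => (1 : ℂ)) (g := g) contDiff_const.contDiffAt
          ((hgs.of_le (by exact_mod_cast le_top)).contDiffAt)
      have e1 : ‖iteratedFDeriv ℝ j (fun _ : Mink => (1 : ℂ)) q‖ ≤ 1 := by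
        rcases Nat.eq_zero_or_pos j with rfl | hj
        · simp
        · rw [iteratedFDeriv_const_of_ne hj.ne']; simp
      rw [e]
      refine (norm_sub_le _ _).trans ?_
      have h2 := hC j q
      have h3 : C j ≤ |C 0| + |C 1| + |C 2| := by
        have a0 := abs_nonneg (C 0)
        have a1 := abs_nonneg (C 1)
        have a2 := abs_nonneg (C 2)
        interval_cases j
        · linarith [le_abs_self (C 0)]
        · linarith [le_abs_self (C 1)]
        · linarith [le_abs_self (C 2)]
      linarith
  refine ⟨2 * (1 + |C 0| + |C 1| + |C 2|), by positivity, fun r hr => ?_⟩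
  refine (h1.comp_smul r⁻¹).mono fun q => ?_
  simp only [hD]
  split_ifs with h
  · simp
  · have h2 : ‖r⁻¹ • q‖ ≤ ‖q‖ := by
      rw [norm_smul, Real.norm_eq_abs, abs_of_pos (by positivity)]
      exact mul_le_of_le_one_left (norm_nonneg _) (inv_le_one_of_one_le₀ hr)
    calc 2 * ((1 + ‖r⁻¹ • q‖) ^ 2 * (1 + |C 0| + |C 1| + |C 2|))
        ≤ 2 * ((1 + ‖q‖) ^ 2 * (1 + |C 0| + |C 1| + |C 2|)) := by gcongr
      _ = _ := by ring

/-- Momenta far from the direction of `k` contribute rapidly decreasing terms, because the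
translated Schwartz function is rapidly decreasing there. -/
theorem exists_flowBounded_tail {K : Mink → ℂ} (hK : GrowthKernel K) {p : Mink}
    (χ : ContDiffBump p) (f : 𝓢(Mink, ℂ)) (N : ℕ) :
    ∃ C : ℝ, 0 ≤ C ∧ ∀ r ≥ 1, ∀ k, ‖k - r • p‖ ≤ r * (χ.rIn / 2) →
      FlowBounded (fun q => K q * (1 - (χ ((r : ℝ)⁻¹ • q) : ℂ)) * f (q - k))
        fun q => C * (r ^ N)⁻¹ * ((1 + ‖q‖) ^ 6)⁻¹ := by
  obtain ⟨A, d, hKb⟩ := hK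
  have hA := hKb.nonneg
  obtain ⟨B, hB, hχ⟩ := exists_flowBounded_one_sub_bump χ
  set M := d + 10 + N with hM
  have hS := schwartzSup_nonneg (M, 2) f
  have hin := χ.rIn_pos
  set C1 : ℝ := 2 + (1 + ‖p‖) * (2 / χ.rIn) with hC1
  refine ⟨4 * (4 * (A * B)) * (2 * (2 ^ M * schwartzSup (M, 2) f)) * (C1 ^ (d + 10) * C1 ^ N),
    by positivity, fun r hr k hk => ?_⟩
  refine ((hKb.mul (hχ r hr)).mul (f.flowBounded_translate M k)).mono fun q => ?_
  have hr0 : 0 < r := by linarith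
  split_ifs with hq
  · simp only [mul_zero, zero_mul]
    positivity
  -- outside the rescaled inner ball `q` is at distance of order `r` from `k`, hence both `r` and
  -- `‖q‖` are controlled by `‖q - k‖`
  · have h1 : r * (χ.rIn / 2) ≤ ‖q - k‖ := by
      rw [not_lt] at hq
      have h2 : r * χ.rIn ≤ ‖q - r • p‖ := by
        have h3 : q - r • p = r • (r⁻¹ • q - p) := by
          rw [smul_sub, smul_smul, mul_inv_cancel₀ hr0.ne', one_smul]
        rw [h3, norm_smul, Real.norm_eq_abs, abs_of_pos hr0]
        gcongr
      have h4 : ‖q - r • p‖ ≤ ‖q - k‖ + ‖k - r • p‖ := by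
        have : q - r • p = (q - k) + (k - r • p) := by abel
        rw [this]; exact norm_add_le _ _
      linarith
    have h2 : r ≤ ‖q - k‖ * (2 / χ.rIn) := by
      rw [mul_div_assoc', le_div_iff₀ hin]
      linarith
    have hn0 := norm_nonneg (q - k)
    have hw : 0 ≤ 2 / χ.rIn := by positivity
    have hexp : C1 * (1 + ‖q - k‖) = 2 + 2 * ‖q - k‖ + 2 / χ.rIn + ‖p‖ * (2 / χ.rIn) +
        ‖q - k‖ * (2 / χ.rIn) + ‖q - k‖ * (2 / χ.rIn) * ‖p‖ := by rw [hC1]; ring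
    have hp1 : 0 ≤ ‖p‖ * (2 / χ.rIn) := by positivity
    have hp2 : 0 ≤ ‖q - k‖ * (2 / χ.rIn) * ‖p‖ := by positivity
    have hrC : r ≤ C1 * (1 + ‖q - k‖) := by linarith
    have hqC : 1 + ‖q‖ ≤ C1 * (1 + ‖q - k‖) := by
      have h3 : ‖q‖ ≤ ‖q - k‖ + ‖k - r • p‖ + r * ‖p‖ := by
        have h4 : q = (q - k) + (k - r • p) + r • p := by abel
        have h5 : ‖r • p‖ = r * ‖p‖ := by rw [norm_smul, Real.norm_eq_abs, abs_of_pos hr0]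
        calc ‖q‖ = ‖(q - k) + (k - r • p) + r • p‖ := by rw [← h4]
          _ ≤ _ := by rw [← h5]; exact norm_add₃_le
      have h4 : r * ‖p‖ ≤ ‖q - k‖ * (2 / χ.rIn) * ‖p‖ :=
        mul_le_mul_of_nonneg_right h2 (norm_nonneg _)
      linarith [mul_nonneg hn0 hw]
    have e1 : (1 + ‖q‖) ^ (d + 10) ≤ C1 ^ (d + 10) * (1 + ‖q - k‖) ^ (d + 10) := by
      rw [← mul_pow]; exact pow_le_pow_left₀ (by positivity) hqC _
    have e2 : r ^ N ≤ C1 ^ N * (1 + ‖q - k‖) ^ N := by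
      rw [← mul_pow]; exact pow_le_pow_left₀ (by positivity) hrC _
    have e3 : (1 + ‖q‖) ^ d * (1 + ‖q‖) ^ 2 * (1 + ‖q‖) ^ 2 * ((1 + ‖q - k‖) ^ M)⁻¹ ≤
        (C1 ^ (d + 10) * C1 ^ N) * (r ^ N)⁻¹ * ((1 + ‖q‖) ^ 6)⁻¹ := by
      rw [mul_assoc (_ * _) (r ^ N)⁻¹, ← mul_inv, ← div_eq_mul_inv, ← div_eq_mul_inv,
        div_le_div_iff₀ (by positivity) (by positivity)]
      calc _ = (1 + ‖q‖) ^ (d + 10) * r ^ N := by ring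
        _ ≤ (C1 ^ (d + 10) * (1 + ‖q - k‖) ^ (d + 10)) * (C1 ^ N * (1 + ‖q - k‖) ^ N) := by
          gcongr
        _ = _ := by rw [hM]; ring
    calc _ = (4 * (4 * (A * B)) * (2 * (2 ^ M * schwartzSup (M, 2) f))) *
          ((1 + ‖q‖) ^ d * (1 + ‖q‖) ^ 2 * (1 + ‖q‖) ^ 2 * ((1 + ‖q - k‖) ^ M)⁻¹) := by ring
      _ ≤ (4 * (4 * (A * B)) * (2 * (2 ^ M * schwartzSup (M, 2) f))) *
          ((C1 ^ (d + 10) * C1 ^ N) * (r ^ N)⁻¹ * ((1 + ‖q‖) ^ 6)⁻¹) := by gcongr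
      _ = _ := by ring

theorem GrowthKernel.mul_bump {K : Mink → ℂ} (hK : GrowthKernel K) {p : Mink}
    (χ : ContDiffBump p) (r : ℝ) : GrowthKernel fun q => K q * (χ ((r : ℝ)⁻¹ • q) : ℂ) := by
  obtain ⟨A, d, hKb⟩ := hK
  have hgc : HasCompactSupport fun q => (χ q : ℂ) :=
    χ.hasCompactSupport.comp_left (g := fun x : ℝ => (x : ℂ)) rfl
  have h := ((hgc.toSchwartzMap (contDiffBump_ofReal χ)).flowBounded 0).comp_smul r⁻¹
  refine ⟨4 * (A * (2 * (2 ^ (0 + 2) * schwartzSup (0 + 2, 2)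
    (hgc.toSchwartzMap (contDiffBump_ofReal χ))))), d, (hKb.mul h).mono fun q => le_of_eq ?_⟩
  rw [pow_zero, inv_one, mul_one]
  ring

theorem GrowthKernel.mul_translate {K : Mink → ℂ} (hK : GrowthKernel K) (f : 𝓢(Mink, ℂ))
    (k : Mink) : ∃ A, FlowBounded (fun q => K q * f (q - k)) fun q => A * ((1 + ‖q‖) ^ 6)⁻¹ := by
  obtain ⟨A, d, hKb⟩ := hK
  exact ⟨_, hKb.mul_translate f k⟩

/-- The splitting of the propagator with shifted argument into momenta in a conic neighbourhood of
the direction `p`, at scale `r`, and the rest. -/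
theorem shiftedProp_eq_add {σ : ℝ} (hσ : σ ^ 2 = 1) (μ : ℝ) {K : Mink → ℂ} (hK : GrowthKernel K)
    {p : Mink} (χ : ContDiffBump p) (f : 𝓢(Mink, ℂ)) {r : ℝ} (hr : 1 ≤ r) {k : Mink}
    (hk : ‖k - r • p‖ ≤ r * (χ.rIn / 2)) :
    shiftedProp σ μ K f k =
      propFunctional σ μ (fun q => K q * (χ ((r : ℝ)⁻¹ • q) : ℂ) * f (q - k)) +
      propFunctional σ μ (fun q => K q * (1 - (χ ((r : ℝ)⁻¹ • q) : ℂ)) * f (q - k)) := by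
  obtain ⟨A, hA⟩ := (hK.mul_bump χ r).mul_translate f k
  obtain ⟨C, -, hC⟩ := exists_flowBounded_tail hK χ f 0
  rw [← propFunctional_add hσ μ hA (hC r hr k hk), shiftedProp]
  congr 1
  ext q
  ring

/-- A positively homogeneous function of degree `d`, smooth away from the origin, of controlled
growth along the hyperbolic flow. -/
structure HomogeneousKernel (d : ℕ) (K : Mink → ℂ) : Prop where
  growth : GrowthKernel K
  contDiffAt : ∀ p ≠ 0, ContDiffAt ℝ ∞ K p
  map_smul : ∀ r > 0, ∀ p ≠ 0, K ((r : ℝ) • p) = (r : ℂ) ^ d * K p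

/-- The Fourier transform of `φ` times the propagator with kernel `K` decreases rapidly near `p`,
for all `φ` supported near `x`, unless `x` is zero or lightlike and `p` is a positive multiple of
`x`. Testing with Schwartz functions rather than with test functions makes the condition stable
under shrinking of the support. -/
def MicrolocallyRegular (μ : ℝ) (K : Mink → ℂ) : Prop :=
  ∀ x p : Mink, x ≠ 0 → p ≠ 0 → ¬ (mdot x x = 0 ∧ ∃ t : ℝ, 0 < t ∧ p = t • x) →
    ∃ U V : Set Mink, IsOpen U ∧ x ∈ U ∧ IsOpen V ∧ p ∈ V ∧
      (∀ k ∈ V, ∀ t : ℝ, 0 < t → t • k ∈ V) ∧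
      ∀ φ : 𝓢(Mink, ℂ), tsupport φ ⊆ U → ∀ N : ℕ, ∃ C : ℝ, ∀ k ∈ V,
        (1 + ‖k‖) ^ N * ‖shiftedProp 1 μ K (minkFourier φ) k‖ ≤ C

theorem HomogeneousKernel.mul_bump_eq {d : ℕ} {K : Mink → ℂ} (hK : HomogeneousKernel d K)
    {p : Mink} (χ : ContDiffBump p) (h0 : (0 : Mink) ∉ Metric.closedBall p χ.rOut) {r : ℝ}
    (hr : 0 < r) (q : Mink) :
    K q * (χ ((r : ℝ)⁻¹ • q) : ℂ) = (r : ℂ) ^ d * (K (r⁻¹ • q) * (χ ((r : ℝ)⁻¹ • q) : ℂ)) := by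
  by_cases hq : q = 0
  · have h1 : χ (0 : Mink) = 0 := by
      refine χ.zero_of_le_dist ?_
      rw [Metric.mem_closedBall, not_le] at h0
      exact h0.le
    rw [hq, smul_zero, h1]
    simp
  · have h1 : K q = (r : ℂ) ^ d * K (r⁻¹ • q) := by
      rw [← hK.map_smul r hr _ (smul_ne_zero (inv_ne_zero hr.ne') hq), smul_smul,
        mul_inv_cancel₀ hr.ne', one_smul]
    rw [h1]
    ring

theorem HomogeneousKernel.contDiff_mul_bump {d : ℕ} {K : Mink → ℂ} (hK : HomogeneousKernel d K)
    {p : Mink} (χ : ContDiffBump p) (h0 : (0 : Mink) ∉ Metric.closedBall p χ.rOut) :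
    ContDiff ℝ ∞ fun q => K q * (χ q : ℂ) := by
  refine contDiff_iff_contDiffAt.2 fun q => ?_
  by_cases hq : q ∈ Metric.closedBall p χ.rOut
  · exact (hK.contDiffAt q (fun h => h0 (h ▸ hq))).mul (contDiffBump_ofReal χ).contDiffAt
  · refine (contDiffAt_const (c := (0 : ℂ))).congr_of_eventuallyEq ?_
    have h1 : q ∉ tsupport χ := by rwa [χ.tsupport_eq]
    filter_upwards [notMem_tsupport_iff_eventuallyEq.1 h1] with y hy
    rw [hy]
    simp

/-- For momenta near the direction of a vector with `p² ≠ 0` the mass shell is avoided at large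
scales, and the two boundary values agree. -/
theorem propFunctional_bump_eq {σ : ℝ} (hσ : σ ^ 2 = 1) (μ : ℝ) {K : Mink → ℂ}
    (hK : GrowthKernel K) {p : Mink} (χ : ContDiffBump p) {a : ℝ} (ha : 0 < a)
    (h : ∀ q ∈ Metric.closedBall p χ.rOut, a ≤ |mdot q q|) (f : 𝓢(Mink, ℂ)) {r : ℝ}
    (hr : 1 + 2 * |μ| / a ≤ r) (k : Mink) :
    propFunctional σ μ (fun q => K q * (χ ((r : ℝ)⁻¹ • q) : ℂ) * f (q - k)) =
      ∫ q, K q * (χ ((r : ℝ)⁻¹ • q) : ℂ) * f (q - k) / ((mdot q q : ℂ) - μ) := by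
  obtain ⟨A, hA⟩ := (hK.mul_bump χ r).mul_translate f k
  refine propFunctional_eq_integral hσ μ hA ha fun q hq => ?_
  have h1 : χ ((r : ℝ)⁻¹ • q) ≠ 0 := fun h => hq (by rw [h]; simp)
  have h2 : r⁻¹ • q ∈ Metric.closedBall p χ.rOut := by
    rw [← χ.tsupport_eq]; exact subset_tsupport _ h1
  have h3 := h _ h2
  have h4 : 0 ≤ 2 * |μ| / a := by positivity
  have hr1 : 1 ≤ r := by linarith
  have hr0 : 0 < r := by linarith
  have h5 : a * r ^ 2 ≤ |mdot q q| := by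
    rw [mdot_smul_left, mdot_smul_right, abs_mul, abs_mul, abs_of_pos (inv_pos.2 hr0)] at h3
    calc a * r ^ 2 ≤ (r⁻¹ * (r⁻¹ * |mdot q q|)) * r ^ 2 := by gcongr
      _ = _ := by field_simp
  have h6 : a + 2 * |μ| ≤ a * r ^ 2 := by
    have h7 : a + 2 * |μ| = a * (1 + 2 * |μ| / a) := by field_simp
    rw [h7]
    refine mul_le_mul_of_nonneg_left (hr.trans ?_) ha.le
    nlinarith
  have h8 := abs_sub_abs_le_abs_sub (mdot q q) μ
  have := abs_nonneg μ
  linarith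

/-- If `p` is a unit vector and some `v` satisfies `σ (p v) > 0` and `(x v) < 0`, then the phase
`σ t q² - (q x)` of the Schwinger integral has no stationary point for momenta `q` near the
direction `p`. The sign `σ = -1` may be used only where the two boundary values agree. -/
theorem exists_rapid_decay_of_direction {σ : ℝ} (hσ : σ ^ 2 = 1) (μ : ℝ) {d : ℕ} {K : Mink → ℂ}
    (hK : HomogeneousKernel d K) {x p v : Mink} (hp : ‖p‖ = 1) (hpv : 0 < σ * mdot p v)
    (hxv : 0 < -mdot x v) (hor : σ = 1 ∨ mdot p p ≠ 0) :
    ∃ U V : Set Mink, IsOpen U ∧ x ∈ U ∧ IsOpen V ∧ p ∈ V ∧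
      (∀ k ∈ V, ∀ t : ℝ, 0 < t → t • k ∈ V) ∧
      ∀ φ : 𝓢(Mink, ℂ), tsupport φ ⊆ U → ∀ N : ℕ, ∃ C : ℝ, ∀ k ∈ V,
        (1 + ‖k‖) ^ N * ‖shiftedProp 1 μ K (minkFourier φ) k‖ ≤ C := by
  set c : ℝ := min (σ * mdot p v) (-mdot x v) / 2 with hc
  have hmin : 0 < min (σ * mdot p v) (-mdot x v) := lt_min hpv hxv
  have hc0 : 0 < c := by positivity
  have hcp : c < σ * mdot p v := (half_lt_self hmin).trans_le (min_le_left _ _)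
  have hcx : c < -mdot x v := (half_lt_self hmin).trans_le (min_le_right _ _)
  -- momenta with `σ (q v)` bounded below, and `q²` bounded away from zero if `p² ≠ 0`; for `p² = 0`
  -- the second condition is made vacuous
  set W : Set Mink := {q | c < σ * mdot q v ∧
    |mdot p p| / 2 < |mdot q q| + (if mdot p p = 0 then 1 else 0)} ∩ {0}ᶜ
    with hWdef
  have hWo : IsOpen W := by
    refine IsOpen.inter (IsOpen.inter ?_ ?_) isOpen_compl_singleton
    · exact isOpen_lt continuous_const (continuous_const.mul (continuous_id.mdot continuous_const))
    · exact isOpen_lt continuous_const ((continuous_id.mdot continuous_id).abs.add continuous_const)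
  have hpW : p ∈ W := by
    refine ⟨⟨hcp, ?_⟩, fun h => by rw [mem_singleton_iff.1 h, norm_zero] at hp; norm_num at hp⟩
    split_ifs with h
    · rw [h]; norm_num
    · have : 0 < |mdot p p| := abs_pos.2 h
      linarith
  obtain ⟨ε, hε, hεW⟩ := Metric.nhds_basis_closedBall.mem_iff.1 (hWo.mem_nhds hpW)
  let χ : ContDiffBump p := ⟨ε / 2, ε, by positivity, by linarith⟩
  have hOut : Metric.closedBall p χ.rOut ⊆ W := hεW
  have h0 : (0 : Mink) ∉ Metric.closedBall p χ.rOut := fun h => (hOut h).2 rfl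
  have hn : Continuous fun k : Mink => ‖k‖ := continuous_norm
  refine ⟨{y | c < -mdot y v}, {k | ‖k - ‖k‖ • p‖ < ‖k‖ * (χ.rIn / 2)},
    isOpen_lt continuous_const (continuous_id.mdot continuous_const).neg, hcx,
    isOpen_lt (continuous_id.sub (hn.smul continuous_const)).norm (hn.mul continuous_const), ?_,
    fun k hk t ht => ?_, fun φ hφ N => ?_⟩
  · simp only [mem_ofPred_eq, hp, one_smul, sub_self, norm_zero, one_mul]
    exact half_pos χ.rIn_pos
  · have h1 : ‖t • k‖ = t * ‖k‖ := by rw [norm_smul, Real.norm_eq_abs, abs_of_pos ht]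
    simp only [mem_ofPred_eq] at hk ⊢
    rw [h1, mul_smul, ← smul_sub, norm_smul, Real.norm_eq_abs, abs_of_pos ht, mul_assoc]
    gcongr
  set f : 𝓢(Mink, ℂ) := minkFourierCLM φ with hf
  have hff : minkFourier φ = f := (coe_minkFourierCLM φ).symm
  have hgc : HasCompactSupport fun q => K q * (χ q : ℂ) :=
    (χ.hasCompactSupport.comp_left (g := fun x : ℝ => (x : ℂ)) rfl).mul_left
  obtain ⟨C1, hC1, h1⟩ := exists_norm_propFunctional_scaled_le hσ μ hc0 (W := W)
    (S := {y | c < -mdot y v}) (fun q hq => hq.1.1.le) (fun y hy => le_of_lt hy)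
    (hK.contDiff_mul_bump χ h0) hgc
    (((tsupport_mul_subset_right (f := K) (g := fun q => (χ q : ℂ))).trans
      ((closure_mono fun q hq => by
        simpa using hq).trans_eq χ.tsupport_eq)).trans hOut) φ
    (fun y hy => hφ (subset_tsupport _ hy)) (N + d)
  obtain ⟨C2, hC2, h2⟩ := exists_flowBounded_tail hK.growth χ f N
  obtain ⟨A, d', hA⟩ := hK.growth
  have h3 := hA.norm_shiftedProp_le (σ := 1) (by norm_num) μ f
  set r₀ : ℝ := 1 + 2 * |μ| / (|mdot p p| / 2) with hr₀
  have hr₀1 : 1 ≤ r₀ := by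
    have : 0 ≤ 2 * |μ| / (|mdot p p| / 2) := by positivity
    linarith
  set C3 := 8 * A * 2 ^ (d' + 8) * schwartzSup (d' + 8, 2) f * propConst with hC3
  have hC3' : 0 ≤ C3 := mul_nonneg (mul_nonneg (by have := hA.nonneg; positivity)
    (schwartzSup_nonneg _ _)) propConst_nonneg
  have hPC := propConst_nonneg
  refine ⟨2 ^ N * (C1 + C2 * propConst) + (1 + r₀) ^ N * (C3 * (1 + r₀) ^ (d' + 8)),
    fun k hk => ?_⟩
  rw [hff]
  -- small momenta are covered by the polynomial bound
  rcases lt_or_ge ‖k‖ r₀ with hkr | hkr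
  · refine le_add_of_nonneg_of_le (by positivity) ?_
    refine mul_le_mul (by gcongr) ((h3 k).trans ?_) (norm_nonneg _) (by positivity)
    gcongr
  · refine le_add_of_le_of_nonneg ?_ (by positivity)
    have hk1 : 1 ≤ ‖k‖ := hr₀1.trans hkr
    have hk0 : 0 < ‖k‖ := by linarith
    have hkk : ‖k - ‖k‖ • p‖ ≤ ‖k‖ * (χ.rIn / 2) := le_of_lt hk
    -- near the direction `p` the boundary value may be taken with the sign `σ`
    have hsgn : propFunctional 1 μ (fun q => K q * (χ ((‖k‖ : ℝ)⁻¹ • q) : ℂ) * f (q - k)) =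
        propFunctional σ μ (fun q => K q * (χ ((‖k‖ : ℝ)⁻¹ • q) : ℂ) * f (q - k)) := by
      rcases hor with h | h
      · rw [h]
      · have ha : ∀ q ∈ Metric.closedBall p χ.rOut, |mdot p p| / 2 ≤ |mdot q q| := fun q hq => by
          have := (hOut hq).1.2
          rw [if_neg h, add_zero] at this
          exact this.le
        have hpos : 0 < |mdot p p| / 2 := by have := abs_pos.2 h; positivity
        rw [propFunctional_bump_eq (by norm_num) μ hK.growth χ hpos ha f hkr,
          propFunctional_bump_eq hσ μ hK.growth χ hpos ha f hkr]
    have h4 : ‖propFunctional σ μ (fun q => K q * (χ ((‖k‖ : ℝ)⁻¹ • q) : ℂ) * f (q - k))‖ ≤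
        C1 * (‖k‖ ^ N)⁻¹ := by
      have h5 : (fun q => K q * (χ ((‖k‖ : ℝ)⁻¹ • q) : ℂ) * f (q - k)) = fun q =>
          (‖k‖ : ℂ) ^ d * (K (‖k‖⁻¹ • q) * (χ ((‖k‖ : ℝ)⁻¹ • q) : ℂ) * minkFourier φ (q - k)) := by
        ext q
        rw [hK.mul_bump_eq χ h0 hk0, hff, mul_assoc]
      rw [h5, propFunctional_const_mul, norm_mul, norm_pow, Complex.norm_real, norm_norm]
      refine (mul_le_mul_of_nonneg_left (h1 ‖k‖ hk1 k) (by positivity)).trans_eq ?_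
      rw [pow_add]
      field_simp
    have h5 := (h2 ‖k‖ hk1 k hkk).norm_propFunctional_le (σ := 1) (by norm_num) μ
    rw [shiftedProp_eq_add (by norm_num) μ hK.growth χ f hk1 hkk, hsgn]
    have h6 : (1 + ‖k‖) ^ N ≤ 2 ^ N * ‖k‖ ^ N := by
      rw [← mul_pow]; exact pow_le_pow_left₀ (by positivity) (by linarith) _
    calc _ ≤ (2 ^ N * ‖k‖ ^ N) * (C1 * (‖k‖ ^ N)⁻¹ + C2 * (‖k‖ ^ N)⁻¹ * propConst) := by
          refine mul_le_mul h6 ((norm_add_le _ _).trans (add_le_add h4 h5)) (norm_nonneg _)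
            (by positivity)
      _ = _ := by field_simp

/-- It suffices to find a vector `v` with `σ (p v) > 0` and `(x v) < 0` for an admissible sign
`σ`. For `p` not parallel to `x` it is the reflection of `p/|p| - x/|x|`, with `σ = 1`. For `p` a
positive multiple of `x` with `p² ≠ 0`, the boundary values with either sign agree near the
direction `p`, and `v = -J p` works for `σ = -1`. -/
theorem HomogeneousKernel.microlocallyRegular (μ : ℝ) {d : ℕ} {K : Mink → ℂ}
    (hK : HomogeneousKernel d K) : MicrolocallyRegular μ K := by
  intro x p hx hp hxp
  have hx0 : 0 < ‖x‖ := norm_pos_iff.2 hx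
  have hp0 : 0 < ‖p‖ := norm_pos_iff.2 hp
  set e := ‖p‖⁻¹ • p with he
  set y := ‖x‖⁻¹ • x with hy
  have hpe : p = ‖p‖ • e := by rw [he, smul_smul, mul_inv_cancel₀ hp0.ne', one_smul]
  have hxy : x = ‖x‖ • y := by rw [hy, smul_smul, mul_inv_cancel₀ hx0.ne', one_smul]
  have he1 : ‖e‖ = 1 := by rw [he, norm_smul, norm_inv, norm_norm, inv_mul_cancel₀ hp0.ne']
  have hy1 : ‖y‖ = 1 := by rw [hy, norm_smul, norm_inv, norm_norm, inv_mul_cancel₀ hx0.ne']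
  have hdot : ∀ a b : Mink, mdot a (minkReflect b) = inner ℝ b a := fun a b => by
    rw [mdot_comm, mdot_minkReflect_left]
  -- by conic invariance of the momentum set `p` may be replaced by a unit vector
  suffices h : ∃ U V : Set Mink, IsOpen U ∧ x ∈ U ∧ IsOpen V ∧ e ∈ V ∧
      (∀ k ∈ V, ∀ t : ℝ, 0 < t → t • k ∈ V) ∧
      ∀ φ : 𝓢(Mink, ℂ), tsupport φ ⊆ U → ∀ N : ℕ, ∃ C : ℝ, ∀ k ∈ V,
        (1 + ‖k‖) ^ N * ‖shiftedProp 1 μ K (minkFourier φ) k‖ ≤ C by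
    obtain ⟨U, V, h1, h2, h3, h4, h5, h6⟩ := h
    exact ⟨U, V, h1, h2, h3, hpe ▸ h5 e h4 _ hp0, h5, h6⟩
  by_cases hey : e = y
  · have hpp : mdot e e ≠ 0 := fun h => by
      refine hxp ⟨?_, ‖p‖ * ‖x‖⁻¹, by positivity, ?_⟩
      · rw [hxy, mdot_smul_left, mdot_smul_right, ← hey, h]; simp
      · rw [mul_smul, ← hy, ← hey, ← hpe]
    refine exists_rapid_decay_of_direction (σ := -1) (by norm_num) μ hK (v := -minkReflect e) he1
      ?_ ?_ (Or.inr hpp)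
    · rw [mdot_neg_right, hdot, real_inner_self_eq_norm_sq, he1]; norm_num
    · rw [mdot_neg_right, hdot, hxy, ← hey, real_inner_smul_right, real_inner_self_eq_norm_sq, he1]
      simpa using hx
  · have hlt : inner ℝ e y < 1 := by
      have h1 := real_inner_le_norm e y
      rw [he1, hy1, one_mul] at h1
      refine lt_of_le_of_ne h1 fun h => hey ?_
      exact (inner_eq_one_iff_of_norm_eq_one he1 hy1).1 h
    have hlt' : inner ℝ y e < 1 := by rwa [real_inner_comm]
    refine exists_rapid_decay_of_direction (σ := 1) (by norm_num) μ hK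
      (v := minkReflect (e - y)) he1 ?_ ?_ (Or.inl rfl)
    · rw [hdot, inner_sub_left, real_inner_self_eq_norm_sq, he1]; linarith
    · rw [hdot, hxy, real_inner_smul_right, inner_sub_left, real_inner_self_eq_norm_sq, hy1]
      nlinarith

theorem shiftedProp_add {K L : Mink → ℂ} (hK : GrowthKernel K) (hL : GrowthKernel L) (μ : ℝ)
    (f : 𝓢(Mink, ℂ)) (k : Mink) :
    shiftedProp 1 μ (fun p => K p + L p) f k = shiftedProp 1 μ K f k + shiftedProp 1 μ L f k := by
  obtain ⟨A, hA⟩ := hK.mul_translate f k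
  obtain ⟨B, hB⟩ := hL.mul_translate f k
  rw [shiftedProp, shiftedProp, shiftedProp, ← propFunctional_add (by norm_num) μ hA hB]
  simp only [add_mul]

theorem GrowthKernel.add {K L : Mink → ℂ} (hK : GrowthKernel K) (hL : GrowthKernel L) :
    GrowthKernel fun p => K p + L p := by
  obtain ⟨A, d, hA⟩ := hK
  obtain ⟨B, e, hB⟩ := hL
  have := hA.nonneg
  have := hB.nonneg
  refine ⟨A + B, d + e, (hA.add hB).mono fun p => ?_⟩
  have h1 : (1 + ‖p‖) ^ d ≤ (1 + ‖p‖) ^ (d + e) :=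
    pow_le_pow_right₀ (by linarith [norm_nonneg p]) (by omega)
  have h2 : (1 + ‖p‖) ^ e ≤ (1 + ‖p‖) ^ (d + e) :=
    pow_le_pow_right₀ (by linarith [norm_nonneg p]) (by omega)
  rw [add_mul]
  gcongr

theorem MicrolocallyRegular.add {μ : ℝ} {K L : Mink → ℂ} (hK : MicrolocallyRegular μ K)
    (hL : MicrolocallyRegular μ L) (hK' : GrowthKernel K) (hL' : GrowthKernel L) :
    MicrolocallyRegular μ fun p => K p + L p := by
  intro x p hx hp hxp
  obtain ⟨U, V, a1, a2, a3, a4, a5, a6⟩ := hK x p hx hp hxp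
  obtain ⟨U', V', b1, b2, b3, b4, b5, b6⟩ := hL x p hx hp hxp
  refine ⟨U ∩ U', V ∩ V', a1.inter b1, ⟨a2, b2⟩, a3.inter b3, ⟨a4, b4⟩,
    fun k hk t ht => ⟨a5 k hk.1 t ht, b5 k hk.2 t ht⟩, fun φ hφ N => ?_⟩
  obtain ⟨C, hC⟩ := a6 φ (hφ.trans inter_subset_left) N
  obtain ⟨D, hD⟩ := b6 φ (hφ.trans inter_subset_right) N
  refine ⟨C + D, fun k hk => ?_⟩
  have h1 := hC k hk.1
  have h2 := hD k hk.2
  rw [← coe_minkFourierCLM, shiftedProp_add hK' hL', coe_minkFourierCLM]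
  calc _ ≤ (1 + ‖k‖) ^ N * (‖shiftedProp 1 μ K (minkFourier φ) k‖ +
        ‖shiftedProp 1 μ L (minkFourier φ) k‖) := by gcongr; exact norm_add_le _ _
    _ ≤ _ := by rw [mul_add]; exact add_le_add h1 h2

/-! ### Convolutions of functions decaying rapidly in cones -/

/-- `A` decays rapidly on `G`. -/
def RapidOn (A : Mink → ℂ) (G : Set Mink) : Prop :=
  ∀ N : ℕ, ∃ C : ℝ, ∀ k ∈ G, (1 + ‖k‖) ^ N * ‖A k‖ ≤ C

/-- `A` is bounded by a polynomial. -/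
def PolyBounded (A : Mink → ℂ) : Prop :=
  ∃ (C : ℝ) (n : ℕ), ∀ k, ‖A k‖ ≤ C * (1 + ‖k‖) ^ n

theorem RapidOn.exists_bound {A : Mink → ℂ} {G : Set Mink} (h : RapidOn A G) (N : ℕ) :
    ∃ C : ℝ, 0 ≤ C ∧ ∀ k ∈ G, ‖A k‖ ≤ C * ((1 + ‖k‖) ^ N)⁻¹ := by
  obtain ⟨C, hC⟩ := h N
  refine ⟨|C|, abs_nonneg C, fun k hk => ?_⟩
  rw [← div_eq_mul_inv, le_div_iff₀ (by positivity), mul_comm]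
  exact (hC k hk).trans (le_abs_self C)

theorem PolyBounded.exists_bound {A : Mink → ℂ} (h : PolyBounded A) :
    ∃ (C : ℝ) (n : ℕ), 0 ≤ C ∧ ∀ k, ‖A k‖ ≤ C * (1 + ‖k‖) ^ n := by
  obtain ⟨C, n, hC⟩ := h
  refine ⟨|C|, n, abs_nonneg C, fun k => (hC k).trans ?_⟩
  gcongr
  exact le_abs_self C

theorem RapidOn.polyBounded {A : Mink → ℂ} (h : RapidOn A univ) : PolyBounded A := by
  obtain ⟨C, hC⟩ := h 0
  exact ⟨C, 0, fun k => by simpa using hC k (mem_univ k)⟩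

theorem SchwartzMap.rapidOn (f : 𝓢(Mink, ℂ)) : RapidOn f univ := fun N => by
  obtain ⟨C, -, hC⟩ := f.exists_decay N
  refine ⟨C, fun k _ => ?_⟩
  have := hC k
  rw [← div_eq_mul_inv, le_div_iff₀ (by positivity)] at this
  linarith

theorem RapidOn.neg {A : Mink → ℂ} (h : RapidOn A univ) : RapidOn (fun k => A (-k)) univ :=
  fun N => by
    obtain ⟨C, hC⟩ := h N
    exact ⟨C, fun k _ => by simpa using hC (-k) (mem_univ _)⟩

/-- Numerical bound for a product of a rapidly decreasing and a polynomially bounded factor; `a`,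
`b` and `l` stand for `1 + ‖k‖`, `1 + ‖L - k‖` and `1 + ‖L‖`. -/
theorem mul_le_of_left_decay {x y C D a b l δ : ℝ} {n j : ℕ} (hy0 : 0 ≤ y)
    (hC : 0 ≤ C) (hD : 0 ≤ D) (ha : 1 ≤ a) (hb : 0 ≤ b) (hl : 1 ≤ l) (hδ : 0 < δ)
    (hx : x ≤ C * (a ^ (n + 6 + j))⁻¹) (hy : y ≤ D * b ^ n) (hba : b ≤ l * a)
    (hj : (δ * l) ^ j ≤ a ^ j) :
    x * y ≤ C * D * (δ ^ j)⁻¹ * (l ^ (n + 6) * (l ^ j)⁻¹ * (a ^ 6)⁻¹) := by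
  have h1 : y ≤ D * (l ^ n * a ^ n) := hy.trans (by rw [← mul_pow]; gcongr)
  have h2 : (a ^ j)⁻¹ ≤ (δ ^ j)⁻¹ * (l ^ j)⁻¹ := by
    rw [← mul_inv, ← mul_pow]
    exact inv_anti₀ (by positivity) hj
  have h3 : l ^ n ≤ l ^ (n + 6) := pow_le_pow_right₀ hl (by omega)
  calc x * y ≤ C * (a ^ (n + 6 + j))⁻¹ * (D * (l ^ n * a ^ n)) :=
        mul_le_mul hx h1 hy0 (by positivity)
    _ = C * D * (l ^ n * (a ^ j)⁻¹ * (a ^ 6)⁻¹) := by rw [pow_add, pow_add]; field_simp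
    _ ≤ C * D * (l ^ (n + 6) * ((δ ^ j)⁻¹ * (l ^ j)⁻¹) * (a ^ 6)⁻¹) := by gcongr
    _ = _ := by ring

/-- The bound `mul_le_of_left_decay` with the roles of the two factors exchanged. -/
theorem mul_le_of_right_decay {x y C D a b l δ : ℝ} {n j : ℕ} (hx0 : 0 ≤ x)
    (hC : 0 ≤ C) (hD : 0 ≤ D) (ha : 1 ≤ a) (hb : 1 ≤ b) (hl : 1 ≤ l) (hδ : 0 < δ)
    (hx : x ≤ D * a ^ n) (hy : y ≤ C * (b ^ (n + 6 + j))⁻¹) (hab : a ≤ l * b)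
    (hj : (δ * l) ^ j ≤ b ^ j) :
    x * y ≤ C * D * (δ ^ j)⁻¹ * (l ^ (n + 6) * (l ^ j)⁻¹ * (a ^ 6)⁻¹) := by
  have h2 : (b ^ j)⁻¹ ≤ (δ ^ j)⁻¹ * (l ^ j)⁻¹ := by
    rw [← mul_inv, ← mul_pow]
    exact inv_anti₀ (by positivity) hj
  have h4 : a ^ (n + 6) * (b ^ (n + 6))⁻¹ ≤ l ^ (n + 6) := by
    rw [← div_eq_mul_inv, div_le_iff₀ (by positivity), ← mul_pow]
    exact pow_le_pow_left₀ (by positivity) hab _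
  calc x * y ≤ D * a ^ n * (C * (b ^ (n + 6 + j))⁻¹) := by
        refine (mul_le_mul_of_nonneg_left hy hx0).trans ?_
        exact mul_le_mul_of_nonneg_right hx (by positivity)
    _ = C * D * ((a ^ (n + 6) * (b ^ (n + 6))⁻¹) * (b ^ j)⁻¹ * (a ^ 6)⁻¹) := by
        rw [pow_add b, pow_add a]; field_simp
    _ ≤ C * D * (l ^ (n + 6) * ((δ ^ j)⁻¹ * (l ^ j)⁻¹) * (a ^ 6)⁻¹) := by gcongr
    _ = _ := by ring

theorem one_add_norm_sub_le (L k : Mink) : 1 + ‖L - k‖ ≤ (1 + ‖L‖) * (1 + ‖k‖) := by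
  have h := norm_sub_le L k
  have := mul_nonneg (norm_nonneg L) (norm_nonneg k)
  linarith

theorem one_add_norm_le_mul_sub (L k : Mink) : 1 + ‖k‖ ≤ (1 + ‖L‖) * (1 + ‖L - k‖) := by
  have h : ‖k‖ ≤ ‖L‖ + ‖L - k‖ := by
    have := norm_sub_le L (L - k)
    rwa [sub_sub_cancel] at this
  have := mul_nonneg (norm_nonneg L) (norm_nonneg (L - k))
  linarith

/-- The convolution integrand of `A` and `B` is dominated if the two factors decay rapidly on sets
that leave only momenta bounded in terms of the total momentum. -/
theorem exists_convolution_bound {A B : Mink → ℂ} {G H : Set Mink} (hA : PolyBounded A)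
    (hB : PolyBounded B) (hAG : RapidOn A G) (hBH : RapidOn B H) {R : ℝ} (hR0 : 0 ≤ R)
    (hR : ∀ L k, ‖k‖ ≤ R * ‖L‖ ∨ k ∈ G ∨ L - k ∈ H) :
    ∃ (C : ℝ) (m : ℕ), 0 ≤ C ∧ ∀ L k,
      ‖A k‖ * ‖B (L - k)‖ ≤ C * (1 + ‖L‖) ^ m * ((1 + ‖k‖) ^ 6)⁻¹ := by
  obtain ⟨CA, n, hCA, hA⟩ := hA.exists_bound
  obtain ⟨CB, n', hCB, hB⟩ := hB.exists_bound
  obtain ⟨DA, hDA, hAG⟩ := hAG.exists_bound (n' + 6 + 0)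
  obtain ⟨DB, hDB, hBH⟩ := hBH.exists_bound (n + 6 + 0)
  refine ⟨CA * CB * (1 + R) ^ (n + n' + 6) + DA * CB + DB * CA, n + n' + n' + 6, by positivity,
    fun L k => ?_⟩
  have ha : 1 ≤ 1 + ‖k‖ := by linarith [norm_nonneg k]
  have hb : 1 ≤ 1 + ‖L - k‖ := by linarith [norm_nonneg (L - k)]
  have hl : 1 ≤ 1 + ‖L‖ := by linarith [norm_nonneg L]
  have hba := one_add_norm_sub_le L k
  have hab := one_add_norm_le_mul_sub L k
  -- either `k` is controlled by `L`, or one of the factors decays rapidly and the other is bounded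
  -- by a polynomial
  rcases hR L k with h | h | h
  · have h1 : 1 + ‖k‖ ≤ (1 + R) * (1 + ‖L‖) := by nlinarith [norm_nonneg L]
    have h2 : ‖A k‖ * ‖B (L - k)‖ ≤ CA * CB * (1 + R) ^ (n + n' + 6) *
        (1 + ‖L‖) ^ (n + n' + n' + 6) * ((1 + ‖k‖) ^ 6)⁻¹ := by
      rw [← div_eq_mul_inv, le_div_iff₀ (by positivity)]
      calc _ ≤ CA * (1 + ‖k‖) ^ n * (CB * ((1 + ‖L‖) * (1 + ‖k‖)) ^ n') * (1 + ‖k‖) ^ 6 := by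
            gcongr
            · exact hA k
            · exact (hB _).trans (by gcongr)
        _ = CA * CB * (1 + ‖L‖) ^ n' * (1 + ‖k‖) ^ (n + n' + 6) := by rw [mul_pow]; ring
        _ ≤ CA * CB * (1 + ‖L‖) ^ n' * ((1 + R) * (1 + ‖L‖)) ^ (n + n' + 6) := by gcongr
        _ = _ := by rw [mul_pow]; ring
    refine h2.trans ?_
    gcongr
    linarith [mul_nonneg hDA hCB, mul_nonneg hDB hCA]
  · have h1 := mul_le_of_left_decay (j := 0) (δ := 1) (norm_nonneg (B (L - k))) hDA hCB ha
      (by linarith) hl one_pos (hAG k h) (hB (L - k)) hba (by simp)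
    refine h1.trans ?_
    simp only [pow_zero, inv_one, mul_one]
    rw [← mul_assoc]
    have : (0 : ℝ) ≤ CA * CB * (1 + R) ^ (n + n' + 6) := by positivity
    gcongr
    · linarith [mul_nonneg hDB hCA]
    · omega
  · have h1 := mul_le_of_right_decay (j := 0) (δ := 1) (norm_nonneg (A k)) hDB hCA ha
      hb hl one_pos (hA k) (hBH _ h) hab (by simp)
    refine h1.trans ?_
    simp only [pow_zero, inv_one, mul_one]
    rw [← mul_assoc]
    have : (0 : ℝ) ≤ CA * CB * (1 + R) ^ (n + n' + 6) := by positivity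
    gcongr
    · linarith [mul_nonneg hDA hCB]
    · omega

/-- If for every total momentum in `F` one of the two momenta lies in the region of rapid decay
and is comparable with the total momentum, then the convolution integrand decays rapidly on `F`. -/
theorem exists_convolution_rapid {A B : Mink → ℂ} {F G H : Set Mink} (hA : PolyBounded A)
    (hB : PolyBounded B) (hAG : RapidOn A G) (hBH : RapidOn B H) {δ : ℝ} (hδ : 0 < δ)
    (hδ1 : δ ≤ 1)
    (hF : ∀ L ∈ F, ∀ k, (k ∈ G ∧ δ * ‖L‖ ≤ ‖k‖) ∨ (L - k ∈ H ∧ δ * ‖L‖ ≤ ‖L - k‖)) (N : ℕ) :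
    ∃ C : ℝ, 0 ≤ C ∧ ∀ L ∈ F, ∀ k,
      ‖A k‖ * ‖B (L - k)‖ ≤ C * ((1 + ‖L‖) ^ N)⁻¹ * ((1 + ‖k‖) ^ 6)⁻¹ := by
  obtain ⟨CA, n, hCA, hA⟩ := hA.exists_bound
  obtain ⟨CB, n', hCB, hB⟩ := hB.exists_bound
  obtain ⟨DA, hDA, hAG⟩ := hAG.exists_bound (n' + 6 + (N + n' + 6))
  obtain ⟨DB, hDB, hBH⟩ := hBH.exists_bound (n + 6 + (N + n + 6))
  refine ⟨DA * CB * (δ ^ (N + n' + 6))⁻¹ + DB * CA * (δ ^ (N + n + 6))⁻¹, by positivity,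
    fun L hL k => ?_⟩
  have ha : 1 ≤ 1 + ‖k‖ := by linarith [norm_nonneg k]
  have hb : 1 ≤ 1 + ‖L - k‖ := by linarith [norm_nonneg (L - k)]
  have hl : 1 ≤ 1 + ‖L‖ := by linarith [norm_nonneg L]
  have hba := one_add_norm_sub_le L k
  have hab := one_add_norm_le_mul_sub L k
  have hpow : ∀ m, (1 + ‖L‖) ^ (m + 6) * ((1 + ‖L‖) ^ (N + m + 6))⁻¹ = ((1 + ‖L‖) ^ N)⁻¹ :=
    fun m => by
      rw [show N + m + 6 = N + (m + 6) by ring, pow_add _ N]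
      field_simp
  rcases hF L hL k with ⟨h, h'⟩ | ⟨h, h'⟩
  · have h1 := mul_le_of_left_decay (norm_nonneg (B (L - k))) hDA hCB ha (by linarith) hl hδ
      (hAG k h) (hB (L - k)) hba (pow_le_pow_left₀ (by positivity) (by nlinarith) _)
    rw [hpow] at h1
    refine h1.trans ?_
    rw [← mul_assoc]
    gcongr
    exact le_add_of_nonneg_right (by positivity)
  · have h1 := mul_le_of_right_decay (norm_nonneg (A k)) hDB hCA ha hb hl hδ
      (hA k) (hBH _ h) hab (pow_le_pow_left₀ (by positivity) (by nlinarith) _)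
    rw [hpow] at h1
    refine h1.trans ?_
    rw [← mul_assoc]
    gcongr
    exact le_add_of_nonneg_left (by positivity)

/-- The complement of the closed convex cone of all `k` with `⟨k, e⟩ ≥ c ‖k‖`. -/
def coneCompl (e : Mink) (c : ℝ) : Set Mink := {k | inner ℝ k e < c * ‖k‖}

theorem isOpen_coneCompl (e : Mink) (c : ℝ) : IsOpen (coneCompl e c) :=
  isOpen_lt (continuous_id.inner continuous_const) (continuous_const.mul continuous_norm)

theorem smul_mem_coneCompl {e k : Mink} {c t : ℝ} (ht : 0 < t) (hk : k ∈ coneCompl e c) :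
    t • k ∈ coneCompl e c := by
  have h : inner ℝ k e < c * ‖k‖ := hk
  change inner ℝ (t • k) e < c * ‖t • k‖
  rw [real_inner_smul_left, norm_smul, Real.norm_eq_abs, abs_of_pos ht]
  nlinarith

theorem ne_zero_of_mem_coneCompl {e k : Mink} {c : ℝ} (hk : k ∈ coneCompl e c) : k ≠ 0 :=
  fun h => by
    have h' : inner ℝ k e < c * ‖k‖ := hk
    rw [h] at h'
    simp at h'

/-- Two momenta in a proper convex cone are bounded by their sum. -/
theorem norm_le_or_mem_coneCompl {e : Mink} {c : ℝ} (hc : 0 < c) (L k : Mink) (he : ‖e‖ = 1) :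
    ‖k‖ ≤ c⁻¹ * ‖L‖ ∨ k ∈ coneCompl e c ∨ L - k ∈ coneCompl e c := by
  by_contra! h
  obtain ⟨h1, h2, h3⟩ := h
  have h2' : c * ‖k‖ ≤ inner ℝ k e := not_lt.1 h2
  have h3' : c * ‖L - k‖ ≤ inner ℝ (L - k) e := not_lt.1 h3
  rw [inner_sub_left] at h3'
  have h4 := real_inner_le_norm L e
  rw [he, mul_one] at h4
  rw [inv_mul_eq_div, div_lt_iff₀ hc] at h1
  have := mul_nonneg hc.le (norm_nonneg (L - k))
  linarith

/-- If the sum of two momenta lies outside the cone of opening `c'`, then one of them is outside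
the cone of the larger parameter `c > c'` and comparable with the sum. -/
theorem exists_mem_coneCompl {e : Mink} (he : ‖e‖ = 1) {c c' : ℝ} (hc : c' < c) (hc0 : 0 < c)
    (hc1 : c < 1) : ∃ δ : ℝ, 0 < δ ∧ δ ≤ 1 ∧ ∀ L ∈ coneCompl e c', ∀ k,
      (k ∈ coneCompl e c ∧ δ * ‖L‖ ≤ ‖k‖) ∨ (L - k ∈ coneCompl e c ∧ δ * ‖L‖ ≤ ‖L - k‖) := by
  set δ : ℝ := min (1 / 2) ((c - c') / 4) with hδ
  have hδ0 : 0 < δ := lt_min (by norm_num) (by linarith)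
  have hδ2 : δ ≤ 1 / 2 := min_le_left _ _
  have hδ4 : δ ≤ (c - c') / 4 := min_le_right _ _
  refine ⟨δ, hδ0, by linarith, fun L hL k => ?_⟩
  have hL0 : 0 < ‖L‖ := norm_pos_iff.2 (ne_zero_of_mem_coneCompl hL)
  have hL' : inner ℝ L e < c' * ‖L‖ := hL
  -- a summand that is small compared with the total momentum does not move it into the cone
  have key : ∀ q : Mink, ‖q‖ < δ * ‖L‖ → L - q ∈ coneCompl e c ∧ δ * ‖L‖ ≤ ‖L - q‖ := by
    intro q hq
    have h1 : ‖L‖ ≤ ‖L - q‖ + ‖q‖ := by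
      have := norm_add_le (L - q) q
      rwa [sub_add_cancel] at this
    have h2 : -‖q‖ ≤ inner ℝ q e := by
      have := (abs_le.1 (abs_real_inner_le_norm q e)).1
      rwa [he, mul_one] at this
    refine ⟨?_, by nlinarith⟩
    change inner ℝ (L - q) e < c * ‖L - q‖
    rw [inner_sub_left]
    have h3 : c * ‖L‖ ≤ c * (‖L - q‖ + ‖q‖) := mul_le_mul_of_nonneg_left h1 hc0.le
    have h4 : c * ‖q‖ ≤ 1 * ‖q‖ := mul_le_mul_of_nonneg_right hc1.le (norm_nonneg q)
    have h5 : δ * ‖L‖ ≤ (c - c') / 4 * ‖L‖ := mul_le_mul_of_nonneg_right hδ4 hL0.le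
    have h6 : 0 < (c - c') * ‖L‖ := mul_pos (by linarith) hL0
    linarith
  by_cases h1 : ‖k‖ < δ * ‖L‖
  · exact Or.inr (key k h1)
  by_cases h2 : ‖L - k‖ < δ * ‖L‖
  · have := key _ h2
    rw [sub_sub_cancel] at this
    exact Or.inl this
  rw [not_lt] at h1 h2
  -- if `k` lies in the closed cone then `L - k` does not, as otherwise so would `L` by convexity
  by_cases h3 : k ∈ coneCompl e c
  · exact Or.inl ⟨h3, h1⟩
  · refine Or.inr ⟨?_, h2⟩
    have h3' : c * ‖k‖ ≤ inner ℝ k e := not_lt.1 h3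
    change inner ℝ (L - k) e < c * ‖L - k‖
    rw [inner_sub_left]
    have h4 : ‖L‖ ≤ ‖L - k‖ + ‖k‖ := by
      have := norm_add_le (L - k) k
      rwa [sub_add_cancel] at this
    nlinarith

/-! ### Partitions of unity and gluing of distributions -/

theorem testMul_apply {Ω : Opens Mink} (φ : 𝓓(Ω, ℂ)) (g : Mink → ℂ) (hg : ContDiff ℝ ∞ g)
    (x : Mink) : testMul φ g hg x = φ x * g x := rfl

theorem tsupport_testMul_subset_left {Ω : Opens Mink} (φ : 𝓓(Ω, ℂ)) (g : Mink → ℂ)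
    (hg : ContDiff ℝ ∞ g) : tsupport (testMul φ g hg) ⊆ tsupport φ :=
  tsupport_mul_subset_left (f := fun x => φ x) (g := g)

theorem tsupport_testMul_subset_right {Ω : Opens Mink} (φ : 𝓓(Ω, ℂ)) (g : Mink → ℂ)
    (hg : ContDiff ℝ ∞ g) : tsupport (testMul φ g hg) ⊆ tsupport g :=
  tsupport_mul_subset_right (f := fun x => φ x) (g := g)

theorem testFunction_sum_apply {Ω : Opens Mink} {ι : Type*} (t : Finset ι) (f : ι → 𝓓(Ω, ℂ))
    (y : Mink) : (∑ i ∈ t, f i) y = ∑ i ∈ t, f i y := by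
  classical
  induction t using Finset.induction_on with
  | empty => simp
  | insert a s ha ih => rw [Finset.sum_insert ha, Finset.sum_insert ha, ← ih]; rfl

/-- A finite partition of unity near a compact subset of `Ω`, by test functions subordinate to a
given family of open sets. -/
theorem exists_testFunction_partition {Ω : Opens Mink} {U : Mink → Set Mink}
    (hU : ∀ x ∈ Ω, IsOpen (U x) ∧ x ∈ U x) {K : Set Mink} (hK : IsCompact K)
    (hKΩ : K ⊆ Ω) : ∃ (t : Finset Mink) (ρ : Mink → 𝓓(Ω, ℂ)), (∀ x ∈ t, x ∈ Ω) ∧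
      (∀ x ∈ t, tsupport (ρ x) ⊆ U x) ∧ ∀ y ∈ K, ∑ x ∈ t, ρ x y = 1 := by
  classical
  set V : Mink → Set Mink := fun x => U x ∩ (Ω ∩ Metric.ball x 1) with hV
  have hVo : ∀ x ∈ Ω, IsOpen (V x) := fun x hx =>
    (hU x hx).1.inter (Ω.isOpen.inter Metric.isOpen_ball)
  obtain ⟨t, htK, hcov⟩ := hK.elim_nhds_subcover V fun x hx =>
    (hVo x (hKΩ hx)).mem_nhds ⟨(hU x (hKΩ hx)).2, hKΩ hx, Metric.mem_ball_self one_pos⟩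
  obtain ⟨f, hf⟩ := SmoothPartitionOfUnity.exists_isSubordinate (modelWithCornersSelf ℝ Mink)
    hK.isClosed (fun i : t => V i) (fun i => hVo _ (hKΩ (htK i i.2))) (fun y hy => by
      obtain ⟨x, hx, hxy⟩ := mem_iUnion₂.1 (hcov hy)
      exact mem_iUnion.2 ⟨⟨x, hx⟩, hxy⟩)
  have hs : ∀ i : t, ContDiff ℝ ∞ fun y => ((f i y : ℝ) : ℂ) := fun i =>
    Complex.ofRealCLM.contDiff.comp (f i).contMDiff.contDiff
  have hts : ∀ i : t, tsupport (fun y => ((f i y : ℝ) : ℂ)) ⊆ V i := fun i =>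
    (closure_mono fun y hy => by simpa using hy).trans (hf i)
  let g : t → 𝓓(Ω, ℂ) := fun i =>
    ⟨fun y => ((f i y : ℝ) : ℂ), hs i,
      Metric.isCompact_of_isClosed_isBounded (isClosed_tsupport _)
        (Metric.isBounded_ball.subset ((hts i).trans fun y hy => hy.2.2)),
      (hts i).trans fun y hy => hy.2.1⟩
  refine ⟨t, fun x => if h : x ∈ t then g ⟨x, h⟩ else 0, fun x hx => hKΩ (htK x hx),
    fun x hx => ?_, fun y hy => ?_⟩
  · simp only [hx, dif_pos]
    exact (hts ⟨x, hx⟩).trans fun y hy => hy.1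
  · rw [← Finset.sum_attach]
    have h1 : ∀ i ∈ t.attach, (if h : (i : Mink) ∈ t then g ⟨i, h⟩ else 0 : 𝓓(Ω, ℂ)) y =
        ((f i y : ℝ) : ℂ) := fun i _ => by
      rw [dif_pos i.2]; rfl
    rw [Finset.sum_congr rfl h1, ← Complex.ofReal_sum]
    have h2 := f.sum_eq_one hy
    rw [finsum_eq_sum_of_fintype] at h2
    rw [← Finset.univ_eq_attach, h2, Complex.ofReal_one]

/-- A test function equal to one near a compact set and supported in a given neighbourhood. -/
theorem exists_cutoff {Ω : Opens Mink} {K U : Set Mink} (hK : IsCompact K) (hU : IsOpen U)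
    (hKU : K ⊆ U) (hKΩ : K ⊆ Ω) : ∃ ψ : 𝓓(Ω, ℂ), tsupport ψ ⊆ U ∧ ∀ y ∈ K, ψ y = 1 := by
  obtain ⟨t, ρ, -, hρ, h1⟩ := exists_testFunction_partition (Ω := ⟨Ω ∩ U, Ω.isOpen.inter hU⟩)
    (U := fun _ => univ) (fun x _ => ⟨isOpen_univ, mem_univ x⟩) hK (fun y hy => ⟨hKΩ hy, hKU hy⟩)
  set s := ∑ x ∈ t, ρ x with hs
  refine ⟨⟨s, s.contDiff, s.hasCompactSupport, s.tsupport_subset.trans fun y hy => hy.1⟩,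
    s.tsupport_subset.trans fun y hy => hy.2, fun y hy => ?_⟩
  rw [← h1 y hy, ← testFunction_sum_apply]
  rfl

theorem sum_testMul_partition {Ω : Opens Mink} {ι : Type*} {t : Finset ι} {ρ : ι → 𝓓(Ω, ℂ)}
    (χ : 𝓓(Ω, ℂ)) (h : ∀ y ∈ tsupport χ, ∑ x ∈ t, ρ x y = 1) :
    χ = ∑ x ∈ t, testMul χ (ρ x) (ρ x).contDiff := by
  refine TestFunction.ext fun y => ?_
  rw [testFunction_sum_apply]
  simp only [testMul_apply, ← Finset.mul_sum]
  by_cases hy : y ∈ tsupport χ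
  · rw [h y hy, mul_one]
  · rw [image_eq_zero_of_notMem_tsupport hy, zero_mul]

theorem testMul_eq_self {Ω : Opens Mink} {χ ψ : 𝓓(Ω, ℂ)} (h : ∀ y ∈ tsupport χ, ψ y = 1) :
    testMul χ ψ ψ.contDiff = χ := by
  refine TestFunction.ext fun y => ?_
  rw [testMul_apply]
  by_cases hy : y ∈ tsupport χ
  · rw [h y hy, mul_one]
  · rw [image_eq_zero_of_notMem_tsupport hy, zero_mul]

/-- Distributions that agree locally agree. -/
theorem distr_ext_of_local {Ω : Opens Mink} {w w' : Distr Ω}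
    (h : ∀ x ∈ Ω, ∃ U : Set Mink, IsOpen U ∧ x ∈ U ∧ ∀ χ : 𝓓(Ω, ℂ), tsupport χ ⊆ U →
      w χ = w' χ) : w = w' := by
  have h' : ∀ x : Mink, ∃ U : Set Mink, x ∈ Ω → IsOpen U ∧ x ∈ U ∧
      ∀ χ : 𝓓(Ω, ℂ), tsupport χ ⊆ U → w χ = w' χ := fun x => by
    by_cases hx : x ∈ Ω
    · obtain ⟨U, hU⟩ := h x hx; exact ⟨U, fun _ => hU⟩
    · exact ⟨∅, fun h => absurd h hx⟩
  choose U hU using h'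
  refine ContinuousLinearMap.ext fun χ => ?_
  obtain ⟨t, ρ, ht, hρ, h1⟩ := exists_testFunction_partition
    (fun x hx => ⟨(hU x hx).1, (hU x hx).2.1⟩) χ.hasCompactSupport χ.tsupport_subset
  rw [sum_testMul_partition χ h1, map_sum, map_sum]
  exact Finset.sum_congr rfl fun x hx => (hU x (ht x hx)).2.2 _
    ((tsupport_testMul_subset_right _ _ _).trans (hρ x hx))

/-- Tempered functionals that agree on overlaps glue to a distribution. -/
theorem exists_distr_of_local {Ω : Opens Mink} {U : Mink → Set Mink}
    (hU : ∀ x ∈ Ω, IsOpen (U x) ∧ x ∈ U x) (T : Mink → 𝓢(Mink, ℂ) →L[ℂ] ℂ)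
    (hT : ∀ x ∈ Ω, ∀ y ∈ Ω, ∀ χ : 𝓓(Ω, ℂ), tsupport χ ⊆ U x → tsupport χ ⊆ U y →
      T x (testToSchwartzCLM Ω χ) = T y (testToSchwartzCLM Ω χ)) :
    ∃ w : Distr Ω, ∀ x ∈ Ω, ∀ χ : 𝓓(Ω, ℂ), tsupport χ ⊆ U x →
      w χ = T x (testToSchwartzCLM Ω χ) := by
  have hpart := fun K : {K : Compacts Mink // (K : Set Mink) ⊆ Ω} =>
    exists_testFunction_partition hU K.1.isCompact K.2
  choose t ρ ht hρ h1 using hpart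
  let L : Mink → 𝓓(Ω, ℂ) →ₗ[ℂ] ℂ := fun x =>
    ((T x).comp (testToSchwartzCLM Ω)).toLinearMap
  have hL : ∀ x ∈ Ω, ∀ y ∈ Ω, ∀ χ : 𝓓(Ω, ℂ), tsupport χ ⊆ U x → tsupport χ ⊆ U y →
    L x χ = L y χ := hT
  -- `S K` is the candidate functional on test functions supported in `K`
  let S : {K : Compacts Mink // (K : Set Mink) ⊆ Ω} → 𝓓(Ω, ℂ) → ℂ := fun K χ =>
    ∑ x ∈ t K, L x (testMul χ (ρ K x) (ρ K x).contDiff)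
  -- two partitions of unity give the same value, by refining one with the other
  have hindep : ∀ K K' : {K : Compacts Mink // (K : Set Mink) ⊆ Ω}, ∀ χ : 𝓓(Ω, ℂ),
      tsupport χ ⊆ K.1 → tsupport χ ⊆ K'.1 → S K χ = S K' χ := by
    intro K K' χ hχ hχ'
    have e1 : ∀ x ∈ t K, L x (testMul χ (ρ K x) (ρ K x).contDiff) = ∑ y ∈ t K',
        L y (testMul (testMul χ (ρ K x) (ρ K x).contDiff) (ρ K' y) (ρ K' y).contDiff) := by
      intro x hx
      conv_lhs => rw [sum_testMul_partition (t := t K') (ρ := ρ K')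
        (testMul χ (ρ K x) (ρ K x).contDiff)
        (fun y hy => h1 K' y (hχ' (tsupport_testMul_subset_left _ _ _ hy))), map_sum]
      exact Finset.sum_congr rfl fun y hy => hL x (ht K x hx) y (ht K' y hy) _
        ((tsupport_testMul_subset_left _ _ _).trans
          ((tsupport_testMul_subset_right _ _ _).trans (hρ K x hx)))
        ((tsupport_testMul_subset_right _ _ _).trans (hρ K' y hy))
    have e2 : ∀ y ∈ t K', L y (testMul χ (ρ K' y) (ρ K' y).contDiff) = ∑ x ∈ t K,
        L y (testMul (testMul χ (ρ K x) (ρ K x).contDiff) (ρ K' y) (ρ K' y).contDiff) := by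
      intro y hy
      conv_lhs => rw [sum_testMul_partition (t := t K) (ρ := ρ K)
        (testMul χ (ρ K' y) (ρ K' y).contDiff)
        (fun z hz => h1 K z (hχ (tsupport_testMul_subset_left _ _ _ hz))), map_sum]
      refine Finset.sum_congr rfl fun x hx => congrArg _ (TestFunction.ext fun z => ?_)
      simp only [testMul_apply]
      ring
    simp only [S]
    rw [Finset.sum_congr rfl e1, Finset.sum_congr rfl e2, Finset.sum_comm]
  have hSadd : ∀ K χ χ', S K (χ + χ') = S K χ + S K χ' := fun K χ χ' => by
    simp only [S]
    rw [← Finset.sum_add_distrib]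
    refine Finset.sum_congr rfl fun x _ => ?_
    rw [← map_add]
    refine congrArg _ (TestFunction.ext fun z => ?_)
    exact add_mul (χ z) (χ' z) (ρ K x z)
  have hSsmul : ∀ K (c : ℂ) χ, S K (c • χ) = c * S K χ := fun K c χ => by
    simp only [S]
    rw [Finset.mul_sum]
    refine Finset.sum_congr rfl fun x _ => ?_
    rw [← smul_eq_mul, ← map_smul]
    refine congrArg _ (TestFunction.ext fun z => ?_)
    exact mul_assoc c (χ z) (ρ K x z)
  have hScont : ∀ K, Continuous (S K) := fun K => by
    refine continuous_finsetSum _ fun x _ => ?_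
    have h : (fun χ => L x (testMul χ (ρ K x) (ρ K x).contDiff)) = fun χ =>
        T x (SchwartzMap.smulLeftCLM ℂ (testToSchwartz (ρ K x)) (testToSchwartzCLM Ω χ)) := by
      funext χ
      change T x _ = T x _
      refine congrArg _ (SchwartzMap.ext fun z => ?_)
      rw [SchwartzMap.smulLeftCLM_apply_apply (testToSchwartz (ρ K x)).hasTemperateGrowth]
      exact mul_comm (χ z) (ρ K x z)
    rw [h]
    exact (T x).continuous.comp ((SchwartzMap.smulLeftCLM ℂ _).continuous.comp
      (testToSchwartzCLM Ω).continuous)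
  -- the value on `χ` is computed with the partition belonging to the support of `χ`
  let supp : 𝓓(Ω, ℂ) → {K : Compacts Mink // (K : Set Mink) ⊆ Ω} := fun χ =>
    ⟨⟨tsupport χ, χ.hasCompactSupport⟩, χ.tsupport_subset⟩
  have hsup : ∀ (K : {K : Compacts Mink // (K : Set Mink) ⊆ Ω}) (χ : 𝓓(Ω, ℂ)),
      tsupport χ ⊆ K.1 → S (supp χ) χ = S K χ := fun K χ h => hindep _ _ χ Subset.rfl h
  let w : Distr Ω := TestFunction.mkCLM ℂ (fun χ => S (supp χ) χ)
    (fun χ χ' => by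
      let K : {K : Compacts Mink // (K : Set Mink) ⊆ Ω} :=
        ⟨⟨tsupport χ ∪ tsupport χ', χ.hasCompactSupport.isCompact.union
          χ'.hasCompactSupport.isCompact⟩, union_subset χ.tsupport_subset χ'.tsupport_subset⟩
      change S (supp (χ + χ')) (χ + χ') = S (supp χ) χ + S (supp χ') χ'
      rw [hsup K χ subset_union_left, hsup K χ' subset_union_right, ← hSadd]
      exact hsup K _ (tsupport_add (f := fun x => χ x) (g := fun x => χ' x)))
    (fun c χ => by
      change S (supp (c • χ)) (c • χ) = c * S (supp χ) χ
      rw [← hSsmul]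
      exact hsup (supp χ) _ (tsupport_smul_subset_right (fun _ => c) (fun x => χ x)))
    (fun K hK => by
      have h : (fun χ => S (supp χ) χ) ∘ TestFunction.ofSupportedIn hK =
          S ⟨K, hK⟩ ∘ TestFunction.ofSupportedIn hK := by
        funext χ
        exact hsup ⟨K, hK⟩ _ χ.tsupport_subset
      rw [h]
      exact (hScont _).comp (TestFunction.continuous_ofSupportedIn hK))
  refine ⟨w, fun x hx χ hχ => ?_⟩
  change S (supp χ) χ = L x χ
  conv_rhs => rw [sum_testMul_partition χ (h1 (supp χ)), map_sum]
  refine Finset.sum_congr rfl fun y hy => hL y (ht _ y hy) x hx _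
    ((tsupport_testMul_subset_right _ _ _).trans (hρ _ y hy))
    ((tsupport_testMul_subset_left _ _ _).trans hχ)

/-! ### Spectral densities and Hörmander products -/

/-- On `U` the distribution `u` is `∫ A(k) e^{-i(kx)} dk` with a polynomially bounded function `A`;
that is, `A` is up to normalization the Fourier transform of a localization of `u`. -/
structure IsSpectralDensity {Ω : Opens Mink} (u : Distr Ω) (U : Set Mink) (A : Mink → ℂ) :
    Prop where
  measurable : Measurable A
  polyBounded : PolyBounded A
  apply_eq : ∀ χ : 𝓓(Ω, ℂ), tsupport χ ⊆ U → u χ = ∫ k, A k * minkFourier χ k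

theorem IsSpectralDensity.mono {Ω : Opens Mink} {u : Distr Ω} {U V : Set Mink} {A : Mink → ℂ}
    (h : IsSpectralDensity u U A) (hV : V ⊆ U) : IsSpectralDensity u V A :=
  ⟨h.measurable, h.polyBounded, fun χ hχ => h.apply_eq χ (hχ.trans hV)⟩

theorem IsSpectralDensity.localFourier_eq {Ω : Opens Mink} {u : Distr Ω} {U : Set Mink}
    {A : Mink → ℂ} (h : IsSpectralDensity u U A) {φ : 𝓓(Ω, ℂ)} (hφ : tsupport φ ⊆ U) (k : Mink) :
    localFourier u φ k = ∫ p, A p * minkFourier φ (p - k) := by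
  rw [localFourier, h.apply_eq _ ((tsupport_testMul_subset_left _ _ _).trans hφ)]
  refine integral_congr_ae (Eventually.of_forall fun p => ?_)
  simp only
  rw [← minkFourier_mul_planeWave]
  rfl

theorem PolyBounded.integrable_mul {A : Mink → ℂ} (hA : PolyBounded A) (hm : Measurable A)
    (f : 𝓢(Mink, ℂ)) : Integrable fun k => A k * f k := by
  obtain ⟨C, n, hC, hA⟩ := hA.exists_bound
  obtain ⟨D, hD, hf⟩ := f.exists_decay (n + 6)
  refine (integrable_inv_one_add_norm_pow.const_mul (C * D)).mono'
    (hm.aestronglyMeasurable.mul f.continuous.aestronglyMeasurable)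
    (Eventually.of_forall fun k => ?_)
  rw [norm_mul]
  refine (mul_le_mul (hA k) (hf k) (norm_nonneg _) (by positivity)).trans_eq ?_
  rw [pow_add]
  field_simp

/-- The tempered functional `f ↦ ∫ A f`. -/
def densityCLM (A : Mink → ℂ) (hA : PolyBounded A) (hm : Measurable A) : 𝓢(Mink, ℂ) →L[ℂ] ℂ :=
  SchwartzMap.mkCLMtoNormedSpace (σ := RingHom.id ℂ) (fun f => ∫ k, A k * f k)
    (fun f g => by
      simp only [_root_.add_apply, mul_add]
      exact integral_add (hA.integrable_mul hm f) (hA.integrable_mul hm g))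
    (fun a f => by
      simp only [_root_.smul_apply, smul_eq_mul, RingHom.id_apply]
      rw [← integral_const_mul]
      congr 1
      ext p
      ring)
    (by
      obtain ⟨C, n, hC, hA⟩ := hA.exists_bound
      refine ⟨Finset.Iic (n + 6, 0), C * 2 ^ (n + 6) * ∫ x : Mink, ((1 + ‖x‖) ^ 6)⁻¹,
        mul_nonneg (by positivity) (integral_nonneg fun x => by positivity), fun f => ?_⟩
      suffices hs : ‖∫ k, A k * f k‖ ≤
          ∫ k : Mink, C * 2 ^ (n + 6) * schwartzSup (n + 6, 0) f * ((1 + ‖k‖) ^ 6)⁻¹ by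
        refine hs.trans_eq ?_
        rw [integral_const_mul, schwartzSup]
        ring
      refine norm_integral_le_of_norm_le (integrable_inv_one_add_norm_pow.const_mul _)
        (Eventually.of_forall fun k => ?_)
      have h := SchwartzMap.one_add_le_sup_seminorm_apply (𝕜 := ℂ) (m := (n + 6, 0)) (k := n + 6)
        (n := 0) le_rfl le_rfl f k
      rw [norm_iteratedFDeriv_zero] at h
      rw [norm_mul, ← div_eq_mul_inv, le_div_iff₀ (by positivity)]
      calc _ ≤ C * (1 + ‖k‖) ^ n * ‖f k‖ * (1 + ‖k‖) ^ 6 := by gcongr; exact hA k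
        _ = C * ((1 + ‖k‖) ^ (n + 6) * ‖f k‖) := by ring
        _ ≤ C * (2 ^ (n + 6) * schwartzSup (n + 6, 0) f) := mul_le_mul_of_nonneg_left h hC
        _ = _ := by ring)

theorem densityCLM_apply (A : Mink → ℂ) (hA : PolyBounded A) (hm : Measurable A)
    (f : 𝓢(Mink, ℂ)) : densityCLM A hA hm f = ∫ k, A k * f k := rfl

theorem integrable_triple_bound (C : ℝ) : Integrable fun z : Mink × Mink × Mink =>
    C * (((1 + ‖z.2.1 - z.1‖) ^ 6)⁻¹ * (((1 + ‖z.2.1‖) ^ 6)⁻¹ * ((1 + ‖z.2.2‖) ^ 6)⁻¹)) := by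
  have hi := integrable_inv_one_add_norm_pow
  refine Integrable.const_mul ?_ C
  have hc : Continuous fun z : Mink × Mink × Mink =>
      ((1 + ‖z.2.1 - z.1‖) ^ 6)⁻¹ * (((1 + ‖z.2.1‖) ^ 6)⁻¹ * ((1 + ‖z.2.2‖) ^ 6)⁻¹) := by
    refine Continuous.mul ?_ (Continuous.mul ?_ ?_) <;>
    exact Continuous.inv₀ (by fun_prop) (fun z => by positivity)
  refine (integrable_prod_iff' hc.aestronglyMeasurable).2
    ⟨Eventually.of_forall fun y => by
      exact (hi.comp_sub_left y.1).mul_const (((1 + ‖y.1‖) ^ 6)⁻¹ * ((1 + ‖y.2‖) ^ 6)⁻¹), ?_⟩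
  refine ((hi.mul_prod hi).const_mul (∫ x : Mink, ((1 + ‖x‖) ^ 6)⁻¹)).congr
    (Eventually.of_forall fun y => ?_)
  simp only
  have h1 : ∀ x : Mink, ‖((1 + ‖y.1 - x‖) ^ 6)⁻¹ *
      (((1 + ‖y.1‖) ^ 6)⁻¹ * ((1 + ‖y.2‖) ^ 6)⁻¹)‖ = ((1 + ‖y.1 - x‖) ^ 6)⁻¹ *
      (((1 + ‖y.1‖) ^ 6)⁻¹ * ((1 + ‖y.2‖) ^ 6)⁻¹) := fun x =>
    Real.norm_of_nonneg (by positivity)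
  simp only [h1]
  rw [integral_mul_const, integral_sub_left_eq_self (fun x : Mink => ((1 + ‖x‖) ^ 6)⁻¹)]

/-- The pairing of two convolutions is the pairing of the convolution of the amplitudes with the
convolution of the test functions. -/
theorem integral_convolution_mul_convolution {A B : Mink → ℂ} (hA : Measurable A)
    (hB : Measurable B) {C : ℝ} {m : ℕ} (hC : 0 ≤ C)
    (hAB : ∀ L k, ‖A k‖ * ‖B (L - k)‖ ≤ C * (1 + ‖L‖) ^ m * ((1 + ‖k‖) ^ 6)⁻¹)
    (f g : 𝓢(Mink, ℂ)) :
    Integrable (fun k => (∫ p, A p * f (p - k)) * ∫ q, B q * g (q + k)) ∧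
    ∫ k, (∫ p, A p * f (p - k)) * (∫ q, B q * g (q + k)) =
      ∫ L, (∫ p, A p * B (L - p)) * ∫ k, f k * g (L - k) := by
  obtain ⟨Cf, hCf, hf⟩ := f.exists_decay (m + 12)
  obtain ⟨Cg, hCg, hg⟩ := g.exists_decay (m + 6)
  -- the common integrand in the variables `k`, `p` and `L = p + q`
  set G : Mink × Mink × Mink → ℂ := fun z =>
    A z.2.1 * B (z.2.2 - z.2.1) * (f (z.2.1 - z.1) * g (z.2.2 - (z.2.1 - z.1))) with hG
  have hfm := f.continuous.measurable
  have hgm := g.continuous.measurable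
  have hGm : Measurable G := by
    refine Measurable.mul (Measurable.mul ?_ ?_) (Measurable.mul ?_ ?_)
    · exact hA.comp (by fun_prop)
    · exact hB.comp (by fun_prop)
    · exact hfm.comp (by fun_prop)
    · exact hgm.comp (by fun_prop)
  have hGi : Integrable G := by
    refine (integrable_triple_bound (C * Cf * Cg)).mono' hGm.aestronglyMeasurable
      (Eventually.of_forall fun z => ?_)
    obtain ⟨k, p, L⟩ := z
    simp only [hG]
    have h1 := hAB L p
    have h2 := hf (p - k)
    have h3 := hg (L - (p - k))
    have h4 : (1 + ‖L‖) ≤ (1 + ‖p - k‖) * (1 + ‖L - (p - k)‖) := by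
      have h5 : ‖L‖ ≤ ‖p - k‖ + ‖L - (p - k)‖ := by
        have := norm_add_le (p - k) (L - (p - k))
        rwa [add_sub_cancel] at this
      nlinarith [mul_nonneg (norm_nonneg (p - k)) (norm_nonneg (L - (p - k)))]
    rw [norm_mul, norm_mul, norm_mul]
    set a := 1 + ‖p - k‖ with ha
    set b := 1 + ‖L - (p - k)‖ with hb
    set l := 1 + ‖L‖ with hl
    have ha0 : 0 < a := by positivity
    have hb0 : 0 < b := by positivity
    have hl0 : 0 < l := by positivity
    have h6 : l ^ (m + 6) * (a ^ (m + 6))⁻¹ * (b ^ (m + 6))⁻¹ ≤ 1 := by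
      rw [mul_assoc, ← mul_inv, ← div_eq_mul_inv, div_le_one (by positivity), ← mul_pow]
      exact pow_le_pow_left₀ hl0.le h4 _
    calc _ ≤ C * l ^ m * ((1 + ‖p‖) ^ 6)⁻¹ * (Cf * (a ^ (m + 12))⁻¹ * (Cg * (b ^ (m + 6))⁻¹)) := by
          gcongr
      _ = C * Cf * Cg * ((a ^ 6)⁻¹ * (((1 + ‖p‖) ^ 6)⁻¹ * (l ^ 6)⁻¹)) *
          (l ^ (m + 6) * (a ^ (m + 6))⁻¹ * (b ^ (m + 6))⁻¹) := by
        rw [show m + 12 = m + 6 + 6 by ring, pow_add a (m + 6) 6, pow_add l m 6]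
        field_simp
      _ ≤ C * Cf * Cg * ((a ^ 6)⁻¹ * (((1 + ‖p‖) ^ 6)⁻¹ * (l ^ 6)⁻¹)) * 1 := by gcongr
      _ = _ := mul_one _
  -- integrating out `(p, L)` for fixed `k` gives the product of the two convolutions
  have hsec : ∀ᵐ k : Mink, ∫ z, G (k, z) =
      (∫ p, A p * f (p - k)) * ∫ q, B q * g (q + k) := by
    filter_upwards [hGi.prod_right_ae] with k hk
    refine (integral_prod (μ := volume) (ν := volume) (fun z => G (k, z)) hk).trans ?_
    rw [← integral_mul_const]
    refine integral_congr_ae (Eventually.of_forall fun p => ?_)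
    simp only [hG]
    rw [← integral_const_mul, ← integral_add_right_eq_self _ p]
    refine integral_congr_ae (Eventually.of_forall fun q => ?_)
    simp only [add_sub_cancel_right]
    rw [show q + p - (p - k) = q + k by abel]
    ring
  have hGi2 : Integrable fun z : Mink × Mink => ∫ k, G (k, z) := hGi.integral_prod_right
  refine ⟨(hGi.integral_prod_left).congr hsec, ?_⟩
  rw [← integral_congr_ae hsec]
  refine (integral_integral_swap (f := fun k z => G (k, z)) hGi).trans ?_
  -- integrating out `k` and then `p` for fixed `L` gives the pairing of the convolutions
  refine (integral_prod_symm (μ := volume) (ν := volume) _ hGi2).trans ?_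
  refine integral_congr_ae (Eventually.of_forall fun L => ?_)
  simp only [hG]
  rw [← integral_mul_const]
  refine integral_congr_ae (Eventually.of_forall fun p => ?_)
  simp only
  rw [integral_const_mul, integral_sub_left_eq_self (fun k => f k * g (L - k)) _ p]

/-- The convolution of two spectral densities. -/
def densityConv (A B : Mink → ℂ) (L : Mink) : ℂ := ∫ p, A p * B (L - p)

theorem measurable_densityConv {A B : Mink → ℂ} (hA : Measurable A) (hB : Measurable B) :
    Measurable (densityConv A B) := by
  have h : Measurable fun z : Mink × Mink => A z.2 * B (z.1 - z.2) :=
    (hA.comp measurable_snd).mul (hB.comp (measurable_fst.sub measurable_snd))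
  exact (StronglyMeasurable.integral_prod_right' (ν := (volume : Measure Mink))
    h.stronglyMeasurable).measurable

theorem norm_densityConv_le {A B : Mink → ℂ} {L : Mink} {C : ℝ}
    (h : ∀ k, ‖A k‖ * ‖B (L - k)‖ ≤ C * ((1 + ‖k‖) ^ 6)⁻¹) :
    ‖densityConv A B L‖ ≤ C * ∫ k : Mink, ((1 + ‖k‖) ^ 6)⁻¹ := by
  rw [densityConv, ← integral_const_mul]
  refine norm_integral_le_of_norm_le (integrable_inv_one_add_norm_pow.const_mul _)
    (Eventually.of_forall fun k => ?_)
  rw [norm_mul]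
  exact h k

theorem rapidOn_densityConv {A B : Mink → ℂ} {F G H : Set Mink} (hA : PolyBounded A)
    (hB : PolyBounded B) (hAG : RapidOn A G) (hBH : RapidOn B H) {δ : ℝ} (hδ : 0 < δ)
    (hδ1 : δ ≤ 1)
    (hF : ∀ L ∈ F, ∀ k, (k ∈ G ∧ δ * ‖L‖ ≤ ‖k‖) ∨ (L - k ∈ H ∧ δ * ‖L‖ ≤ ‖L - k‖)) :
    RapidOn (densityConv A B) F := fun N => by
  obtain ⟨C, hC, h⟩ := exists_convolution_rapid hA hB hAG hBH hδ hδ1 hF N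
  refine ⟨C * ∫ k : Mink, ((1 + ‖k‖) ^ 6)⁻¹, fun L hL => ?_⟩
  have h1 := norm_densityConv_le (h L hL)
  calc _ ≤ (1 + ‖L‖) ^ N * (C * ((1 + ‖L‖) ^ N)⁻¹ * ∫ k : Mink, ((1 + ‖k‖) ^ 6)⁻¹) := by gcongr
    _ = _ := by field_simp

theorem polyBounded_densityConv {A B : Mink → ℂ} {C : ℝ} {m : ℕ}
    (h : ∀ L k, ‖A k‖ * ‖B (L - k)‖ ≤ C * (1 + ‖L‖) ^ m * ((1 + ‖k‖) ^ 6)⁻¹) :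
    PolyBounded (densityConv A B) :=
  ⟨C * ∫ k : Mink, ((1 + ‖k‖) ^ 6)⁻¹, m, fun L => by
    refine (norm_densityConv_le (h L)).trans_eq ?_
    ring⟩

theorem minkFourier_testFunction {Ω : Opens Mink} (φ : 𝓓(Ω, ℂ)) :
    minkFourier φ = minkFourierCLM (testToSchwartz φ) :=
  (coe_minkFourierCLM (testToSchwartz φ)).symm

/-- The localized Fourier transform of a distribution with spectral density `A` decays rapidly in
every cone slightly smaller than those where `A` does. -/
theorem IsSpectralDensity.rapidOn_localFourier {Ω : Opens Mink} {u : Distr Ω} {U : Set Mink}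
    {A : Mink → ℂ} (h : IsSpectralDensity u U A) {e : Mink} (he : ‖e‖ = 1) {c c' : ℝ}
    (hc : c' < c) (hc0 : 0 < c) (hc1 : c < 1) (hA : RapidOn A (coneCompl e c)) {φ : 𝓓(Ω, ℂ)}
    (hφ : tsupport φ ⊆ U) : RapidOn (localFourier u φ) (coneCompl e c') := by
  obtain ⟨δ, hδ, hδ1, hF⟩ := exists_mem_coneCompl he hc hc0 hc1
  have hB : RapidOn (fun k => minkFourier φ (-k)) univ := by
    rw [minkFourier_testFunction]
    exact (SchwartzMap.rapidOn _).neg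
  have h1 : localFourier u φ = densityConv A fun k => minkFourier φ (-k) := by
    funext k
    rw [h.localFourier_eq hφ, densityConv]
    simp only [neg_sub]
  rw [h1]
  exact rapidOn_densityConv h.polyBounded hB.polyBounded hA hB hδ hδ1 fun L hL k =>
    (hF L hL k).imp id fun h => ⟨mem_univ _, h.2⟩

theorem IsSpectralDensity.notMem_frequencySet {Ω : Opens Mink} {u : Distr Ω} {U : Set Mink}
    (hU : IsOpen U) {A : Mink → ℂ} (h : IsSpectralDensity u U A) {e : Mink} (he : ‖e‖ = 1)
    {c c' : ℝ} (hc : c' < c) (hc0 : 0 < c) (hc1 : c < 1) (hA : RapidOn A (coneCompl e c))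
    {x p : Mink} (hx : x ∈ U) (hxΩ : x ∈ Ω) (hp : p ∈ coneCompl e c') : p ∉ frequencySet u x := by
  obtain ⟨φ, hφ, hφ1⟩ := exists_cutoff (Ω := Ω) (K := {x}) isCompact_singleton hU
    (singleton_subset_iff.2 hx) (singleton_subset_iff.2 hxΩ)
  intro hfr
  refine hfr.2 φ (by rw [hφ1 x rfl]; exact one_ne_zero) ⟨coneCompl e c', isOpen_coneCompl e c', hp,
    fun k hk t ht => smul_mem_coneCompl ht hk, h.rapidOn_localFourier he hc hc0 hc1 hA hφ⟩

/-- If the convolution of the densities of `u` and `v` is absolutely convergent with polynomial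
bounds, then so is the pairing in the definition of the Hörmander product, and it is given by the
convolution of the densities. -/
theorem IsSpectralDensity.integral_localFourier_mul {Ω : Opens Mink} {u v : Distr Ω}
    {U : Set Mink} {A B : Mink → ℂ} (hu : IsSpectralDensity u U A) (hv : IsSpectralDensity v U B)
    {C : ℝ} {m : ℕ} (hC : 0 ≤ C)
    (hAB : ∀ L k, ‖A k‖ * ‖B (L - k)‖ ≤ C * (1 + ‖L‖) ^ m * ((1 + ‖k‖) ^ 6)⁻¹)
    {φ ψ : 𝓓(Ω, ℂ)} (hφ : tsupport φ ⊆ U) (hψ : tsupport ψ ⊆ U) :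
    Integrable (fun k => localFourier u φ k * localFourier v ψ (-k)) ∧
      ((2 * Real.pi : ℝ) : ℂ)⁻¹ ^ 4 * ∫ k, localFourier u φ k * localFourier v ψ (-k) =
        ∫ L, densityConv A B L * minkFourier (testMul φ ψ ψ.contDiff) L := by
  have h := integral_convolution_mul_convolution hu.measurable hv.measurable hC hAB
    (minkFourierCLM (testToSchwartz φ)) (minkFourierCLM (testToSchwartz ψ))
  rw [← minkFourier_testFunction, ← minkFourier_testFunction] at h
  have h1 : (fun k => localFourier u φ k * localFourier v ψ (-k)) = fun k =>
      (∫ p, A p * minkFourier φ (p - k)) * ∫ q, B q * minkFourier ψ (q + k) := by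
    funext k
    rw [hu.localFourier_eq hφ, hv.localFourier_eq hψ]
    simp only [sub_neg_eq_add]
  rw [h1]
  refine ⟨h.1, ?_⟩
  rw [h.2, ← integral_const_mul]
  refine integral_congr_ae (Eventually.of_forall fun L => ?_)
  have h2 := minkFourier_mul (testToSchwartz ψ) (testToSchwartz φ) L
  have h3 : minkFourier (testMul φ ψ ψ.contDiff) L =
      minkFourier (fun x => testToSchwartz ψ x * testToSchwartz φ x) L := by
    congr 1
    funext x
    exact mul_comm (φ x) (ψ x)
  simp only
  rw [h3, h2, densityConv]
  change _ = _ * (_ * ∫ k, minkFourier φ k * minkFourier ψ (L - k))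
  ring

/-- Near every point `x`, the distribution `u` has spectral densities that decay rapidly outside
narrow cones around `e`, where `e = x/|x|` if `x` is lightlike and `e` is arbitrary otherwise.
Hence `WF u` lies over the light cone, in the directions of the positive multiples of `x`. -/
def ConeDirected (u : Distr punctured) : Prop :=
  ∀ x : Mink, x ≠ 0 → ∀ e : Mink, ‖e‖ = 1 → (mdot x x = 0 → e = ‖x‖⁻¹ • x) →
    ∀ c : ℝ, 0 < c → c < 1 → ∃ (U : Set Mink) (A : Mink → ℂ), IsOpen U ∧ x ∈ U ∧
      IsSpectralDensity u U A ∧ RapidOn A (coneCompl e c)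

theorem norm_inv_norm_smul {x : Mink} (hx : x ≠ 0) : ‖‖x‖⁻¹ • x‖ = 1 := by
  rw [norm_smul, norm_inv, norm_norm, inv_mul_cancel₀ (norm_ne_zero_iff.2 hx)]

/-- Over a given point all singular directions of cone directed distributions lie in one open half
space. -/
theorem ConeDirected.hormanderCriterion {u v : Distr punctured} (hu : ConeDirected u)
    (hv : ConeDirected v) :
    HormanderCriterion u v := by
  rintro x p ⟨hx, hp⟩ ⟨-, hp'⟩
  have hx0 : x ≠ 0 := hx
  have he := norm_inv_norm_smul hx0
  have key : ∀ w : Distr punctured, ConeDirected w → ∀ q ∈ frequencySet w x,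
      0 < inner ℝ q (‖x‖⁻¹ • x) := by
    intro w hw q hq
    obtain ⟨U, A, hU, hxU, hA, hr⟩ := hw x hx0 _ he (fun _ => rfl) (1 / 2) (by norm_num)
      (by norm_num)
    by_contra! h
    refine hA.notMem_frequencySet hU he (c' := 1 / 4) (by norm_num) (by norm_num) (by norm_num) hr
      hxU hx ?_ hq
    have : 0 < ‖q‖ := norm_pos_iff.2 hq.1
    change inner ℝ q (‖x‖⁻¹ • x) < 1 / 4 * ‖q‖
    linarith
  have h1 := key u hu p hp
  have h2 := key v hv (-p) hp'
  rw [inner_neg_left] at h2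
  linarith

/-- Densities of two cone directed distributions, decaying outside the same proper convex cone,
have an absolutely convergent convolution. -/
theorem ConeDirected.exists_pair {u v : Distr punctured} (hu : ConeDirected u) (hv : ConeDirected v)
    {x : Mink} (hx : x ≠ 0) {e : Mink} (he : ‖e‖ = 1) (hxe : mdot x x = 0 → e = ‖x‖⁻¹ • x)
    {c : ℝ} (hc0 : 0 < c) (hc1 : c < 1) :
    ∃ (U : Set Mink) (A B : Mink → ℂ) (C : ℝ) (m : ℕ), IsOpen U ∧ x ∈ U ∧
      IsSpectralDensity u U A ∧ IsSpectralDensity v U B ∧ RapidOn A (coneCompl e c) ∧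
      RapidOn B (coneCompl e c) ∧ 0 ≤ C ∧
      ∀ L k, ‖A k‖ * ‖B (L - k)‖ ≤ C * (1 + ‖L‖) ^ m * ((1 + ‖k‖) ^ 6)⁻¹ := by
  obtain ⟨U, A, hU, hxU, hA, hAr⟩ := hu x hx e he hxe c hc0 hc1
  obtain ⟨V, B, hV, hxV, hB, hBr⟩ := hv x hx e he hxe c hc0 hc1
  obtain ⟨C, m, hC, hb⟩ := exists_convolution_bound hA.polyBounded hB.polyBounded hAr hBr
    (inv_nonneg.2 hc0.le) (fun L k => norm_le_or_mem_coneCompl hc0 L k he)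
  exact ⟨U ∩ V, A, B, C, m, hU.inter hV, ⟨hxU, hxV⟩, hA.mono inter_subset_left,
    hB.mono inter_subset_right, hAr, hBr, hC, hb⟩

/-- The Hörmander product is determined near every point, since test functions of small support
are of the form `φ ψ`. -/
theorem IsHormanderProduct.unique {Ω : Opens Mink} {u v w w' : Distr Ω}
    (h : IsHormanderProduct u v w) (h' : IsHormanderProduct u v w') : w = w' := by
  refine distr_ext_of_local fun x hx => ?_
  obtain ⟨U, hU, hxU, h1⟩ := h.2 x hx
  obtain ⟨V, hV, hxV, h2⟩ := h'.2 x hx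
  refine ⟨U ∩ V, hU.inter hV, ⟨hxU, hxV⟩, fun χ hχ => ?_⟩
  obtain ⟨ψ, hψ, hψ1⟩ := exists_cutoff (Ω := Ω) χ.hasCompactSupport (hU.inter hV) hχ
    χ.tsupport_subset
  rw [← testMul_eq_self hψ1,
    (h1 χ ψ (hχ.trans inter_subset_left) (hψ.trans inter_subset_left)).2,
    (h2 χ ψ (hχ.trans inter_subset_right) (hψ.trans inter_subset_right)).2]

/-- Locally the product has the convolution of the spectral densities as spectral density; the
local products agree on overlaps by the formula for the pairing. -/
theorem ConeDirected.exists_product {u v : Distr punctured} (hu : ConeDirected u)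
    (hv : ConeDirected v) :
    ∃ w, IsHormanderProduct u v w := by
  have hloc : ∀ x : Mink, ∃ (U : Set Mink) (W : Mink → ℂ), PolyBounded W ∧ Measurable W ∧
      (x ≠ 0 → IsOpen U ∧ x ∈ U ∧ ∀ φ ψ : 𝓓(punctured, ℂ), tsupport φ ⊆ U → tsupport ψ ⊆ U →
        Integrable (fun k => localFourier u φ k * localFourier v ψ (-k)) ∧
        ((2 * Real.pi : ℝ) : ℂ)⁻¹ ^ 4 * ∫ k, localFourier u φ k * localFourier v ψ (-k) =
          ∫ L, W L * minkFourier (testMul φ ψ ψ.contDiff) L) := fun x => by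
    by_cases hx : x = 0
    · exact ⟨∅, 0, ⟨0, 0, fun k => by simp⟩, measurable_zero, fun h => absurd hx h⟩
    · obtain ⟨U, A, B, C, m, hU, hxU, hA, hB, -, -, hC, hb⟩ := hu.exists_pair hv hx
        (norm_inv_norm_smul hx) (fun _ => rfl) (c := 1 / 2) (by norm_num) (by norm_num)
      exact ⟨U, densityConv A B, polyBounded_densityConv hb,
        measurable_densityConv hA.measurable hB.measurable, fun _ => ⟨hU, hxU,
          fun φ ψ hφ hψ => hA.integral_localFourier_mul hB hC hb hφ hψ⟩⟩
  choose U W hWp hWm hUW using hloc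
  have happ : ∀ x, ∀ χ : 𝓓(punctured, ℂ), (densityCLM (W x) (hWp x) (hWm x)).comp minkFourierCLM
      (testToSchwartzCLM punctured χ) = ∫ L, W x L * minkFourier χ L := fun x χ => by
    rw [ContinuousLinearMap.comp_apply, densityCLM_apply, minkFourier_testFunction]
    rfl
  obtain ⟨w, hw⟩ := exists_distr_of_local (Ω := punctured) (U := U)
    (fun x hx => ⟨(hUW x hx).1, (hUW x hx).2.1⟩)
    (fun x => (densityCLM (W x) (hWp x) (hWm x)).comp minkFourierCLM)
    (fun x hx y hy χ hχ hχ' => by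
      have hx' := hUW x hx
      have hy' := hUW y hy
      obtain ⟨ψ, hψ, hψ1⟩ := exists_cutoff (Ω := punctured) χ.hasCompactSupport
        (hx'.1.inter hy'.1) (subset_inter hχ hχ') χ.tsupport_subset
      rw [happ, happ, ← testMul_eq_self hψ1,
        ← (hx'.2.2 χ ψ hχ (hψ.trans inter_subset_left)).2,
        ← (hy'.2.2 χ ψ hχ' (hψ.trans inter_subset_right)).2])
  refine ⟨w, hu.hormanderCriterion hv, fun x hx => ⟨U x, (hUW x hx).1, (hUW x hx).2.1,
    fun φ ψ hφ hψ => ?_⟩⟩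
  have h := (hUW x hx).2.2 φ ψ hφ hψ
  exact ⟨h.1, by rw [h.2, hw x hx _ ((tsupport_testMul_subset_left _ _ _).trans hφ), happ]⟩

/-- A closed convex cone is closed under addition, so that the convolution of the densities again
decays rapidly outside any larger cone. -/
theorem ConeDirected.of_product {u v w : Distr punctured} (hu : ConeDirected u)
    (hv : ConeDirected v) (hw : IsHormanderProduct u v w) : ConeDirected w := by
  intro x hx e he hxe c hc0 hc1
  obtain ⟨U, A, B, C, m, hU, hxU, hA, hB, hAr, hBr, hC, hb⟩ := hu.exists_pair hv hx he hxe
    (c := (1 + c) / 2) (by linarith) (by linarith)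
  obtain ⟨V, hV, hxV, h⟩ := hw.2 x hx
  -- the densities decay outside a cone that is slightly narrower than the required one
  obtain ⟨δ, hδ, hδ1, hF⟩ := exists_mem_coneCompl he (c := (1 + c) / 2) (c' := c) (by linarith)
    (by linarith) (by linarith)
  refine ⟨U ∩ V, densityConv A B, hU.inter hV, ⟨hxU, hxV⟩,
    ⟨measurable_densityConv hA.measurable hB.measurable, polyBounded_densityConv hb,
      fun χ hχ => ?_⟩,
    rapidOn_densityConv hA.polyBounded hB.polyBounded hAr hBr hδ hδ1 hF⟩
  obtain ⟨ψ, hψ, hψ1⟩ := exists_cutoff (Ω := punctured) χ.hasCompactSupport (hU.inter hV) hχ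
    χ.tsupport_subset
  rw [← testMul_eq_self hψ1,
    (h χ ψ (hχ.trans inter_subset_right) (hψ.trans inter_subset_right)).2,
    (hA.integral_localFourier_mul hB hC hb (hχ.trans inter_subset_left)
      (hψ.trans inter_subset_left)).2]

/-- Cone directed distributions form a class closed under Hörmander products, so that all iterated
products exist. -/
theorem existsUnique_hormanderProductList {l : List (Distr punctured)} (hl : l ≠ [])
    (h : ∀ u ∈ l, ConeDirected u) :
    ∃! w, IsHormanderProductList l w := by
  suffices hs : ∃ w, ConeDirected w ∧ IsHormanderProductList l w ∧
      ∀ w', IsHormanderProductList l w' → w' = w by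
    obtain ⟨w, -, h1, h2⟩ := hs
    exact ⟨w, h1, h2⟩
  induction l with
  | nil => exact absurd rfl hl
  | cons u us ih =>
    have hu := h u List.mem_cons_self
    rcases us.eq_nil_or_concat with rfl | ⟨_, _, hne⟩
    · refine ⟨u, hu, .single u, fun w' hw' => ?_⟩
      cases hw' with
      | single => rfl
      | cons _ _ v _ hv _ => cases hv
    · have hus : us ≠ [] := by rw [hne]; simp
      obtain ⟨v, hv, hv1, hv2⟩ := ih hus fun u' hu' => h u' (List.mem_cons_of_mem _ hu')
      obtain ⟨w, hw⟩ := hu.exists_product hv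
      refine ⟨w, hu.of_product hv hw, .cons u us v w hv1 hw, fun w' hw' => ?_⟩
      cases hw' with
      | single => exact absurd rfl hus
      | cons _ _ v' _ hv' hw' =>
        rw [hv2 v' hv'] at hw'
        exact hw'.unique hw

/-! ### Wavefront sets of propagators -/

theorem localFourier_propagator {Ω : Opens Mink} (μ : ℝ) {K : Mink → ℂ} (hK : GrowthKernel K)
    (φ : 𝓓(Ω, ℂ)) (k : Mink) :
    localFourier (restrictTo Ω (propagator μ K hK)) φ k =
      ((2 * Real.pi : ℝ) : ℂ)⁻¹ ^ 4 * shiftedProp 1 μ K (minkFourier φ) k := by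
  change propagator μ K hK (testToSchwartz (testMul φ (planeWave k) (contDiff_planeWave k))) = _
  rw [propagator_apply, shiftedProp]
  congr 2
  funext p
  rw [← minkFourier_mul_planeWave]
  rfl

/-- The localization of a propagator has its shifted functional as spectral density. -/
theorem propagator_mul {Ω : Opens Mink} (μ : ℝ) {K : Mink → ℂ} (hK : GrowthKernel K)
    (φ χ : 𝓓(Ω, ℂ)) :
    restrictTo Ω (propagator μ K hK) (testMul φ χ χ.contDiff) =
      ∫ k, (((2 * Real.pi : ℝ) : ℂ)⁻¹ ^ 4) ^ 2 * shiftedProp 1 μ K (minkFourier φ) k *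
        minkFourier χ k := by
  have h1 := propFunctional_convolution (σ := 1) (by norm_num) μ hK
    (minkFourierCLM (testToSchwartz φ)) (minkFourierCLM (testToSchwartz χ))
  rw [← minkFourier_testFunction, ← minkFourier_testFunction] at h1
  change propagator μ K hK (testToSchwartz (testMul φ χ χ.contDiff)) = _
  rw [propagator_apply]
  have h2 : (fun p => K p * minkFourier (testToSchwartz (testMul φ χ χ.contDiff)) p) = fun p =>
      ((2 * Real.pi : ℝ) : ℂ)⁻¹ ^ 4 *
        (K p * ∫ k, minkFourier χ k * minkFourier φ (p - k)) := by
    funext p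
    have h3 := minkFourier_mul (testToSchwartz φ) (testToSchwartz χ) p
    have h4 : minkFourier (testToSchwartz (testMul φ χ χ.contDiff)) p = _ := h3
    rw [h4]
    change K p * (_ * ∫ k, minkFourier χ k * minkFourier φ (p - k)) = _
    ring
  rw [h2, propFunctional_const_mul, h1, ← integral_const_mul, ← integral_const_mul]
  refine integral_congr_ae (Eventually.of_forall fun k => ?_)
  simp only
  ring

/-- Near a point other than the origin a microlocally regular propagator has a spectral density
that decays rapidly outside any cone around the direction allowed by the wavefront set: finitely
many of the cones of the definition cover the complement of that cone. -/
theorem MicrolocallyRegular.exists_spectralDensity {Ω : Opens Mink} {μ : ℝ} {K : Mink → ℂ}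
    (h : MicrolocallyRegular μ K) (hK : GrowthKernel K) {x : Mink} (hxΩ : x ∈ Ω) (hx : x ≠ 0)
    {e : Mink} (he : ‖e‖ = 1) (hxe : mdot x x = 0 → e = ‖x‖⁻¹ • x) {c : ℝ} (hc1 : c < 1) :
    ∃ (U : Set Mink) (A : Mink → ℂ), IsOpen U ∧ x ∈ U ∧
      IsSpectralDensity (restrictTo Ω (propagator μ K hK)) U A ∧ RapidOn A (coneCompl e c) := by
  -- the compact set of directions in which rapid decay is required
  set Q : Set Mink := Metric.sphere 0 1 ∩ {p | inner ℝ p e ≤ c} with hQ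
  have hQc : IsCompact Q := (isCompact_sphere 0 1).inter_right
    (isClosed_le (continuous_id.inner continuous_const) continuous_const)
  have hex : ∀ p : Mink, ∃ U V : Set Mink, p ∈ Q → IsOpen U ∧ x ∈ U ∧ IsOpen V ∧ p ∈ V ∧
      (∀ k ∈ V, ∀ t : ℝ, 0 < t → t • k ∈ V) ∧
      ∀ φ : 𝓢(Mink, ℂ), tsupport φ ⊆ U → ∀ N : ℕ, ∃ C : ℝ, ∀ k ∈ V,
        (1 + ‖k‖) ^ N * ‖shiftedProp 1 μ K (minkFourier φ) k‖ ≤ C := fun p => by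
    by_cases hp : p ∈ Q
    · have hp1 : ‖p‖ = 1 := mem_sphere_zero_iff_norm.1 hp.1
      obtain ⟨U, V, hUV⟩ := h x p hx (fun h0 => by rw [h0, norm_zero] at hp1; norm_num at hp1) (by
        rintro ⟨hxx, t, ht, hpt⟩
        have h1 : t * ‖x‖ = 1 := by
          rw [← hp1, hpt, norm_smul, Real.norm_eq_abs, abs_of_pos ht]
        have h2 : p = e := by
          rw [hpt, hxe hxx, eq_inv_of_mul_eq_one_left h1]
        have h3 : inner ℝ p e ≤ c := hp.2
        rw [h2, real_inner_self_eq_norm_sq, he] at h3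
        linarith)
      exact ⟨U, V, fun _ => hUV⟩
    · exact ⟨∅, ∅, fun h => absurd h hp⟩
  choose U V hUV using hex
  obtain ⟨t, htQ, hcov⟩ := hQc.elim_nhds_subcover V fun p hp =>
    (hUV p hp).2.2.1.mem_nhds (hUV p hp).2.2.2.1
  have hUo : IsOpen (⋂ p ∈ t, U p) :=
    isOpen_biInter_finset fun p hp => (hUV p (htQ p hp)).1
  have hxU : x ∈ ⋂ p ∈ t, U p := mem_iInter₂.2 fun p hp => (hUV p (htQ p hp)).2.1
  obtain ⟨ε, hε, hball⟩ := Metric.nhds_basis_closedBall.mem_iff.1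
    ((hUo.inter Ω.isOpen).mem_nhds ⟨hxU, hxΩ⟩)
  obtain ⟨φ, hφ, hφ1⟩ := exists_cutoff (Ω := Ω) (isCompact_closedBall x ε) hUo
    (hball.trans inter_subset_left) (hball.trans inter_subset_right)
  -- the density is the Fourier transform of `φ u` for a cutoff `φ` supported in all of the finitely
  -- many neighbourhoods and equal to one near `x`
  refine ⟨Metric.ball x ε, fun k => (((2 * Real.pi : ℝ) : ℂ)⁻¹ ^ 4) ^ 2 *
    shiftedProp 1 μ K (minkFourier φ) k, Metric.isOpen_ball, Metric.mem_ball_self hε,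
    ⟨?_, ?_, fun χ hχ => ?_⟩, fun N => ?_⟩
  · obtain ⟨A, d, hA⟩ := hK
    rw [minkFourier_testFunction]
    exact (stronglyMeasurable_shiftedProp 1 μ hA.measurable _).measurable.const_mul _
  · obtain ⟨A, d, hA⟩ := hK
    rw [minkFourier_testFunction]
    refine ⟨‖(((2 * Real.pi : ℝ) : ℂ)⁻¹ ^ 4) ^ 2‖ * (8 * A * 2 ^ (d + 8) *
      schwartzSup (d + 8, 2) (minkFourierCLM (testToSchwartz φ)) * propConst), d + 8, fun k => ?_⟩
    rw [norm_mul, mul_assoc]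
    exact mul_le_mul_of_nonneg_left
      (hA.norm_shiftedProp_le (σ := 1) (by norm_num) μ _ k) (norm_nonneg _)
  · rw [← propagator_mul μ hK φ χ]
    refine congrArg _ (TestFunction.ext fun y => ?_)
    rw [testMul_apply]
    by_cases hy : y ∈ tsupport χ
    · rw [hφ1 y (Metric.ball_subset_closedBall (hχ hy)), one_mul]
    · rw [image_eq_zero_of_notMem_tsupport hy, mul_zero]
  · have hex : ∀ p : Mink, ∃ C : ℝ, p ∈ t → ∀ k ∈ V p,
        (1 + ‖k‖) ^ N * ‖shiftedProp 1 μ K (minkFourier φ) k‖ ≤ C := fun p => by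
      by_cases hp : p ∈ t
      · obtain ⟨C, hC⟩ := (hUV p (htQ p hp)).2.2.2.2.2 (testToSchwartz φ)
          (hφ.trans (biInter_subset_of_mem hp)) N
        exact ⟨C, fun _ => hC⟩
      · exact ⟨0, fun h => absurd h hp⟩
    choose C hC using hex
    refine ⟨‖(((2 * Real.pi : ℝ) : ℂ)⁻¹ ^ 4) ^ 2‖ * ∑ p ∈ t, |C p|, fun k hk => ?_⟩
    have hk0 := ne_zero_of_mem_coneCompl hk
    have hkn : 0 < ‖k‖ := norm_pos_iff.2 hk0
    have hkQ : ‖k‖⁻¹ • k ∈ Q := by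
      refine ⟨mem_sphere_zero_iff_norm.2 (norm_inv_norm_smul hk0), ?_⟩
      have hk' : inner ℝ k e < c * ‖k‖ := hk
      change inner ℝ (‖k‖⁻¹ • k) e ≤ c
      rw [real_inner_smul_left, inv_mul_le_iff₀ hkn]
      linarith
    obtain ⟨p, hp, hkp⟩ := mem_iUnion₂.1 (hcov hkQ)
    have hkV : k ∈ V p := by
      have := (hUV p (htQ p hp)).2.2.2.2.1 _ hkp ‖k‖ hkn
      rwa [smul_smul, mul_inv_cancel₀ hkn.ne', one_smul] at this
    rw [norm_mul, mul_left_comm]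
    refine mul_le_mul_of_nonneg_left ((hC p hp k hkV).trans ((le_abs_self _).trans ?_))
      (norm_nonneg _)
    exact Finset.single_le_sum (f := fun p => |C p|) (fun _ _ => abs_nonneg _) hp

theorem MicrolocallyRegular.coneDirected {μ : ℝ} {K : Mink → ℂ} (h : MicrolocallyRegular μ K)
    (hK : GrowthKernel K) : ConeDirected (restrictTo punctured (propagator μ K hK)) :=
  fun _ hx _ he hxe _ _ hc1 => h.exists_spectralDensity hK hx hx he hxe hc1

theorem MicrolocallyRegular.waveFrontSet_subset {μ : ℝ} {K : Mink → ℂ}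
    (h : MicrolocallyRegular μ K) (hK : GrowthKernel K) :
    waveFrontSet (restrictTo ⊤ (propagator μ K hK)) ⊆
      {z | z.1 ≠ 0 ∧ mdot z.1 z.1 = 0 ∧ ∃ t : ℝ, 0 < t ∧ z.2 = t • z.1}
        ∪ {z | z.1 = 0 ∧ z.2 ≠ 0} := by
  rintro ⟨x, p⟩ ⟨-, hp⟩
  by_cases hx : x = 0
  · exact Or.inr ⟨hx, hp.1⟩
  refine Or.inl ⟨hx, ?_⟩
  by_contra hcon
  obtain ⟨U, V, hU, hxU, hV, hpV, hcone, hr⟩ := h x p hx hp.1 hcon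
  obtain ⟨φ, hφ, hφ1⟩ := exists_cutoff (Ω := ⊤) (K := {x}) isCompact_singleton hU
    (singleton_subset_iff.2 hxU) (fun _ _ => trivial)
  refine hp.2 φ (by rw [hφ1 x rfl]; exact one_ne_zero) ⟨V, hV, hpV, hcone, fun N => ?_⟩
  obtain ⟨C, hC⟩ := hr (testToSchwartz φ) hφ N
  refine ⟨‖((2 * Real.pi : ℝ) : ℂ)⁻¹ ^ 4‖ * C, fun k hk => ?_⟩
  rw [localFourier_propagator, norm_mul, mul_left_comm]
  exact mul_le_mul_of_nonneg_left (hC k hk) (norm_nonneg _)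

/-! ### Propagators of point-localized fields -/

theorem GrowthKernel.const (c : ℂ) : GrowthKernel fun _ => c :=
  ⟨‖c‖, 0, (FlowBounded.const c).mono fun p => by simp⟩

theorem GrowthKernel.mul {K L : Mink → ℂ} (hK : GrowthKernel K) (hL : GrowthKernel L) :
    GrowthKernel fun p => K p * L p := by
  obtain ⟨A, d, hA⟩ := hK
  obtain ⟨B, e, hB⟩ := hL
  exact ⟨4 * (A * B), d + e, (hA.mul hB).mono fun p => le_of_eq (by rw [pow_add]; ring)⟩

theorem GrowthKernel.coord (i : Fin 4) : GrowthKernel fun p => (p i : ℂ) := by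
  have hm : Measurable fun p : Mink => (p i : ℂ) := by fun_prop
  have hm' : Measurable fun p : Mink => (minkReflect p i : ℂ) :=
    hm.comp minkReflect.continuous.measurable
  have hd : HasFlowDeriv (fun p => (p i : ℂ)) fun p => (minkReflect p i : ℂ) := fun p =>
    HasDerivAt.ofReal_comp
      ((EuclideanSpace.proj i : Mink →L[ℝ] ℝ).hasFDerivAt.comp_hasDerivAt 0 (hasDerivAt_hypFlow p))
  have hd' : HasFlowDeriv (fun p => (minkReflect p i : ℂ)) fun p => (p i : ℂ) := fun p => by
    have h := (((EuclideanSpace.proj i : Mink →L[ℝ] ℝ).comp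
      (minkReflect.toContinuousLinearEquiv : Mink →L[ℝ] Mink)).hasFDerivAt.comp_hasDerivAt 0
        (hasDerivAt_hypFlow p)).ofReal_comp
    refine h.congr_deriv ?_
    change ((minkReflect (minkReflect p) i : ℝ) : ℂ) = _
    rw [minkReflect_minkReflect]
  have hle : ∀ p : Mink, ‖(p i : ℂ)‖ ≤ 1 * (1 + ‖p‖) ^ 1 := fun p => by
    rw [Complex.norm_real, one_mul, pow_one]
    exact (PiLp.norm_apply_le p i).trans (by linarith)
  refine ⟨1, 1, _, _, hm, hm', hm, hd, hd', fun p => ⟨hle p, ?_, hle p⟩⟩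
  have := hle (minkReflect p)
  rwa [LinearIsometryEquiv.norm_map] at this

/-- The polynomial function of the momentum defined by `R`. -/
def polyKernel (R : MvPolynomial (Fin 4) ℂ) (p : Mink) : ℂ :=
  MvPolynomial.eval (fun i => (p i : ℂ)) R

theorem polyKernel_C (a : ℂ) : polyKernel (MvPolynomial.C a) = fun _ => a :=
  funext fun _ => MvPolynomial.eval_C _

theorem polyKernel_add (P Q : MvPolynomial (Fin 4) ℂ) :
    polyKernel (P + Q) = fun p => polyKernel P p + polyKernel Q p :=
  funext fun _ => map_add _ P Q

theorem polyKernel_mul_X (P : MvPolynomial (Fin 4) ℂ) (i : Fin 4) :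
    polyKernel (P * MvPolynomial.X i) = fun p => polyKernel P p * (p i : ℂ) :=
  funext fun p => by simp only [polyKernel, map_mul, MvPolynomial.eval_X]

theorem growthKernel_polyKernel (R : MvPolynomial (Fin 4) ℂ) : GrowthKernel (polyKernel R) := by
  induction R using MvPolynomial.induction_on with
  | C a => rw [polyKernel_C]; exact GrowthKernel.const a
  | add P Q hP hQ => rw [polyKernel_add]; exact hP.add hQ
  | mul_X P i hP => rw [polyKernel_mul_X]; exact hP.mul (GrowthKernel.coord i)

theorem contDiff_polyKernel (R : MvPolynomial (Fin 4) ℂ) : ContDiff ℝ ∞ (polyKernel R) := by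
  induction R using MvPolynomial.induction_on with
  | C a => rw [polyKernel_C]; exact contDiff_const
  | add P Q hP hQ => rw [polyKernel_add]; exact hP.add hQ
  | mul_X P i hP =>
    rw [polyKernel_mul_X]
    exact hP.mul (Complex.ofRealCLM.contDiff.comp
      (EuclideanSpace.proj i : Mink →L[ℝ] ℝ).contDiff)

theorem homogeneousKernel_monomial (u : Fin 4 →₀ ℕ) (a : ℂ) :
    HomogeneousKernel u.degree (polyKernel (MvPolynomial.monomial u a)) where
  growth := growthKernel_polyKernel _
  contDiffAt _ _ := (contDiff_polyKernel _).contDiffAt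
  map_smul r hr p _ := by
    simp only [polyKernel, MvPolynomial.eval_monomial, Finsupp.prod, PiLp.smul_apply, smul_eq_mul,
      Complex.ofReal_mul, mul_pow, Finset.prod_mul_distrib, Finsupp.degree_apply]
    rw [Finset.prod_pow_eq_pow_sum]
    ring

theorem microlocallyRegular_polyKernel (μ : ℝ) (R : MvPolynomial (Fin 4) ℂ) :
    MicrolocallyRegular μ (polyKernel R) := by
  induction R using MvPolynomial.induction_on' with
  | monomial u a => exact (homogeneousKernel_monomial u a).microlocallyRegular μ
  | add P Q hP hQ =>
    rw [polyKernel_add]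
    exact hP.add hQ (growthKernel_polyKernel P) (growthKernel_polyKernel Q)

theorem tendsto_integral_div_of_flowBounded {σ : ℝ} (hσ : σ ^ 2 = 1) (μ : ℝ) {g : Mink → ℂ} {A : ℝ}
    (hg : FlowBounded g fun p => A * ((1 + ‖p‖) ^ 6)⁻¹) :
    Tendsto (fun ε : ℝ => ∫ p, g p / ((mdot p p : ℂ) - μ + σ * Complex.I * ε)) (𝓝[>] 0)
      (𝓝 (propFunctional σ μ g)) :=
  tendsto_propFunctional hσ μ (g := fun _ => g) (ε := fun ε => ε) self_mem_nhdsWithin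
    nhdsWithin_le_nhds (Eventually.of_forall fun _ => hg.integrable) (integrableOn_oscBound A)
    (Eventually.of_forall fun _ _ ht => hg.norm_oscInt_le hσ ht) fun _ _ => tendsto_const_nhds

theorem momentumPairing_eq (K : Mink → ℂ) (φ : 𝓢(Mink, ℂ)) :
    momentumPairing K φ = ((2 * Real.pi : ℝ) : ℂ)⁻¹ ^ 4 * ∫ p, K p * minkFourier φ p := rfl

theorem denom_ne_zero (z : ℝ) {ε : ℝ} (hε : 0 < ε) : (z : ℂ) + Complex.I * ε ≠ 0 := fun h => by
  have := congrArg Complex.im h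
  simp at this
  exact hε.ne' this

theorem Integrable.div_denom {g : Mink → ℂ} (hg : Integrable g) (μ : ℝ) {ε : ℝ} (hε : 0 < ε) :
    Integrable fun p => g p / ((mdot p p : ℂ) - μ + Complex.I * ε) := by
  have hm : Measurable fun p : Mink => ((mdot p p : ℂ) - μ + Complex.I * ε)⁻¹ := by
    have := measurable_mdot_self
    fun_prop
  simp only [div_eq_mul_inv]
  refine hg.mul_bdd (c := ε⁻¹) hm.aestronglyMeasurable (Eventually.of_forall fun p => ?_)
  rw [norm_inv]
  refine inv_anti₀ hε ?_
  refine le_trans ?_ (Complex.abs_im_le_norm _)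
  simp [abs_of_pos hε]

/-- The kernel `P + Q (p² - m²)`, which turns the contact term `Q` into a numerator. -/
def pointKernel (m : ℝ) (P Q : MvPolynomial (Fin 4) ℂ) : MvPolynomial (Fin 4) ℂ :=
  P + Q * (∑ i, MvPolynomial.C (etaDiag i : ℂ) * MvPolynomial.X i ^ 2 -
    MvPolynomial.C ((m : ℂ) ^ 2))

theorem polyKernel_pointKernel (m : ℝ) (P Q : MvPolynomial (Fin 4) ℂ) (p : Mink) :
    polyKernel (pointKernel m P Q) p =
      polyKernel P p + polyKernel Q p * ((mdot p p : ℂ) - ((m ^ 2 : ℝ) : ℂ)) := by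
  have h : (mdot p p : ℂ) = ∑ i, (etaDiag i : ℂ) * (p i : ℂ) ^ 2 := by
    rw [mdot]
    push_cast
    exact Finset.sum_congr rfl fun i _ => by ring
  simp only [polyKernel, pointKernel, map_add, map_mul, map_sub, map_sum, map_pow,
    MvPolynomial.eval_C, MvPolynomial.eval_X, h, Complex.ofReal_pow]

theorem isPointPropagator_propagator (m : ℝ) (P Q : MvPolynomial (Fin 4) ℂ) :
    IsPointPropagator m P Q (propagator (m ^ 2) (polyKernel (pointKernel m P Q))
      (growthKernel_polyKernel _)) := by
  intro φ
  rw [propagator_apply]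
  obtain ⟨A, d, hA⟩ := growthKernel_polyKernel (pointKernel m P Q)
  obtain ⟨B, d', hB⟩ := growthKernel_polyKernel Q
  obtain ⟨B', d'', hB'⟩ := growthKernel_polyKernel P
  have h1 := tendsto_integral_div_of_flowBounded (one_pow 2) (m ^ 2)
    (hA.mul_schwartz (minkFourierCLM φ))
  have h2 := tendsto_integral_div_of_flowBounded (one_pow 2) (m ^ 2)
    (hB.mul_schwartz (minkFourierCLM φ))
  have hPi := (hB'.mul_schwartz (minkFourierCLM φ)).integrable
  have hQi := (hB.mul_schwartz (minkFourierCLM φ)).integrable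
  have hKi := (hA.mul_schwartz (minkFourierCLM φ)).integrable
  rw [coe_minkFourierCLM] at h1 h2 hPi hQi hKi
  simp only [Complex.ofReal_one, one_mul] at h1 h2
  have hε : Tendsto (fun ε : ℝ => Complex.I * (ε : ℂ)) (𝓝[>] 0) (𝓝 0) := by
    have : Continuous fun ε : ℝ => Complex.I * (ε : ℂ) := by fun_prop
    simpa using (this.tendsto 0).mono_left nhdsWithin_le_nhds
  have h3 := (h1.add (hε.mul h2)).const_mul (((2 * Real.pi : ℝ) : ℂ)⁻¹ ^ 4)
  rw [zero_mul, add_zero] at h3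
  refine h3.congr' ?_
  filter_upwards [self_mem_nhdsWithin] with ε hε0
  rw [momentumPairing_eq, ← integral_const_mul]
  congr 1
  rw [← integral_add (Integrable.div_denom hKi _ hε0)
    ((Integrable.div_denom hQi _ hε0).const_mul _)]
  refine integral_congr_ae (Eventually.of_forall fun p => ?_)
  have hne := denom_ne_zero (mdot p p - m ^ 2) hε0
  simp only [polyKernel_pointKernel]
  simp only [polyKernel]
  push_cast at hne ⊢
  field_simp
  ring

theorem IsPointPropagator.eq {m : ℝ} {P Q : MvPolynomial (Fin 4) ℂ} {T : 𝓢'(Mink, ℂ)}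
    (h : IsPointPropagator m P Q T) : T = propagator (m ^ 2) (polyKernel (pointKernel m P Q))
      (growthKernel_polyKernel _) :=
  DFunLike.ext _ _ fun φ => tendsto_nhds_unique (h φ) (isPointPropagator_propagator m P Q φ)

/-! ### Radial integrals of Schwartz functions -/

section Radial

variable {F : Type} [NormedAddCommGroup F] [NormedSpace ℝ F]

theorem SchwartzMap.exists_radial_bound (H : 𝓢(Mink, F)) (m : ℕ) :
    ∃ D : ℝ, 0 ≤ D ∧ ∀ r > 0, ∀ q : Mink, r ≤ ‖q‖ → ∀ τ > 0, ∀ w : ℝ, |w| ≤ τ ^ m →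
      ‖w • H (τ • q)‖ ≤ D * (r ^ m)⁻¹ * (1 + (r * τ) ^ 2)⁻¹ := by
  obtain ⟨D, hD, hH⟩ := H.exists_decay (m + 2)
  refine ⟨D, hD, fun r hr q hq τ hτ w hw => ?_⟩
  have h1 : ‖τ • q‖ = τ * ‖q‖ := by rw [norm_smul, Real.norm_eq_abs, abs_of_pos hτ]
  have h2 := hH (τ • q)
  rw [h1] at h2
  have h3 : 0 < r * τ := by positivity
  have h4 : ((1 + τ * ‖q‖) ^ (m + 2))⁻¹ ≤ ((r * τ) ^ m)⁻¹ * (1 + (r * τ) ^ 2)⁻¹ := by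
    rw [← mul_inv]
    refine inv_anti₀ (by positivity) ?_
    rw [pow_add]
    have h5 : r * τ ≤ τ * ‖q‖ := by rw [mul_comm]; gcongr
    have h6 : (r * τ) ^ m ≤ (1 + τ * ‖q‖) ^ m := by
      refine pow_le_pow_left₀ h3.le ?_ m
      linarith
    have h7 : 1 + (r * τ) ^ 2 ≤ (1 + τ * ‖q‖) ^ 2 := by nlinarith
    gcongr
  rw [norm_smul, Real.norm_eq_abs]
  calc |w| * ‖H (τ • q)‖ ≤ τ ^ m * (D * (((r * τ) ^ m)⁻¹ * (1 + (r * τ) ^ 2)⁻¹)) := by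
        gcongr
        exact h2.trans (by gcongr)
    _ = _ := by
      rw [mul_pow]
      field_simp

theorem integrableOn_inv_one_add_mul_sq {r : ℝ} (hr : 0 < r) :
    IntegrableOn (fun τ : ℝ => (1 + (r * τ) ^ 2)⁻¹) (Ioi 0) :=
  (integrable_inv_one_add_sq.comp_mul_left' hr.ne').integrableOn

theorem aestronglyMeasurable_radial {H : Mink → F} (hH : Continuous H) {w : ℝ → ℝ}
    (hw : Measurable w) (p : Mink) (μ : Measure ℝ) :
    AEStronglyMeasurable (fun τ => w τ • H (τ • p)) μ :=
  hw.aestronglyMeasurable.smul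
    (hH.comp (continuous_id.smul continuous_const)).aestronglyMeasurable

theorem integrableOn_radial (H : 𝓢(Mink, F)) {w : ℝ → ℝ} (hw : Measurable w) {m : ℕ}
    (hwm : ∀ τ > 0, |w τ| ≤ τ ^ m) {p : Mink} (hp : p ≠ 0) :
    IntegrableOn (fun τ => w τ • H (τ • p)) (Ioi 0) := by
  obtain ⟨D, hD, h⟩ := H.exists_radial_bound m
  have hp0 := norm_pos_iff.2 hp
  exact ((integrableOn_inv_one_add_mul_sq hp0).const_mul (D * (‖p‖ ^ m)⁻¹)).mono'
    (aestronglyMeasurable_radial H.continuous hw p _) ((ae_restrict_iff' measurableSet_Ioi).2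
      (Eventually.of_forall fun τ hτ => h _ hp0 p le_rfl τ hτ _ (hwm τ hτ)))

theorem hasFDerivAt_radial (H : 𝓢(Mink, F)) {w : ℝ → ℝ} (hw : Measurable w) {m : ℕ}
    (hwm : ∀ τ > 0, |τ * w τ| ≤ τ ^ m) {p : Mink} (hp : p ≠ 0)
    (hint : IntegrableOn (fun τ => w τ • H (τ • p)) (Ioi 0)) :
    HasFDerivAt (fun p => ∫ τ in Ioi (0 : ℝ), w τ • H (τ • p))
      (∫ τ in Ioi (0 : ℝ), (τ * w τ) • SchwartzMap.fderivCLM ℝ Mink F H (τ • p)) p := by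
  obtain ⟨D, hD, h⟩ := (SchwartzMap.fderivCLM ℝ Mink F H).exists_radial_bound m
  have hp0 := norm_pos_iff.2 hp
  refine hasFDerivAt_integral_of_dominated_of_fderiv_le (s := Metric.ball p (‖p‖ / 2))
    (F' := fun q τ => (τ * w τ) • SchwartzMap.fderivCLM ℝ Mink F H (τ • q))
    (bound := fun τ => D * ((‖p‖ / 2) ^ m)⁻¹ * (1 + (‖p‖ / 2 * τ) ^ 2)⁻¹)
    (Metric.ball_mem_nhds p (by positivity))
    (Eventually.of_forall fun q => aestronglyMeasurable_radial H.continuous hw q _) hint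
    (aestronglyMeasurable_radial (SchwartzMap.continuous _) (measurable_id.mul hw) p _)
    ((ae_restrict_iff' measurableSet_Ioi).2 (Eventually.of_forall fun τ hτ q hq => ?_))
    ((integrableOn_inv_one_add_mul_sq (by positivity)).const_mul _)
    (Eventually.of_forall fun τ q _ => ?_)
  · refine h _ (by positivity) q ?_ τ hτ _ (hwm τ hτ)
    have h1 : ‖p‖ ≤ ‖q‖ + ‖q - p‖ := by
      have := norm_sub_le q (q - p)
      rwa [sub_sub_cancel] at this
    have h2 := mem_ball_iff_norm.1 hq
    linarith
  · have h1 : HasFDerivAt (fun q : Mink => τ • q) (τ • ContinuousLinearMap.id ℝ Mink) q :=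
      (hasFDerivAt_id q).const_smul τ
    have h2 := ((H.differentiableAt (x := τ • q)).hasFDerivAt.comp q h1).const_smul (w τ)
    refine h2.congr_fderiv (ContinuousLinearMap.ext fun v => ?_)
    simp only [SchwartzMap.fderivCLM_apply, _root_.smul_apply, ContinuousLinearMap.comp_apply,
      ContinuousLinearMap.id_apply, map_smul, smul_smul, mul_comm]

end Radial

/-- Each derivative in `p` raises the power of `τ` by one, and the decay of `H` absorbs it as long
as `p ≠ 0`. -/
theorem contDiffOn_radial (n : ℕ) : ∀ (F : Type) [NormedAddCommGroup F] [NormedSpace ℝ F]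
    (H : 𝓢(Mink, F)) (m : ℕ),
    ContDiffOn ℝ n (fun p => ∫ τ in Ioi (0 : ℝ), τ ^ m • H (τ • p)) {0}ᶜ := by
  have hfd : ∀ (F : Type) [NormedAddCommGroup F] [NormedSpace ℝ F] (H : 𝓢(Mink, F)) (m : ℕ),
      ∀ p ∈ ({0}ᶜ : Set Mink), HasFDerivAt (fun p => ∫ τ in Ioi (0 : ℝ), τ ^ m • H (τ • p))
        (∫ τ in Ioi (0 : ℝ), τ ^ (m + 1) • SchwartzMap.fderivCLM ℝ Mink F H (τ • p)) p := by
    intro F _ _ H m p hp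
    have hw : Measurable fun τ : ℝ => τ ^ m := measurable_id.pow_const m
    have h := hasFDerivAt_radial H hw (m := m + 1) (fun τ hτ => by
      rw [abs_of_pos (mul_pos hτ (pow_pos hτ m)), pow_succ, mul_comm]) hp
      (integrableOn_radial H hw (m := m) (fun τ hτ => by rw [abs_of_pos (pow_pos hτ m)]) hp)
    simpa only [pow_succ'] using h
  induction n with
  | zero =>
    intro F _ _ H m
    exact contDiffOn_zero.2 fun p hp => (hfd F H m p hp).continuousAt.continuousWithinAt
  | succ n ih =>
    intro F _ _ H m
    refine (contDiffOn_succ_iff_fderiv_of_isOpen isOpen_compl_singleton).2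
      ⟨fun p hp => (hfd F H m p hp).differentiableAt.differentiableWithinAt, by simp,
        (ih _ (SchwartzMap.fderivCLM ℝ Mink F H) (m + 1)).congr fun p hp =>
          (hfd F H m p hp).fderiv⟩

/-- The derivative of a Schwartz function along the hyperbolic flow. -/
def flowSchwartz (H : 𝓢(Mink, ℂ)) : 𝓢(Mink, ℂ) :=
  SchwartzMap.bilinLeftCLM (ContinuousLinearMap.id ℝ (Mink →L[ℝ] ℂ))
    (g := fun p => minkReflect p)
    (minkReflect.toContinuousLinearEquiv : Mink →L[ℝ] Mink).hasTemperateGrowth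
    (SchwartzMap.fderivCLM ℝ Mink ℂ H)

theorem flowSchwartz_apply (H : 𝓢(Mink, ℂ)) (q : Mink) :
    flowSchwartz H q = fderiv ℝ H q (minkReflect q) := rfl

theorem flowSchwartz_zero (H : 𝓢(Mink, ℂ)) : flowSchwartz H 0 = 0 := by
  rw [flowSchwartz_apply, map_zero, map_zero]

/-- A bound that is integrable with respect to the scale invariant measure `dτ/τ` along every ray.
-/
theorem SchwartzMap.exists_bound_of_zero (H : 𝓢(Mink, ℂ)) (h0 : H 0 = 0) :
    ∃ C : ℝ, 0 ≤ C ∧ ∀ q, ‖H q‖ ≤ C * (‖q‖ * (1 + ‖q‖ ^ 2)⁻¹) := by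
  obtain ⟨C1, hC1, h1⟩ := (SchwartzMap.fderivCLM ℝ Mink ℂ H).exists_decay 0
  obtain ⟨C2, hC2, h2⟩ := H.exists_decay 1
  have hlip : ∀ q, ‖H q‖ ≤ C1 * ‖q‖ := fun q => by
    have h := Convex.norm_image_sub_le_of_norm_fderiv_le (𝕜 := ℝ) (f := H) (C := C1)
      (fun x _ => H.differentiableAt) (fun x _ => by simpa using h1 x) convex_univ
      (mem_univ (0 : Mink)) (mem_univ q)
    simpa [h0] using h
  refine ⟨2 * C1 + 2 * C2, by positivity, fun q => ?_⟩
  have hq := norm_nonneg q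
  rw [← mul_assoc, ← div_eq_mul_inv, le_div_iff₀ (by positivity)]
  rcases le_or_gt ‖q‖ 1 with h | h
  · have h3 := hlip q
    have h4 : ‖q‖ ^ 2 ≤ 1 := by nlinarith
    calc ‖H q‖ * (1 + ‖q‖ ^ 2) ≤ C1 * ‖q‖ * (1 + 1) := by gcongr
      _ ≤ _ := by nlinarith [mul_nonneg hC2 hq]
  · have h3 := h2 q
    rw [pow_one, ← div_eq_mul_inv, le_div_iff₀ (by positivity)] at h3
    have h4 : 1 + ‖q‖ ^ 2 ≤ (1 + ‖q‖) * (2 * ‖q‖) := by nlinarith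
    calc ‖H q‖ * (1 + ‖q‖ ^ 2) ≤ ‖H q‖ * ((1 + ‖q‖) * (2 * ‖q‖)) := by gcongr
      _ = ‖H q‖ * (1 + ‖q‖) * (2 * ‖q‖) := by ring
      _ ≤ C2 * (2 * ‖q‖) := by gcongr
      _ ≤ _ := by nlinarith [mul_nonneg hC1 hq]

/-- The regularized logarithmic radial integral `∫₀^∞ e^{-aτ} H(τp) dτ/τ`. -/
def radialInt (a : ℝ) (H : Mink → ℂ) (p : Mink) : ℂ :=
  ∫ τ in Ioi (0 : ℝ), (Real.exp (-a * τ) * τ⁻¹) • H (τ • p)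

theorem measurable_radialWeight (a : ℝ) : Measurable fun τ : ℝ => Real.exp (-a * τ) * τ⁻¹ := by
  fun_prop

theorem abs_mul_radialWeight_le {a : ℝ} (ha : 0 ≤ a) {τ : ℝ} (hτ : 0 < τ) :
    |τ * (Real.exp (-a * τ) * τ⁻¹)| ≤ τ ^ 0 := by
  rw [mul_left_comm, mul_inv_cancel₀ hτ.ne', mul_one, abs_of_pos (Real.exp_pos _), pow_zero,
    Real.exp_le_one_iff]
  nlinarith

theorem norm_radialIntegrand_le {H : Mink → ℂ} {C : ℝ}
    (hC : ∀ q, ‖H q‖ ≤ C * (‖q‖ * (1 + ‖q‖ ^ 2)⁻¹)) {a : ℝ} (ha : 0 ≤ a) {τ : ℝ} (hτ : 0 < τ)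
    (p : Mink) :
    ‖(Real.exp (-a * τ) * τ⁻¹) • H (τ • p)‖ ≤ C * ‖p‖ * (1 + (‖p‖ * τ) ^ 2)⁻¹ := by
  have h1 : ‖τ • p‖ = τ * ‖p‖ := by rw [norm_smul, Real.norm_eq_abs, abs_of_pos hτ]
  have h2 := hC (τ • p)
  rw [h1] at h2
  have h3 : Real.exp (-a * τ) ≤ 1 := by
    rw [Real.exp_le_one_iff]
    nlinarith
  rw [norm_smul, Real.norm_eq_abs, abs_of_pos (by positivity)]
  calc _ ≤ 1 * τ⁻¹ * (C * (τ * ‖p‖ * (1 + (τ * ‖p‖) ^ 2)⁻¹)) := by gcongr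
    _ = _ := by
      rw [mul_comm ‖p‖ τ]
      field_simp

/-- The substitution `τ ↦ τ / ‖p‖` makes the bound independent of `p`. -/
theorem norm_radialInt_le {H : Mink → ℂ} {C : ℝ} (hC0 : 0 ≤ C)
    (hC : ∀ q, ‖H q‖ ≤ C * (‖q‖ * (1 + ‖q‖ ^ 2)⁻¹)) {a : ℝ} (ha : 0 ≤ a) (p : Mink) :
    ‖radialInt a H p‖ ≤ C * ∫ τ in Ioi (0 : ℝ), (1 + τ ^ 2)⁻¹ := by
  have hI : 0 ≤ ∫ τ in Ioi (0 : ℝ), (1 + τ ^ 2)⁻¹ :=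
    setIntegral_nonneg measurableSet_Ioi fun τ _ => by positivity
  by_cases hp : p = 0
  · have h0 : H 0 = 0 := by simpa using hC 0
    simp only [radialInt, hp, smul_zero, h0, integral_zero, norm_zero]
    positivity
  have hp0 := norm_pos_iff.2 hp
  calc _ ≤ ∫ τ in Ioi (0 : ℝ), C * ‖p‖ * (1 + (‖p‖ * τ) ^ 2)⁻¹ :=
        norm_integral_le_of_norm_le ((integrableOn_inv_one_add_mul_sq hp0).const_mul _)
          ((ae_restrict_iff' measurableSet_Ioi).2 (Eventually.of_forall fun τ hτ =>
            norm_radialIntegrand_le hC ha hτ p))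
    _ = _ := by
      rw [integral_const_mul, integral_comp_mul_left_Ioi (fun x => (1 + x ^ 2)⁻¹) 0 hp0, mul_zero,
        smul_eq_mul]
      field_simp

theorem integrableOn_radialIntegrand (H : 𝓢(Mink, ℂ)) (h0 : H 0 = 0) {a : ℝ} (ha : 0 ≤ a)
    (p : Mink) : IntegrableOn (fun τ => (Real.exp (-a * τ) * τ⁻¹) • H (τ • p)) (Ioi 0) := by
  by_cases hp : p = 0
  · simp only [hp, smul_zero, h0]
    exact integrableOn_zero
  obtain ⟨C, hC0, hC⟩ := H.exists_bound_of_zero h0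
  exact ((integrableOn_inv_one_add_mul_sq (norm_pos_iff.2 hp)).const_mul (C * ‖p‖)).mono'
    (aestronglyMeasurable_radial H.continuous (measurable_radialWeight a) p _)
    ((ae_restrict_iff' measurableSet_Ioi).2 (Eventually.of_forall fun τ hτ =>
      norm_radialIntegrand_le hC ha hτ p))

theorem measurable_radialInt (a : ℝ) {H : Mink → ℂ} (hH : Continuous H) :
    Measurable (radialInt a H) := by
  have h : Measurable fun z : Mink × ℝ => (Real.exp (-a * z.2) * z.2⁻¹) • H (z.2 • z.1) :=
    ((measurable_radialWeight a).comp measurable_snd).smul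
      (hH.measurable.comp (measurable_snd.smul measurable_fst))
  exact (StronglyMeasurable.integral_prod_right' (ν := volume.restrict (Ioi (0 : ℝ)))
    h.stronglyMeasurable).measurable

theorem hasFlowDeriv_radialInt (H : 𝓢(Mink, ℂ)) (h0 : H 0 = 0) {a : ℝ} (ha : 0 ≤ a) :
    HasFlowDeriv (radialInt a H) (radialInt a (flowSchwartz H)) := fun p => by
  by_cases hp : p = 0
  · have h1 : ∀ s, hypFlow s p = 0 := fun s => by simp [hp, hypFlow]
    simp only [h1]
    refine (hasDerivAt_const 0 _).congr_deriv ?_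
    simp [radialInt, hp, flowSchwartz_zero]
  have h1 := hasFDerivAt_radial H (measurable_radialWeight a)
    (fun τ hτ => abs_mul_radialWeight_le ha hτ) hp (integrableOn_radialIntegrand H h0 ha p)
  have h2 : HasFDerivAt (radialInt a H) (∫ τ in Ioi (0 : ℝ), (τ * (Real.exp (-a * τ) * τ⁻¹)) •
      SchwartzMap.fderivCLM ℝ Mink ℂ H (τ • p)) (hypFlow 0 p) := by rw [hypFlow_zero]; exact h1
  refine (h2.comp_hasDerivAt 0 (hasDerivAt_hypFlow p)).congr_deriv ?_
  have hm : Measurable fun τ : ℝ => τ * (Real.exp (-a * τ) * τ⁻¹) :=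
    measurable_id.mul (measurable_radialWeight a)
  have h3 : IntegrableOn (fun τ : ℝ => (τ * (Real.exp (-a * τ) * τ⁻¹)) •
      SchwartzMap.fderivCLM ℝ Mink ℂ H (τ • p)) (Ioi 0) :=
    integrableOn_radial _ hm (fun τ hτ => abs_mul_radialWeight_le ha hτ) hp
  refine (ContinuousLinearMap.integral_apply (𝕜 := ℝ) h3 (minkReflect p)).trans ?_
  refine integral_congr_ae (Eventually.of_forall fun τ => ?_)
  simp only [_root_.smul_apply, SchwartzMap.fderivCLM_apply, flowSchwartz_apply, map_smul,
    smul_smul, mul_comm]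

/-- The flow commutes with dilations, so the flow derivatives of a radial integral are again radial
integrals of Schwartz functions vanishing at the origin. -/
theorem exists_flowBounded_radialInt (H : 𝓢(Mink, ℂ)) (h0 : H 0 = 0) :
    ∃ C : ℝ, ∀ a ≥ 0, FlowBounded (radialInt a H) fun _ => C := by
  obtain ⟨C, hC0, hC⟩ := H.exists_bound_of_zero h0
  obtain ⟨C', hC0', hC'⟩ := (flowSchwartz H).exists_bound_of_zero (flowSchwartz_zero H)
  obtain ⟨C'', hC0'', hC''⟩ := (flowSchwartz (flowSchwartz H)).exists_bound_of_zero
    (flowSchwartz_zero _)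
  have hI : 0 ≤ ∫ τ in Ioi (0 : ℝ), (1 + τ ^ 2)⁻¹ :=
    setIntegral_nonneg measurableSet_Ioi fun τ _ => by positivity
  refine ⟨(C + C' + C'') * ∫ τ in Ioi (0 : ℝ), (1 + τ ^ 2)⁻¹, fun a ha =>
    ⟨radialInt a (flowSchwartz H), radialInt a (flowSchwartz (flowSchwartz H)),
      measurable_radialInt a H.continuous, measurable_radialInt a (SchwartzMap.continuous _),
      measurable_radialInt a (SchwartzMap.continuous _), hasFlowDeriv_radialInt H h0 ha,
      hasFlowDeriv_radialInt _ (flowSchwartz_zero H) ha, fun p => ⟨?_, ?_, ?_⟩⟩⟩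
  · exact (norm_radialInt_le hC0 hC ha p).trans
      (mul_le_mul_of_nonneg_right (by linarith) hI)
  · exact (norm_radialInt_le hC0' hC' ha p).trans
      (mul_le_mul_of_nonneg_right (by linarith) hI)
  · exact (norm_radialInt_le hC0'' hC'' ha p).trans
      (mul_le_mul_of_nonneg_right (by linarith) hI)

theorem tendsto_radialInt (H : 𝓢(Mink, ℂ)) (h0 : H 0 = 0) (p : Mink) :
    Tendsto (fun a => radialInt a H p) (𝓝[>] 0) (𝓝 (radialInt 0 H p)) := by
  by_cases hp : p = 0
  · simp only [radialInt, hp, smul_zero, h0]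
    exact tendsto_const_nhds
  obtain ⟨C, hC0, hC⟩ := H.exists_bound_of_zero h0
  refine tendsto_integral_filter_of_dominated_convergence
    (fun τ => C * ‖p‖ * (1 + (‖p‖ * τ) ^ 2)⁻¹)
    (Eventually.of_forall fun a =>
      aestronglyMeasurable_radial H.continuous (measurable_radialWeight a) p _) ?_
    ((integrableOn_inv_one_add_mul_sq (norm_pos_iff.2 hp)).const_mul _)
    (Eventually.of_forall fun τ => ?_)
  · filter_upwards [self_mem_nhdsWithin] with a ha
    exact (ae_restrict_iff' measurableSet_Ioi).2 (Eventually.of_forall fun τ hτ =>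
      norm_radialIntegrand_le hC (le_of_lt ha) hτ p)
  · have hc : Continuous fun a : ℝ => (Real.exp (-a * τ) * τ⁻¹) • H (τ • p) := by fun_prop
    exact (hc.tendsto 0).mono_left nhdsWithin_le_nhds

theorem radialInt_smul (H : Mink → ℂ) {r : ℝ} (hr : 0 < r) (p : Mink) :
    radialInt 0 H (r • p) = radialInt 0 H p := by
  have h := integral_comp_mul_left_Ioi (fun τ : ℝ => (τ⁻¹) • H (τ • p)) 0 hr
  rw [mul_zero] at h
  simp only [radialInt, neg_zero, zero_mul, Real.exp_zero, one_mul]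
  have h2 : ∀ τ : ℝ, τ⁻¹ • H (τ • r • p) = r • ((r * τ)⁻¹ • H ((r * τ) • p)) := fun τ => by
    rw [smul_smul, smul_smul, mul_inv, ← mul_assoc, mul_inv_cancel₀ hr.ne', one_mul, mul_comm τ r]
  simp only [h2]
  rw [integral_smul, h, smul_smul, mul_inv_cancel₀ hr.ne', one_smul]

/-- The first derivative cancels the singular weight `τ⁻¹`; the higher ones are those of the regular
radial integrals of `contDiffOn_radial`. -/
theorem contDiffAt_radialInt (H : 𝓢(Mink, ℂ)) (h0 : H 0 = 0) {p : Mink} (hp : p ≠ 0) :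
    ContDiffAt ℝ ∞ (radialInt 0 H) p := by
  have hfd : ∀ q ∈ ({0}ᶜ : Set Mink), HasFDerivAt (radialInt 0 H)
      (∫ τ in Ioi (0 : ℝ), τ ^ 0 • SchwartzMap.fderivCLM ℝ Mink ℂ H (τ • q)) q := fun q hq => by
    have h1 := hasFDerivAt_radial H (measurable_radialWeight 0)
      (fun τ hτ => abs_mul_radialWeight_le le_rfl hτ) hq
      (integrableOn_radialIntegrand H h0 le_rfl q)
    refine h1.congr_fderiv ?_
    refine setIntegral_congr_fun measurableSet_Ioi fun τ hτ => ?_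
    have hτ' : τ ≠ 0 := ne_of_gt hτ
    simp [hτ']
  have hs : ContDiffOn ℝ ∞ (radialInt 0 H) {0}ᶜ := by
    refine contDiffOn_infty.2 fun n => ?_
    refine ContDiffOn.of_le (n := (n : WithTop ℕ∞) + 1) ?_ le_self_add
    exact (contDiffOn_succ_iff_fderiv_of_isOpen isOpen_compl_singleton).2
      ⟨fun q hq => (hfd q hq).differentiableAt.differentiableWithinAt, by simp,
        (contDiffOn_radial n _ (SchwartzMap.fderivCLM ℝ Mink ℂ H) 0).congr fun q hq =>
          (hfd q hq).fderiv⟩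
  exact hs.contDiffAt (isOpen_compl_singleton.mem_nhds hp)

/-! ### Smeared string factors -/

theorem integrableOn_pow_mul_exp_neg (j : ℕ) {a : ℝ} (ha : 0 < a) :
    IntegrableOn (fun τ : ℝ => τ ^ j * Real.exp (-a * τ)) (Ioi 0) := by
  have h := integrableOn_rpow_mul_exp_neg_mul_rpow (s := j) (p := 1)
    (by have : (0 : ℝ) ≤ j := Nat.cast_nonneg j
        linarith) one_pos ha
  simpa only [Real.rpow_natCast, Real.rpow_one] using h

theorem integrableOn_pow_mul_cexp_neg (j : ℕ) {r : ℂ} (hr : 0 < r.re) :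
    IntegrableOn (fun τ : ℝ => (τ : ℂ) ^ j * Complex.exp (-r * τ)) (Ioi 0) := by
  have hc : Continuous fun τ : ℝ => (τ : ℂ) ^ j * Complex.exp (-r * τ) := by fun_prop
  refine (integrableOn_pow_mul_exp_neg j hr).mono' hc.aestronglyMeasurable
    ((ae_restrict_iff' measurableSet_Ioi).2 (Eventually.of_forall fun τ hτ => ?_))
  rw [norm_mul, norm_pow, Complex.norm_real, Real.norm_eq_abs, abs_of_pos hτ, Complex.norm_exp]
  simp

theorem integral_pow_mul_cexp_neg (j : ℕ) {r : ℂ} (hr : 0 < r.re) :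
    ∫ τ in Ioi (0 : ℝ), (τ : ℂ) ^ j * Complex.exp (-r * τ) = j.factorial / r ^ (j + 1) := by
  have hr0 : r ≠ 0 := fun h => by rw [h] at hr; simp at hr
  induction j with
  | zero =>
    have h := integral_exp_mul_complex_Ioi (a := -r) (by simpa using hr) 0
    simp only [pow_zero, one_mul, zero_add, Nat.factorial_zero, Nat.cast_one, pow_one]
    rw [h]
    simp
  | succ j ih =>
    have hd : ∀ τ : ℝ, HasDerivAt (fun τ : ℝ => (τ : ℂ) ^ (j + 1) * Complex.exp (-r * τ))
        ((j + 1) * ((τ : ℂ) ^ j * Complex.exp (-r * τ)) -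
          r * ((τ : ℂ) ^ (j + 1) * Complex.exp (-r * τ))) τ := fun τ => by
      have h1 := (hasDerivAt_id τ).ofReal_comp.pow (j + 1)
      have h2 := ((hasDerivAt_id τ).ofReal_comp.const_mul (-r)).cexp
      refine (h1.mul h2).congr_deriv ?_
      simp
      ring
    have hi := (integrableOn_pow_mul_cexp_neg j hr).const_mul ((j : ℂ) + 1)
    have hi' := integrableOn_pow_mul_cexp_neg (j + 1) hr
    have hd' : ∀ τ ∈ Ioi (0 : ℝ), _ := fun τ _ => hd τ
    have h := integral_Ioi_of_hasDerivAt_of_tendsto (hd 0).continuousAt.continuousWithinAt hd'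
      (hi.sub (hi'.const_mul r)) (tendsto_zero_of_hasDerivAt_of_integrableOn_Ioi hd'
        (hi.sub (hi'.const_mul r)) hi')
    rw [integral_sub hi (hi'.const_mul r), integral_const_mul, integral_const_mul, ih] at h
    simp only [Complex.ofReal_zero, ne_eq, Nat.add_eq_zero_iff, one_ne_zero, and_false,
      not_false_eq_true, zero_pow, zero_mul, sub_zero, sub_eq_zero] at h
    rw [Nat.factorial_succ]
    push_cast
    rw [eq_div_iff (pow_ne_zero _ hr0), pow_succ, mul_comm _ r, ← mul_assoc, mul_comm _ r, ← h]
    field_simp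

/-- The smeared power `∫ d⁴e h(e) [(fp) / ((pe) - ia)]^j`. -/
def stringFactor (h : 𝓢(Mink, ℂ)) (f : Mink) (j : ℕ) (a : ℝ) (p : Mink) : ℂ :=
  ∫ e, h e * ((mdot f p : ℂ) / ((mdot p e : ℂ) - Complex.I * a)) ^ j

/-- The Schwartz function `q ↦ (fq)^j ĥ(q)`. -/
def stringSymbol (h : 𝓢(Mink, ℂ)) (f : Mink) (j : ℕ) : 𝓢(Mink, ℂ) :=
  SchwartzMap.smulLeftCLM ℂ (fun q => mdot f q ^ j) (minkFourierCLM h)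

theorem stringSymbol_apply (h : 𝓢(Mink, ℂ)) (f : Mink) (j : ℕ) (q : Mink) :
    stringSymbol h f j q = (mdot f q : ℂ) ^ j * minkFourier h q := by
  have hf : (fun q => mdot f q) = innerSL ℝ (minkReflect f) :=
    funext fun q => by rw [mdot_eq_inner]; rfl
  have hg : Function.HasTemperateGrowth fun q => mdot f q ^ j := by
    refine Function.HasTemperateGrowth.pow (f := fun q => mdot f q) ?_ j
    rw [hf]
    exact ContinuousLinearMap.hasTemperateGrowth _
  rw [stringSymbol, SchwartzMap.smulLeftCLM_apply_apply hg, minkFourierCLM_apply, Complex.real_smul,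
    Complex.ofReal_pow]

theorem stringSymbol_zero (h : 𝓢(Mink, ℂ)) (f : Mink) (j : ℕ) :
    stringSymbol h f (j + 1) 0 = 0 := by
  rw [stringSymbol_apply]
  simp [mdot]

/-- The Laplace representation `((pe) - ia)^{-j-1} = i^{j+1}/j! ∫₀^∞ dτ τ^j e^{-aτ} e^{-iτ(pe)}`
turns the smearing of `e` into a Fourier transform. -/
theorem stringFactor_succ (h : 𝓢(Mink, ℂ)) (f : Mink) (j : ℕ) {a : ℝ} (ha : 0 < a) (p : Mink) :
    stringFactor h f (j + 1) a p =
      Complex.I ^ (j + 1) / j.factorial * radialInt a (stringSymbol h f (j + 1)) p := by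
  -- `i ((pe) - ia)` has real part `a > 0`
  have hre : ∀ e : Mink, 0 < (Complex.I * ((mdot p e : ℂ) - Complex.I * a)).re := fun e => by
    simpa using ha
  have hfac : (j.factorial : ℂ) ≠ 0 := by exact_mod_cast j.factorial_ne_zero
  have h1 : ∀ e : Mink, h e * ((mdot f p : ℂ) / ((mdot p e : ℂ) - Complex.I * a)) ^ (j + 1) =
      Complex.I ^ (j + 1) / j.factorial * (mdot f p : ℂ) ^ (j + 1) *
        ∫ τ in Ioi (0 : ℝ), h e * ((τ : ℂ) ^ j *
          Complex.exp (-(Complex.I * ((mdot p e : ℂ) - Complex.I * a)) * τ)) := fun e => by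
    rw [integral_const_mul, integral_pow_mul_cexp_neg j (hre e), mul_pow]
    have h0 : (mdot p e : ℂ) - Complex.I * a ≠ 0 := fun h0 => by
      have := hre e
      rw [h0] at this
      simp at this
    have := Complex.I_ne_zero
    rw [div_pow]
    field_simp
  have hnorm : ∀ (τ : ℝ) (e : Mink),
      ‖Complex.exp (-(Complex.I * ((mdot p e : ℂ) - Complex.I * a)) * τ)‖ = Real.exp (-a * τ) := by
    intro τ e
    rw [Complex.norm_exp]
    congr 1
    simp
  have hint : Integrable (Function.uncurry fun (e : Mink) (τ : ℝ) => h e * ((τ : ℂ) ^ j *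
      Complex.exp (-(Complex.I * ((mdot p e : ℂ) - Complex.I * a)) * τ)))
      (volume.prod (volume.restrict (Ioi 0))) := by
    refine ((h.integrable (μ := volume)).norm.mul_prod (integrableOn_pow_mul_exp_neg j ha)).mono'
      ?_ ?_
    · have hm : Continuous fun z : Mink × ℝ => mdot p z.1 := continuous_const.mdot continuous_fst
      have hc : Continuous (Function.uncurry fun (e : Mink) (τ : ℝ) => h e * ((τ : ℂ) ^ j *
          Complex.exp (-(Complex.I * ((mdot p e : ℂ) - Complex.I * a)) * τ))) := by
        have := h.continuous
        simp only [Function.uncurry_def]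
        fun_prop
      exact hc.aestronglyMeasurable
    · have h2 : ∀ᵐ z : Mink × ℝ ∂(volume.prod (volume.restrict (Ioi 0))), z.2 ∈ Ioi (0 : ℝ) :=
        Measure.quasiMeasurePreserving_snd.ae (ae_restrict_mem measurableSet_Ioi)
      filter_upwards [h2] with z hz
      have hz' : 0 < z.2 := hz
      simp only [Function.uncurry]
      rw [norm_mul, norm_mul, hnorm, norm_pow, Complex.norm_real, Real.norm_eq_abs,
        abs_of_pos hz']
  rw [stringFactor, integral_congr_ae (Eventually.of_forall h1), integral_const_mul,
    integral_integral_swap hint, mul_assoc]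
  congr 1
  rw [radialInt, ← integral_const_mul]
  refine setIntegral_congr_fun measurableSet_Ioi fun τ hτ => ?_
  have hτ' : (τ : ℂ) ≠ 0 := by exact_mod_cast ne_of_gt hτ
  simp only [stringSymbol_apply, minkFourier]
  rw [Complex.real_smul, ← mul_assoc, ← integral_const_mul, ← integral_const_mul]
  refine integral_congr_ae (Eventually.of_forall fun e => ?_)
  simp only [planeWave, mdot_neg_left, mdot_smul_left, mdot_smul_right]
  have h3 : Complex.exp (-(Complex.I * ((mdot p e : ℂ) - Complex.I * a)) * τ) =
      Complex.exp ((-a * τ : ℝ) : ℂ) * Complex.exp (Complex.I * ((-(τ * mdot p e) : ℝ) : ℂ)) := by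
    rw [← Complex.exp_add]
    congr 1
    push_cast
    linear_combination ((a : ℂ) * τ) * Complex.I_sq
  rw [h3]
  push_cast
  field_simp
  ring

theorem HomogeneousKernel.const (c : ℂ) : HomogeneousKernel 0 fun _ => c :=
  ⟨GrowthKernel.const c, fun _ _ => contDiffAt_const, fun r _ p _ => by simp⟩

theorem HomogeneousKernel.add {d : ℕ} {K L : Mink → ℂ} (hK : HomogeneousKernel d K)
    (hL : HomogeneousKernel d L) : HomogeneousKernel d fun p => K p + L p :=
  ⟨hK.growth.add hL.growth, fun p hp => (hK.contDiffAt p hp).add (hL.contDiffAt p hp),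
    fun r hr p hp => by rw [hK.map_smul r hr p hp, hL.map_smul r hr p hp, mul_add]⟩

theorem HomogeneousKernel.mul {d e : ℕ} {K L : Mink → ℂ} (hK : HomogeneousKernel d K)
    (hL : HomogeneousKernel e L) : HomogeneousKernel (d + e) fun p => K p * L p :=
  ⟨hK.growth.mul hL.growth, fun p hp => (hK.contDiffAt p hp).mul (hL.contDiffAt p hp),
    fun r hr p hp => by rw [hK.map_smul r hr p hp, hL.map_smul r hr p hp, pow_add]; ring⟩

theorem HomogeneousKernel.comp_neg {d : ℕ} {K : Mink → ℂ} (hK : HomogeneousKernel d K) :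
    HomogeneousKernel d fun p => K (-p) := by
  refine ⟨?_, fun p hp => (hK.contDiffAt (-p) (neg_ne_zero.2 hp)).comp p contDiffAt_id.neg,
    fun r hr p hp => by rw [← smul_neg, hK.map_smul r hr _ (neg_ne_zero.2 hp)]⟩
  obtain ⟨A, d, h⟩ := hK.growth
  have h' := h.comp_smul (-1)
  simp only [neg_smul, one_smul, norm_neg] at h'
  exact ⟨A, d, h'⟩

/-- Smeared string factors converge, with uniform bounds along the flow, to kernels that are
homogeneous of degree zero. -/
theorem exists_stringFactor_limit (h : 𝓢(Mink, ℂ)) (f : Mink) (j : ℕ) :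
    ∃ (K : Mink → ℂ) (C : ℝ), (∀ a > 0, FlowBounded (stringFactor h f j a) fun _ => C) ∧
      (∀ p, Tendsto (fun a => stringFactor h f j a p) (𝓝[>] 0) (𝓝 (K p))) ∧
      HomogeneousKernel 0 K := by
  rcases j with _ | j
  · have h1 : ∀ a, stringFactor h f 0 a = fun _ => ∫ e, h e := fun a => by
      ext p
      simp only [stringFactor, pow_zero, mul_one]
    exact ⟨fun _ => ∫ e, h e, _, fun a _ => by rw [h1]; exact FlowBounded.const _,
      fun p => by simp only [h1]; exact tendsto_const_nhds, HomogeneousKernel.const _⟩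
  · have h0 := stringSymbol_zero h f j
    obtain ⟨C, hC⟩ := exists_flowBounded_radialInt _ h0
    set c : ℂ := Complex.I ^ (j + 1) / j.factorial
    have hK : HomogeneousKernel 0 (radialInt 0 (stringSymbol h f (j + 1))) :=
      ⟨⟨C, 0, by simpa using hC 0 le_rfl⟩, fun p hp => contDiffAt_radialInt _ h0 hp,
        fun r hr p _ => by rw [radialInt_smul _ hr, pow_zero, one_mul]⟩
    refine ⟨fun p => c * radialInt 0 (stringSymbol h f (j + 1)) p, 4 * (‖c‖ * C), fun a ha => ?_,
      fun p => ?_, by simpa using (HomogeneousKernel.const c).mul hK⟩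
    · have h2 : stringFactor h f (j + 1) a = _ := funext fun p => stringFactor_succ h f j ha p
      rw [h2]
      exact (FlowBounded.const c).mul (hC a (le_of_lt ha))
    · refine ((tendsto_radialInt _ h0 p).const_mul c).congr' ?_
      filter_upwards [self_mem_nhdsWithin] with a ha
      exact (stringFactor_succ h f j ha p).symm

/-! ### The smeared string kernel -/

/-- Sums of products of a function of `(x, e)` and a function of `(y, e')`, polynomial in `x` and
`y` and smooth in the string directions `e` and `e'`. -/
inductive SeparableKernel : (ℂ → ℂ → Mink → Mink → ℂ) → Prop
  | term (g g' : Mink → ℂ) (hg : ContDiff ℝ ∞ g) (hg' : ContDiff ℝ ∞ g') (j j' : ℕ) :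
      SeparableKernel fun x y e e' => g e * x ^ j * (g' e' * y ^ j')
  | add (M N : ℂ → ℂ → Mink → Mink → ℂ) (hM : SeparableKernel M) (hN : SeparableKernel N) :
      SeparableKernel fun x y e e' => M x y e e' + N x y e e'

theorem SeparableKernel.const (c : ℂ) : SeparableKernel fun _ _ _ _ => c := by
  simpa using SeparableKernel.term (fun _ => c) (fun _ => 1) contDiff_const contDiff_const 0 0

theorem SeparableKernel.mul {M N : ℂ → ℂ → Mink → Mink → ℂ} (hM : SeparableKernel M)
    (hN : SeparableKernel N) : SeparableKernel fun x y e e' => M x y e e' * N x y e e' := by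
  induction hM with
  | term g g' hg hg' j j' =>
    induction hN with
    | term h h' hh hh' i i' =>
      convert SeparableKernel.term (fun e => g e * h e) (fun e => g' e * h' e) (hg.mul hh)
        (hg'.mul hh') (j + i) (j' + i') using 5
      ring
    | add N N' _ _ hN hN' =>
      simp only [mul_add]
      exact .add _ _ hN hN'
  | add M M' _ _ hM hM' =>
    simp only [add_mul]
    exact .add _ _ hM hM'

theorem SeparableKernel.pow {M : ℂ → ℂ → Mink → Mink → ℂ} (hM : SeparableKernel M) (n : ℕ) :
    SeparableKernel fun x y e e' => M x y e e' ^ n := by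
  induction n with
  | zero => simpa using SeparableKernel.const 1
  | succ n ih =>
    simp only [pow_succ]
    exact ih.mul hM

theorem SeparableKernel.sum {ι : Type*} {s : Finset ι} {M : ι → ℂ → ℂ → Mink → Mink → ℂ}
    (hM : ∀ n, SeparableKernel (M n)) : SeparableKernel fun x y e e' => ∑ n ∈ s, M n x y e e' := by
  classical
  induction s using Finset.induction_on with
  | empty => simpa using SeparableKernel.const 0
  | insert n s hn ih =>
    simp only [Finset.sum_insert hn]
    exact .add _ _ (hM n) ih

theorem contractE_eq (f g : Mink) (a b : ℝ) (p e e' : Mink) :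
    contractE f g a b p e e' = mdot f g
      - mdot g e * ((mdot f p : ℂ) / ((mdot p e : ℂ) - Complex.I * a))
      - mdot f e' * ((mdot g p : ℂ) / ((mdot p e' : ℂ) + Complex.I * b))
      + mdot e e' * (((mdot f p : ℂ) / ((mdot p e : ℂ) - Complex.I * a)) *
        ((mdot g p : ℂ) / ((mdot p e' : ℂ) + Complex.I * b))) := by
  have h1 : ∀ u v : Mink, (mdot u v : ℂ) = ∑ μ, (u μ : ℂ) * (lower v μ : ℂ) := fun u v => by
    simp only [mdot, lower]
    push_cast
    exact Finset.sum_congr rfl fun μ _ => by ring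
  have h2 : ∑ μ, ∑ κ, (f μ : ℂ) * (eta μ κ : ℂ) * (g κ : ℂ) = mdot f g := by
    rw [h1]
    refine Finset.sum_congr rfl fun μ _ => ?_
    rw [Finset.sum_eq_single μ (fun κ _ hκ => by simp [eta, hκ.symm]) (by simp)]
    simp only [eta, lower, if_true]
    push_cast
    ring
  have h3 : ∀ (c : ℂ) (u v : Mink), ∑ μ, ∑ κ, (f μ : ℂ) * (c * (lower u μ * lower v κ : ℂ)) *
      (g κ : ℂ) = c * (mdot f u * mdot g v) := fun c u v => by
    rw [h1, h1, Finset.sum_mul_sum, Finset.mul_sum]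
    refine Finset.sum_congr rfl fun μ _ => ?_
    rw [Finset.mul_sum]
    exact Finset.sum_congr rfl fun κ _ => by ring
  set D := (mdot p e : ℂ) - Complex.I * a
  set D' := (mdot p e' : ℂ) + Complex.I * b
  have h4 : contractE f g a b p e e' = ∑ μ, ∑ κ, ((f μ : ℂ) * (eta μ κ : ℂ) * (g κ : ℂ)
      - (f μ : ℂ) * (D⁻¹ * (lower p μ * lower e κ : ℂ)) * (g κ : ℂ)
      - (f μ : ℂ) * (D'⁻¹ * (lower e' μ * lower p κ : ℂ)) * (g κ : ℂ)
      + (f μ : ℂ) * (mdot e e' * (D⁻¹ * D'⁻¹) * (lower p μ * lower p κ : ℂ)) * (g κ : ℂ)) := by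
    refine Finset.sum_congr rfl fun μ _ => Finset.sum_congr rfl fun κ _ => ?_
    simp only [tensorE, div_eq_mul_inv, mul_inv]
    ring
  rw [h4]
  simp only [Finset.sum_add_distrib, Finset.sum_sub_distrib, h2, h3]
  ring

theorem SeparableKernel.left {g : Mink → ℝ} (hg : ContDiff ℝ ∞ g) (j : ℕ) :
    SeparableKernel fun x _ e _ => g e * x ^ j := by
  simpa using SeparableKernel.term (fun e => g e) (fun _ => 1) (Complex.ofRealCLM.contDiff.comp hg)
    contDiff_const j 0

theorem SeparableKernel.right {g : Mink → ℝ} (hg : ContDiff ℝ ∞ g) (j : ℕ) :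
    SeparableKernel fun _ y _ e' => g e' * y ^ j := by
  simpa using SeparableKernel.term (fun _ => 1) (fun e => g e) contDiff_const
    (Complex.ofRealCLM.contDiff.comp hg) 0 j

theorem separableKernel_mdot : SeparableKernel fun x y e e' => mdot e e' * (x * y) := by
  have h : (fun (x y : ℂ) (e e' : Mink) => (mdot e e' : ℂ) * (x * y)) = fun x y e e' =>
      ∑ n : Fin 4, (((lower e n : ℝ) : ℂ) * x ^ 1) * (((e' n : ℝ) : ℂ) * y ^ 1) := by
    ext x y e e'
    rw [mdot, Complex.ofReal_sum, Finset.sum_mul]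
    refine Finset.sum_congr rfl fun i _ => ?_
    simp only [lower]
    push_cast
    ring
  rw [h]
  refine .sum fun n => .term (fun e => ((lower e n : ℝ) : ℂ)) (fun e => ((e n : ℝ) : ℂ)) ?_ ?_ 1 1
  · have h : ContDiff ℝ ∞ fun e : Mink => etaDiag n * e n := by fun_prop
    exact Complex.ofRealCLM.contDiff.comp h
  · exact Complex.ofRealCLM.contDiff.comp (by fun_prop)

/-- The string kernel depends on the momentum only through the ratios `(fp) / ((pe) - ia)` and
`(f'p) / ((pe') + ib)`. -/
theorem exists_separableKernel (s : ℕ) (β : ℕ → ℂ) (f f' : Mink) :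
    ∃ M, SeparableKernel M ∧ ∀ a b p e e', stringKernel s β f f' a b p e e' =
      M ((mdot f p : ℂ) / ((mdot p e : ℂ) - Complex.I * a))
        ((mdot f' p : ℂ) / ((mdot p e' : ℂ) + Complex.I * b)) e e' := by
  -- the contraction `E_ff` depends on the first ratio only
  have hl : SeparableKernel fun x _ e _ =>
      mdot f f + ((-2 : ℂ) * (mdot f e * x ^ 1) + mdot e e * x ^ 2) :=
    .add _ _ (.const _) (.add _ _ ((SeparableKernel.const (-2)).mul (.left (contDiff_mdot f) 1))
      (.left contDiff_mdot_self 2))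
  -- the contraction `E_f'f'` depends on the second ratio only
  have hr : SeparableKernel fun _ y _ e' =>
      mdot f' f' + ((-2 : ℂ) * (mdot f' e' * y ^ 1) + mdot e' e' * y ^ 2) :=
    .add _ _ (.const _) (.add _ _ ((SeparableKernel.const (-2)).mul (.right (contDiff_mdot f') 1))
      (.right contDiff_mdot_self 2))
  have hm : SeparableKernel fun x y e e' => mdot f f' + ((-1 : ℂ) * (mdot f' e * x ^ 1) +
      ((-1 : ℂ) * (mdot f e' * y ^ 1) + mdot e e' * (x * y))) :=
    .add _ _ (.const _) (.add _ _ ((SeparableKernel.const (-1)).mul (.left (contDiff_mdot f') 1))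
      (.add _ _ ((SeparableKernel.const (-1)).mul (.right (contDiff_mdot f) 1))
        separableKernel_mdot))
  refine ⟨_, (SeparableKernel.const ((-1) ^ s)).mul (.sum (s := Finset.range (s / 2 + 1)) fun n =>
    (((SeparableKernel.const (β n)).mul (hl.pow n)).mul (hr.pow n)).mul (hm.pow (s - 2 * n))),
    fun a b p e e' => ?_⟩
  have h1 : contractE f f a a p e (-e) = mdot f f +
      ((-2 : ℂ) * (mdot f e * ((mdot f p : ℂ) / ((mdot p e : ℂ) - Complex.I * a)) ^ 1) +
        mdot e e * ((mdot f p : ℂ) / ((mdot p e : ℂ) - Complex.I * a)) ^ 2) := by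
    rw [contractE_eq, mdot_neg_right, mdot_neg_right, mdot_neg_right]
    have h : (((-mdot p e : ℝ) : ℂ) + Complex.I * a) = -((mdot p e : ℂ) - Complex.I * a) := by
      push_cast; ring
    rw [h, div_neg]
    push_cast
    ring
  have h2 : contractE f' f' b b p (-e') e' = mdot f' f' +
      ((-2 : ℂ) * (mdot f' e' * ((mdot f' p : ℂ) / ((mdot p e' : ℂ) + Complex.I * b)) ^ 1) +
        mdot e' e' * ((mdot f' p : ℂ) / ((mdot p e' : ℂ) + Complex.I * b)) ^ 2) := by
    rw [contractE_eq, mdot_neg_right, mdot_neg_right, mdot_neg_left]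
    have h : (((-mdot p e' : ℝ) : ℂ) - Complex.I * b) = -((mdot p e' : ℂ) + Complex.I * b) := by
      push_cast; ring
    rw [h, div_neg]
    push_cast
    ring
  rw [stringKernel, h1, h2, contractE_eq]
  congr 1
  refine Finset.sum_congr rfl fun n _ => ?_
  congr 2
  ring

/-- The kernel `M`, evaluated on the two string ratios and smeared with `c` in both string
directions. -/
def smearedKernel (M : ℂ → ℂ → Mink → Mink → ℂ) (f f' : Mink) (c : 𝓓(spacelike, ℂ)) (a b : ℝ)
    (p : Mink) : ℂ :=
  ∫ z : Mink × Mink, c z.1 * c z.2 * M ((mdot f p : ℂ) / ((mdot p z.1 : ℂ) - Complex.I * a))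
    ((mdot f' p : ℂ) / ((mdot p z.2 : ℂ) + Complex.I * b)) z.1 z.2

theorem integrable_stringFactor (h : 𝓢(Mink, ℂ)) (f : Mink) (j : ℕ) {a : ℝ} (ha : 0 < a)
    (p : Mink) :
    Integrable fun e => h e * ((mdot f p : ℂ) / ((mdot p e : ℂ) - Complex.I * a)) ^ j := by
  have hm : Measurable fun e : Mink => mdot p e := (continuous_const.mdot continuous_id).measurable
  have hm' : Measurable fun e : Mink =>
      ((mdot f p : ℂ) / ((mdot p e : ℂ) - Complex.I * a)) ^ j :=
    ((hm.complex_ofReal.sub_const _).const_div _).pow_const j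
  refine (h.integrable (μ := volume)).mul_bdd (c := (‖(mdot f p : ℂ)‖ / a) ^ j)
    hm'.aestronglyMeasurable (Eventually.of_forall fun e => ?_)
  rw [norm_pow, norm_div]
  have h1 : a ≤ ‖(mdot p e : ℂ) - Complex.I * a‖ := by
    refine le_trans ?_ (Complex.abs_im_le_norm _)
    simp [abs_of_pos ha]
  gcongr

/-- Smearing a separable kernel gives sums of products of a string factor at `p` and a string
factor at `-p`, because `(pe') + ib = -((-p e') - ib)`. -/
theorem SeparableKernel.exists_limit {M : ℂ → ℂ → Mink → Mink → ℂ} (hM : SeparableKernel M)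
    (f f' : Mink) (c : 𝓓(spacelike, ℂ)) :
    ∃ (K : Mink → ℂ) (C : ℝ),
      (∀ a > 0, ∀ b > 0, FlowBounded (smearedKernel M f f' c a b) fun _ => C) ∧
      (∀ a > 0, ∀ b > 0, ∀ p, Integrable fun z : Mink × Mink => c z.1 * c z.2 *
        M ((mdot f p : ℂ) / ((mdot p z.1 : ℂ) - Complex.I * (a : ℝ)))
          ((mdot f' p : ℂ) / ((mdot p z.2 : ℂ) + Complex.I * (b : ℝ))) z.1 z.2) ∧
      (∀ p, Tendsto (fun r : ℝ × ℝ => smearedKernel M f f' c r.1 r.2 p) (𝓝[>] 0 ×ˢ 𝓝[>] 0)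
        (𝓝 (K p))) ∧ HomogeneousKernel 0 K := by
  induction hM with
  | term g g' hg hg' j j' =>
    set h := testToSchwartz (testMul c g hg)
    set h' := testToSchwartz (testMul c g' hg')
    obtain ⟨K, C, hC, hlim, hK⟩ := exists_stringFactor_limit h f j
    obtain ⟨K', C', hC', hlim', hK'⟩ := exists_stringFactor_limit h' f' j'
    have h1 : ∀ (a b : ℝ) (p : Mink) (z : Mink × Mink), c z.1 * c z.2 *
        (g z.1 * ((mdot f p : ℂ) / ((mdot p z.1 : ℂ) - Complex.I * (a : ℝ))) ^ j *
          (g' z.2 * ((mdot f' p : ℂ) / ((mdot p z.2 : ℂ) + Complex.I * (b : ℝ))) ^ j')) =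
        (h z.1 * ((mdot f p : ℂ) / ((mdot p z.1 : ℂ) - Complex.I * a)) ^ j) *
        (h' z.2 * ((mdot f' (-p) : ℂ) / ((mdot (-p) z.2 : ℂ) - Complex.I * b)) ^ j') := by
      intro a b p z
      have h2 : (mdot f' (-p) : ℂ) / ((mdot (-p) z.2 : ℂ) - Complex.I * b) =
          (mdot f' p : ℂ) / ((mdot p z.2 : ℂ) + Complex.I * b) := by
        rw [mdot_neg_right, mdot_neg_left, ← neg_div_neg_eq]
        push_cast
        congr 1 <;> ring
      rw [h2]
      change _ = (c z.1 * g z.1 * _) * (c z.2 * g' z.2 * _)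
      ring
    have h3 : ∀ a b : ℝ, smearedKernel (fun x y e e' => g e * x ^ j * (g' e' * y ^ j')) f f' c a b =
        fun p => stringFactor h f j a p * stringFactor h' f' j' b (-p) := fun a b => by
      ext p
      simp only [smearedKernel, h1]
      exact integral_prod_mul (μ := (volume : Measure Mink)) (ν := (volume : Measure Mink))
        (fun e => h e * ((mdot f p : ℂ) / ((mdot p e : ℂ) - Complex.I * a)) ^ j)
        fun e => h' e * ((mdot f' (-p) : ℂ) / ((mdot (-p) e : ℂ) - Complex.I * b)) ^ j'
    -- the factor in `e'` is `(f'p)/((pe') + ib) = (f'(-p))/((-p e') - ib)`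
    refine ⟨fun p => K p * K' (-p), 4 * (C * C'), fun a ha b hb => ?_, fun a ha b hb p => ?_,
      fun p => ?_, hK.mul hK'.comp_neg⟩
    · rw [h3]
      have h4 := (hC' b hb).comp_smul (-1)
      simp only [neg_smul, one_smul] at h4
      exact (hC a ha).mul h4
    · simp only [h1]
      exact (integrable_stringFactor h f j ha p).mul_prod (integrable_stringFactor h' f' j' hb (-p))
    · simp only [h3]
      exact ((hlim p).comp tendsto_fst).mul ((hlim' (-p)).comp tendsto_snd)
  | add M N _ _ hM hN =>
    obtain ⟨K, C, hC, hi, hlim, hK⟩ := hM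
    obtain ⟨K', C', hC', hi', hlim', hK'⟩ := hN
    have h3 : ∀ a > 0, ∀ b > 0, ∀ p, smearedKernel (fun x y e e' => M x y e e' + N x y e e')
        f f' c a b p = smearedKernel M f f' c a b p + smearedKernel N f f' c a b p := by
      intro a ha b hb p
      simp only [smearedKernel, mul_add]
      exact integral_add (hi a ha b hb p) (hi' a ha b hb p)
    refine ⟨fun p => K p + K' p, C + C', fun a ha b hb => ?_, fun a ha b hb p => ?_,
      fun p => ?_, hK.add hK'⟩
    · rw [funext (h3 a ha b hb)]
      exact (hC a ha b hb).add (hC' a ha b hb)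
    · simp only [mul_add]
      exact (hi a ha b hb p).add (hi' a ha b hb p)
    · refine ((hlim p).add (hlim' p)).congr' ?_
      filter_upwards [prod_mem_prod self_mem_nhdsWithin self_mem_nhdsWithin] with r hr
      exact (h3 _ hr.1 _ hr.2 p).symm

/-- The numerator and the denominator may converge simultaneously, as long as the numerators are
flow bounded uniformly. -/
theorem tendsto_integral_kernel_div {ι : Type*} {l : Filter ι} [l.IsCountablyGenerated]
    {K : ι → Mink → ℂ} {K₀ : Mink → ℂ} {C : ℝ} {ε : ι → ℝ} (hε : ∀ᶠ i in l, 0 < ε i)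
    (hε0 : Tendsto ε l (𝓝 0)) (hC : ∀ᶠ i in l, FlowBounded (K i) fun _ => C)
    (hlim : ∀ p, Tendsto (fun i => K i p) l (𝓝 (K₀ p))) (f : 𝓢(Mink, ℂ)) :
    Tendsto (fun i => ∫ p, K i p * f p / ((mdot p p : ℂ) + Complex.I * ε i)) l
      (𝓝 (propFunctional 1 0 fun p => K₀ p * f p)) := by
  have hF : ∀ᶠ i in l, FlowBounded (fun p => K i p * f p)
      fun p => 8 * C * 2 ^ (0 + 8) * schwartzSup (0 + 8, 2) f * ((1 + ‖p‖) ^ 6)⁻¹ := by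
    filter_upwards [hC] with i hi
    have hi' : FlowBounded (K i) fun p => C * (1 + ‖p‖) ^ 0 := by
      simpa only [pow_zero, mul_one] using hi
    exact hi'.mul_schwartz f
  have hosc : ∀ t > 0, Tendsto (fun i => oscInt (1 * t) fun p => K i p * f p) l
      (𝓝 (oscInt (1 * t) fun p => K₀ p * f p)) := fun t _ => by
    refine tendsto_integral_filter_of_dominated_convergence (fun p => C * ‖f p‖)
      ?_ ?_ ((f.integrable (μ := volume)).norm.const_mul C) (Eventually.of_forall fun p => ?_)
    · filter_upwards [hF] with i hi
      exact ((measurable_oscPhase _).mul hi.measurable).aestronglyMeasurable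
    · filter_upwards [hC] with i hi
      refine Eventually.of_forall fun p => ?_
      rw [norm_mul, norm_mul, norm_cexp_I_mul_mul, one_mul]
      exact mul_le_mul_of_nonneg_right (hi.norm_le p) (norm_nonneg _)
    · exact ((hlim p).mul_const _).const_mul _
  have h := tendsto_propFunctional (one_pow 2) 0 hε hε0 (hF.mono fun i hi => hi.integrable)
    (integrableOn_oscBound _) (hF.mono fun i hi t ht => hi.norm_oscInt_le (one_pow 2) ht) hosc
  simpa only [Complex.ofReal_zero, sub_zero, Complex.ofReal_one, one_mul] using h

theorem exists_isSmearedStringPropagator (s : ℕ) (β : ℕ → ℂ) (f f' : Mink)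
    (c : 𝓓(spacelike, ℂ)) : ∃ (K : Mink → ℂ) (hK : HomogeneousKernel 0 K),
      IsSmearedStringPropagator s β f f' c (propagator 0 K hK.growth) := by
  obtain ⟨M, hM, hMs⟩ := exists_separableKernel s β f f'
  obtain ⟨K, C, hC, hi, hlim, hK⟩ := hM.exists_limit f f' c
  refine ⟨K, hK, fun φ => ?_⟩
  rw [propagator_apply]
  have hfst : Tendsto (fun r : ℝ × ℝ × ℝ => (r.1, r.2.1)) (𝓝[>] 0 ×ˢ 𝓝[>] 0 ×ˢ 𝓝[>] 0)
      (𝓝[>] 0 ×ˢ 𝓝[>] 0) := tendsto_fst.prodMk (tendsto_fst.comp tendsto_snd)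
  have hpos : ∀ᶠ r : ℝ × ℝ × ℝ in 𝓝[>] 0 ×ˢ 𝓝[>] 0 ×ˢ 𝓝[>] 0,
      0 < r.1 ∧ 0 < r.2.1 ∧ 0 < r.2.2 := by
    filter_upwards [prod_mem_prod self_mem_nhdsWithin
      (prod_mem_prod self_mem_nhdsWithin self_mem_nhdsWithin)] with r hr
    exact ⟨hr.1, hr.2.1, hr.2.2⟩
  have hε0 : Tendsto (fun r : ℝ × ℝ × ℝ => r.2.2) (𝓝[>] 0 ×ˢ 𝓝[>] 0 ×ˢ 𝓝[>] 0) (𝓝 0) :=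
    (tendsto_snd.comp tendsto_snd).mono_right nhdsWithin_le_nhds
  have hKC : ∀ᶠ r : ℝ × ℝ × ℝ in 𝓝[>] 0 ×ˢ 𝓝[>] 0 ×ˢ 𝓝[>] 0,
      FlowBounded (smearedKernel M f f' c r.1 r.2.1) fun _ => C := by
    filter_upwards [hpos] with r hr
    exact hC _ hr.1 _ hr.2.1
  have hKlim : ∀ p, Tendsto (fun r : ℝ × ℝ × ℝ => smearedKernel M f f' c r.1 r.2.1 p)
      (𝓝[>] 0 ×ˢ 𝓝[>] 0 ×ˢ 𝓝[>] 0) (𝓝 (K p)) := by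
    intro p
    have h := (hlim p).comp hfst
    simpa only [Function.comp_def] using h
  -- the three regulators are removed simultaneously
  have h1 := tendsto_integral_kernel_div (hpos.mono fun r hr => hr.2.2) hε0 hKC hKlim
    (minkFourierCLM φ)
  rw [coe_minkFourierCLM] at h1
  refine (h1.const_mul (((2 * Real.pi : ℝ) : ℂ)⁻¹ ^ 4)).congr' ?_
  filter_upwards [hpos] with r hr
  rw [momentumPairing_eq]
  congr 1
  refine integral_congr_ae (Eventually.of_forall fun p => ?_)
  have h2 : ∫ e, ∫ e', c e * c e' * stringKernel s β f f' r.1 r.2.1 p e e' =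
      smearedKernel M f f' c r.1 r.2.1 p := by
    simp only [hMs]
    exact (integral_prod (μ := (volume : Measure Mink)) (ν := (volume : Measure Mink)) _
      (hi _ hr.1 _ hr.2.1 p)).symm
  simp only [h2]
  ring

theorem IsSmearedStringPropagator.unique {s : ℕ} {β : ℕ → ℂ} {f f' : Mink} {c : 𝓓(spacelike, ℂ)}
    {T T' : 𝓢'(Mink, ℂ)} (h : IsSmearedStringPropagator s β f f' c T)
    (h' : IsSmearedStringPropagator s β f f' c T') : T = T' :=
  DFunLike.ext _ _ fun φ => tendsto_nhds_unique (h φ) (h' φ)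

/-! ### The massless Feynman propagator in momentum space -/

/-- The coefficients of the quadratic form `ε ‖x‖² + i t x²`. -/
def fresnelCoeff (ε t : ℝ) (i : Fin 4) : ℂ := ε + Complex.I * t * etaDiag i

theorem fresnelCoeff_re (ε t : ℝ) (i : Fin 4) : (fresnelCoeff ε t i).re = ε := by
  simp [fresnelCoeff]

/-- The regularized Fresnel kernel `e^{-ε‖x‖² - i t x²}`. -/
def fresnelKernel (ε t : ℝ) (x : Mink) : ℂ :=
  Complex.exp (-∑ i, fresnelCoeff ε t i * (x i : ℂ) ^ 2)

theorem norm_fresnelKernel_le {ε : ℝ} (hε : 0 ≤ ε) (t : ℝ) (x : Mink) :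
    ‖fresnelKernel ε t x‖ ≤ 1 := by
  rw [fresnelKernel, Complex.norm_exp, Real.exp_le_one_iff, Complex.neg_re, Complex.re_sum,
    neg_nonpos]
  refine Finset.sum_nonneg fun i _ => ?_
  rw [← Complex.ofReal_pow, Complex.re_mul_ofReal, fresnelCoeff_re]
  positivity

theorem continuous_fresnelKernel (ε t : ℝ) : Continuous (fresnelKernel ε t) := by
  unfold fresnelKernel
  fun_prop

theorem fresnelKernel_zero (t : ℝ) (x : Mink) :
    fresnelKernel 0 t x = Complex.exp (Complex.I * ((-t : ℝ) : ℂ) * (mdot x x : ℂ)) := by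
  rw [fresnelKernel, mdot]
  congr 1
  push_cast
  rw [Finset.mul_sum, ← Finset.sum_neg_distrib]
  refine Finset.sum_congr rfl fun i _ => ?_
  simp only [fresnelCoeff]
  push_cast
  ring

/-- The normalization of the Fourier transform of `fresnelKernel`. -/
def fresnelConst (ε t : ℝ) : ℂ := ∏ i, ((Real.pi : ℂ) / fresnelCoeff ε t i) ^ (1 / 2 : ℂ)

/-- The Gaussian factor of the Fourier transform of `fresnelKernel`. -/
def fresnelDual (ε t : ℝ) (p : Mink) : ℂ :=
  Complex.exp (-∑ i, (p i : ℂ) ^ 2 / (4 * fresnelCoeff ε t i))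

theorem etaDiag_sq (i : Fin 4) : etaDiag i ^ 2 = 1 := by rw [sq, etaDiag_mul_self]

theorem fresnelKernel_mul_planeWave (ε t : ℝ) (p x : Mink) :
    fresnelKernel ε t x * planeWave p x = Complex.exp (-∑ i, fresnelCoeff ε t i * (x i : ℂ) ^ 2 +
      ∑ i, (Complex.I * etaDiag i * p i) * (x i : ℂ)) := by
  rw [fresnelKernel, planeWave, ← Complex.exp_add, mdot]
  congr 2
  push_cast
  rw [Finset.mul_sum]
  exact Finset.sum_congr rfl fun i _ => by ring

theorem integral_fresnelKernel_mul_planeWave {ε : ℝ} (hε : 0 < ε) (t : ℝ) (p : Mink) :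
    ∫ x, fresnelKernel ε t x * planeWave p x = fresnelConst ε t * fresnelDual ε t p := by
  rw [← (PiLp.volume_preserving_toLp (Fin 4)).integral_comp
    (MeasurableEquiv.toLp 2 _).measurableEmbedding]
  simp only [fresnelKernel_mul_planeWave]
  rw [GaussianFourier.integral_cexp_neg_sum_mul_add (b := fresnelCoeff ε t)
    (fun i => by rw [fresnelCoeff_re]; exact hε), Finset.prod_mul_distrib, fresnelConst,
    ← Complex.exp_sum, fresnelDual, ← Finset.sum_neg_distrib]
  congr 2
  refine Finset.sum_congr rfl fun i _ => ?_
  have h : ((etaDiag i : ℝ) : ℂ) ^ 2 = 1 := by exact_mod_cast etaDiag_sq i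
  rw [mul_pow, mul_pow, Complex.I_sq, h]
  ring

theorem integrable_fresnelKernel {ε : ℝ} (hε : 0 < ε) (t : ℝ) :
    Integrable (fresnelKernel ε t) := by
  have h := GaussianFourier.integrable_cexp_neg_sum_mul_add (b := fresnelCoeff ε t)
    (fun i => by rw [fresnelCoeff_re]; exact hε) 0
  refine ((PiLp.volume_preserving_ofLp (Fin 4)).integrable_comp_emb
    (MeasurableEquiv.toLp 2 _).symm.measurableEmbedding).2 h |>.congr
      (Eventually.of_forall fun x => ?_)
  simp [fresnelKernel]

theorem integral_fresnelKernel_mul {ε : ℝ} (hε : 0 < ε) (t : ℝ) (φ : 𝓢(Mink, ℂ)) :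
    ∫ x, fresnelKernel ε t x * φ x = ((2 * Real.pi : ℝ) : ℂ)⁻¹ ^ 4 *
      (fresnelConst ε t * ∫ p, fresnelDual ε t p * minkFourier φ p) := by
  have hint : Integrable (Function.uncurry fun (x p : Mink) =>
      fresnelKernel ε t x * (minkFourier φ p * planeWave p x)) (volume.prod volume) := by
    have h := (integrable_fresnelKernel hε t).mul_prod
      ((minkFourierCLM φ).integrable (μ := volume))
    rw [coe_minkFourierCLM] at h
    have hc : Continuous fun z : Mink × Mink => planeWave z.2 z.1 :=
      continuous_snd.planeWave continuous_fst
    refine (h.bdd_mul (c := 1) hc.aestronglyMeasurable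
      (Eventually.of_forall fun z => (norm_planeWave _ _).le)).congr
      (Eventually.of_forall fun z => ?_)
    simp only [Function.uncurry]
    ring
  calc ∫ x, fresnelKernel ε t x * φ x = ∫ x, ((2 * Real.pi : ℝ) : ℂ)⁻¹ ^ 4 *
        ∫ p, fresnelKernel ε t x * (minkFourier φ p * planeWave p x) := by
        refine integral_congr_ae (Eventually.of_forall fun x => ?_)
        simp only
        rw [integral_const_mul, ← integral_minkFourier_mul_planeWave φ x]
        ring
    _ = ((2 * Real.pi : ℝ) : ℂ)⁻¹ ^ 4 *
          ∫ p, ∫ x, fresnelKernel ε t x * (minkFourier φ p * planeWave p x) := by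
        rw [integral_const_mul, integral_integral_swap hint]
    _ = _ := by
        congr 1
        rw [← integral_const_mul]
        refine integral_congr_ae (Eventually.of_forall fun p => ?_)
        simp only
        rw [← mul_assoc, ← integral_fresnelKernel_mul_planeWave hε, ← integral_mul_const]
        exact integral_congr_ae (Eventually.of_forall fun x => by simp only; ring)

theorem inv_etaDiag (i : Fin 4) : (etaDiag i : ℂ)⁻¹ = etaDiag i :=
  inv_eq_of_mul_eq_one_left (by exact_mod_cast etaDiag_mul_self i)

theorem fresnelCoeff_zero_ne {t : ℝ} (ht : 0 < t) (i : Fin 4) : fresnelCoeff 0 t i ≠ 0 := by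
  have h : etaDiag i ≠ 0 := fun h => by
    have := etaDiag_sq i
    rw [h] at this
    norm_num at this
  simp [fresnelCoeff, h, ht.ne']

theorem continuous_fresnelCoeff (t : ℝ) (i : Fin 4) :
    Continuous fun ε : ℝ => fresnelCoeff ε t i := by
  unfold fresnelCoeff
  fun_prop

theorem pi_div_fresnelCoeff_zero (t : ℝ) (i : Fin 4) :
    (Real.pi : ℂ) / fresnelCoeff 0 t i = ((-(Real.pi / t * etaDiag i) : ℝ) : ℂ) * Complex.I := by
  have h := inv_etaDiag i
  rw [fresnelCoeff, Complex.ofReal_zero, zero_add, div_eq_mul_inv, mul_inv, mul_inv, h,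
    Complex.inv_I]
  push_cast
  ring

theorem tendsto_fresnelConst {t : ℝ} (ht : 0 < t) :
    Tendsto (fun ε => fresnelConst ε t) (𝓝[>] 0) (𝓝 (fresnelConst 0 t)) := by
  have hc : ContinuousAt (fun ε => fresnelConst ε t) 0 := by
    refine tendsto_finsetProd _ fun i _ => ?_
    refine ContinuousAt.cpow (continuousAt_const.div (continuous_fresnelCoeff t i).continuousAt
      (fresnelCoeff_zero_ne ht i)) continuousAt_const ?_
    rw [pi_div_fresnelCoeff_zero, Complex.mem_slitPlane_iff]
    right
    have h := etaDiag_sq i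
    have h' : etaDiag i ≠ 0 := fun h0 => by rw [h0] at h; norm_num at h
    simp [Real.pi_ne_zero, ht.ne', h']
  exact hc.tendsto.mono_left nhdsWithin_le_nhds

theorem fresnelDual_zero {t : ℝ} (p : Mink) :
    fresnelDual 0 t p = Complex.exp (Complex.I * (((4 * t)⁻¹ : ℝ) : ℂ) * (mdot p p : ℂ)) := by
  rw [fresnelDual, mdot]
  congr 1
  push_cast
  rw [Finset.mul_sum, ← Finset.sum_neg_distrib]
  refine Finset.sum_congr rfl fun i _ => ?_
  have h := inv_etaDiag i
  rw [fresnelCoeff, Complex.ofReal_zero, zero_add, div_eq_mul_inv, mul_inv, mul_inv, mul_inv, h,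
    Complex.inv_I, mul_inv]
  ring

theorem norm_fresnelDual_le {ε : ℝ} (hε : 0 < ε) (t : ℝ) (p : Mink) :
    ‖fresnelDual ε t p‖ ≤ 1 := by
  rw [fresnelDual, Complex.norm_exp, Real.exp_le_one_iff, Complex.neg_re, Complex.re_sum,
    neg_nonpos]
  refine Finset.sum_nonneg fun i _ => ?_
  have h : ((p i : ℂ) ^ 2 / (4 * fresnelCoeff ε t i)) =
      (((p i) ^ 2 / 4 : ℝ) : ℂ) * (fresnelCoeff ε t i)⁻¹ := by
    push_cast
    rw [div_eq_mul_inv, mul_inv]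
    ring
  rw [h, Complex.re_ofReal_mul, Complex.inv_re, fresnelCoeff_re]
  have := Complex.normSq_nonneg (fresnelCoeff ε t i)
  positivity

/-- The phases of the four Fresnel integrals, `e^{-iπ/4}` once and `e^{iπ/4}` three times,
combine to `i`. -/
theorem fresnelConst_zero {t : ℝ} (ht : 0 < t) :
    fresnelConst 0 t = Complex.I * ((Real.pi / t : ℝ) : ℂ) ^ 2 := by
  have ha : 0 < Real.pi / t := div_pos Real.pi_pos ht
  set a := Real.pi / t
  have h0 : (Real.pi : ℂ) / fresnelCoeff 0 t 0 = -((a : ℂ) * Complex.I) := by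
    rw [pi_div_fresnelCoeff_zero]
    simp [etaDiag, a]
  have h1 : ∀ i : Fin 4, i ≠ 0 → (Real.pi : ℂ) / fresnelCoeff 0 t i = (a : ℂ) * Complex.I := by
    intro i hi
    rw [pi_div_fresnelCoeff_zero]
    have : etaDiag i = -1 := by fin_cases i <;> simp_all [etaDiag]
    rw [this]
    simp [a]
  rw [fresnelConst, Fin.prod_univ_four, h0, h1 1 (by decide), h1 2 (by decide), h1 3 (by decide)]
  set w : ℂ := ((a : ℂ) * Complex.I) ^ (1 / 2 : ℂ)
  have hw2 : w ^ 2 = (a : ℂ) * Complex.I := by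
    have h := Complex.cpow_nat_inv_pow ((a : ℂ) * Complex.I) (n := 2) (by norm_num)
    rw [← h]
    simp [w]
  have harg : ((a : ℂ) * Complex.I).arg ≠ Real.pi := by
    rw [Complex.arg_real_mul _ ha, Complex.arg_I]
    have := Real.pi_pos
    linarith
  have hz : (-((a : ℂ) * Complex.I)) ^ (1 / 2 : ℂ) = (starRingEnd ℂ) w := by
    have h : -((a : ℂ) * Complex.I) = (starRingEnd ℂ) ((a : ℂ) * Complex.I) := by simp
    rw [h, Complex.conj_cpow _ _ harg]
    have h2 : (starRingEnd ℂ) (1 / 2) = 1 / 2 := by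
      rw [map_div₀, map_one, Complex.conj_ofNat]
    rw [h2]
  have hzw : (starRingEnd ℂ) w * w = a := by
    rw [mul_comm, Complex.mul_conj, Complex.normSq_eq_norm_sq, ← norm_pow, hw2]
    simp [abs_of_pos ha]
  rw [hz]
  calc _ = ((starRingEnd ℂ) w * w) * w ^ 2 := by ring
    _ = _ := by rw [hzw, hw2]; ring

/-- The Fresnel integral: the Fourier transform of `e^{-itx²}` is
`i (π/t)² e^{ip²/(4t)}`. -/
theorem oscInt_neg_eq {t : ℝ} (ht : 0 < t) (φ : 𝓢(Mink, ℂ)) :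
    oscInt (-t) φ = ((2 * Real.pi : ℝ) : ℂ)⁻¹ ^ 4 *
      (Complex.I * ((Real.pi / t : ℝ) : ℂ) ^ 2 * oscInt (4 * t)⁻¹ (minkFourier φ)) := by
  -- both sides are limits of their Gaussian regularizations
  have h1 : Tendsto (fun ε => ∫ x, fresnelKernel ε t x * φ x) (𝓝[>] 0)
      (𝓝 (oscInt (-t) φ)) := by
    simp only [oscInt, ← fresnelKernel_zero]
    refine tendsto_integral_filter_of_dominated_convergence (fun x => ‖φ x‖)
      (Eventually.of_forall fun ε => ((continuous_fresnelKernel ε t).mul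
        φ.continuous).aestronglyMeasurable) ?_ (φ.integrable (μ := volume)).norm
      (Eventually.of_forall fun x => ?_)
    · filter_upwards [self_mem_nhdsWithin] with ε hε
      refine Eventually.of_forall fun x => ?_
      rw [norm_mul]
      exact mul_le_of_le_one_left (norm_nonneg _) (norm_fresnelKernel_le (le_of_lt hε) t x)
    · have hc : Continuous fun ε => fresnelKernel ε t x * φ x := by
        unfold fresnelKernel
        have := continuous_fresnelCoeff t
        fun_prop
      exact (hc.tendsto 0).mono_left nhdsWithin_le_nhds
  have h2 : Tendsto (fun ε => ∫ p, fresnelDual ε t p * minkFourierCLM φ p) (𝓝[>] 0)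
      (𝓝 (oscInt (4 * t)⁻¹ (minkFourierCLM φ))) := by
    simp only [oscInt, ← fresnelDual_zero]
    refine tendsto_integral_filter_of_dominated_convergence (fun p => ‖minkFourierCLM φ p‖)
      (Eventually.of_forall fun ε => ?_) ?_ ((minkFourierCLM φ).integrable (μ := volume)).norm
      (Eventually.of_forall fun p => ?_)
    · have hc : Continuous fun p => fresnelDual ε t p := by
        unfold fresnelDual
        simp only [div_eq_mul_inv]
        fun_prop
      exact (hc.mul (minkFourierCLM φ).continuous).aestronglyMeasurable
    · filter_upwards [self_mem_nhdsWithin] with ε hε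
      refine Eventually.of_forall fun p => ?_
      rw [norm_mul]
      exact mul_le_of_le_one_left (norm_nonneg _) (norm_fresnelDual_le hε t p)
    · have hc : ContinuousAt (fun ε => fresnelDual ε t p) 0 := by
        refine ContinuousAt.cexp (ContinuousAt.neg (tendsto_finsetSum _ fun i _ => ?_))
        exact (continuousAt_const.div (continuousAt_const.mul
          (continuous_fresnelCoeff t i).continuousAt)
          (mul_ne_zero (by norm_num) (fresnelCoeff_zero_ne ht i)))
      exact (hc.mul continuousAt_const).tendsto.mono_left nhdsWithin_le_nhds
  rw [coe_minkFourierCLM] at h2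
  have h3 := ((tendsto_fresnelConst ht).mul h2).const_mul (((2 * Real.pi : ℝ) : ℂ)⁻¹ ^ 4)
  rw [fresnelConst_zero ht] at h3
  refine tendsto_nhds_unique h1 (h3.congr' ?_)
  filter_upwards [self_mem_nhdsWithin] with ε hε
  exact (integral_fresnelKernel_mul hε t φ).symm

theorem integral_comp_inv_four_mul (F : ℝ → ℂ) :
    ∫ t in Ioi (0 : ℝ), ((t : ℂ) ^ 2)⁻¹ * F (4 * t)⁻¹ = 4 * ∫ s in Ioi (0 : ℝ), F s := by
  have h1 := integral_comp_rpow_Ioi (fun y => F (4⁻¹ * y)) (p := -1) (by norm_num)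
  have h2 := integral_comp_mul_left_Ioi F 0 (b := 4⁻¹) (by norm_num)
  rw [mul_zero, inv_inv, Complex.real_smul] at h2
  rw [h2] at h1
  push_cast at h1
  rw [← h1]
  refine setIntegral_congr_fun measurableSet_Ioi fun t ht => ?_
  have ht' : (0 : ℝ) < t := ht
  simp only [abs_neg, abs_one, one_mul, Real.rpow_neg_one, Complex.real_smul, mul_inv]
  congr 1
  rw [show (-1 : ℝ) - 1 = -(2 : ℕ) by norm_num, Real.rpow_neg ht'.le, Real.rpow_natCast]
  push_cast
  rfl

/-- Inserting the Fresnel integral into the Schwinger integral of `(x² - i0)⁻¹` and substituting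
`s = 1/(4t)` gives the Schwinger integral of `(p² + i0)⁻¹`. -/
theorem propFunctional_neg_one_eq (φ : 𝓢(Mink, ℂ)) :
    propFunctional (-1) 0 φ = ((2 * Real.pi : ℝ) : ℂ)⁻¹ ^ 4 *
      (-(4 * (Real.pi : ℂ) ^ 2 * Complex.I) * propFunctional 1 0 (minkFourier φ)) := by
  have h1 : ∫ t in Ioi (0 : ℝ), oscInt (-t) φ = ∫ t in Ioi (0 : ℝ),
      ((2 * Real.pi : ℝ) : ℂ)⁻¹ ^ 4 * (Complex.I * (Real.pi : ℂ) ^ 2) *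
        (((t : ℂ) ^ 2)⁻¹ * oscInt (4 * t)⁻¹ (minkFourier φ)) := by
    refine setIntegral_congr_fun measurableSet_Ioi fun t ht => ?_
    rw [oscInt_neg_eq ht]
    push_cast
    rw [div_pow, div_eq_mul_inv]
    ring
  rw [integral_const_mul, integral_comp_inv_four_mul fun s => oscInt s (minkFourier φ)] at h1
  simp only [propFunctional, mul_zero, neg_zero, Complex.ofReal_zero, zero_mul, Complex.exp_zero,
    one_mul, neg_one_mul, h1]
  push_cast
  ring

/-- The constant `-4π²i` relating `1/(x² - i0)` to the Fourier transform of `1/(p² + i0)`. -/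
def feynmanConst : ℂ := -(4 * (Real.pi : ℂ) ^ 2 * Complex.I)

theorem feynmanConst_ne_zero : feynmanConst ≠ 0 := by
  simp [feynmanConst, Real.pi_ne_zero]

/-- The massless Feynman propagator, as a momentum space integral. -/
def feynmanPropagator : 𝓢'(Mink, ℂ) := propagator 0 (fun _ => feynmanConst) (GrowthKernel.const _)

theorem isMasslessFeynman_feynmanPropagator : IsMasslessFeynman feynmanPropagator := fun φ => by
  have h1 : FlowBounded (fun _ => (1 : ℂ)) fun p : Mink => 1 * (1 + ‖p‖) ^ 0 := by
    simpa using FlowBounded.const 1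
  have h2 := h1.mul_schwartz φ
  simp only [one_mul] at h2
  have h3 := tendsto_integral_div_of_flowBounded (σ := -1) (by norm_num) 0 h2
  rw [feynmanPropagator, propagator_apply, propFunctional_const_mul]
  change Tendsto _ _ (𝓝 (_ * (-(4 * (Real.pi : ℂ) ^ 2 * Complex.I) *
    propFunctional 1 0 (minkFourier φ))))
  rw [← propFunctional_neg_one_eq]
  refine h3.congr fun ε => ?_
  refine integral_congr_ae (Eventually.of_forall fun x => ?_)
  simp only
  push_cast
  ring

/-! ### The wavefront set of the massless Feynman propagator -/

theorem mdot_add_smul_minkReflect {x : Mink} (hx : mdot x x = 0) (s : ℝ) :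
    mdot (x + s • minkReflect x) (x + s • minkReflect x) = 2 * s * ‖x‖ ^ 2 := by
  have h1 : mdot (minkReflect x) (minkReflect x) = 0 := by
    rw [mdot_eq_inner, minkReflect_minkReflect, real_inner_comm, ← mdot_eq_inner, hx]
  simp only [mdot_add_left, mdot_add_right, mdot_smul_left, mdot_smul_right, hx, h1,
    mdot_comm x (minkReflect x), mdot_minkReflect_self]
  ring

theorem tendsto_add_smul_minkReflect (x : Mink) :
    Tendsto (fun s : ℝ => x + s • minkReflect x) (𝓝[>] 0) (𝓝 x) := by
  have hc : Continuous fun s : ℝ => x + s • minkReflect x := by fun_prop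
  have h := (hc.tendsto 0).mono_left (nhdsWithin_le_nhds (s := Ioi 0))
  rwa [zero_smul, add_zero] at h

theorem exists_mem_mdot_ne_zero {V : Set Mink} (hV : IsOpen V) {p : Mink} (hp : p ∈ V)
    (hp0 : p ≠ 0) : ∃ q ∈ V, mdot q q ≠ 0 := by
  by_cases h : mdot p p = 0
  · obtain ⟨s, hs, hs0⟩ := (((tendsto_add_smul_minkReflect p).eventually (hV.mem_nhds hp)).and
      self_mem_nhdsWithin).exists
    have hs0' : (0 : ℝ) < s := hs0
    have := norm_pos_iff.2 hp0
    exact ⟨_, hs, by rw [mdot_add_smul_minkReflect h]; positivity⟩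
  · exact ⟨p, hp, h⟩

/-- For a constant kernel and a momentum `p` off the light cone, the shifted functional has the
elliptic asymptotics `r⁻² c / p² ∫ f` along the ray through `p`. -/
theorem tendsto_sq_mul_shiftedProp (c : ℂ) {p : Mink} (hp : mdot p p ≠ 0) (f : 𝓢(Mink, ℂ)) :
    Tendsto (fun r : ℝ => (r : ℂ) ^ 2 * shiftedProp 1 0 (fun _ => c) f (r • p)) atTop
      (𝓝 (c / (mdot p p : ℂ) * ∫ q, f q)) := by
  set a := |mdot p p| / 2 with ha
  have ha0 : 0 < a := by positivity
  have hW : IsOpen {q : Mink | a < |mdot q q|} :=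
    isOpen_lt continuous_const (continuous_id.mdot continuous_id).abs
  obtain ⟨ε, hε, hεW⟩ := Metric.nhds_basis_closedBall.mem_iff.1
    (hW.mem_nhds (show a < |mdot p p| from half_lt_self (abs_pos.2 hp)))
  let χ : ContDiffBump p := ⟨ε / 2, ε, by positivity, by linarith⟩
  have hOut : ∀ q ∈ Metric.closedBall p χ.rOut, a ≤ |mdot q q| := fun q hq => (hεW hq).le
  have hK : GrowthKernel fun _ : Mink => c := GrowthKernel.const c
  have hp0 : Tendsto (fun r : ℝ => r⁻¹) atTop (𝓝 0) := tendsto_inv_atTop_zero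
  obtain ⟨C, hC, hfar⟩ := exists_flowBounded_tail hK χ f 3
  -- the near part, in the variable `q - r p` and with `r²` absorbed into the denominator
  set N : ℝ → Mink → ℂ := fun r q => c * (χ (r⁻¹ • q + p) : ℂ) * f q /
    (mdot (r⁻¹ • q + p) (r⁻¹ • q + p) : ℂ) with hN
  have hk : ∀ r : ℝ, 1 ≤ r → ‖r • p - r • p‖ ≤ r * (χ.rIn / 2) := fun r hr => by
    have := χ.rIn_pos
    rw [sub_self, norm_zero]
    positivity
  have hnear : ∀ r : ℝ, 1 ≤ r → (r : ℂ) ^ 2 * propFunctional 1 0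
      (fun q => c * (χ ((r : ℝ)⁻¹ • q) : ℂ) * f (q - r • p)) = ∫ q, N r q := by
    intro r hr
    have hr0 : r ≠ 0 := by positivity
    have hr0' : (r : ℂ) ≠ 0 := by exact_mod_cast hr0
    rw [propFunctional_bump_eq (one_pow 2) 0 hK χ ha0 hOut f (by simpa using hr),
      ← integral_add_right_eq_self _ (r • p), ← integral_const_mul]
    refine integral_congr_ae (Eventually.of_forall fun q => ?_)
    have h1 : r⁻¹ • (q + r • p) = r⁻¹ • q + p := by
      rw [smul_add, smul_smul, inv_mul_cancel₀ hr0, one_smul]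
    have h2 : q + r • p = r • (r⁻¹ • q + p) := by
      rw [smul_add, smul_smul, mul_inv_cancel₀ hr0, one_smul]
    simp only [h1, add_sub_cancel_right, hN]
    rw [h2, mdot_smul_left, mdot_smul_right]
    push_cast
    rw [sub_zero]
    field_simp
  have hNlim : Tendsto (fun r => ∫ q, N r q) atTop (𝓝 (∫ q, c * 1 * f q / (mdot p p : ℂ))) := by
    refine tendsto_integral_filter_of_dominated_convergence (fun q => ‖c‖ * ‖f q‖ * a⁻¹)
      (Eventually.of_forall fun r => ?_)
      (Eventually.of_forall fun r => Eventually.of_forall fun q => ?_)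
      (((f.integrable (μ := volume)).norm.const_mul _).mul_const _)
      (Eventually.of_forall fun q => ?_)
    · have h1 : Continuous fun q : Mink => r⁻¹ • q + p := by fun_prop
      have h2 : Measurable fun q : Mink => (mdot (r⁻¹ • q + p) (r⁻¹ • q + p) : ℂ) :=
        (Complex.continuous_ofReal.comp (h1.mdot h1)).measurable
      have h3 : Continuous fun q : Mink => (χ (r⁻¹ • q + p) : ℂ) :=
        Complex.continuous_ofReal.comp (χ.continuous.comp h1)
      exact (((h3.const_mul c).mul f.continuous).measurable.div h2).aestronglyMeasurable
    · simp only [hN]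
      by_cases hq : χ (r⁻¹ • q + p) = 0
      · rw [hq]
        simp only [Complex.ofReal_zero, mul_zero, zero_mul, zero_div, norm_zero]
        positivity
      · have h1 : r⁻¹ • q + p ∈ Metric.closedBall p χ.rOut := by
          rw [← χ.tsupport_eq]; exact subset_tsupport _ hq
        rw [norm_div, norm_mul, norm_mul, Complex.norm_real, Complex.norm_real, Real.norm_eq_abs,
          Real.norm_eq_abs, abs_of_nonneg χ.nonneg, div_eq_mul_inv]
        have h2 := χ.le_one (x := r⁻¹ • q + p)
        have h3 := inv_anti₀ ha0 (hOut _ h1)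
        have h4 := χ.nonneg (x := r⁻¹ • q + p)
        calc _ ≤ ‖c‖ * 1 * ‖f q‖ * a⁻¹ := by gcongr
          _ = _ := by ring
    · have h1 : Tendsto (fun r : ℝ => r⁻¹ • q + p) atTop (𝓝 p) := by
        have := (hp0.smul_const q).add_const p
        rwa [zero_smul, zero_add] at this
      have h2 : Tendsto (fun r : ℝ => (χ (r⁻¹ • q + p) : ℂ)) atTop (𝓝 1) := by
        have h3 := (Complex.continuous_ofReal.comp χ.continuous).tendsto p
        have h4 : χ p = 1 := χ.one_of_mem_closedBall (Metric.mem_closedBall_self χ.rIn_pos.le)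
        simp only [Function.comp_apply, h4, Complex.ofReal_one] at h3
        exact h3.comp h1
      have h3 : Tendsto (fun r : ℝ => (mdot (r⁻¹ • q + p) (r⁻¹ • q + p) : ℂ)) atTop
          (𝓝 (mdot p p : ℂ)) :=
        ((Complex.continuous_ofReal.comp continuous_mdot_self).tendsto p).comp h1
      exact ((tendsto_const_nhds.mul h2).mul tendsto_const_nhds).div h3 (by exact_mod_cast hp)
  -- the far part is `O(r⁻³)`
  have hfarlim : Tendsto (fun r : ℝ => (r : ℂ) ^ 2 * propFunctional 1 0
      (fun q => c * (1 - (χ ((r : ℝ)⁻¹ • q) : ℂ)) * f (q - r • p))) atTop (𝓝 0) := by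
    have h1 : Tendsto (fun r : ℝ => C * propConst * r⁻¹) atTop (𝓝 0) := by
      simpa using hp0.const_mul (C * propConst)
    refine squeeze_zero_norm' ?_ h1
    filter_upwards [eventually_ge_atTop 1] with r hr
    have hr0 : 0 < r := by linarith
    have h2 := (hfar r hr (r • p) (hk r hr)).norm_propFunctional_le (σ := 1) (one_pow 2) 0
    rw [norm_mul, norm_pow, Complex.norm_real, Real.norm_eq_abs, abs_of_pos hr0]
    calc _ ≤ r ^ 2 * (C * (r ^ 3)⁻¹ * propConst) := by gcongr
      _ = _ := by field_simp
  have hsum := hNlim.add hfarlim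
  have hval : (∫ q, c * 1 * f q / (mdot p p : ℂ)) + 0 = c / (mdot p p : ℂ) * ∫ q, f q := by
    rw [add_zero, ← integral_const_mul]
    exact integral_congr_ae (Eventually.of_forall fun q => by simp only; ring)
  rw [hval] at hsum
  refine hsum.congr' ?_
  filter_upwards [eventually_ge_atTop 1] with r hr
  rw [shiftedProp_eq_add (one_pow 2) 0 hK χ f hr (hk r hr), mul_add, hnear r hr]

theorem integral_minkFourier (f : 𝓢(Mink, ℂ)) :
    ∫ p, minkFourier f p = ((2 * Real.pi : ℝ) : ℂ) ^ 4 * f 0 := by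
  have h0 : ((2 * Real.pi : ℝ) : ℂ) ≠ 0 := by exact_mod_cast (by positivity : 2 * Real.pi ≠ 0)
  have h := integral_minkFourier_mul_planeWave f 0
  simp only [planeWave_comm _ (0 : Mink), planeWave_zero, mul_one] at h
  rw [← h, ← mul_assoc, ← mul_pow, mul_inv_cancel₀ h0, one_pow, one_mul]

/-- Every direction is singular over the origin: any open cone contains momenta off the light
cone, and in those directions the propagator decays only like `|p|⁻²`. -/
theorem mem_frequencySet_zero {c : ℂ} (hc : c ≠ 0) (hK : GrowthKernel fun _ : Mink => c) {p : Mink}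
    (hp : p ≠ 0) : p ∈ frequencySet (restrictTo ⊤ (propagator 0 (fun _ => c) hK)) 0 := by
  refine ⟨hp, fun φ hφ ⟨V, hV, hpV, hcone, hr⟩ => ?_⟩
  obtain ⟨q, hqV, hq⟩ := exists_mem_mdot_ne_zero hV hpV hp
  have hq0 : q ≠ 0 := fun h => hq (by rw [h]; simp [mdot])
  have hqn := norm_pos_iff.2 hq0
  have h0 : ((2 * Real.pi : ℝ) : ℂ) ≠ 0 := by exact_mod_cast (by positivity : 2 * Real.pi ≠ 0)
  have h1 := (tendsto_sq_mul_shiftedProp c hq (minkFourierCLM (testToSchwartz φ))).const_mul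
    (((2 * Real.pi : ℝ) : ℂ)⁻¹ ^ 4)
  rw [coe_minkFourierCLM, integral_minkFourier] at h1
  obtain ⟨C, hC⟩ := hr 3
  have h2 : Tendsto (fun r : ℝ => C * (‖q‖ ^ 3)⁻¹ * r⁻¹) atTop (𝓝 0) := by
    simpa using (tendsto_inv_atTop_zero (𝕜 := ℝ)).const_mul (C * (‖q‖ ^ 3)⁻¹)
  -- rapid decay would force the limit of `r²` times the localized Fourier transform to be zero
  have h3 : Tendsto (fun r : ℝ => ((2 * Real.pi : ℝ) : ℂ)⁻¹ ^ 4 * ((r : ℂ) ^ 2 *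
      shiftedProp 1 0 (fun _ => c) (minkFourier (testToSchwartz φ)) (r • q))) atTop (𝓝 0) := by
    refine squeeze_zero_norm' ?_ h2
    filter_upwards [eventually_gt_atTop 0] with r hr0
    have h4 := hC _ (hcone q hqV r hr0)
    rw [localFourier_propagator] at h4
    change _ * ‖_ * shiftedProp 1 0 (fun _ => c) (minkFourier (testToSchwartz φ)) _‖ ≤ C at h4
    have h5 : ‖r • q‖ = r * ‖q‖ := by rw [norm_smul, Real.norm_eq_abs, abs_of_pos hr0]
    rw [h5, norm_mul] at h4
    set z : ℝ := ‖shiftedProp 1 0 (fun _ => c) (minkFourier (testToSchwartz φ)) (r • q)‖ with hz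
    set w : ℝ := ‖((2 * Real.pi : ℝ) : ℂ)⁻¹ ^ 4‖ with hw
    have h6 : (r * ‖q‖) ^ 3 * (w * z) ≤ C := by
      refine le_trans (mul_le_mul_of_nonneg_right ?_ (by positivity)) h4
      exact pow_le_pow_left₀ (by positivity) (by linarith) 3
    calc _ = w * (r ^ 2 * z) := by
          rw [norm_mul, norm_mul, norm_pow (r : ℂ), Complex.norm_real, Real.norm_eq_abs,
            abs_of_pos hr0]
      _ = (r * ‖q‖) ^ 3 * (w * z) * (‖q‖ ^ 3)⁻¹ * r⁻¹ := by field_simp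
      _ ≤ _ := by gcongr
  have h7 := tendsto_nhds_unique h1 h3
  have h8 : (mdot q q : ℂ) ≠ 0 := by exact_mod_cast hq
  have h9 : testToSchwartz φ 0 ≠ 0 := hφ
  refine absurd h7 ?_
  exact mul_ne_zero (pow_ne_zero _ (inv_ne_zero h0))
    (mul_ne_zero (div_ne_zero hc h8) (mul_ne_zero (pow_ne_zero _ h0) h9))

/-- Momenta near the axis of a cone arise only from such momenta, up to a large remainder. -/
theorem exists_notMem_coneCompl {e : Mink} (he : ‖e‖ = 1) {c c' : ℝ} (hc : c < c')
    (hc0 : 0 < c) (hc1 : c' < 1) : ∃ δ : ℝ, 0 < δ ∧ δ ≤ 1 ∧ ∀ L ∈ (coneCompl e c')ᶜ, ∀ k,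
      (k ∈ (coneCompl e c)ᶜ \ {0} ∧ δ * ‖L‖ ≤ ‖k‖) ∨ δ * ‖L‖ ≤ ‖L - k‖ := by
  refine ⟨(c' - c) / 2, by linarith, by linarith, fun L hL k => ?_⟩
  -- if `L - k` is small then `k` is close to `L` in the cone of parameter `c'`
  by_cases h : (c' - c) / 2 * ‖L‖ ≤ ‖L - k‖
  · exact Or.inr h
  rw [not_le] at h
  have hL' : c' * ‖L‖ ≤ inner ℝ L e := not_lt.1 hL
  have hL0 : 0 < ‖L‖ := by
    by_contra h0
    have h0' : ‖L‖ = 0 := le_antisymm (not_lt.1 h0) (norm_nonneg L)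
    rw [h0', mul_zero] at h
    exact absurd h (not_lt.2 (norm_nonneg _))
  have h1 := real_inner_le_norm (L - k) e
  rw [he, mul_one, inner_sub_left] at h1
  have h2 : ‖k‖ ≤ ‖L‖ + ‖L - k‖ := by
    have := norm_sub_le L (L - k)
    rwa [sub_sub_cancel] at this
  have h3 : ‖L‖ ≤ ‖k‖ + ‖L - k‖ := by
    have := norm_add_le k (L - k)
    rwa [add_sub_cancel] at this
  have h4 : (c' - c) / 2 * ‖L‖ ≤ ‖k‖ := by nlinarith
  refine Or.inl ⟨⟨fun hlt => ?_, fun h0 => ?_⟩, h4⟩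
  · have hlt' : inner ℝ k e < c * ‖k‖ := hlt
    have h5 : c * ‖k‖ ≤ c * ‖L‖ + ‖L - k‖ := by
      nlinarith [mul_nonneg (by linarith : 0 ≤ 1 - c) (norm_nonneg (L - k))]
    linarith
  · rw [mem_singleton_iff.1 h0, norm_zero] at h4
    nlinarith [mul_pos (sub_pos.2 hc) hL0]

/-- An open cone around `e` contains a closed convex cone around `e`. -/
theorem exists_notMem_coneCompl_subset {e : Mink} (he : ‖e‖ = 1) {V : Set Mink} (hV : IsOpen V)
    (heV : e ∈ V) (hcone : ∀ k ∈ V, ∀ t : ℝ, 0 < t → t • k ∈ V) :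
    ∃ c : ℝ, 0 < c ∧ c < 1 ∧ (coneCompl e c)ᶜ \ {0} ⊆ V := by
  obtain ⟨ρ, hρ, hball⟩ := Metric.isOpen_iff.1 hV e heV
  refine ⟨max (1 / 2) (1 - ρ ^ 2 / 4), by positivity, max_lt (by norm_num) (by nlinarith),
    fun k ⟨hk, hk0⟩ => ?_⟩
  have hk0' : k ≠ 0 := hk0
  have hkn := norm_pos_iff.2 hk0'
  have hk' : max (1 / 2) (1 - ρ ^ 2 / 4) * ‖k‖ ≤ inner ℝ k e := not_lt.1 hk
  have h1 : (1 - ρ ^ 2 / 4) * ‖k‖ ≤ inner ℝ k e :=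
    (mul_le_mul_of_nonneg_right (le_max_right _ _) hkn.le).trans hk'
  have h2 : 1 - ρ ^ 2 / 4 ≤ inner ℝ (‖k‖⁻¹ • k) e := by
    rw [real_inner_smul_left, inv_mul_eq_div, le_div_iff₀ hkn]
    exact h1
  have h3 : ‖‖k‖⁻¹ • k - e‖ ^ 2 < ρ ^ 2 := by
    rw [norm_sub_sq_real, norm_inv_norm_smul hk0', he]
    nlinarith
  have h4 : ‖k‖⁻¹ • k ∈ V := hball (mem_ball_iff_norm.2 (lt_of_pow_lt_pow_left₀ 2 hρ.le h3))
  have h5 := hcone _ h4 ‖k‖ hkn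
  rwa [smul_smul, mul_inv_cancel₀ hkn.ne', one_smul] at h5

theorem norm_minkFourier_le (f : Mink → ℂ) (k : Mink) : ‖minkFourier f k‖ ≤ ∫ x, ‖f x‖ := by
  refine (norm_integral_le_integral_norm _).trans_eq ?_
  simp only [norm_mul, norm_planeWave, one_mul]

/-- If the only direction allowed by microlocal regularity is absent from the wavefront set over a
lightlike point, then the propagator is a bounded function near that point. -/
theorem MicrolocallyRegular.exists_bound_of_notMem_frequencySet {μ : ℝ} {K : Mink → ℂ}
    (h : MicrolocallyRegular μ K) (hK : GrowthKernel K) {x : Mink} (hx : x ≠ 0) {t : ℝ}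
    (ht : 0 < t) (hfr : t • x ∉ frequencySet (restrictTo ⊤ (propagator μ K hK)) x) :
    ∃ (g : 𝓓((⊤ : Opens Mink), ℂ)) (C : ℝ), g x ≠ 0 ∧ ∀ ψ : 𝓓((⊤ : Opens Mink), ℂ),
      ‖restrictTo ⊤ (propagator μ K hK) (testMul g ψ ψ.contDiff)‖ ≤ C * ∫ y, ‖ψ y‖ := by
  set u := restrictTo ⊤ (propagator μ K hK) with hu
  have hex : ∃ φ : 𝓓((⊤ : Opens Mink), ℂ), φ x ≠ 0 ∧
      RapidlyDecayingNear (localFourier u φ) (t • x) := by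
    by_contra hcon
    push Not at hcon
    exact hfr ⟨smul_ne_zero ht.ne' hx, hcon⟩
  -- the localization `φ u` decays rapidly in the forbidden cone `V`
  obtain ⟨φ, hφ, V, hV, hxV, hcone, hrapid⟩ := hex
  have hxn := norm_pos_iff.2 hx
  set e := ‖x‖⁻¹ • x with he
  have he1 : ‖e‖ = 1 := norm_inv_norm_smul hx
  have heV : e ∈ V := by
    have h1 := hcone _ hxV (t⁻¹ * ‖x‖⁻¹) (by positivity)
    rwa [smul_smul, mul_right_comm, inv_mul_cancel₀ ht.ne', one_mul] at h1
  obtain ⟨c, hc0, hc1, hcV⟩ := exists_notMem_coneCompl_subset he1 hV heV hcone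
  obtain ⟨c', hcc', hc'1⟩ := exists_between hc1
  obtain ⟨c'', hc'c'', hc''1⟩ := exists_between hc'1
  -- outside a narrower cone the density of `u` decays rapidly
  obtain ⟨U, A, hU, hxU, hA, hAr⟩ := h.exists_spectralDensity (Ω := ⊤) hK (x := x) trivial hx he1
    (fun _ => rfl) hc''1
  obtain ⟨χ, hχ, hχ1⟩ := exists_cutoff (Ω := ⊤) (K := {x}) isCompact_singleton hU
    (singleton_subset_iff.2 hxU) (fun _ _ => trivial)
  set g := testMul χ φ φ.contDiff with hg
  have hout : RapidOn (localFourier u g) (coneCompl e c') :=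
    hA.rapidOn_localFourier he1 hc'c'' (by linarith) hc''1 hAr
      ((tsupport_testMul_subset_left _ _ _).trans hχ)
  set F : Mink → ℂ := fun k => (((2 * Real.pi : ℝ) : ℂ)⁻¹ ^ 4) ^ 2 *
    shiftedProp 1 μ K (minkFourier φ) k with hF
  have hFu : ∀ k, F k = ((2 * Real.pi : ℝ) : ℂ)⁻¹ ^ 4 * localFourier u φ k := fun k => by
    rw [hu, localFourier_propagator, hF]
    ring
  -- multiplication of `φ u` by the second cutoff convolves its Fourier transform with a rapidly
  -- decreasing function
  have hconv : localFourier u g = densityConv F fun k => minkFourier χ (-k) := by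
    funext k
    have h1 : testMul g (planeWave k) (contDiff_planeWave k) =
        testMul φ (testMul χ (planeWave k) (contDiff_planeWave k))
          (testMul χ (planeWave k) (contDiff_planeWave k)).contDiff :=
      TestFunction.ext fun y => by simp only [testMul_apply, hg]; ring
    rw [localFourier, h1, hu, propagator_mul, densityConv]
    refine integral_congr_ae (Eventually.of_forall fun l => ?_)
    simp only [hF, neg_sub]
    rw [← minkFourier_mul_planeWave]
    rfl
  have hFp : PolyBounded F := by
    have hK' := hK
    obtain ⟨B, d, hB⟩ := hK'
    rw [hF, minkFourier_testFunction]
    refine ⟨‖(((2 * Real.pi : ℝ) : ℂ)⁻¹ ^ 4) ^ 2‖ * (8 * B * 2 ^ (d + 8) *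
      schwartzSup (d + 8, 2) (minkFourierCLM (testToSchwartz φ)) * propConst), d + 8, fun k => ?_⟩
    rw [norm_mul, mul_assoc]
    exact mul_le_mul_of_nonneg_left
      (hB.norm_shiftedProp_le (σ := 1) (by norm_num) μ _ k) (norm_nonneg _)
  have hFr : RapidOn F V := fun N => by
    obtain ⟨C, hC⟩ := hrapid N
    refine ⟨‖((2 * Real.pi : ℝ) : ℂ)⁻¹ ^ 4‖ * C, fun k hk => ?_⟩
    rw [hFu, norm_mul, mul_left_comm]
    exact mul_le_mul_of_nonneg_left (hC k hk) (norm_nonneg _)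
  have hB : RapidOn (fun k => minkFourier χ (-k)) univ := by
    rw [minkFourier_testFunction]
    exact (SchwartzMap.rapidOn _).neg
  have hin : RapidOn (localFourier u g) (coneCompl e c')ᶜ := by
    obtain ⟨δ, hδ, hδ1, hsplit⟩ := exists_notMem_coneCompl he1 hcc' hc0 hc'1
    rw [hconv]
    exact rapidOn_densityConv hFp hB.polyBounded hFr hB hδ hδ1 fun L hL k =>
      (hsplit L hL k).imp (fun h => ⟨hcV h.1, h.2⟩) fun h => ⟨mem_univ _, h⟩
  obtain ⟨C₁, hC₁, h1⟩ := hout.exists_bound 6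
  obtain ⟨C₂, hC₂, h2⟩ := hin.exists_bound 6
  -- together the two cones cover all momenta, so the Fourier transform of `g u` is integrable
  have hall : ∀ k, ‖localFourier u g k‖ ≤ (C₁ + C₂) * ((1 + ‖k‖) ^ 6)⁻¹ := fun k => by
    have hpos : 0 ≤ ((1 + ‖k‖) ^ 6)⁻¹ := by positivity
    by_cases hk : k ∈ coneCompl e c'
    · exact (h1 k hk).trans (mul_le_mul_of_nonneg_right (by linarith) hpos)
    · exact (h2 k hk).trans (mul_le_mul_of_nonneg_right (by linarith) hpos)
  refine ⟨g, ‖((2 * Real.pi : ℝ) : ℂ)⁻¹ ^ 4‖ * ((C₁ + C₂) * ∫ k : Mink, ((1 + ‖k‖) ^ 6)⁻¹), ?_,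
    fun ψ => ?_⟩
  · rw [hg, testMul_apply, hχ1 x rfl, one_mul]
    exact hφ
  · have hψ : 0 ≤ ∫ y, ‖ψ y‖ := integral_nonneg fun y => norm_nonneg _
    rw [hu, propagator_mul]
    calc _ ≤ ∫ k : Mink, ‖((2 * Real.pi : ℝ) : ℂ)⁻¹ ^ 4‖ *
          ((C₁ + C₂) * ((1 + ‖k‖) ^ 6)⁻¹) * ∫ y, ‖ψ y‖ := by
          refine norm_integral_le_of_norm_le
            (((integrable_inv_one_add_norm_pow.const_mul _).const_mul _).mul_const _)
            (Eventually.of_forall fun k => ?_)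
          rw [norm_mul]
          refine mul_le_mul ?_ (norm_minkFourier_le _ _) (norm_nonneg _) (by positivity)
          have h3 := hall k
          rw [hu, localFourier_propagator] at h3
          rw [sq, mul_assoc, norm_mul]
          exact mul_le_mul_of_nonneg_left h3 (norm_nonneg _)
      _ = _ := by
          rw [integral_mul_const, integral_const_mul, integral_const_mul]

theorem feynmanPropagator_apply (φ : 𝓢(Mink, ℂ)) :
    feynmanPropagator φ = propFunctional (-1) 0 φ := by
  rw [feynmanPropagator, propagator_apply, propFunctional_const_mul, propFunctional_neg_one_eq]
  rfl

/-- Off the light cone the Feynman propagator is the function `1/x²`. -/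
theorem feynmanPropagator_eq_integral (φ : 𝓢(Mink, ℂ)) {a : ℝ} (ha : 0 < a)
    (hφ : ∀ x, φ x ≠ 0 → a ≤ |mdot x x|) :
    feynmanPropagator φ = ∫ x, φ x / (mdot x x : ℂ) := by
  have h1 : FlowBounded (fun _ => (1 : ℂ)) fun p : Mink => 1 * (1 + ‖p‖) ^ 0 := by
    simpa using FlowBounded.const 1
  have h2 := h1.mul_schwartz φ
  simp only [one_mul] at h2
  rw [feynmanPropagator_apply, propFunctional_eq_integral (by norm_num) 0 h2 ha
    (fun p hp => by simpa using hφ p hp)]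
  simp only [Complex.ofReal_zero, sub_zero]

/-- A bound of `1/x²` against `L¹` norms bounds it pointwise. -/
theorem norm_div_mdot_le {g : 𝓓((⊤ : Opens Mink), ℂ)} {C : ℝ}
    (hC : ∀ ψ : 𝓓((⊤ : Opens Mink), ℂ), ‖restrictTo ⊤ feynmanPropagator
      (testMul g ψ ψ.contDiff)‖ ≤ C * ∫ y, ‖ψ y‖) {y : Mink} (hy : mdot y y ≠ 0) :
    ‖g y / (mdot y y : ℂ)‖ ≤ C := by
  refine le_of_forall_pos_le_add fun η hη => ?_
  set h : Mink → ℂ := fun z => g z / (mdot z z : ℂ) with hh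
  have hcont : ContinuousAt h y := g.continuous.continuousAt.div
    (Complex.continuous_ofReal.comp continuous_mdot_self).continuousAt (by exact_mod_cast hy)
  set a := |mdot y y| / 2 with ha
  have ha0 : 0 < a := by positivity
  have hev : ∀ᶠ z in 𝓝 y, dist (h z) (h y) < η ∧ a < |mdot z z| :=
    (Metric.continuousAt_iff'.1 hcont η hη).and
      ((isOpen_lt continuous_const (continuous_id.mdot continuous_id).abs).mem_nhds
        (show a < |mdot y y| from half_lt_self (abs_pos.2 hy)))
  obtain ⟨ε, hε, hball⟩ := Metric.nhds_basis_closedBall.mem_iff.1 hev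
  let θ : ContDiffBump y := ⟨ε / 2, ε, by positivity, by linarith⟩
  -- test with a bump function concentrated near `y`, where `g z / z²` is almost constant
  let ψ : 𝓓((⊤ : Opens Mink), ℂ) :=
    ⟨fun z => (θ z : ℂ), contDiffBump_ofReal θ,
      θ.hasCompactSupport.comp_left (g := fun x : ℝ => (x : ℂ)) rfl, fun _ _ => trivial⟩
  have hψ : ∀ z, ψ z = (θ z : ℂ) := fun z => rfl
  have hsupp : ∀ z, θ z ≠ 0 → dist (h z) (h y) < η ∧ a < |mdot z z| := fun z hz =>
    hball (by
      have : z ∈ tsupport θ := subset_tsupport _ hz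
      rwa [θ.tsupport_eq] at this)
  have hpos : 0 < ∫ z, θ z := θ.integral_pos
  have hθi : Integrable θ := θ.integrable
  have h1 : restrictTo ⊤ feynmanPropagator (testMul g ψ ψ.contDiff) = ∫ z, h z * (θ z : ℂ) := by
    change feynmanPropagator (testToSchwartz (testMul g ψ ψ.contDiff)) = _
    rw [feynmanPropagator_eq_integral _ ha0 fun z hz => ?_]
    · refine integral_congr_ae (Eventually.of_forall fun z => ?_)
      change g z * (θ z : ℂ) / _ = _
      simp only [hh]
      ring
    · have hz' : g z * (θ z : ℂ) ≠ 0 := hz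
      exact (hsupp z (by exact_mod_cast right_ne_zero_of_mul hz')).2.le
  have h2 : ∫ z, ‖ψ z‖ = ∫ z, θ z := by
    refine integral_congr_ae (Eventually.of_forall fun z => ?_)
    simp only [hψ, Complex.norm_real, Real.norm_eq_abs, abs_of_nonneg θ.nonneg]
  have hgi : Integrable fun z => h z * (θ z : ℂ) := by
    have hm : Measurable h := by
      have := g.continuous.measurable
      have := measurable_mdot_self
      fun_prop
    refine (hθi.const_mul (‖h y‖ + η)).mono'
      (hm.mul (contDiffBump_ofReal θ).continuous.measurable).aestronglyMeasurable
      (Eventually.of_forall fun z => ?_)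
    rw [norm_mul, Complex.norm_real, Real.norm_eq_abs, abs_of_nonneg θ.nonneg]
    by_cases hz : θ z = 0
    · simp [hz]
    · refine mul_le_mul_of_nonneg_right ?_ θ.nonneg
      have h3 := (hsupp z hz).1
      rw [dist_eq_norm] at h3
      have := norm_le_norm_add_norm_sub' (h z) (h y)
      linarith
  have h3 : ‖h y‖ * ∫ z, θ z ≤ (C + η) * ∫ z, θ z := by
    have h4 := hC ψ
    rw [h1, h2] at h4
    have h5 : ∫ z, h y * (θ z : ℂ) = h y * ((∫ z, θ z : ℝ) : ℂ) := by
      rw [integral_const_mul]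
      exact congrArg _ integral_ofReal
    have hθc : Integrable fun z => h y * (θ z : ℂ) := hθi.ofReal.const_mul _
    have h6 : ‖(∫ z, h y * (θ z : ℂ)) - ∫ z, h z * (θ z : ℂ)‖ ≤ η * ∫ z, θ z := by
      rw [← integral_sub hθc hgi, ← integral_const_mul]
      refine norm_integral_le_of_norm_le (hθi.const_mul η) (Eventually.of_forall fun z => ?_)
      rw [← sub_mul, norm_mul, Complex.norm_real, Real.norm_eq_abs, abs_of_nonneg θ.nonneg]
      by_cases hz : θ z = 0
      · simp [hz]
      · refine mul_le_mul_of_nonneg_right ?_ θ.nonneg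
        have h7 := (hsupp z hz).1
        rw [dist_comm, dist_eq_norm] at h7
        exact h7.le
    have h7 : ‖h y‖ * ∫ z, θ z = ‖∫ z, h y * (θ z : ℂ)‖ := by
      rw [h5, norm_mul, Complex.norm_real, Real.norm_eq_abs, abs_of_pos hpos]
    rw [h7]
    have := norm_le_norm_add_norm_sub' (∫ z, h y * (θ z : ℂ)) (∫ z, h z * (θ z : ℂ))
    linarith
  exact le_of_mul_le_mul_right h3 hpos

/-- Otherwise `D` would be bounded near the lightlike point `x`, whereas `D = 1/x²` off the light
cone is unbounded there. -/
theorem smul_mem_frequencySet_feynmanPropagator {x : Mink} (hx : x ≠ 0) (hxx : mdot x x = 0)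
    {t : ℝ} (ht : 0 < t) : t • x ∈ frequencySet (restrictTo ⊤ feynmanPropagator) x := by
  by_contra hfr
  obtain ⟨g, C, hg, hC⟩ := ((HomogeneousKernel.const feynmanConst).microlocallyRegular
    0).exists_bound_of_notMem_frequencySet (GrowthKernel.const _) hx ht hfr
  have hxn := norm_pos_iff.2 hx
  -- approach `x` along the curve `x + s J x`, on which the square is `2 s ‖x‖²`
  have h1 : Tendsto (fun s : ℝ => ‖g (x + s • minkReflect x)‖) (𝓝[>] 0) (𝓝 ‖g x‖) :=
    (g.continuous.norm.tendsto x).comp (tendsto_add_smul_minkReflect x)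
  have h2 : Tendsto (fun s : ℝ => C * (2 * s * ‖x‖ ^ 2)) (𝓝[>] 0) (𝓝 0) := by
    have hc : Continuous fun s : ℝ => C * (2 * s * ‖x‖ ^ 2) := by fun_prop
    simpa using (hc.tendsto 0).mono_left nhdsWithin_le_nhds
  have h3 : ‖g x‖ ≤ 0 := by
    refine le_of_tendsto_of_tendsto h1 h2 ?_
    filter_upwards [self_mem_nhdsWithin] with s hs
    have hs' : (0 : ℝ) < s := hs
    have hpos : 0 < 2 * s * ‖x‖ ^ 2 := by positivity
    have h4 := norm_div_mdot_le hC (y := x + s • minkReflect x)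
      (by rw [mdot_add_smul_minkReflect hxx]; exact hpos.ne')
    rwa [mdot_add_smul_minkReflect hxx, norm_div, Complex.norm_real, Real.norm_eq_abs,
      abs_of_pos hpos, div_le_iff₀ hpos] at h4
  exact hg (norm_le_zero_iff.1 h3)

theorem waveFrontSet_feynmanPropagator : waveFrontSet (restrictTo ⊤ feynmanPropagator) =
    {z | z.1 ≠ 0 ∧ mdot z.1 z.1 = 0 ∧ ∃ t : ℝ, 0 < t ∧ z.2 = t • z.1}
      ∪ {z | z.1 = 0 ∧ z.2 ≠ 0} := by
  refine Subset.antisymm (((HomogeneousKernel.const feynmanConst).microlocallyRegular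
    0).waveFrontSet_subset (GrowthKernel.const _)) ?_
  rintro ⟨x, p⟩ (⟨hx, hxx, t, ht, hp⟩ | ⟨hx, hp⟩)
  · have hp' : p = t • x := hp
    rw [hp']
    exact ⟨trivial, smul_mem_frequencySet_feynmanPropagator hx hxx ht⟩
  · have hx' : x = 0 := hx
    rw [hx']
    exact ⟨trivial, mem_frequencySet_zero feynmanConst_ne_zero _ hp⟩

/-! ### Wavefront sets and products of propagators -/

/-- The propagators of both kinds are given by microlocally regular kernels, which bounds their
wavefront sets and makes them directed away from the origin. -/
theorem mainTheorem1 :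
    (∃ D : 𝓢'(Mink, ℂ), IsMasslessFeynman D ∧
      waveFrontSet (restrictTo ⊤ D) =
        {z | z.1 ≠ 0 ∧ mdot z.1 z.1 = 0 ∧ ∃ t : ℝ, 0 < t ∧ z.2 = t • z.1}
          ∪ {z | z.1 = 0 ∧ z.2 ≠ 0} ∧
      ∀ (s : ℕ) (β : ℕ → ℂ) (f f' : Mink) (c : 𝓓(spacelike, ℂ)),
        ∃ T : 𝓢'(Mink, ℂ), IsSmearedStringPropagator s β f f' c T ∧
          waveFrontSet (restrictTo ⊤ T) ⊆ waveFrontSet (restrictTo ⊤ D)) ∧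
    (∀ (m : ℝ) (P Q : MvPolynomial (Fin 4) ℂ), 0 ≤ m →
      ∃ T : 𝓢'(Mink, ℂ), IsPointPropagator m P Q T) ∧
    (∀ l : List 𝓢'(Mink, ℂ), l ≠ [] →
      (∀ T ∈ l,
        (∃ (s : ℕ) (β : ℕ → ℂ) (f f' : Mink) (c : 𝓓(spacelike, ℂ)),
          IsSmearedStringPropagator s β f f' c T) ∨
        (∃ (m : ℝ) (P Q : MvPolynomial (Fin 4) ℂ), 0 ≤ m ∧ IsPointPropagator m P Q T)) →
      ∃! w : Distr punctured, IsHormanderProductList (l.map (restrictTo punctured)) w) := by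
  refine ⟨⟨feynmanPropagator, isMasslessFeynman_feynmanPropagator, waveFrontSet_feynmanPropagator,
    fun s β f f' c => ?_⟩, fun m P Q _ => ⟨_, isPointPropagator_propagator m P Q⟩,
    fun l hl h => existsUnique_hormanderProductList (by simpa using hl) fun u hu => ?_⟩
  · obtain ⟨K, hK, hT⟩ := exists_isSmearedStringPropagator s β f f' c
    refine ⟨_, hT, ?_⟩
    rw [waveFrontSet_feynmanPropagator]
    exact (hK.microlocallyRegular 0).waveFrontSet_subset hK.growth
  · obtain ⟨T, hTl, rfl⟩ := List.mem_map.1 hu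
    rcases h T hTl with ⟨s, β, f, f', c, hT⟩ | ⟨m, P, Q, _, hT⟩
    · obtain ⟨K, hK, hT'⟩ := exists_isSmearedStringPropagator s β f f' c
      rw [hT.unique hT']
      exact (hK.microlocallyRegular 0).coneDirected hK.growth
    · rw [hT.eq]
      exact (microlocallyRegular_polyKernel _ _).coneDirected _

end
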